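/- **Setting.** Let $\Omega$ be either an open subset of $\mathbb R^2$ with $C^1$ boundary (possibly unbounded, possibly $\mathbb R^2$), with the Euclidean distance $d$, or the flat torus $\mathbb T^2=\mathbb R^2/\mathbb Z^2$ with its geodesic distance $d$. For $1\le p<\infty$ put $\|f\|_{L^p_{ul}}=\sup_{x\in\Omega}\|f\|_{L^p(\{z\in\Omega:\,d(x,z)<1\})}$. For a nondecreasing function $\Theta:[1,\infty)\to(0,\infty)$ put $\|f\|_{Y^\Theta_{ul}}=\sup_{1\le p<\infty}\|f\|_{L^p_{ul}}/\Theta(p)$, and let $\varphi_\Theta(0)=0$, $\varphi_\Theta(r)=r(1-\log r)\,\Theta(1-\log r)$ for $0<r\le e^{-2}$, and $\varphi_\Theta(r)=3e^{-2}\,\Theta(3)$ for $r>e^{-2}$. Fix $p\in(2,\infty)$ and constants $C_1,C_2,C_3>0$. Let $k:\Omega\times\Omega\to\mathbb R^2$ be measurable with $$|k(x,y)|\le \frac{C_1}{d(x,y)},\qquad |k(x,z)-k(y,z)|\le C_2\,\frac{d(x,y)}{d(x,z)\,d(y,z)}$$ off the diagonals, and let $K\omega(x)=\int_\Omega k(x,z)\,\omega(z)\,dz$.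 Assume that for every $\omega\in L^1\cap L^p_{ul}$ the distributional divergence of $K\omega$ satisfies $\|\operatorname{div}K\omega\|_{L^\infty}\le C_3\|\omega\|_{L^1}$, and that in the planar case $\nu_\Omega\cdot K\omega=0$ on $\partial\Omega$, where $\nu_\Omega$ is the inner unit normal and $K\omega$ is extended to $\partial\Omega$ by continuity. A *weak solution with vorticity in $L^1\cap L^p_{ul}$* of $\partial_t\omega+\operatorname{div}(v\omega)=0$, $v=K\omega$, $\omega|_{t=0}=\omega_0$ is a pair $(\omega,v)$ of measurable functions on $[0,\infty)\times\Omega$ such that: $\omega(t,\cdot)\in L^1$ for every $t\ge0$ and $\omega\in L^\infty_{loc}([0,\infty);L^1\cap L^p_{ul})$; $v=K\omega$ in $L^\infty_{loc}([0,\infty);C_b(\Omega;\mathbb R^2))$; and for all $T>0$ and $\phi\in C^1_c([0,T]\times\Omega)$ $$\int_\Omega\phi(T,x)\,\omega(T,x)\,dx-\int_\Omega\phi(0,x)\,\omega_0(x)\,dx=\int_0^T\!\!\int_\Omega\omega\,(\partial_t\phi+v\cdot\nabla\phi)\,dx\,dt .$$ It is *Lagrangian* if there is a flow $X:[0,\infty)\times\Omega\to\Omega$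 of $v$ (that is, for every $x\in\Omega$, $X(0,x)=x$, $t\mapsto X(t,x)$ is continuous on $[0,\infty)$, and $\frac{d}{dt}X(t,x)=v(t,X(t,x))$ in the classical sense for all $t>0$), with $X(t,\cdot)$ measurable, such that for a.e. $t\ge0$ one has $\int_\Omega\omega(t,x)\,\phi(x)\,dx=\int_\Omega\omega_0(x)\,\phi(X(t,x))\,dx$ for all bounded Borel functions $\phi$. **Theorem.** (1) For every $\omega_0\in L^1(\Omega)\cap L^p_{ul}(\Omega)$ there is a weak solution $(\omega,v)$ with vorticity in $L^1\cap L^p_{ul}$ such that for every $T>0$, for a.e. $t\in[0,T]$ and all $x,y\in\Omega$, $$\|\omega(t)\|_{L^1}\le\|\omega_0\|_{L^1},\qquad \|\omega(t)\|_{L^p_{ul}}\le C,\qquad |v(t,x)|\le C,$$ $$|v(t,x)-v(t,y)|\le\max\Big\{1,\frac1{p-2}\Big\}\,C\,p\,d(x,y)^{1-2/p},$$ where $C$ depends only on $T$, $p$, $\|\omega_0\|_{L^1}$, $\|\omega_0\|_{L^p_{ul}}$ and on $C_1,C_2,C_3$. (2) For every nondecreasing $\Theta:[1,\infty)\to(0,\infty)$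 (with no condition on its growth) for which $\|\omega_0\|_{Y^\Theta_{ul}}<\infty$, the same solution satisfies, for every $T>0$, for a.e. $t\in[0,T]$ and all $x,y\in\Omega$, $$\|\omega(t)\|_{Y^\Theta_{ul}}\le C',\qquad |v(t,x)|\le C',\qquad |v(t,x)-v(t,y)|\le C'\,\varphi_\Theta(d(x,y)),$$ where $C'$ depends only on $T$, $\|\omega_0\|_{L^1}$, $\|\omega_0\|_{Y^\Theta_{ul}}$, $\Theta(3)$ and on $C_1,C_2,C_3$. If moreover $\int^{\infty}\frac{dq}{q\,\Theta(q)}=\infty$, then $(\omega,v)$ is Lagrangian. (3) These hypotheses hold, for suitable $C_1,C_2,C_3$ and every $p\in(2,\infty)$, for the Biot–Savart law of the Euler equations on the plane and on the torus: on $\mathbb R^2$ for the kernel $k(x,y)=\frac1{2\pi}\frac{(x-y)^\perp}{|x-y|^2}$, and on $\mathbb T^2$ for some kernel $k$ such that, for every $p\in(2,\infty)$ and every $\omega\in L^1\cap L^p_{ul}$ with zero mean, $K\omega=\nabla^\perp\psi$ for some $\psi\in C^1(\mathbb T^2)$ with $\Delta\psi=\omega$ in the sense of distributions. -/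

import Mathlib

open MeasureTheory Set Filter Topology
open scoped ENNReal

noncomputable section

/-- The Euclidean plane. -/
abbrev Plane : Type := EuclideanSpace ℝ (Fin 2)

/-- Rotation by a right angle, `(x₁, x₂) ↦ (-x₂, x₁)`. -/
def perp (x : Plane) : Plane := !₂[-x 1, x 0]

/-- The vector of `ℝ²` with the given integer coordinates. -/
def latticeVec (m : Fin 2 → ℤ) : Plane := WithLp.toLp 2 (fun i => (m i : ℝ))

/-- The fluid domain: a subset of the plane or the flat torus `ℝ² / ℤ²`.  Functions on the torus
are represented by `ℤ²`-periodic functions on the plane. -/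
inductive FlowDomain : Type where
  | region (Ω : Set Plane) : FlowDomain
  | torus : FlowDomain

namespace FlowDomain

/-- The points of the plane that represent points of the domain. -/
def pts : FlowDomain → Set Plane
  | region Ω => Ω
  | torus => univ

/-- A set that represents every point of the domain exactly once. -/
def cell : FlowDomain → Set Plane
  | region Ω => Ω
  | torus => {x | ∀ i, x i ∈ Ico (0 : ℝ) 1}

/-- The Lebesgue measure of the domain. -/
def area (D : FlowDomain) : Measure Plane := volume.restrict D.cell

/-- The Euclidean distance on a planar region, the geodesic distance on the flat torus. -/
def gdist : FlowDomain → Plane → Plane → ℝ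
  | region _, x, y => dist x y
  | torus, x, y => ⨅ m : Fin 2 → ℤ, dist x (y + latticeVec m)

/-- `f` defines a function on the domain: no condition on a planar region, periodicity on the
torus. -/
def Descends {α : Type} (D : FlowDomain) (f : Plane → α) : Prop :=
  match D with
  | region _ => True
  | torus => ∀ (m : Fin 2 → ℤ) (x : Plane), f (x + latticeVec m) = f x

/-- `X` defines a self-map of the domain. -/
def SelfMap (D : FlowDomain) (X : Plane → Plane) : Prop :=
  match D with
  | region Ω => MapsTo X Ω Ω
  | torus => ∀ (m : Fin 2 → ℤ) (x : Plane), X (x + latticeVec m) = X x + latticeVec m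

/-- `C^n` test functions on time × domain, with compact support in the domain (an empty condition
on the torus).  They are restrictions to `[0, T]` of functions defined for all real times; as
`C^1` functions on `[0, T]` extend to `ℝ`, this is no loss of generality. -/
def IsTest (D : FlowDomain) (n : ℕ∞) (φ : ℝ → Plane → ℝ) : Prop :=
  ContDiff ℝ n (Function.uncurry φ) ∧
    match D with
    | region Ω => ∃ S : Set Plane, IsCompact S ∧ S ⊆ Ω ∧ ∀ t, ∀ x ∉ S, φ t x = 0
    | torus => ∀ t, torus.Descends (φ t)

/-- Smooth test functions on the domain, independent of time. -/
def IsSpaceTest (D : FlowDomain) (φ : Plane → ℝ) : Prop :=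
  D.IsTest (⊤ : ℕ∞) (fun _ => φ)

end FlowDomain

/-- Near `x`, the function `ρ` is of class `C¹` and `Ω` is the set `{ρ > 0}`, with nonvanishing
differential of `ρ` at `x`. -/
def IsLocalDefining (Ω : Set Plane) (x : Plane) (ρ : Plane → ℝ) : Prop :=
  ContDiffAt ℝ 1 ρ x ∧ fderiv ℝ ρ x ≠ 0 ∧ ∀ᶠ y in 𝓝 x, (y ∈ Ω ↔ 0 < ρ y)

/-- `ν` is the inner unit normal to `Ω` at the boundary point `x`. -/
def IsInnerNormal (Ω : Set Plane) (x ν : Plane) : Prop :=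
  ‖ν‖ = 1 ∧ ∃ ρ, IsLocalDefining Ω x ρ ∧ ∃ c : ℝ, 0 < c ∧ gradient ρ x = c • ν

namespace FlowDomain

/-- An open subset of the plane with `C¹` boundary, or the torus. -/
def IsRegular : FlowDomain → Prop
  | region Ω => IsOpen Ω ∧ ∀ x ∈ frontier Ω, ∃ ρ, IsLocalDefining Ω x ρ
  | torus => True

/-- The uniformly localized norm `sup_x ‖f‖_{L^p(Ω ∩ B₁(x))}`. -/
def ulNorm (D : FlowDomain) (p : ℝ) (f : Plane → ℝ) : ℝ≥0∞ :=
  ⨆ x ∈ D.pts, eLpNorm f (ENNReal.ofReal p) (D.area.restrict {z | D.gdist x z < 1})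

/-- The space `L¹ ∩ L^p_ul`. -/
structure MemL1Ul (D : FlowDomain) (p : ℝ) (f : Plane → ℝ) : Prop where
  descends : D.Descends f
  memL1 : MemLp f 1 D.area
  ul_finite : D.ulNorm p f < ∞

/-- The uniformly localized Yudovich norm `sup_{1 ≤ p < ∞} ‖f‖_{L^p_ul} / Θ(p)`. -/
def yulNorm (D : FlowDomain) (Θ : ℝ → ℝ) (f : Plane → ℝ) : ℝ≥0∞ :=
  ⨆ p ∈ Ici (1 : ℝ), D.ulNorm p f / ENNReal.ofReal (Θ p)

/-- The operator `Kω(x) = ∫ k(x, z) ω(z) dz`. -/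
def velocity (D : FlowDomain) (k : Plane → Plane → Plane) (ω : Plane → ℝ) (x : Plane) : Plane :=
  ∫ z, ω z • k x z ∂D.area

/-- A (measurable) kernel on the domain satisfying the size and oscillation estimates. -/
structure KernelBounds (D : FlowDomain) (k : Plane → Plane → Plane) (C₁ C₂ : ℝ) : Prop where
  measurable : Measurable (fun q : D.pts × D.pts => k q.1 q.2)
  descends_left : ∀ y, D.Descends (fun x => k x y)
  descends_right : ∀ x, D.Descends (k x)
  size : ∀ x ∈ D.pts, ∀ y ∈ D.pts, D.gdist x y ≠ 0 → ‖k x y‖ ≤ C₁ / D.gdist x y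
  oscillation : ∀ x ∈ D.pts, ∀ y ∈ D.pts, ∀ z ∈ D.pts, D.gdist x z ≠ 0 → D.gdist y z ≠ 0 →
    ‖k x z - k y z‖ ≤ C₂ * (D.gdist x y / (D.gdist x z * D.gdist y z))

/-- The distributional divergence of the vector field `u` on the domain is a function with
`L^∞` norm at most `B`. -/
def DivBounded (D : FlowDomain) (u : Plane → Plane) (B : ℝ≥0∞) : Prop :=
  ∃ g : Plane → ℝ, AEStronglyMeasurable g D.area ∧ eLpNorm g ∞ D.area ≤ B ∧
    ∀ φ, D.IsSpaceTest φ →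
      ∫ x, fderiv ℝ φ x (u x) ∂D.area = - ∫ x, g x * φ x ∂D.area

/-- The normal component of `u` vanishes on the boundary of the domain, where `u` is taken on the
boundary by passing to the limit from inside. Empty on the torus. -/
def NoFlow (D : FlowDomain) (u : Plane → Plane) : Prop :=
  match D with
  | region Ω => ∀ x ∈ frontier Ω, ∀ ν, IsInnerNormal Ω x ν →
      Tendsto (fun y => inner ℝ ν (u y)) (𝓝[Ω] x) (𝓝 0)
  | torus => True

/-- Bounded divergence and no-flow boundary condition for the operator `K` on `L¹ ∩ L^p_ul`. -/
def OperatorBounds (D : FlowDomain) (k : Plane → Plane → Plane) (p C₃ : ℝ) : Prop :=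
  ∀ ω, D.MemL1Ul p ω →
    D.DivBounded (D.velocity k ω) (ENNReal.ofReal C₃ * eLpNorm ω 1 D.area) ∧
      D.NoFlow (D.velocity k ω)

/-- `(ω, v)` is a weak solution of `∂ₜω + div(vω) = 0`, `v = Kω`, `ω(0) = ω₀` on
`[0, ∞) × domain`, with vorticity in `L¹ ∩ L^p_ul`. -/
structure IsWeakSolution (D : FlowDomain) (k : Plane → Plane → Plane) (p : ℝ) (ω₀ : Plane → ℝ)
    (ω : ℝ → Plane → ℝ) (v : ℝ → Plane → Plane) : Prop where
  ω_descends : ∀ t, 0 ≤ t → D.Descends (ω t)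
  ω_measurable :
    AEStronglyMeasurable (Function.uncurry ω) ((volume.restrict (Ici (0 : ℝ))).prod D.area)
  -- every time slice is in `L¹`, so that the terms at time `T` below are meaningful
  ω_slice : ∀ t, 0 ≤ t → MemLp (ω t) 1 D.area
  ω_bounded : ∀ T > 0, ∃ M : ℝ, ∀ᵐ t ∂(volume.restrict (Icc 0 T)),
    eLpNorm (ω t) 1 D.area ≤ ENNReal.ofReal M ∧ D.ulNorm p (ω t) ≤ ENNReal.ofReal M
  v_descends : ∀ t, 0 ≤ t → D.Descends (v t)
  v_measurable :
    AEStronglyMeasurable (Function.uncurry v) ((volume.restrict (Ici (0 : ℝ))).prod D.area)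
  v_eq : ∀ᵐ t ∂(volume.restrict (Ici (0 : ℝ))), ∀ x ∈ D.pts,
    Integrable (fun z => ω t z • k x z) D.area ∧ v t x = D.velocity k (ω t) x
  v_continuous : ∀ᵐ t ∂(volume.restrict (Ici (0 : ℝ))), ContinuousOn (v t) D.pts
  v_bounded : ∀ T > 0, ∃ M : ℝ, ∀ᵐ t ∂(volume.restrict (Icc 0 T)), ∀ x ∈ D.pts, ‖v t x‖ ≤ M
  weak_form : ∀ T > 0, ∀ φ, D.IsTest 1 φ →
    ∫ x, φ T x * ω T x ∂D.area - ∫ x, φ 0 x * ω₀ x ∂D.area =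
      ∫ t in Icc 0 T, ∫ x,
        ω t x * (deriv (fun s => φ s x) t + fderiv ℝ (φ t) x (v t x)) ∂D.area

/-- `X` is a flow of the velocity field `v`, in the classical sense (on the torus, trajectories
are lifted to the plane). -/
structure IsFlow (D : FlowDomain) (v : ℝ → Plane → Plane) (X : ℝ → Plane → Plane) : Prop where
  selfMap : ∀ t, 0 ≤ t → D.SelfMap (X t)
  initial : ∀ x ∈ D.pts, X 0 x = x
  continuous : ∀ x ∈ D.pts, ContinuousOn (fun t => X t x) (Ici 0)
  ode : ∀ x ∈ D.pts, ∀ t > 0, HasDerivAt (fun s => X s x) (v t (X t x)) t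

/-- `ω(t)` is, for a.e. `t`, the push-forward of `ω₀` under `X(t)`, for some (measurable) flow `X`
of `v`. -/
def IsLagrangian (D : FlowDomain) (ω₀ : Plane → ℝ) (ω : ℝ → Plane → ℝ)
    (v : ℝ → Plane → Plane) : Prop :=
  ∃ X, D.IsFlow v X ∧ (∀ t, 0 ≤ t → Measurable (fun x : D.pts => X t x)) ∧
    ∀ᵐ t ∂(volume.restrict (Ici (0 : ℝ))), ∀ φ : Plane → ℝ, Measurable φ → (∃ M, ∀ x, |φ x| ≤ M) →
      D.Descends φ → ∫ x, ω t x * φ x ∂D.area = ∫ x, ω₀ x * φ (X t x) ∂D.area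

end FlowDomain

/-- Growth functions: nondecreasing and positive on `[1, ∞)`. -/
def IsGrowth (Θ : ℝ → ℝ) : Prop :=
  MonotoneOn Θ (Ici 1) ∧ ∀ p, 1 ≤ p → 0 < Θ p

/-- The modulus of continuity associated with the growth function `Θ`. -/
def phiMod (Θ : ℝ → ℝ) (r : ℝ) : ℝ :=
  if r ≤ 0 then 0
  else if r ≤ Real.exp (-2) then r * (1 - Real.log r) * Θ (1 - Real.log r)
  else Real.exp (-2) * 3 * Θ 3

/-- `∫^∞ dp / (p Θ(p)) = ∞`. -/
def OsgoodGrowth (Θ : ℝ → ℝ) : Prop :=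
  ∫⁻ p in Ioi (1 : ℝ), ENNReal.ofReal (1 / (p * Θ p)) = ∞

/-- The Biot–Savart kernel of the plane, `(x - y)^⊥ / (2π |x - y|²)`. -/
def planeKernel (x y : Plane) : Plane :=
  (1 / (2 * Real.pi * ‖x - y‖ ^ 2)) • perp (x - y)

/-- `k` is a kernel of the Biot–Savart operator of the torus: for every mean-zero vorticity
`ω ∈ L¹ ∩ L^p_ul` one has `Kω = ∇^⊥ψ` for a stream function `ψ` on the torus that solves
`Δψ = ω` in the sense of distributions. -/
def IsTorusBiotSavart (k : Plane → Plane → Plane) (p : ℝ) : Prop :=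
  ∀ ω, FlowDomain.torus.MemL1Ul p ω → ∫ x, ω x ∂FlowDomain.torus.area = 0 →
    ∃ ψ : Plane → ℝ, FlowDomain.torus.Descends ψ ∧ ContDiff ℝ 1 ψ ∧
      (∀ x, FlowDomain.torus.velocity k ω x = perp (gradient ψ x)) ∧
      ∀ φ, FlowDomain.torus.IsSpaceTest φ →
        ∫ x, inner ℝ (gradient ψ x) (gradient φ x) ∂FlowDomain.torus.area =
          - ∫ x, ω x * φ x ∂FlowDomain.torus.area

end

noncomputable section

open scoped Convolution Real
open ENNReal (add_lt_top div_le_iff le_tsum measurable_ofReal mul_lt_top mul_rpow_of_nonneg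
  ofNat_ne_top ofReal ofReal_add ofReal_eq_zero ofReal_le_ofReal ofReal_le_ofReal_iff
  ofReal_lt_top ofReal_mul ofReal_ne_top ofReal_one ofReal_rpow_of_nonneg ofReal_toReal
  rpow_lt_top_of_nonneg rpow_mul rpow_one toReal_mono toReal_nonneg toReal_ofReal)
open Real (add_one_le_exp cos div_rpow exp exp_add exp_le_exp exp_neg exp_nonneg exp_pos log
  mul_rpow norm_eq_abs norm_of_nonneg pi_gt_three pi_pos rpow_add rpow_le_rpow rpow_neg
  rpow_nonneg rpow_sub sin zero_rpow)
open Metric (ball closedBall infDist infDist_le_dist_of_mem isOpen_ball mem_ball mem_closedBall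
  mem_closedBall_self)
open EuclideanSpace (basisFun norm_sq_eq single)
open Function (comp_apply comp_def uncurry uncurry_def)

variable {φ ψ f g ω ω0 : Plane → ℝ} {u : Plane → Plane} {x y : Plane} {n j : ℕ} {Θ : ℝ → ℝ}
  {h : ℕ → ℝ}
  {q r s t p C M N N1 R T ε C1 C2 C3 : ℝ} {D : FlowDomain} {k : Plane → Plane → Plane} {σ : ℕ → ℕ}

/-! The solution is a limit of an explicit scheme, and the theorem follows from estimates that hold
for the scheme uniformly. One step freezes the vorticity `ω`, mollifies `Kω` at scale `1/(n+1)` to a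
field `w`, pushes the vorticity of the set `innerPart` (points whose closed `1/(n+1)`-ball lies in
the domain) forward by `x ↦ x + h w(x)`, and drops the rest. For small `h` this map is a
homeomorphism of the plane. The mollified divergence on the inner part is bounded by `B = C₃‖ω₀‖₁`,
so the Jacobian is at least `exp(-2h(B+1))` there (`transportStep_mollify`). Hence the mass never
grows, and local `L^q` integrals grow only through an exponential in time and through enlarging the
ball by the distance travelled (`Setup.lintegral_scheme_le`).

The a priori bound closes because `q > 2`. Splitting the kernel at distance one bounds the speed by
`‖ω‖_{L^q_ul}` and `‖ω‖₁` (`norm_velocity_le`). After a displacement `S` the ball to be controlled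
is covered by `O((1+S)²)` pieces of diameter below one, and the `q`-th root of this number is at
most linear in `S`. So the speed is at most `a(1+S)`, and a discrete Gronwall argument gives bounds
for all times (`Setup.velocity_scheme_step`).

With the weight `exp(-‖x‖)` all vorticities lie in one Hilbert space. The discrete weak form makes
them nearly equicontinuous in time against test functions, and a diagonal argument gives a limit
with convergence that is locally uniform in time (`exists_weak_limit_curve`). Norm bounds pass to
the limit because norm balls are closed and convex. Velocities converge pointwise because the kernel
can be cut off near its singularity and at infinity with small error (`tendsto_velocity`). This is
enough for the nonlinear term (`Setup.IsLimit.tendsto_discreteRate`).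

The Hölder estimate with exponent `q` has a constant that grows linearly in `q`. Inserting `q = 1 -
log d` at distance `d` yields the modulus `φ_Θ`. For the flow the infimum over all `q` is used
instead (`growthMod`); the substitution `r = exp(1 - s)` turns its Osgood integral into `∫ ds / (s
Θ(s))`.

The flow is the limit of the Euler polygons of the scheme. The field is almost tangent at the
boundary, so an Osgood argument run backwards in time keeps polygons at a positive distance from it
(`Setup.exists_traj_safe`). A second Osgood argument, comparing two polygons, shows that they form a
Cauchy sequence (`Setup.IsLimit.cauchySeq_polygon`). Passing to the limit in the push-forward
formula of the scheme gives the Lagrangian property for continuous test functions, and a measure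
argument extends it to Borel ones.

The planar kernel is a rotated inversion, which gives both kernel bounds exactly, and it is
divergence free because it points in the angular direction. On the torus the kernel is built by
Ewald splitting: the planar kernel times a Gaussian is periodized, and a rapidly convergent sine
series supplies the remainder. Poisson summation shows that the curl of the result is `δ - 1`, which
inverts the Laplacian on mean-zero functions. -/

lemma latticeVec_apply (m : Fin 2 → ℤ) (i : Fin 2) : latticeVec m i = m i := rfl

lemma latticeVec_zero : latticeVec 0 = 0 := by
  ext i; simp [latticeVec_apply]

lemma latticeVec_add (m n : Fin 2 → ℤ) : latticeVec (m + n) = latticeVec m + latticeVec n := by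
  ext i; simp [latticeVec_apply]

lemma latticeVec_neg (m : Fin 2 → ℤ) : latticeVec (-m) = -latticeVec m := by
  ext i; simp [latticeVec_apply]

/-! ### Lattice tilings, the geodesic distance, and comparison of the torus with the plane. -/

namespace FlowDomain

lemma isOpen_pts (hD : D.IsRegular) : IsOpen D.pts := by
  cases D with
  | region Ω => exact hD.1
  | torus => exact isOpen_univ

lemma cell_subset_pts : D.cell ⊆ D.pts := by
  cases D with
  | region Ω => exact subset_rfl
  | torus => exact subset_univ _

lemma measurableSet_torus_cell : MeasurableSet torus.cell := by
  have : torus.cell = ⋂ i : Fin 2, {x : Plane | x i ∈ Ico (0 : ℝ) 1} := by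
    ext x; simp [cell]
  rw [this]
  exact MeasurableSet.iInter fun i => measurableSet_Ico.preimage (by fun_prop)

lemma measurableSet_cell (hD : D.IsRegular) : MeasurableSet D.cell := by
  cases D with
  | region Ω => exact hD.1.measurableSet
  | torus => exact measurableSet_torus_cell

lemma measurableSet_pts (hD : D.IsRegular) : MeasurableSet D.pts := (isOpen_pts hD).measurableSet

lemma ae_area_mem_cell (hD : D.IsRegular) : ∀ᵐ x ∂D.area, x ∈ D.cell :=
  ae_restrict_mem (measurableSet_cell hD)

lemma ae_area_mem_pts (hD : D.IsRegular) : ∀ᵐ x ∂D.area, x ∈ D.pts :=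
  (ae_area_mem_cell hD).mono fun _ h => cell_subset_pts h

def floorVec (x : Plane) : Fin 2 → ℤ := fun i => ⌊x i⌋

lemma sub_floorVec_mem_cell (x : Plane) : x - latticeVec (floorVec x) ∈ torus.cell := by
  intro i
  simp only [PiLp.sub_apply, latticeVec_apply, floorVec]
  exact ⟨Int.fract_nonneg (x i), Int.fract_lt_one (x i)⟩

lemma floorVec_eq_zero_iff : floorVec x = 0 ↔ x ∈ torus.cell := by
  simp only [cell, Set.mem_ofPred_eq, mem_Ico, funext_iff, floorVec, Pi.zero_apply,
    Int.floor_eq_zero_iff]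

lemma floorVec_add_latticeVec (x : Plane) (m : Fin 2 → ℤ) :
    floorVec (x + latticeVec m) = floorVec x + m := by
  ext i; simp [floorVec, latticeVec_apply]

lemma measurable_floorVec : Measurable floorVec :=
  measurable_pi_lambda _ fun i => Int.measurable_floor.comp (by fun_prop)

lemma measurable_latticeVec : Measurable latticeVec := measurable_of_countable _

lemma lintegral_plane_eq_tsum (f : Plane → ℝ≥0∞) :
    ∫⁻ x, f x = ∑' m : Fin 2 → ℤ, ∫⁻ x in torus.cell, f (x + latticeVec m) := by
  have hm : ∀ m, MeasurableSet (floorVec ⁻¹' {m}) := fun m =>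
    measurable_floorVec (measurableSet_singleton m)
  have hu : (⋃ m, floorVec ⁻¹' {m}) = univ := by ext x; simp
  rw [← setLIntegral_univ, ← hu, lintegral_iUnion hm]
  · refine tsum_congr fun m => ?_
    have := (measurePreserving_add_right (volume : Measure Plane)
      (latticeVec m)).setLIntegral_comp_preimage_emb (measurableEmbedding_addRight _) f
        (floorVec ⁻¹' {m})
    rw [← this]
    congr 2
    ext x
    simp [floorVec_add_latticeVec, ← floorVec_eq_zero_iff]
  · intro m n hmn
    exact Disjoint.preimage _ (by simpa using hmn)

lemma lintegral_plane_eq_lintegral_tsum {f : Plane → ℝ≥0∞} (hf : Measurable f) :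
    ∫⁻ x, f x = ∫⁻ x in torus.cell, ∑' m : Fin 2 → ℤ, f (x + latticeVec m) := by
  rw [lintegral_plane_eq_tsum, lintegral_tsum]
  intro m
  exact (hf.comp (by fun_prop)).aemeasurable

lemma dist_sq_plane (x y : Plane) : dist x y ^ 2 = |x 0 - y 0| ^ 2 + |x 1 - y 1| ^ 2 := by
  rw [EuclideanSpace.dist_eq, Real.sq_sqrt (by positivity)]
  simp [Fin.sum_univ_two, Real.dist_eq]

lemma gdist_torus_bddBelow (x y : Plane) :
    BddBelow (range fun m : Fin 2 → ℤ => dist x (y + latticeVec m)) :=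
  ⟨0, by rintro _ ⟨m, rfl⟩; exact dist_nonneg⟩

lemma gdist_torus_le (x y : Plane) (m : Fin 2 → ℤ) : torus.gdist x y ≤ dist x (y + latticeVec m) :=
  ciInf_le (gdist_torus_bddBelow x y) m

/-- Rounding gives the nearest integer in each coordinate separately, and the squared distance is
the sum of the squared coordinates; so one translate minimizes everything and the infimum is
attained. -/
lemma gdist_torus_eq_round (x y : Plane) :
    torus.gdist x y = dist x (y + latticeVec fun i => round (x i - y i)) := by
  refine le_antisymm (gdist_torus_le x y _) (le_ciInf fun m => ?_)
  refine (sq_le_sq₀ dist_nonneg dist_nonneg).1 ?_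
  have key : ∀ i : Fin 2, |x i - (y i + ((round (x i - y i) : ℤ) : ℝ))| ≤ |x i - (y i + m i)| := by
    intro i
    have := round_le (x i - y i) (m i)
    rwa [sub_sub, sub_sub] at this
  rw [dist_sq_plane, dist_sq_plane]
  simp only [PiLp.add_apply, latticeVec_apply]
  exact add_le_add (pow_le_pow_left₀ (abs_nonneg _) (key 0) 2)
    (pow_le_pow_left₀ (abs_nonneg _) (key 1) 2)

lemma exists_gdist_torus_eq (x y : Plane) :
    ∃ m, torus.gdist x y = dist x (y + latticeVec m) := ⟨_, gdist_torus_eq_round x y⟩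

/-- The nearest translate is off by at most `1/2` in each coordinate, and `√2/2 < 1`. Hence a unit
ball is the whole torus, and the uniformly local norm there is the full `L^p` norm. -/
lemma gdist_torus_lt_one (x y : Plane) : torus.gdist x y < 1 := by
  rw [gdist_torus_eq_round, ← abs_of_nonneg (dist_nonneg (α := Plane))]
  refine abs_lt_of_sq_lt_sq' ?_ zero_le_one |> fun h => abs_lt.2 h
  rw [dist_sq_plane]
  have key : ∀ i : Fin 2, |x i - (y i + ((round (x i - y i) : ℤ) : ℝ))| ≤ 1 / 2 := by
    intro i
    have := abs_sub_round (x i - y i)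
    rwa [sub_sub] at this
  simp only [PiLp.add_apply, latticeVec_apply]
  have h0 := key 0
  have h1 := key 1
  nlinarith [abs_nonneg (x 0 - (y 0 + ((round (x 0 - y 0) : ℤ) : ℝ))),
    abs_nonneg (x 1 - (y 1 + ((round (x 1 - y 1) : ℤ) : ℝ)))]

lemma gdist_nonneg (x y : Plane) : 0 ≤ D.gdist x y := by
  cases D with
  | region Ω => exact dist_nonneg
  | torus => exact Real.iInf_nonneg fun m => dist_nonneg

lemma gdist_le_dist (x y : Plane) : D.gdist x y ≤ dist x y := by
  cases D with
  | region Ω => exact le_rfl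
  | torus => simpa [latticeVec_zero] using gdist_torus_le x y 0

lemma gdist_self (x : Plane) : D.gdist x x = 0 :=
  le_antisymm ((gdist_le_dist x x).trans (dist_self x).le) (gdist_nonneg x x)

lemma gdist_torus_comm (x y : Plane) : torus.gdist x y = torus.gdist y x := by
  suffices h : ∀ x y : Plane, torus.gdist x y ≤ torus.gdist y x from le_antisymm (h x y) (h y x)
  intro x y
  obtain ⟨m, hm⟩ := exists_gdist_torus_eq y x
  rw [hm]
  refine (gdist_torus_le x y (-m)).trans_eq ?_
  rw [dist_comm y, dist_eq_norm, dist_eq_norm, latticeVec_neg]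
  congr 1; abel

lemma gdist_comm (x y : Plane) : D.gdist x y = D.gdist y x := by
  cases D with
  | region Ω => exact dist_comm x y
  | torus => exact gdist_torus_comm x y

lemma gdist_triangle (x y z : Plane) : D.gdist x z ≤ D.gdist x y + D.gdist y z := by
  cases D with
  | region Ω => exact dist_triangle x y z
  | torus =>
    obtain ⟨m, hm⟩ := exists_gdist_torus_eq x y
    obtain ⟨n, hn⟩ := exists_gdist_torus_eq y z
    rw [hm, hn]
    refine (gdist_torus_le x z (m + n)).trans ?_
    refine (dist_triangle x (y + latticeVec m) _).trans_eq ?_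
    congr 1
    rw [latticeVec_add, dist_eq_norm, dist_eq_norm]
    congr 1; abel

lemma gdist_torus_add_right (x y : Plane) (m : Fin 2 → ℤ) :
    torus.gdist x (y + latticeVec m) = torus.gdist x y := by
  suffices h : ∀ (y : Plane) (m : Fin 2 → ℤ), torus.gdist x (y + latticeVec m) ≤ torus.gdist x y by
    refine le_antisymm (h y m) ?_
    simpa [add_assoc, ← latticeVec_add, latticeVec_zero] using h (y + latticeVec m) (-m)
  intro y m
  obtain ⟨n, hn⟩ := exists_gdist_torus_eq x y
  rw [hn]
  refine (gdist_torus_le _ _ (n - m)).trans_eq ?_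
  rw [sub_eq_add_neg, latticeVec_add, latticeVec_neg]
  congr 1; abel

lemma lipschitzWith_gdist (x : Plane) : LipschitzWith 1 (D.gdist x) :=
  LipschitzWith.of_le_add fun y z => by
    refine (gdist_triangle x z y).trans ?_
    have := gdist_le_dist (D := D) z y
    rw [dist_comm] at this
    linarith

lemma continuous_gdist (x : Plane) : Continuous (D.gdist x) := (lipschitzWith_gdist x).continuous

/-- Unfolding the plane integral over the cell produces a sum of nonnegative terms over all
translates, and one of them is the translate that realizes the geodesic distance. Through this
comparison every radial estimate on the plane holds on the torus with the same constant. -/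
lemma lintegral_gdist_le (x : Plane) {f : ℝ → ℝ≥0∞} (hf : Measurable f) :
    ∫⁻ z, f (D.gdist x z) ∂D.area ≤ ∫⁻ y : Plane, f ‖y‖ := by
  have hfm : Measurable fun y : Plane => f ‖y‖ := hf.comp measurable_norm
  have key : ∫⁻ z : Plane, f (dist x z) = ∫⁻ y : Plane, f ‖y‖ := by
    simp_rw [dist_eq_norm]
    exact lintegral_sub_left_eq_self (fun y : Plane => f ‖y‖) x
  cases D with
  | region Ω => exact (setLIntegral_le_lintegral _ _).trans_eq key
  | torus =>
    rw [← key, lintegral_plane_eq_lintegral_tsum (f := fun z => f (dist x z))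
      (hf.comp (by fun_prop))]
    refine lintegral_mono fun z => ?_
    obtain ⟨m, hm⟩ := exists_gdist_torus_eq x z
    rw [hm]
    exact le_tsum m

lemma ae_gdist_ne_zero (x : Plane) : ∀ᵐ z ∂D.area, D.gdist x z ≠ 0 := by
  have h := lintegral_gdist_le (D := D) x (f := indicator {0} 1)
    (measurable_one.indicator (measurableSet_singleton 0))
  have h0 : ∫⁻ y : Plane, indicator {(0 : ℝ)} (1 : ℝ → ℝ≥0∞) ‖y‖ = 0 := by
    rw [lintegral_eq_zero_iff']
    · have : ∀ᵐ y : Plane, y ≠ 0 := by simp [ae_iff]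
      filter_upwards [this] with y hy
      simp [hy]
    · exact ((measurable_one.indicator (measurableSet_singleton 0)).comp
        measurable_norm).aemeasurable
  rw [h0, nonpos_iff_eq_zero, lintegral_eq_zero_iff] at h
  · filter_upwards [h] with z hz hz0
    simp [hz0] at hz
  · exact (measurable_one.indicator (measurableSet_singleton 0)).comp
      (continuous_gdist x).measurable

lemma area_gdist_lt_le (x : Plane) (r : ℝ) :
    D.area {z | D.gdist x z < r} ≤ volume (ball (0 : Plane) r) := by
  have h := lintegral_gdist_le (D := D) x (f := indicator (Iio r) 1)
    (measurable_one.indicator measurableSet_Iio)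
  have hm : MeasurableSet {z | D.gdist x z < r} :=
    (isOpen_Iio.preimage (continuous_gdist x)).measurableSet
  have e1 : ∫⁻ z, indicator (Iio r) (1 : ℝ → ℝ≥0∞) (D.gdist x z) ∂D.area
      = D.area {z | D.gdist x z < r} := by
    rw [← lintegral_indicator_one hm]; rfl
  have e2 : ∫⁻ y : Plane, indicator (Iio r) (1 : ℝ → ℝ≥0∞) ‖y‖ = volume (ball (0 : Plane) r) := by
    rw [← lintegral_indicator_one isOpen_ball.measurableSet]
    congr 1 with y
    simp [indicator, mem_ball]
  rwa [e1, e2] at h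

end FlowDomain

/-! ### Radial integrals and the Hölder majorant of the singular kernel. -/

lemma lintegral_plane_radial {f : ℝ → ℝ} (h0 : ∀ r, 0 < r → 0 ≤ f r)
    (hf : IntegrableOn (fun r => r * f r) (Ioi 0)) : ∫⁻ x : Plane, ofReal (f ‖x‖) =
      ofReal (2 * π * ∫ r in Ioi (0 : ℝ), r * f r) := by
  have hi : Integrable (fun x : Plane => f ‖x‖) := by
    rw [integrable_fun_norm_addHaar]; simpa using hf
  have hne : ∀ᵐ x : Plane, x ≠ 0 := by simp [ae_iff]
  rw [← ofReal_integral_eq_lintegral_ofReal hi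
    (hne.mono fun x hx => h0 _ (norm_pos_iff.2 hx)), integral_fun_norm_addHaar]
  have hv : (volume : Measure Plane).real (ball 0 1) = π := by simp [Measure.real, pi_pos.le]
  rw [hv]
  simp [mul_assoc]

lemma lintegral_plane_inner_rpow (hs : s < 2) (hR : 0 < R) :
    ∫⁻ x : Plane, ofReal ((Iio R).indicator (fun r => r ^ (-s)) ‖x‖) =
      ofReal (2 * π * (R ^ (2 - s) / (2 - s))) := by
  have e : EqOn (fun r => r * (Iio R).indicator (fun r => r ^ (-s)) r)
      ((Ioo 0 R).indicator fun r => r ^ (1 - s)) (Ioi 0) := by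
    intro r hr
    have hr : 0 < r := hr
    by_cases h : r < R
    · simp [h, hr, sub_eq_add_neg, rpow_add hr]
    · simp [h]
  have hi : IntegrableOn (fun r : ℝ => r ^ (1 - s)) (Ioo 0 R) :=
    (intervalIntegral.integrableOn_Ioo_rpow_iff hR).2 (by linarith)
  rw [lintegral_plane_radial]
  · rw [setIntegral_congr_fun measurableSet_Ioi e, setIntegral_indicator measurableSet_Ioo,
      inter_eq_right.2 Ioo_subset_Ioi_self, ← integral_Ioc_eq_integral_Ioo,
      ← intervalIntegral.integral_of_le hR.le, integral_rpow (Or.inl (by linarith))]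
    have h2 : 1 - s + 1 = 2 - s := by ring
    rw [h2, zero_rpow (by linarith), sub_zero]
  · intro r hr
    by_cases h : r < R <;> simp [h, rpow_nonneg hr.le]
  · rw [integrableOn_congr_fun e measurableSet_Ioi]
    exact (hi.integrable_indicator measurableSet_Ioo).integrableOn

lemma lintegral_plane_outer_rpow (hs : 2 < s) (hR : 0 < R) :
    ∫⁻ x : Plane, ofReal ((Ioi R).indicator (fun r => r ^ (-s)) ‖x‖) =
      ofReal (2 * π * (R ^ (2 - s) / (s - 2))) := by
  have e : EqOn (fun r => r * (Ioi R).indicator (fun r => r ^ (-s)) r)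
      ((Ioi R).indicator fun r => r ^ (1 - s)) (Ioi 0) := by
    intro r hr
    have hr : 0 < r := hr
    by_cases h : R < r
    · simp [h, sub_eq_add_neg, rpow_add hr]
    · simp [h]
  have hi : IntegrableOn (fun r : ℝ => r ^ (1 - s)) (Ioi R) :=
    integrableOn_Ioi_rpow_of_lt (by linarith) hR
  rw [lintegral_plane_radial]
  · rw [setIntegral_congr_fun measurableSet_Ioi e, setIntegral_indicator measurableSet_Ioi,
      inter_eq_right.2 (Ioi_subset_Ioi hR.le), integral_Ioi_rpow_of_lt (by linarith) hR]
    have h2 : 1 - s + 1 = 2 - s := by ring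
    rw [h2, neg_div, ← div_neg, neg_sub]
  · intro r hr
    by_cases h : R < r <;> simp [h, rpow_nonneg hr.le]
  · rw [integrableOn_congr_fun e measurableSet_Ioi]
    exact (hi.integrable_indicator measurableSet_Ioi).integrableOn

/-- A majorant for the change of a `1/r` kernel when the pole moves by `d`: the first entry is the
smaller one for `r ≤ d`, the second for `r ≥ d`. -/
def kerMod (d r : ℝ) : ℝ := min (1 / r) (d / r ^ 2)

lemma kerMod_nonneg {d r : ℝ} (hd : 0 ≤ d) (hr : 0 ≤ r) : 0 ≤ kerMod d r :=
  le_min (by positivity) (by positivity)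

lemma measurable_kerMod (d : ℝ) : Measurable (kerMod d) := by
  unfold kerMod; fun_prop

/-- The two entries are `(1/r)(d/r)^β` with `β = 0` and `β = 1`, and a minimum of two powers lies
below every intermediate one. -/
lemma kerMod_le_rpow {d r α : ℝ} (hd : 0 ≤ d) (hr : 0 < r) (h0 : 0 ≤ α) (h1 : α ≤ 1) :
    kerMod d r ≤ d ^ α * r ^ (-1 - α) := by
  rcases hd.eq_or_lt with rfl | hd
  · have : kerMod 0 r = 0 := by simp [kerMod, hr.le]
    rw [this]; positivity
  have e : d ^ α * r ^ (-1 - α) = (1 / r) * (d / r) ^ α := by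
    rw [div_rpow hd.le hr.le, rpow_sub hr, Real.rpow_neg_one]
    field_simp
  rw [e]
  rcases le_total d r with h | h
  · refine (min_le_right _ _).trans ?_
    have e2 : d / r ^ 2 = 1 / r * (d / r) := by field_simp
    rw [e2]
    gcongr
    conv_lhs => rw [← Real.rpow_one (d / r)]
    exact Real.rpow_le_rpow_of_exponent_ge (by positivity) ((div_le_one hr).2 h) h1
  · refine (min_le_left _ _).trans (le_mul_of_one_le_right (by positivity) ?_)
    exact Real.one_le_rpow ((one_le_div hr).2 h) h0

lemma kerMod_le_of_one_le {d r α : ℝ} (hd : 0 ≤ d) (hr : 1 ≤ r) (h0 : 0 ≤ α) (h1 : α ≤ 1) :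
    kerMod d r ≤ d ^ α := by
  refine (kerMod_le_rpow hd (by linarith) h0 h1).trans (mul_le_of_le_one_right (by positivity) ?_)
  exact Real.rpow_le_one_of_one_le_of_nonpos hr (by linarith)

/-- A bound for the `L^{q'}` norm of `kerMod 1 ‖·‖`, with `q' = q/(q-1)`. The first fraction comes
from `r^{-q'}` near the origin, the second from `r^{-2q'}` away from it. -/
def holderConst (q : ℝ) : ℝ :=
  (2 * π * (4 / (2 - q / (q - 1)) + 1 / (2 * (q / (q - 1)) - 2))) ^ (1 / (q / (q - 1)))

lemma one_sub_two_div_pos (hq : 2 < q) : 0 < 1 - 2 / q := by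
  rw [sub_pos, div_lt_one] <;> linarith

lemma conj_bounds (hq : 2 < q) : 1 < q / (q - 1) ∧ q / (q - 1) < 2 := by
  constructor
  · rw [lt_div_iff₀] <;> linarith
  · rw [div_lt_iff₀] <;> linarith

lemma holderConst_nonneg (hq : 2 < q) : 0 ≤ holderConst q := by
  have := conj_bounds hq
  have h1 : 0 < 2 - q / (q - 1) := by linarith
  have h2 : 0 < 2 * (q / (q - 1)) - 2 := by linarith
  unfold holderConst
  positivity

/-- For `q > 2` the conjugate exponent satisfies `1 < q' < 2`, so `r^{-q'}` is integrable at the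
origin and `d^{q'} r^{-2q'}` at infinity. Both pieces scale like `d^{2-q'}`, the `q'`-th power of
`d^{1-2/q}`. -/
lemma lintegral_kerMod_le {q d : ℝ} (hq : 2 < q) (hd : 0 ≤ d) :
    ∫⁻ y : Plane, ofReal (kerMod d ‖y‖) ^ (q / (q - 1)) ≤
      ofReal (holderConst q * d ^ (1 - 2 / q)) ^ (q / (q - 1)) := by
  obtain ⟨hr1, hr2⟩ := conj_bounds hq
  have hα := one_sub_two_div_pos hq
  have hne : ∀ᵐ x : Plane, x ≠ 0 := by simp [ae_iff]
  have hre : (1 - 2 / q) * (q / (q - 1)) = 2 - q / (q - 1) := by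
    have : q - 1 ≠ 0 := by linarith
    have : q ≠ 0 := by linarith
    field_simp
    ring
  have hK := holderConst_nonneg hq
  have hKd : holderConst q ^ (q / (q - 1)) =
      2 * π * (4 / (2 - q / (q - 1)) + 1 / (2 * (q / (q - 1)) - 2)) := by
    have h1 : 0 < 2 - q / (q - 1) := by linarith
    have h2 : 0 < 2 * (q / (q - 1)) - 2 := by linarith
    rw [holderConst, ← Real.rpow_mul (by positivity), one_div_mul_cancel (by linarith),
      Real.rpow_one]
  set r := q / (q - 1) with hr
  rcases hd.eq_or_lt with rfl | hd
  · have : ∀ᵐ y : Plane, ofReal (kerMod 0 ‖y‖) ^ r = 0 := by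
      refine Eventually.of_forall fun y => ?_
      have : kerMod 0 ‖y‖ = 0 := by simp [kerMod]
      rw [this, ENNReal.ofReal_zero, ENNReal.zero_rpow_of_pos (by linarith)]
    rw [lintegral_congr_ae this]; simp
  -- The inner radius is `2 * d` so that the open regions `r < 2d` and `r > d` overlap and cover
  -- everything; this costs a factor `2^{2-r} ≤ 4`.
  have hI := lintegral_plane_inner_rpow hr2 (show 0 < 2 * d by positivity)
  have hO := lintegral_plane_outer_rpow (show 2 < 2 * r by linarith) hd
  have hm : Measurable fun y : Plane =>
      ofReal ((Iio (2 * d)).indicator (fun t : ℝ => t ^ (-r)) ‖y‖) :=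
    measurable_ofReal.comp
      (((measurable_id.pow_const _).indicator measurableSet_Iio).comp measurable_norm)
  have hm2 : Measurable fun y : Plane =>
      ofReal ((Ioi d).indicator (fun t : ℝ => t ^ (-(2 * r))) ‖y‖) :=
    measurable_ofReal.comp
      (((measurable_id.pow_const _).indicator measurableSet_Ioi).comp measurable_norm)
  calc ∫⁻ y : Plane, ofReal (kerMod d ‖y‖) ^ r
      ≤ ∫⁻ y : Plane, (ofReal ((Iio (2 * d)).indicator (fun t => t ^ (-r)) ‖y‖) + ofReal (d ^ r) *
            ofReal ((Ioi d).indicator (fun t => t ^ (-(2 * r))) ‖y‖)) := by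
        refine lintegral_mono_ae (hne.mono fun y hy => ?_)
        have ht : 0 < ‖y‖ := norm_pos_iff.2 hy
        rw [ofReal_rpow_of_nonneg (kerMod_nonneg hd.le ht.le) (by linarith)]
        rcases le_or_gt ‖y‖ d with h | h
        · refine le_add_right (ofReal_le_ofReal ?_)
          have : ‖y‖ ∈ Iio (2 * d) := by simp only [mem_Iio]; linarith
          rw [indicator_of_mem this, rpow_neg ht.le, ← Real.inv_rpow ht.le, ← one_div]
          exact rpow_le_rpow (kerMod_nonneg hd.le ht.le) (min_le_left _ _) (by linarith)
        · refine le_add_left ?_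
          rw [← ofReal_mul (by positivity)]
          refine ofReal_le_ofReal ?_
          have : ‖y‖ ∈ Ioi d := h
          rw [indicator_of_mem this]
          refine (rpow_le_rpow (kerMod_nonneg hd.le ht.le) (min_le_right _ _)
            (by linarith)).trans_eq ?_
          rw [div_rpow hd.le (by positivity), div_eq_mul_inv, ← Real.rpow_natCast,
            ← Real.rpow_mul ht.le, rpow_neg ht.le]
          norm_num
    _ = ofReal (2 * π * ((2 * d) ^ (2 - r) / (2 - r))) + ofReal (d ^ r) *
          ofReal (2 * π * (d ^ (2 - 2 * r) / (2 * r - 2))) := by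
        rw [lintegral_add_left hm, lintegral_const_mul _ hm2, hI, hO]
    _ ≤ _ := by
        have h1 : 0 < 2 - r := by linarith
        have h2 : 0 < 2 * r - 2 := by linarith
        rw [ofReal_rpow_of_nonneg (by positivity) (by linarith),
          ← ofReal_mul (by positivity), ← ofReal_add (by positivity) (by positivity)]
        refine ofReal_le_ofReal ?_
        rw [mul_rpow hK (by positivity), ← Real.rpow_mul hd.le, hre, hKd]
        have h3 : (2 : ℝ) ^ (2 - r) ≤ 4 := by
          calc (2 : ℝ) ^ (2 - r) ≤ 2 ^ (2 : ℝ) :=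
                Real.rpow_le_rpow_of_exponent_le (by norm_num) (by linarith)
            _ = 4 := by norm_num
        have h4 : d ^ r * (2 * π * (d ^ (2 - 2 * r) / (2 * r - 2))) =
            2 * π * (d ^ (2 - r) / (2 * r - 2)) := by
          have : d ^ (2 - r) = d ^ r * d ^ (2 - 2 * r) := by
            rw [← rpow_add hd]; congr 1; ring
          rw [this]; ring
        rw [h4, mul_rpow (by norm_num) hd.le]
        have h5 : 2 ^ (2 - r) * d ^ (2 - r) / (2 - r) ≤ 4 * d ^ (2 - r) / (2 - r) := by gcongr
        calc _ ≤ 2 * π * (4 * d ^ (2 - r) / (2 - r)) +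
              2 * π * (d ^ (2 - r) / (2 * r - 2)) := by gcongr
          _ = _ := by ring

/-- For `q ≥ 3` one has `2 - q' ≥ 1/2`, so the only unbounded term is `1/(2q' - 2) = (q-1)/2`. This
linear growth is the source of the factor `1 - log r` in the modulus of continuity. -/
lemma holderConst_le (hq : 3 ≤ q) : holderConst q ≤ 8 * π * q := by
  obtain ⟨hr1, hr2⟩ := conj_bounds (show 2 < q by linarith)
  have h0 : 0 < q - 1 := by linarith
  have h1 : 1 / 2 ≤ 2 - q / (q - 1) := by
    rw [le_sub_comm, div_le_iff₀ h0]; linarith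
  have h2 : 2 * (q / (q - 1)) - 2 = 2 / (q - 1) := by
    field_simp; ring
  have h3 : 4 / (2 - q / (q - 1)) ≤ 8 := by
    rw [div_le_iff₀ (by linarith)]; linarith
  have h4 : 1 ≤ 8 * π * q := by nlinarith [pi_gt_three]
  calc holderConst q ≤ (8 * π * q) ^ (1 / (q / (q - 1))) := by
        refine rpow_le_rpow ?_ ?_ (by positivity) <;> rw [h2, one_div_div]
        · positivity
        · nlinarith [pi_pos]
    _ ≤ (8 * π * q) ^ (1 : ℝ) :=
        Real.rpow_le_rpow_of_exponent_le h4 (by rw [div_le_one] <;> linarith)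
    _ = _ := Real.rpow_one _

/-! ### Size and Hölder continuity of the velocity. -/

namespace FlowDomain

lemma rpow_lintegral_le_ulNorm (hq : 1 ≤ q) (f : Plane → ℝ) (hx : x ∈ D.pts) :
    (∫⁻ z in {z | D.gdist x z < 1}, ‖f z‖ₑ ^ q ∂D.area) ^ (1 / q) ≤ D.ulNorm q f := by
  have h := eLpNorm_eq_lintegral_rpow_enorm_toReal (p := ofReal q) (f := f)
    (μ := D.area.restrict {z | D.gdist x z < 1})
    (by simp only [ne_eq, ofReal_eq_zero, not_le]; linarith) ofReal_ne_top
  rw [toReal_ofReal (by linarith)] at h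
  rw [← h]
  exact le_iSup₂ (f := fun x _ =>
    eLpNorm f (ofReal q) (D.area.restrict {z | D.gdist x z < 1})) x hx

/-- Potential estimate: Hölder near the singularity, `L¹` away from it. -/
lemma lintegral_potential_le (hq : 1 < q)
    (hf : AEStronglyMeasurable f D.area) (hx : x ∈ D.pts) {G : ℝ → ℝ≥0∞}
    (hG : Measurable G) {A b : ℝ≥0∞}
    (hA : ∫⁻ y : Plane in ball 0 1, G ‖y‖ ^ (q / (q - 1)) ≤ A ^ (q / (q - 1)))
    (hb : ∀ r, 1 ≤ r → G r ≤ b) :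
    ∫⁻ z, G (D.gdist x z) * ‖f z‖ₑ ∂D.area ≤ A * D.ulNorm q f + b * eLpNorm f 1 D.area := by
  have hm : MeasurableSet {z | D.gdist x z < 1} :=
    (isOpen_Iio.preimage (continuous_gdist x)).measurableSet
  have hconj : (q / (q - 1)).HolderConjugate q := (Real.HolderConjugate.conjExponent hq).symm
  have hr : 0 < q / (q - 1) := hconj.pos
  have hGm : Measurable fun z => G (D.gdist x z) := hG.comp (continuous_gdist x).measurable
  rw [← lintegral_add_compl _ hm]
  refine add_le_add ?_ ?_
  · have h := ENNReal.lintegral_mul_le_Lp_mul_Lq (D.area.restrict {z | D.gdist x z < 1}) hconj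
      hGm.aemeasurable hf.enorm.restrict
    refine h.trans (mul_le_mul' ?_ (rpow_lintegral_le_ulNorm hq.le f hx))
    have h2 : ∫⁻ z in {z | D.gdist x z < 1}, G (D.gdist x z) ^ (q / (q - 1)) ∂D.area ≤
        A ^ (q / (q - 1)) := by
      refine le_trans ?_ hA
      have h3 := lintegral_gdist_le (D := D) x (f := (Iio 1).indicator fun r => G r ^ (q / (q - 1)))
        ((hG.pow_const _).indicator measurableSet_Iio)
      rw [← lintegral_indicator hm, ← lintegral_indicator isOpen_ball.measurableSet]
      refine le_trans (le_of_eq ?_) (h3.trans (le_of_eq ?_))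
      · rfl
      · refine lintegral_congr fun y => ?_
        simp only [indicator, mem_Iio, mem_ball, dist_zero_right]
    calc _ ≤ (A ^ (q / (q - 1))) ^ (1 / (q / (q - 1))) := by gcongr
      _ = A := by rw [← rpow_mul, mul_one_div_cancel hr.ne', rpow_one]
  · calc ∫⁻ z in {z | D.gdist x z < 1}ᶜ, G (D.gdist x z) * ‖f z‖ₑ ∂D.area
        ≤ ∫⁻ z in {z | D.gdist x z < 1}ᶜ, b * ‖f z‖ₑ ∂D.area := by
          refine setLIntegral_mono_ae' hm.compl (.of_forall fun z hz => ?_)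
          gcongr
          exact hb _ (by simpa using hz)
      _ ≤ ∫⁻ z, b * ‖f z‖ₑ ∂D.area := setLIntegral_le_lintegral _ _
      _ = b * eLpNorm f 1 D.area := by
          rw [lintegral_const_mul'' _ hf.enorm, eLpNorm_one_eq_lintegral_enorm]

lemma KernelBounds.aestronglyMeasurable (hk : D.KernelBounds k C1 C2) (hD : D.IsRegular)
    (hx : x ∈ D.pts) : AEStronglyMeasurable (k x) D.area := by
  have h : Measurable fun z : D.pts => k x z :=
    hk.measurable.comp (measurable_const.prodMk measurable_id : Measurable fun z : D.pts =>
      ((⟨x, hx⟩ : D.pts), z))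
  have h2 := aemeasurable_restrict_of_measurable_subtype (μ := (volume : Measure Plane))
    (measurableSet_pts hD) h
  exact (h2.mono_measure (Measure.restrict_mono cell_subset_pts le_rfl)).aestronglyMeasurable

section

variable (hk : D.KernelBounds k C1 C2) (hD : D.IsRegular) (hC1 : 0 ≤ C1)
include hk hD hC1

/-- Inside the unit ball `1/r` equals `kerMod 1 r`, whose `L^{q'}` norm is `holderConst q` at most;
outside it the kernel is bounded by `C1` and the mass suffices. -/
lemma lintegral_velocity_le
    (hq : 2 < q) (hf : AEStronglyMeasurable f D.area) (hx : x ∈ D.pts) : ∫⁻ z,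
      ‖f z • k x z‖ₑ ∂D.area ≤ ofReal C1 *
      (ofReal (holderConst q) * D.ulNorm q f + eLpNorm f 1 D.area) := by
  have hG : Measurable fun r : ℝ => ofReal (1 / r) := by fun_prop
  have hA : ∫⁻ y : Plane in ball 0 1, ofReal (1 / ‖y‖) ^ (q / (q - 1)) ≤
      ofReal (holderConst q) ^ (q / (q - 1)) := by
    have h1 := lintegral_kerMod_le hq zero_le_one
    rw [Real.one_rpow, mul_one] at h1
    refine le_trans ?_ ((setLIntegral_le_lintegral (ball 0 1) _).trans h1)
    refine setLIntegral_mono_ae' isOpen_ball.measurableSet (.of_forall fun y hy => ?_)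
    have hy : ‖y‖ < 1 := by simpa using hy
    have h0 : 0 ≤ q / (q - 1) := by linarith [(conj_bounds hq).1]
    gcongr
    refine le_min le_rfl ?_
    rcases (norm_nonneg y).eq_or_lt with h | h
    · rw [← h]; simp
    · gcongr
      nlinarith
  have h := lintegral_potential_le (show 1 < q by linarith) hf hx hG hA (b := 1) (fun r hr => by
      rw [ENNReal.ofReal_le_one]
      rw [div_le_one] <;> linarith)
  rw [one_mul] at h
  calc ∫⁻ z, ‖f z • k x z‖ₑ ∂D.area
      ≤ ∫⁻ z, ofReal C1 * (ofReal (1 / D.gdist x z) * ‖f z‖ₑ) ∂D.area := by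
        refine lintegral_mono_ae ?_
        filter_upwards [ae_gdist_ne_zero (D := D) x, ae_area_mem_pts hD] with z hz hzp
        rw [enorm_smul, ← mul_assoc, ← ofReal_mul hC1, mul_comm]
        gcongr
        rw [← ofReal_norm, mul_one_div]
        exact ofReal_le_ofReal (hk.size x hx z hzp hz)
    _ = ofReal C1 * ∫⁻ z, ofReal (1 / D.gdist x z) * ‖f z‖ₑ ∂D.area :=
        lintegral_const_mul' _ _ ofReal_ne_top
    _ ≤ _ := by gcongr

lemma integrable_velocity
    (hq : 2 < q) (hf : D.MemL1Ul q f) (hx : x ∈ D.pts) :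
    Integrable (fun z => f z • k x z) D.area := by
  refine ⟨hf.memL1.1.smul (hk.aestronglyMeasurable hD hx), ?_⟩
  refine (lintegral_velocity_le hk hD hC1 hq hf.memL1.1 hx).trans_lt ?_
  refine mul_lt_top ofReal_lt_top (add_lt_top.2 ⟨?_, hf.memL1.2⟩)
  exact mul_lt_top ofReal_lt_top hf.ul_finite

lemma norm_velocity_le (hq : 2 < q)
    (hf : AEStronglyMeasurable f D.area)
    (hN1 : 0 ≤ N1) (hN : 0 ≤ N) (h1 : eLpNorm f 1 D.area ≤ ofReal N1)
    (h2 : D.ulNorm q f ≤ ofReal N) (hx : x ∈ D.pts) :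
    ‖D.velocity k f x‖ ≤ C1 * (holderConst q * N + N1) := by
  have hK := holderConst_nonneg hq
  have h := (enorm_integral_le_lintegral_enorm _).trans (lintegral_velocity_le hk hD hC1 hq hf hx)
  rw [← ofReal_le_ofReal_iff (by positivity), ofReal_norm,
    ofReal_mul hC1, ofReal_add (by positivity) hN1, ofReal_mul hK]
  refine h.trans ?_
  gcongr

end

/-- Only the pole closer to `z`, at distance `a` say, matters. The size bound gives at most `2 C1 /
a`, the oscillation bound at most `C2 d / a²`, and each of the two entries of `kerMod d a` is
dominated accordingly. -/
lemma norm_kernel_sub_le (hk : D.KernelBounds k C1 C2) (hC1 : 0 ≤ C1) (hC2 : 0 ≤ C2)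
    {x y z : Plane} (hx : x ∈ D.pts) (hy : y ∈ D.pts) (hz : z ∈ D.pts)
    (hxz : D.gdist x z ≠ 0) (hyz : D.gdist y z ≠ 0) : ‖k x z - k y z‖ ≤ (2 * C1 + C2) *
      (kerMod (D.gdist x y) (D.gdist x z) + kerMod (D.gdist x y) (D.gdist y z)) := by
  have ha : 0 < D.gdist x z := lt_of_le_of_ne (gdist_nonneg _ _) hxz.symm
  have hb : 0 < D.gdist y z := lt_of_le_of_ne (gdist_nonneg _ _) hyz.symm
  have hd := gdist_nonneg (D := D) x y
  have h1 := hk.size x hx z hz hxz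
  have h2 := hk.size y hy z hz hyz
  have h3 := hk.oscillation x hx y hy z hz hxz hyz
  have h4 : ‖k x z - k y z‖ ≤ C1 / D.gdist x z + C1 / D.gdist y z :=
    (norm_sub_le _ _).trans (add_le_add h1 h2)
  generalize D.gdist x z = a at *
  generalize D.gdist y z = b at *
  generalize D.gdist x y = d at *
  generalize ‖k x z - k y z‖ = w at *
  have key : ∀ a b : ℝ, 0 < a → a ≤ b → w ≤ C1 / a + C1 / b → w ≤ C2 * (d / (a * b)) →
      w ≤ (2 * C1 + C2) * kerMod d a := by
    intro a b ha hab h4 h3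
    have hb : 0 < b := ha.trans_le hab
    rw [kerMod]
    rcases min_choice (1 / a) (d / a ^ 2) with h | h <;> rw [h]
    · have : C1 / b ≤ C1 / a := by gcongr
      have e : (2 * C1 + C2) * (1 / a) = C1 / a + C1 / a + C2 / a := by ring
      have : 0 ≤ C2 / a := by positivity
      linarith
    · have : C2 * (d / (a * b)) ≤ C2 * (d / a ^ 2) := by
        rw [sq]; gcongr
      have : 0 ≤ 2 * C1 * (d / a ^ 2) := by positivity
      linarith
  have hna := kerMod_nonneg hd ha.le
  have hnb := kerMod_nonneg hd hb.le
  have hc : 0 ≤ 2 * C1 + C2 := by positivity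
  rcases le_total a b with h | h
  · refine (key a b ha h h4 h3).trans ?_
    gcongr; linarith
  · refine (key b a hb h (by linarith) (by rwa [mul_comm b a])).trans ?_
    gcongr; linarith

/-- The kernel difference is dominated by two copies of `kerMod`, centred at `x` and at `y`. The
potential estimate yields `d^{1-2/q}` for each: by scaling near the pole, and by interpolation at
distances above one. -/
lemma norm_velocity_sub_le_holder (hk : D.KernelBounds k C1 C2) (hD : D.IsRegular)
    (hC1 : 0 ≤ C1) (hC2 : 0 ≤ C2) (hq : 2 < q) (hf : D.MemL1Ul q f) (hN1 : 0 ≤ N1) (hN : 0 ≤ N)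
      (h1 : eLpNorm f 1 D.area ≤ ofReal N1)
    (h2 : D.ulNorm q f ≤ ofReal N) (hx : x ∈ D.pts) (hy : y ∈ D.pts) :
    ‖D.velocity k f x - D.velocity k f y‖ ≤
      2 * (2 * C1 + C2) * (holderConst q * N + N1) * D.gdist x y ^ (1 - 2 / q) := by
  have hA0 := holderConst_nonneg hq
  have h2q : 2 / q ≤ 1 := by rw [div_le_one] <;> linarith
  have h2q' : 0 ≤ 2 / q := by positivity
  set A := holderConst q
  set α := 1 - 2 / q with hα
  have hd := gdist_nonneg (D := D) x y
  set d := D.gdist x y with hd_def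
  have hG : Measurable fun r : ℝ => ofReal (kerMod d r) :=
    measurable_ofReal.comp (measurable_kerMod d)
  have hpot : ∀ x ∈ D.pts, ∫⁻ z, ofReal (kerMod d (D.gdist x z)) * ‖f z‖ₑ ∂D.area ≤
      ofReal ((A * N + N1) * d ^ α) := by
    intro x hx
    have h := lintegral_potential_le (show 1 < q by linarith) hf.memL1.1 hx hG
      ((setLIntegral_le_lintegral _ _).trans (lintegral_kerMod_le hq hd)) (b := ofReal (d ^ α))
        (fun r hr => ofReal_le_ofReal (kerMod_le_of_one_le hd hr (by linarith) (by linarith)))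
    refine h.trans ?_
    have e : (A * N + N1) * d ^ α = A * d ^ α * N + d ^ α * N1 := by ring
    rw [e, ofReal_add (by positivity) (by positivity), ofReal_mul (p := A * d ^ α) (by positivity),
      ofReal_mul (p := d ^ α) (by positivity)]
    gcongr
  have hsub : D.velocity k f x - D.velocity k f y = ∫ z, f z • (k x z - k y z) ∂D.area := by
    rw [velocity, velocity, ← integral_sub (integrable_velocity hk hD hC1 hq hf hx)
      (integrable_velocity hk hD hC1 hq hf hy)]
    simp_rw [smul_sub]
  have hc : 0 ≤ 2 * C1 + C2 := by positivity
  have hm : ∀ x : Plane, AEMeasurable (fun z => ofReal (kerMod d (D.gdist x z)) * ‖f z‖ₑ) D.area :=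
    fun x => (hG.comp (continuous_gdist x).measurable).aemeasurable.mul hf.memL1.1.enorm
  rw [hsub, ← ofReal_le_ofReal_iff (by positivity), ofReal_norm]
  refine (enorm_integral_le_lintegral_enorm _).trans ?_
  calc ∫⁻ z, ‖f z • (k x z - k y z)‖ₑ ∂D.area
      ≤ ∫⁻ z, ofReal (2 * C1 + C2) * (ofReal (kerMod d (D.gdist x z)) * ‖f z‖ₑ +
            ofReal (kerMod d (D.gdist y z)) * ‖f z‖ₑ) ∂D.area := by
        refine lintegral_mono_ae ?_
        filter_upwards [ae_gdist_ne_zero (D := D) x, ae_gdist_ne_zero (D := D) y,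
          ae_area_mem_pts hD] with z hxz hyz hz
        rw [enorm_smul, ← add_mul, ← mul_assoc, mul_comm,
          ← ofReal_add (kerMod_nonneg hd (gdist_nonneg _ _))
            (kerMod_nonneg hd (gdist_nonneg _ _)), ← ofReal_mul hc]
        gcongr
        rw [← ofReal_norm]
        exact ofReal_le_ofReal (norm_kernel_sub_le hk hC1 hC2 hx hy hz hxz hyz)
    _ = ofReal (2 * C1 + C2) * (∫⁻ z, ofReal (kerMod d (D.gdist x z)) * ‖f z‖ₑ ∂D.area +
            ∫⁻ z, ofReal (kerMod d (D.gdist y z)) * ‖f z‖ₑ ∂D.area) := by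
        rw [lintegral_const_mul' _ _ ofReal_ne_top, lintegral_add_left' (hm x)]
    _ ≤ ofReal (2 * C1 + C2) * (ofReal ((A * N + N1) * d ^ α) + ofReal ((A * N + N1) * d ^ α)) := by
        gcongr
        · exact hpot x hx
        · exact hpot y hy
    _ = ofReal (2 * (2 * C1 + C2) * (A * N + N1) * d ^ α) := by
        rw [← ofReal_add (by positivity) (by positivity), ← ofReal_mul hc]
        congr 1; ring

end FlowDomain

/-! ### Periodization of functions with compact support. -/

lemma finite_latticeVec_norm_le (R : ℝ) : {m : Fin 2 → ℤ | ‖latticeVec m‖ ≤ R}.Finite := by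
  refine (Set.finite_Icc (fun _ : Fin 2 => -⌈R⌉) (fun _ => ⌈R⌉)).subset fun m hm => ?_
  have h : ∀ i, |(m i : ℝ)| ≤ R := fun i => by
    have := (PiLp.norm_apply_le (latticeVec m) i).trans hm
    simpa [latticeVec_apply] using this
  constructor <;> intro i <;> have h := abs_le.1 ((h i).trans (Int.le_ceil R))
  · exact_mod_cast h.1
  · exact_mod_cast h.2

section Periodize

variable {E : Type*} [NormedAddCommGroup E]

def periodize (f : Plane → E) (x : Plane) : E := ∑' m : Fin 2 → ℤ, f (x + latticeVec m)

lemma periodize_descends (f : Plane → E) (m : Fin 2 → ℤ) (x : Plane) :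
    periodize f (x + latticeVec m) = periodize f x := by
  unfold periodize
  rw [← (Equiv.addLeft m).tsum_eq fun n => f (x + latticeVec n)]
  simp [latticeVec_add, add_assoc]

/-- On a bounded set only finitely many translates of a compact support are met; this reduces the
regularity of `periodize f` to that of finite sums. -/
lemma exists_periodize_eq_sum {f : Plane → E} (hf : HasCompactSupport f) (R : ℝ) :
    ∃ s : Finset (Fin 2 → ℤ), ∀ x, ‖x‖ < R → ∀ m ∉ s, f (x + latticeVec m) = 0 := by
  obtain ⟨C, hC⟩ := hf.isCompact.isBounded.exists_norm_le
  refine ⟨(finite_latticeVec_norm_le (C + R)).toFinset, fun x hx m hm => ?_⟩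
  by_contra h
  have h1 := hC _ (subset_tsupport f h)
  have h2 : C + R < ‖latticeVec m‖ := by simpa using hm
  have h3 := norm_sub_le (x + latticeVec m) x
  rw [add_sub_cancel_left] at h3
  linarith

variable [NormedSpace ℝ E]

lemma hasFDerivAt_periodize {f : Plane → E} (hf : HasCompactSupport f)
    (hd : Differentiable ℝ f) (x : Plane) :
    HasFDerivAt (periodize f) (periodize (fderiv ℝ f) x) x := by
  obtain ⟨s, hs⟩ := exists_periodize_eq_sum hf (‖x‖ + 1)
  obtain ⟨s', hs'⟩ := exists_periodize_eq_sum (hf.fderiv ℝ) (‖x‖ + 1)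
  have e : periodize f =ᶠ[𝓝 x] fun y => ∑ m ∈ s ∪ s', f (y + latticeVec m) := by
    filter_upwards [continuous_norm.continuousAt.eventually (gt_mem_nhds (lt_add_one ‖x‖))]
      with y hy
    exact tsum_eq_sum fun m hm => hs y hy m fun h => hm (Finset.mem_union_left _ h)
  have e2 : periodize (fderiv ℝ f) x = ∑ m ∈ s ∪ s', fderiv ℝ f (x + latticeVec m) :=
    tsum_eq_sum fun m hm => hs' x (lt_add_one _) m fun h => hm (Finset.mem_union_right _ h)
  rw [e2]
  refine HasFDerivAt.congr_of_eventuallyEq ?_ e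
  refine HasFDerivAt.fun_sum fun m _ => ?_
  exact (hd _).hasFDerivAt.comp x ((hasFDerivAt_id x).add_const _) |>.congr_fderiv (by ext; simp)

lemma contDiff_periodize {f : Plane → E} (hf : HasCompactSupport f) {n : WithTop ℕ∞}
    (hd : ContDiff ℝ n f) : ContDiff ℝ n (periodize f) := by
  rw [contDiff_iff_contDiffAt]
  intro x
  obtain ⟨s, hs⟩ := exists_periodize_eq_sum hf (‖x‖ + 1)
  have e : periodize f =ᶠ[𝓝 x] fun y => ∑ m ∈ s, f (y + latticeVec m) := by
    filter_upwards [continuous_norm.continuousAt.eventually (gt_mem_nhds (lt_add_one ‖x‖))]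
      with y hy
    exact tsum_eq_sum fun m hm => hs y hy m hm
  refine ContDiffAt.congr_of_eventuallyEq ?_ e
  refine (ContDiff.sum fun m _ => ?_).contDiffAt
  exact hd.comp (contDiff_id.add contDiff_const)

lemma hasSum_integral_cell {f : Plane → E} (hf : Integrable f) :
    HasSum (fun m => ∫ x in FlowDomain.torus.cell, f (x + latticeVec m)) (∫ x, f x) := by
  have hm : ∀ m, MeasurableSet (FlowDomain.floorVec ⁻¹' {m}) := fun m =>
    FlowDomain.measurable_floorVec (measurableSet_singleton m)
  have hu : (⋃ m, FlowDomain.floorVec ⁻¹' {m}) = univ := by ext x; simp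
  have h := hasSum_integral_iUnion (f := f) (μ := volume) hm
    (fun m n hmn => Disjoint.preimage _ (by simpa using hmn)) (by rw [hu]; exact hf.integrableOn)
  rw [hu, setIntegral_univ] at h
  convert h using 2 with m
  have := (measurePreserving_add_right (volume : Measure Plane)
    (latticeVec m)).setIntegral_preimage_emb (measurableEmbedding_addRight _) f
      (FlowDomain.floorVec ⁻¹' {m})
  rw [← this]
  congr 2
  ext x
  simp [FlowDomain.floorVec_add_latticeVec, ← FlowDomain.floorVec_eq_zero_iff]

/-- Unfolding for vector-valued functions. The interchange of sum and integral is justified by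
applying the scalar identity to the norm. -/
lemma integral_cell_periodize {f : Plane → E} (hf : Integrable f) :
    ∫ x in FlowDomain.torus.cell, periodize f x = ∫ x, f x := by
  have h := hasSum_integral_of_summable_integral_norm
    (μ := volume.restrict FlowDomain.torus.cell) (F := fun m x => f (x + latticeVec m))
    (fun m => (hf.comp_add_right (latticeVec m)).integrableOn)
    (hasSum_integral_cell hf.norm).summable
  exact h.unique (hasSum_integral_cell hf)

end Periodize

/-! ### Divergence bounds in terms of test functions on the plane. -/

/-- Weak bound on the divergence, tested with smooth functions compactly supported in `U`. -/
def WeakDivBound (U : Set Plane) (u : Plane → Plane) (B : ℝ) : Prop :=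
  ∀ φ : Plane → ℝ, ContDiff ℝ (⊤ : ℕ∞) φ → HasCompactSupport φ → tsupport φ ⊆ U →
    |∫ x, fderiv ℝ φ x (u x)| ≤ B * ∫ x, |φ x|

namespace FlowDomain

lemma abs_integral_mul_le {B : ℝ} {μ : Measure Plane}
    (hg : eLpNorm g ∞ μ ≤ ofReal B) (hB : 0 ≤ B) (hφ : Integrable φ μ) :
    |∫ x, g x * φ x ∂μ| ≤ B * ∫ x, |φ x| ∂μ := by
  rw [← integral_const_mul, ← norm_eq_abs]
  refine norm_integral_le_of_norm_le (hφ.abs.const_mul B) ?_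
  rw [eLpNorm_exponent_top] at hg
  filter_upwards [enorm_ae_le_eLpNormEssSup g μ] with x hx
  rw [norm_mul, norm_eq_abs (φ x)]
  gcongr
  rw [← ofReal_le_ofReal_iff hB, ofReal_norm]
  exact hx.trans hg

lemma torus_cell_subset_closedBall : torus.cell ⊆ closedBall 0 2 := by
  intro x hx
  have h0 : x 0 ∈ Ico (0 : ℝ) 1 := hx 0
  have h1 : x 1 ∈ Ico (0 : ℝ) 1 := hx 1
  rw [mem_closedBall_zero_iff, ← abs_of_nonneg (norm_nonneg x)]
  refine abs_le_of_sq_le_sq ?_ (by norm_num)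
  rw [norm_sq_eq]
  simp only [Fin.sum_univ_two, norm_eq_abs, sq_abs]
  nlinarith [h0.1, h0.2, h1.1, h1.2]

lemma integrable_torus_area {E : Type*} [NormedAddCommGroup E] {f : Plane → E}
    (hf : Continuous f) : Integrable f torus.area :=
  Integrable.mono_measure (ν := volume.restrict (closedBall 0 2))
    (hf.continuousOn.integrableOn_compact (isCompact_closedBall _ _))
    (Measure.restrict_mono torus_cell_subset_closedBall le_rfl)

/-- A test function with compact support in the plane is not periodic, so on the torus its
periodization is tested instead. Unfolding returns the original pairing because `u` is periodic, and
the bound survives since the absolute value of a sum over translates is at most the sum of absolute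
values. -/
lemma DivBounded.weakDivBound {B : ℝ} (hB : 0 ≤ B)
    (hu : D.DivBounded u (ofReal B)) (hud : D.Descends u)
    (hi : ∀ φ : Plane → ℝ, ContDiff ℝ (⊤ : ℕ∞) φ → HasCompactSupport φ → tsupport φ ⊆ D.pts →
      Integrable fun x => fderiv ℝ φ x (u x)) : WeakDivBound D.pts u B := by
  obtain ⟨g, hg, hgB, h⟩ := hu
  intro φ hφ hφc hφs
  have hφi : Integrable φ := hφ.continuous.integrable_of_hasCompactSupport hφc
  have hdiff : Differentiable ℝ φ := hφ.differentiable (by simp)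
  cases D with
  | region Ω =>
    have h0 : ∀ x ∉ Ω, φ x = 0 := fun x hx => image_eq_zero_of_notMem_tsupport fun h => hx (hφs h)
    have h1 : ∀ x ∉ Ω, fderiv ℝ φ x (u x) = 0 := fun x hx => by
      have : fderiv ℝ φ x = 0 := image_eq_zero_of_notMem_tsupport fun h =>
        hx (hφs (tsupport_fderiv_subset ℝ h))
      rw [this]; rfl
    have h2 := h φ ⟨hφ.comp contDiff_snd, tsupport φ, hφc, hφs,
      fun _ x hx => image_eq_zero_of_notMem_tsupport hx⟩
    have h3 := abs_integral_mul_le hgB hB hφi.integrableOn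
    rw [show (region Ω).area = volume.restrict Ω from rfl] at h2 h3
    rw [setIntegral_eq_integral_of_forall_compl_eq_zero h1] at h2
    rw [h2, abs_neg]
    refine h3.trans_eq ?_
    rw [setIntegral_eq_integral_of_forall_compl_eq_zero fun x hx => by rw [h0 x hx, abs_zero]]
  | torus =>
    have hper := contDiff_periodize hφc hφ
    have h2 := h (periodize φ) ⟨hper.comp contDiff_snd, fun _ => periodize_descends φ⟩
    have hpi : Integrable (periodize φ) torus.area := by exact integrable_torus_area hper.continuous
    have h3 := abs_integral_mul_le hgB hB hpi
    have e1 : ∫ x, fderiv ℝ (periodize φ) x (u x) ∂torus.area = ∫ x, fderiv ℝ φ x (u x) := by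
      rw [← integral_cell_periodize (hi φ hφ hφc hφs)]
      refine integral_congr_ae (ae_of_all _ fun x => ?_)
      have hs : Summable fun m => fderiv ℝ φ (x + latticeVec m) := by
        obtain ⟨s, hs⟩ := exists_periodize_eq_sum (hφc.fderiv ℝ) (‖x‖ + 1)
        exact summable_of_ne_finset_zero (s := s) fun m hm => hs x (lt_add_one _) m hm
      simp only [(hasFDerivAt_periodize hφc hdiff x).fderiv, periodize]
      rw [← ContinuousLinearMap.apply_apply (u x), ContinuousLinearMap.map_tsum _ hs]
      refine tsum_congr fun m => ?_
      rw [ContinuousLinearMap.apply_apply, hud m x]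
    rw [← e1, h2, abs_neg]
    refine h3.trans ?_
    gcongr
    rw [← integral_cell_periodize hφi.abs]
    refine integral_mono_of_nonneg (.of_forall fun x => abs_nonneg _) ?_ (.of_forall fun x => ?_)
    · exact integrable_torus_area (contDiff_periodize hφc.abs
        (contDiff_zero.2 hφ.continuous.abs)).continuous
    · obtain ⟨s, hs⟩ := exists_periodize_eq_sum hφc (‖x‖ + 1)
      have hs' := hs x (lt_add_one _)
      simp only [periodize]
      rw [tsum_eq_sum hs', tsum_eq_sum (s := s) fun m hm => by rw [hs' m hm, abs_zero]]
      exact Finset.abs_sum_le_sum_abs _ _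

/-! ### Change of variables and transport of densities. -/

/-- A map of the plane that commutes with the lattice translations, if the domain is the torus. -/
def Equivariant (D : FlowDomain) (X : Plane → Plane) : Prop := match D with
  | region _ => True
  | torus => ∀ (m : Fin 2 → ℤ) (x : Plane), X (x + latticeVec m) = X x + latticeVec m

/-- On the torus, `F` commutes with translations, so `F` of the part of `S` in the cell contains
exactly one translate of each point of `F '' S`. Folding the planar integral over this set back to
the cell therefore leaves a single term of the lattice sum. -/
lemma lintegral_image_eq (hD : D.IsRegular) (F : Plane ≃ₜ Plane) (hF : Differentiable ℝ F)
    (hFe : D.Equivariant F) {S : Set Plane} (hS : MeasurableSet S) (hSp : S ⊆ D.pts)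
    (hFS : F '' S ⊆ D.pts) (hSd : D.Descends (· ∈ S)) {g : Plane → ℝ≥0∞} (hg : Measurable g)
    (hgd : D.Descends g) : ∫⁻ y in F '' S, g y ∂D.area =
      ∫⁻ x in S, ofReal |(fderiv ℝ F x).det| * g (F x) ∂D.area := by
  have hFSm : MeasurableSet (F '' S) := F.measurableEmbedding.measurableSet_image.2 hS
  have hcv : ∀ A : Set Plane, MeasurableSet A → ∫⁻ y in F '' A, g y =
      ∫⁻ x in A, ofReal |(fderiv ℝ F x).det| * g (F x) := fun A hA =>
    lintegral_image_eq_lintegral_abs_det_fderiv_mul volume hA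
      (fun x _ => (hF x).hasFDerivAt.hasFDerivWithinAt) F.injective.injOn g
  cases D with
  | region Ω =>
    have h1 : F '' S ∩ (region Ω).cell = F '' S := inter_eq_left.2 hFS
    have h2 : S ∩ (region Ω).cell = S := inter_eq_left.2 hSp
    rw [area, Measure.restrict_restrict hFSm, Measure.restrict_restrict hS, h1, h2]
    exact hcv S hS
  | torus =>
    have hFe : ∀ (m : Fin 2 → ℤ) (x : Plane), F (x + latticeVec m) = F x + latticeVec m := hFe
    have hgd : ∀ (m : Fin 2 → ℤ) (x : Plane), g (x + latticeVec m) = g x := hgd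
    have hSd : ∀ (m : Fin 2 → ℤ) (x : Plane), (x + latticeVec m ∈ S) = (x ∈ S) := hSd
    have hc := measurableSet_torus_cell
    have hFSc := F.measurableEmbedding.measurableSet_image.2 (hS.inter hc)
    rw [area, Measure.restrict_restrict hS, ← hcv _ (hS.inter hc), ← lintegral_indicator hFSc,
      lintegral_plane_eq_lintegral_tsum (hg.indicator hFSc), ← lintegral_indicator hFSm]
    refine lintegral_congr fun y => ?_
    have hinv : ∀ m, F.symm (y + latticeVec m) = F.symm y + latticeVec m := fun m => by
      rw [F.symm_apply_eq, hFe, F.apply_symm_apply]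
    have hmem : ∀ (A : Set Plane) (z : Plane), z ∈ F '' A ↔ F.symm z ∈ A := fun A z => by
      rw [F.image_eq_preimage_symm]; rfl
    have hcell : ∀ m, F.symm y + latticeVec m ∈ torus.cell ↔ m = -floorVec (F.symm y) := by
      intro m
      rw [← floorVec_eq_zero_iff, floorVec_add_latticeVec, eq_neg_iff_add_eq_zero, add_comm]
    rw [tsum_eq_single (-floorVec (F.symm y))]
    · by_cases h : F.symm y ∈ S
      · rw [indicator_of_mem ((hmem _ _).2 h), indicator_of_mem, hgd]
        rw [hmem, hinv]
        exact ⟨(hSd _ _).mpr h, (hcell _).2 rfl⟩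
      · rw [indicator_of_notMem (mt (hmem _ _).1 h), indicator_of_notMem]
        rw [hmem, hinv]
        exact fun h' => h ((hSd _ _).mp h'.1)
    · intro m hm
      rw [indicator_of_notMem]
      rw [hmem, hinv]
      exact fun h' => hm ((hcell m).1 h'.2)

/-- Density of the push-forward of `ω` restricted to `S` under a homeomorphism with Jacobian
determinant `J`. -/
def transport (F : Plane ≃ₜ Plane) (J : Plane → ℝ) (S : Set Plane) (ω : Plane → ℝ) : Plane → ℝ :=
  fun y => S.indicator (fun x => ω x / J x) (F.symm y)

/-- Data for a single transport step on the domain `D`. -/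
structure TransportStep (D : FlowDomain) (F : Plane ≃ₜ Plane) (J : Plane → ℝ) (S : Set Plane) :
    Prop where
  diff : Differentiable ℝ F
  equivariant : D.Equivariant F
  jac : ∀ x, J x = |(fderiv ℝ F x).det|
  jac_meas : Measurable J
  jac_pos : ∀ x ∈ S, 0 < J x
  jac_descends : D.Descends J
  meas : MeasurableSet S
  subset : S ⊆ D.pts
  image_subset : F '' S ⊆ D.pts
  descends : D.Descends (· ∈ S)

section Transport

variable {F : Plane ≃ₜ Plane} {J : Plane → ℝ} {S : Set Plane}

lemma Equivariant.symm (hF : D.Equivariant F) : D.Equivariant F.symm := by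
  cases D with
  | region Ω => trivial
  | torus => exact fun m x => by rw [F.symm_apply_eq, hF, F.apply_symm_apply]

lemma Descends.comp_equivariant {α : Type} {f : Plane → α} {X : Plane → Plane}
    (hf : D.Descends f) (hX : D.Equivariant X) : D.Descends fun x => f (X x) := by
  cases D with
  | region Ω => trivial
  | torus => exact fun m x => by simp only [hX m x, hf m (X x)]

lemma Descends.comp {α β : Type} {f : Plane → α} (hf : D.Descends f) (g : α → β) :
    D.Descends fun x => g (f x) := by
  cases D with
  | region Ω => trivial
  | torus => exact fun m x => congrArg g (hf m x)

lemma Descends.comp₂ {α β γ : Type} {f : Plane → α} {f' : Plane → β} (hf : D.Descends f)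
    (hf' : D.Descends f') (g : α → β → γ) : D.Descends fun x => g (f x) (f' x) := by
  cases D with
  | region Ω => trivial
  | torus => exact fun m x => congrArg₂ g (hf m x) (hf' m x)

lemma Descends.const {α : Type} (c : α) : D.Descends fun _ => c := by
  cases D with
  | region Ω => trivial
  | torus => exact fun m x => rfl

lemma Descends.indicator {E : Type} [Zero E] {f : Plane → E} (hS : D.Descends (· ∈ S))
    (hf : D.Descends f) : D.Descends (S.indicator f) := by
  classical
  have := hS.comp₂ hf fun p y => if p then y else 0
  have e : S.indicator f = fun x => if x ∈ S then f x else 0 := by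
    ext x; by_cases h : x ∈ S <;> simp [h]
  rw [e]; exact this

lemma measurable_transport (h : D.TransportStep F J S) (hω : Measurable ω) :
    Measurable (transport F J S ω) :=
  ((hω.div h.jac_meas).indicator h.meas).comp F.symm.continuous.measurable

lemma descends_transport (h : D.TransportStep F J S) (hω : D.Descends ω) :
    D.Descends (transport F J S ω) :=
  (h.descends.indicator (hω.comp₂ h.jac_descends fun a b => a / b)).comp_equivariant
    h.equivariant.symm

lemma lintegral_transport (h : D.TransportStep F J S) (hD : D.IsRegular) (hω : Measurable ω)
    (hωd : D.Descends ω) {G : Plane → ℝ → ℝ≥0∞} (hG : Measurable (uncurry G))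
    (hG0 : ∀ x, G x 0 = 0) (hGd : D.Descends G) : ∫⁻ y, G y (transport F J S ω y) ∂D.area =
      ∫⁻ x in S, ofReal (J x) * G (F x) (ω x / J x) ∂D.area := by
  have hm : Measurable fun y => ω (F.symm y) / J (F.symm y) :=
    (hω.div h.jac_meas).comp F.symm.continuous.measurable
  have h1 := lintegral_image_eq hD F h.diff h.equivariant h.meas h.subset h.image_subset
    h.descends (g := fun y => G y (ω (F.symm y) / J (F.symm y))) (hG.comp (measurable_id.prodMk hm))
    (hGd.comp₂ ((hωd.comp₂ h.jac_descends fun a b => a / b).comp_equivariant h.equivariant.symm)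
      fun G c => G c)
  simp only [F.symm_apply_apply, ← h.jac] at h1
  rw [← h1, ← lintegral_indicator (F.measurableEmbedding.measurableSet_image.2 h.meas)]
  refine lintegral_congr fun y => ?_
  have hmem : y ∈ F '' S ↔ F.symm y ∈ S := by rw [F.image_eq_preimage_symm]; rfl
  by_cases hy : F.symm y ∈ S
  · rw [indicator_of_mem (hmem.2 hy), transport, indicator_of_mem hy]
  · rw [indicator_of_notMem (mt hmem.1 hy), transport, indicator_of_notMem hy, hG0]

/-- After the change of variables the integrand is `J^{1-q}|ω|^q`, and `J ≥ ℓ⁻¹`. For `q = 1` the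
factor is one, so the mass does not grow. Keeping the preimage of `E` on the right is what later
gives finite speed of propagation. -/
lemma lintegral_transport_rpow_le (h : D.TransportStep F J S) (hD : D.IsRegular)
    (hω : Measurable ω) (hωd : D.Descends ω) {q ℓ : ℝ} (hq : 1 ≤ q) (hℓ : 0 < ℓ)
    (hJ : ∀ x ∈ S, ℓ⁻¹ ≤ J x) {E : Set Plane} (hE : MeasurableSet E) (hEd : D.Descends (· ∈ E)) :
    ∫⁻ y in E, ‖transport F J S ω y‖ₑ ^ q ∂D.area ≤
      ofReal (ℓ ^ (q - 1)) * ∫⁻ x in S ∩ F ⁻¹' E, ‖ω x‖ₑ ^ q ∂D.area := by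
  classical
  have hFE : MeasurableSet (F ⁻¹' E) := F.continuous.measurable hE
  have h1 := lintegral_transport h hD hω hωd (G := fun y c => E.indicator (fun _ => ‖c‖ₑ ^ q) y) (by
      have : (uncurry fun y (c : ℝ) => E.indicator (fun _ => ‖c‖ₑ ^ q) y) =
          (E ×ˢ univ).indicator fun z : Plane × ℝ => ‖z.2‖ₑ ^ q := by
        ext ⟨y, c⟩; simp [indicator, uncurry]
      rw [this]
      exact (by fun_prop : Measurable fun z : Plane × ℝ => ‖z.2‖ₑ ^ q).indicator
        (hE.prod MeasurableSet.univ))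
    (fun x => by simp [indicator, ENNReal.zero_rpow_of_pos (show 0 < q by linarith)])
    (by
      have := hEd.comp fun p (c : ℝ) => if p then ‖c‖ₑ ^ q else 0
      convert this using 1
      ext x c; simp [indicator])
  rw [← lintegral_indicator hE]
  refine (lintegral_congr fun y => ?_).trans h1 |>.trans_le ?_
  · rfl
  rw [inter_comm, ← Measure.restrict_restrict hFE, ← lintegral_indicator hFE,
    ← lintegral_const_mul' _ _ ofReal_ne_top]
  refine setLIntegral_mono_ae' h.meas (.of_forall fun x hx => ?_)
  by_cases hxE : F x ∈ E
  · rw [indicator_of_mem hxE, indicator_of_mem (show x ∈ F ⁻¹' E from hxE)]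
    have hJp := h.jac_pos x hx
    have e : ofReal (J x) * ‖ω x / J x‖ₑ ^ q = ofReal ((J x) ^ (1 - q)) * ‖ω x‖ₑ ^ q := by
      rw [← ofReal_norm, ← ofReal_norm, ofReal_rpow_of_nonneg (norm_nonneg _) (by linarith),
        ofReal_rpow_of_nonneg (norm_nonneg _) (by linarith), ← ofReal_mul hJp.le,
        ← ofReal_mul (by positivity), norm_div, norm_of_nonneg hJp.le,
        div_rpow (norm_nonneg _) hJp.le, rpow_sub hJp, Real.rpow_one]
      congr 1; ring
    rw [e]
    gcongr
    rw [← neg_sub q 1, rpow_neg hJp.le, ← Real.inv_rpow hJp.le]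
    refine rpow_le_rpow (by positivity) ?_ (by linarith)
    exact inv_le_of_inv_le₀ hℓ (hJ x hx)
  · rw [indicator_of_notMem hxE, mul_zero]
    exact zero_le

/-- The formula for nonnegative integrands is applied to the norm, the positive part and the
negative part. All three are positively homogeneous in the density, so the Jacobian cancels. -/
lemma integral_transport (h : D.TransportStep F J S) (hD : D.IsRegular) (hω : Measurable ω)
    (hωd : D.Descends ω) (hωi : Integrable ω D.area) (hφ : Measurable φ)
    (hφd : D.Descends φ) (hM : ∀ x, |φ x| ≤ M) :
    Integrable (fun y => φ y * transport F J S ω y) D.area ∧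
    ∫ y, φ y * transport F J S ω y ∂D.area = ∫ x in S, φ (F x) * ω x ∂D.area := by
  have hm : Measurable fun y => φ y * transport F J S ω y := hφ.mul (measurable_transport h hω)
  have hrw : ∀ (G : Plane → ℝ → ℝ≥0∞), (∀ x a b, 0 < b → ofReal b * G x (a / b) = G x a) →
      ∫⁻ x in S, ofReal (J x) * G (F x) (ω x / J x) ∂D.area = ∫⁻ x in S, G (F x) (ω x) ∂D.area := by
    intro G hG
    refine setLIntegral_congr_fun h.meas fun x hx => ?_
    exact hG _ _ _ (h.jac_pos x hx)
  have hφF : Measurable fun x => φ (F x) := hφ.comp F.continuous.measurable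
  have hi2 : Integrable (fun x => φ (F x) * ω x) (D.area.restrict S) :=
    (hωi.bdd_mul (c := M) hφF.aestronglyMeasurable (.of_forall fun x => hM _)).integrableOn
  have e1 := (lintegral_transport h hD hω hωd (G := fun y c => ‖φ y * c‖ₑ)
    (by simp only [uncurry_def]; fun_prop) (by simp)
    (hφd.comp fun a c => ‖a * c‖ₑ)).trans (hrw (fun y c => ‖φ y * c‖ₑ) fun x a b hb => by
      rw [← ofReal_norm, ← ofReal_norm, ← ofReal_mul hb.le]
      congr 1
      rw [norm_mul, norm_mul, norm_div, norm_of_nonneg hb.le]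
      field_simp)
  have e2 := (lintegral_transport h hD hω hωd (G := fun y c => ofReal (φ y * c))
    (by simp only [uncurry_def]; fun_prop) (by simp) (hφd.comp fun a c => ofReal (a * c))).trans
      (hrw (fun y c => ofReal (φ y * c)) fun x a b hb => by
      rw [← ofReal_mul hb.le]
      congr 1
      field_simp)
  have e3 := (lintegral_transport h hD hω hωd (G := fun y c => ofReal (-(φ y * c)))
    (by simp only [uncurry_def]; fun_prop) (by simp) (hφd.comp fun a c => ofReal (-(a * c)))).trans
      (hrw (fun y c => ofReal (-(φ y * c))) fun x a b hb => by
      rw [← ofReal_mul hb.le]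
      congr 1
      field_simp)
  have hi1 : Integrable (fun y => φ y * transport F J S ω y) D.area :=
    ⟨hm.aestronglyMeasurable, e1.trans_lt hi2.2⟩
  refine ⟨hi1, ?_⟩
  rw [integral_eq_lintegral_pos_part_sub_lintegral_neg_part hi1,
    integral_eq_lintegral_pos_part_sub_lintegral_neg_part hi2, e2, e3]

end Transport

end FlowDomain

/-! ### Mollified velocity fields. -/

/-- Mollification bump of radius `1 / (n + 1)`. -/
def bump (n : ℕ) : ContDiffBump (0 : Plane) where
  rIn := 1 / (2 * ((n : ℝ) + 1))
  rOut := 1 / ((n : ℝ) + 1)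
  rIn_pos := by positivity
  rIn_lt_rOut := by
    apply one_div_lt_one_div_of_lt <;> linarith [n.cast_nonneg (α := ℝ)]

/-- Mollification of the extension by zero of `u` from `U` to the plane. -/
def mollify (n : ℕ) (U : Set Plane) (u : Plane → Plane) : Plane → Plane :=
  (bump n).normed volume ⋆[ContinuousLinearMap.lsmul ℝ ℝ, volume] U.indicator u

/-- A mollified field has Lipschitz constant at most `gradBound n` times the supremum of the field.
The dependence on `n` is harmless, because the step length is chosen after `n`. -/
def gradBound (n : ℕ) : ℝ := ∫ t, ‖fderiv ℝ ((bump n).normed volume) t‖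

lemma gradBound_nonneg (n : ℕ) : 0 ≤ gradBound n := integral_nonneg fun _ => norm_nonneg _

section Mollify

variable {U : Set Plane} (n : ℕ)

lemma mollify_apply (x : Plane) :
    mollify n U u x = ∫ t, (bump n).normed volume t • U.indicator u (x - t) := rfl

lemma contDiff_bump_normed : ContDiff ℝ (⊤ : ℕ∞) ((bump n).normed volume) :=
  (bump n).contDiff_normed

lemma integrable_fderiv_bump : Integrable (fderiv ℝ ((bump n).normed volume)) :=
  ((contDiff_bump_normed n).continuous_fderiv (by simp)).integrable_of_hasCompactSupport
    ((bump n).hasCompactSupport_normed.fderiv ℝ)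

lemma locallyIntegrable_indicator (hU : IsOpen U) (hu : ContinuousOn u U)
    (hM : ∀ x ∈ U, ‖u x‖ ≤ M) : LocallyIntegrable (U.indicator u) := by
  have hmeas : AEStronglyMeasurable (U.indicator u) :=
    (aestronglyMeasurable_indicator_iff hU.measurableSet).2
      (hu.aestronglyMeasurable hU.measurableSet)
  refine (locallyIntegrable_const (max M 0)).mono hmeas (.of_forall fun x => ?_)
  rw [norm_of_nonneg (le_max_right _ _)]
  by_cases hx : x ∈ U
  · rw [indicator_of_mem hx]; exact (hM x hx).trans (le_max_left _ _)
  · rw [indicator_of_notMem hx, norm_zero]; exact le_max_right _ _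

lemma norm_indicator_le (hM : ∀ x ∈ U, ‖u x‖ ≤ M) (hM0 : 0 ≤ M) (x : Plane) :
    ‖U.indicator u x‖ ≤ M := by
  by_cases hx : x ∈ U
  · rw [indicator_of_mem hx]; exact hM x hx
  · rw [indicator_of_notMem hx, norm_zero]; exact hM0

lemma contDiff_mollify (hU : IsOpen U) (hu : ContinuousOn u U)
    (hM : ∀ x ∈ U, ‖u x‖ ≤ M) : ContDiff ℝ 1 (mollify n U u) :=
  (bump n).hasCompactSupport_normed.contDiff_convolution_left _
    ((contDiff_bump_normed n).of_le (by simp)) (locallyIntegrable_indicator hU hu hM)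

lemma norm_mollify_le (hM : ∀ x ∈ U, ‖u x‖ ≤ M) (hM0 : 0 ≤ M) (x : Plane) :
    ‖mollify n U u x‖ ≤ M := by
  rw [mollify_apply]
  have h := norm_integral_le_of_norm_le (f := fun t =>
    (bump n).normed volume t • U.indicator u (x - t)) (μ := volume)
    (((bump n).integrable_normed (μ := volume)).mul_const M) (.of_forall fun t => by
      rw [norm_smul, norm_of_nonneg ((bump n).nonneg_normed t)]
      exact mul_le_mul_of_nonneg_left (norm_indicator_le hM hM0 _) ((bump n).nonneg_normed t))
  rwa [integral_mul_const, (bump n).integral_normed, one_mul] at h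

lemma norm_mollify_sub_le (hU : IsOpen U) (hu : ContinuousOn u U) {c : ℝ}
    (hx : closedBall x (1 / ((n : ℝ) + 1)) ⊆ U)
    (hc : ∀ z ∈ ball x (1 / ((n : ℝ) + 1)), ‖u z - u x‖ ≤ c) : ‖mollify n U u x - u x‖ ≤ c := by
  have hmeas : AEStronglyMeasurable (U.indicator u) :=
    (aestronglyMeasurable_indicator_iff hU.measurableSet).2
      (hu.aestronglyMeasurable hU.measurableSet)
  have hxU : x ∈ U := hx (mem_closedBall_self (by positivity))
  have h := (bump n).dist_normed_convolution_le (μ := volume) (g := U.indicator u) (x₀ := x)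
    (ε := c) hmeas (fun z hz => by
      rw [indicator_of_mem hxU, indicator_of_mem (hx (Metric.ball_subset_closedBall hz)),
        dist_eq_norm]
      exact hc z hz)
  rwa [indicator_of_mem hxU, dist_eq_norm] at h

lemma fderiv_mollify_apply (hU : IsOpen U) (hu : ContinuousOn u U)
    (hM : ∀ x ∈ U, ‖u x‖ ≤ M) (x v : Plane) : fderiv ℝ (mollify n U u) x v =
      ∫ t, fderiv ℝ ((bump n).normed volume) t v • U.indicator u (x - t) := by
  have hloc := locallyIntegrable_indicator hU hu hM
  have h := ((bump n).hasCompactSupport_normed (μ := volume)).hasFDerivAt_convolution_left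
    (ContinuousLinearMap.lsmul ℝ ℝ) ((contDiff_bump_normed n).of_le (by simp)) hloc x
  have h2 : fderiv ℝ (mollify n U u) x = _ := h.fderiv
  rw [h2]
  have hce : ConvolutionExistsAt (fderiv ℝ ((bump n).normed volume)) (U.indicator u) x
      ((ContinuousLinearMap.lsmul ℝ ℝ).precompL Plane) volume :=
    (((bump n).hasCompactSupport_normed (μ := volume)).fderiv ℝ).convolutionExists_left _
      ((contDiff_bump_normed n).continuous_fderiv (by simp)) hloc x
  rw [MeasureTheory.convolution_def, ContinuousLinearMap.integral_apply hce]
  rfl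

lemma norm_fderiv_mollify_le (hU : IsOpen U) (hu : ContinuousOn u U)
    (hM : ∀ x ∈ U, ‖u x‖ ≤ M) (hM0 : 0 ≤ M) (x : Plane) :
    ‖fderiv ℝ (mollify n U u) x‖ ≤ gradBound n * M := by
  refine ContinuousLinearMap.opNorm_le_bound _ (mul_nonneg (gradBound_nonneg n) hM0) fun v => ?_
  rw [fderiv_mollify_apply n hU hu hM]
  have h := norm_integral_le_of_norm_le (f := fun t =>
    fderiv ℝ ((bump n).normed volume) t v • U.indicator u (x - t)) (μ := volume)
    ((integrable_fderiv_bump n).norm.mul_const (‖v‖ * M)) (.of_forall fun t => by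
      rw [norm_smul, ← mul_assoc]
      exact mul_le_mul (ContinuousLinearMap.le_opNorm _ _) (norm_indicator_le hM hM0 _)
        (norm_nonneg _) (by positivity))
  rw [integral_mul_const] at h
  refine h.trans_eq ?_
  rw [gradBound]; ring

def entry (A : Plane →L[ℝ] Plane) (i j : Fin 2) : ℝ := A (single j 1) i

lemma abs_entry_le (A : Plane →L[ℝ] Plane) (i j : Fin 2) : |entry A i j| ≤ ‖A‖ := by
  have h1 := PiLp.norm_apply_le (A (single j 1)) i
  have h2 := A.le_opNorm (single j 1)
  rw [PiLp.norm_single, norm_one, mul_one] at h2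
  exact h1.trans h2

lemma det_eq_entry (A : Plane →L[ℝ] Plane) :
    A.det = entry A 0 0 * entry A 1 1 - entry A 0 1 * entry A 1 0 := by
  rw [ContinuousLinearMap.det, ← LinearMap.det_toMatrix (basisFun (Fin 2) ℝ).toBasis,
    Matrix.det_fin_two]
  simp [LinearMap.toMatrix_apply, entry]

/-- The divergence of the mollified field at `x` is, up to sign, the pairing of `u` with the
gradient of `z ↦ ρ(x - z)`. This test function has integral one and its support is contained in the
closed ball about `x`, hence in `U`, so the jump of the extension by zero is not seen. -/
lemma abs_trace_fderiv_mollify_le (hU : IsOpen U) (hu : ContinuousOn u U)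
    (hM : ∀ x ∈ U, ‖u x‖ ≤ M) (hM0 : 0 ≤ M) {B : ℝ} (hB : WeakDivBound U u B)
    (hx : closedBall x (1 / ((n : ℝ) + 1)) ⊆ U) :
    |entry (fderiv ℝ (mollify n U u) x) 0 0 + entry (fderiv ℝ (mollify n U u) x) 1 1| ≤ B := by
  set ρ := (bump n).normed volume with hρ
  set φ : Plane → ℝ := fun z => ρ (x - z) with hφ
  have hφs : ContDiff ℝ (⊤ : ℕ∞) φ := (contDiff_bump_normed n).comp (contDiff_const.sub contDiff_id)
  have hzero : ∀ z, z ∉ closedBall x (1 / ((n : ℝ) + 1)) → φ z = 0 := by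
    intro z hz
    refine image_eq_zero_of_notMem_tsupport (f := ρ) ?_
    rw [hρ, (bump n).tsupport_normed_eq]
    rw [mem_closedBall, dist_comm, dist_eq_norm] at hz
    simpa [bump] using hz
  have hφt : tsupport φ ⊆ closedBall x (1 / ((n : ℝ) + 1)) :=
    closure_minimal (fun z hz => by_contra fun h => hz (hzero z h)) Metric.isClosed_closedBall
  have hφc : HasCompactSupport φ :=
    HasCompactSupport.of_support_subset_isCompact (isCompact_closedBall _ _)
      ((subset_tsupport φ).trans hφt)
  have h := hB φ hφs hφc (hφt.trans hx)
  have h1 : ∫ z, |φ z| = 1 := by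
    have : ∀ z, |φ z| = ρ (x - z) := fun z => abs_of_nonneg ((bump n).nonneg_normed _)
    simp_rw [this]
    rw [integral_sub_left_eq_self, (bump n).integral_normed]
  have hfd : ∀ z, fderiv ℝ φ z = -fderiv ℝ ρ (x - z) := by
    intro z
    have hd : DifferentiableAt ℝ ρ (x - z) := (contDiff_bump_normed n).differentiable (by simp) _
    have := hd.hasFDerivAt.comp z ((hasFDerivAt_id z).const_sub x)
    rw [show φ = ρ ∘ fun z => x - z from rfl]
    refine this.fderiv.trans ?_
    ext v; simp
  have key : entry (fderiv ℝ (mollify n U u) x) 0 0 + entry (fderiv ℝ (mollify n U u) x) 1 1 =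
      -∫ z, fderiv ℝ φ z (u z) := by
    have hint : ∀ v, Integrable fun t => fderiv ℝ ρ t v • U.indicator u (x - t) := by
      intro v
      have hmeas : AEStronglyMeasurable (U.indicator u) :=
        (aestronglyMeasurable_indicator_iff hU.measurableSet).2
          (hu.aestronglyMeasurable hU.measurableSet)
      have h2 : AEStronglyMeasurable fun t => U.indicator u (x - t) :=
        hmeas.comp_quasiMeasurePreserving (quasiMeasurePreserving_sub_left volume x)
      refine ((integrable_fderiv_bump n).apply_continuousLinearMap v).smul_bdd M h2
        (.of_forall fun t => norm_indicator_le hM hM0 _)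
    have hent : ∀ i : Fin 2, entry (fderiv ℝ (mollify n U u) x) i i =
        ∫ t, fderiv ℝ ρ t (single i 1) * U.indicator u (x - t) i := by
      intro i
      have h3 := (EuclideanSpace.proj (𝕜 := ℝ) i).integral_comp_comm (hint (single i 1))
      rw [entry, fderiv_mollify_apply n hU hu hM]
      exact h3.symm
    have hint2 : ∀ i : Fin 2, Integrable fun t =>
        fderiv ℝ ρ t (single i 1) * U.indicator u (x - t) i := fun i =>
      (EuclideanSpace.proj (𝕜 := ℝ) i).integrable_comp (hint (single i 1))
    rw [hent, hent, ← integral_add (hint2 0) (hint2 1), ← integral_neg,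
      ← integral_sub_left_eq_self _ volume x]
    refine integral_congr_ae (ae_of_all _ fun z => ?_)
    simp only [sub_sub_cancel]
    by_cases hz : z ∈ U
    · rw [indicator_of_mem hz, hfd]
      have e : u z = u z 0 • single (0 : Fin 2) (1 : ℝ) + u z 1 • single (1 : Fin 2) (1 : ℝ) := by
        ext i; fin_cases i <;> simp
      conv_rhs => rw [e]
      simp only [neg_apply, map_add, map_smul, smul_eq_mul]
      ring
    · have : fderiv ℝ φ z = 0 := image_eq_zero_of_notMem_tsupport fun h =>
        hz (hx (hφt (tsupport_fderiv_subset ℝ h)))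
      rw [indicator_of_notMem hz, this]
      simp
  rw [key, abs_neg]
  rwa [h1, mul_one] at h

end Mollify

/-! ### A single Euler step as a homeomorphism. -/

/-- The points at which the mollified field only averages genuine values of `u`. -/
def innerPart (n : ℕ) (U : Set Plane) : Set Plane := {x | closedBall x (1 / ((n : ℝ) + 1)) ⊆ U}

lemma isOpen_innerPart (n : ℕ) {U : Set Plane} (hU : IsOpen U) : IsOpen (innerPart n U) := by
  rw [← isClosed_compl_iff]
  have : (innerPart n U)ᶜ = Metric.cthickening (1 / ((n : ℝ) + 1)) Uᶜ := by
    rw [hU.isClosed_compl.cthickening_eq_biUnion_closedBall (by positivity)]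
    ext x
    simp only [innerPart, mem_compl_iff, Set.mem_ofPred_eq, mem_iUnion, not_subset, exists_prop,
      mem_closedBall]
    exact ⟨fun ⟨y, h1, h2⟩ => ⟨y, h2, by rwa [dist_comm]⟩,
      fun ⟨y, h1, h2⟩ => ⟨y, by rwa [dist_comm], h1⟩⟩
  rw [this]
  exact Metric.isClosed_cthickening

lemma innerPart_subset (n : ℕ) (U : Set Plane) : innerPart n U ⊆ U := fun _ hx =>
  hx (mem_closedBall_self (by positivity))

-- The identity is a default value; it never occurs under `SmallStep`.
open Classical in
def stepHomeo (h : ℝ) (w : Plane → Plane) : Plane ≃ₜ Plane :=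
  if H : ∃ F : Plane ≃ₜ Plane, ∀ x, F x = x + h • w x then H.choose else Homeomorph.refl _

/-- A perturbation of the identity by a strict contraction is approximated by the identity on the
whole plane with a constant below one, which makes it a global homeomorphism. -/
lemma stepHomeo_apply {h : ℝ} {w : Plane → Plane} {c : NNReal} (hc : c < 1)
    (hw : LipschitzWith c fun x => h • w x) (x : Plane) : stepHomeo h w x = x + h • w x := by
  have H : ∃ F : Plane ≃ₜ Plane, ∀ x, F x = x + h • w x := by
    have ha : ApproximatesLinearOn (fun x => x + h • w x)
        (ContinuousLinearEquiv.refl ℝ Plane : Plane →L[ℝ] Plane) univ c := by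
      intro x _ y _
      simp only [ContinuousLinearEquiv.coe_refl, ContinuousLinearMap.coe_id', id_eq]
      rw [show x + h • w x - (y + h • w y) - (x - y) = h • w x - h • w y by abel]
      exact hw.norm_sub_le x y
    refine ⟨ha.toHomeomorph _ (Or.inr ?_), fun x => rfl⟩
    have : ‖((ContinuousLinearEquiv.refl ℝ Plane).symm : Plane →L[ℝ] Plane)‖₊ = 1 := by
      rw [ContinuousLinearEquiv.refl_symm, ContinuousLinearEquiv.coe_refl]
      exact ContinuousLinearMap.nnnorm_id
    rw [this, inv_one]
    exact hc
  rw [stepHomeo, dif_pos H]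
  exact H.choose_spec x

/-- Smallness of the time step `h` relative to the mollification index and the velocity bound. -/
structure SmallStep (n : ℕ) (h M B : ℝ) : Prop where
  pos : 0 < h
  lip : h * (gradBound n * M) ≤ 1 / 2
  disp : h * M ≤ 1 / ((n : ℝ) + 1)
  sq : h * (2 * (gradBound n * M) ^ 2) ≤ 1
  div : h * (B + 1) ≤ 1 / 2

lemma exp_neg_two_mul_le {x : ℝ} (hx0 : 0 ≤ x) (hx : x ≤ 1 / 2) : exp (-(2 * x)) ≤ 1 - x := by
  rw [exp_neg]
  have h1 : 1 + 2 * x ≤ exp (2 * x) := by linarith [add_one_le_exp (2 * x)]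
  calc (exp (2 * x))⁻¹ ≤ (1 + 2 * x)⁻¹ := inv_anti₀ (by linarith) h1
    _ ≤ 1 - x := by
      rw [inv_le_iff_one_le_mul₀ (by linarith)]
      nlinarith

namespace FlowDomain

lemma descends_mollify (n : ℕ) (hu : D.Descends u) : D.Descends (mollify n D.pts u) := by
  cases D with
  | region Ω => trivial
  | torus =>
    intro m x
    rw [mollify_apply, mollify_apply]
    refine integral_congr_ae (ae_of_all _ fun t => ?_)
    have := hu m (x - t)
    simp only [pts, indicator_univ]
    rw [← this, sub_add_eq_add_sub]

lemma descends_innerPart (n : ℕ) : D.Descends (· ∈ innerPart n D.pts) := by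
  cases D with
  | region Ω => trivial
  | torus => intro m x; simp [innerPart, pts]

/-- Each smallness condition has its own task: `lip` makes the map a homeomorphism, `disp` keeps the
image of the inner part in the domain, `sq` bounds the quadratic part of the determinant by `h`, and
`div` lets an exponential replace the lower bound `1 - h(B+1)`. -/
lemma transportStep_mollify (hD : D.IsRegular) {h M B : ℝ}
    (hu : ContinuousOn u D.pts) (hud : D.Descends u) (hM0 : 0 ≤ M) (hB0 : 0 ≤ B)
    (hM : ∀ x ∈ D.pts, ‖u x‖ ≤ M) (hB : WeakDivBound D.pts u B) (hs : SmallStep n h M B) :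
    (∀ x, stepHomeo h (mollify n D.pts u) x = x + h • mollify n D.pts u x) ∧
    D.TransportStep (stepHomeo h (mollify n D.pts u))
      (fun x => |(fderiv ℝ (stepHomeo h (mollify n D.pts u)) x).det|) (innerPart n D.pts) ∧
    ∀ x ∈ innerPart n D.pts, (exp (2 * (h * (B + 1))))⁻¹ ≤
      |(fderiv ℝ (stepHomeo h (mollify n D.pts u)) x).det| := by
  have hU := isOpen_pts hD
  set w := mollify n D.pts u with hw
  have hh := hs.pos
  have hwc : ContDiff ℝ 1 w := contDiff_mollify n hU hu hM
  have hwd : Differentiable ℝ w := hwc.differentiable (by simp)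
  have hwb : ∀ x, ‖fderiv ℝ w x‖ ≤ gradBound n * M := norm_fderiv_mollify_le n hU hu hM hM0
  have hlip : LipschitzWith (1 / 2) fun x => h • w x := by
    refine lipschitzWith_of_nnnorm_fderiv_le (𝕜 := ℝ) (hwd.const_smul h) fun x => ?_
    rw [fderiv_fun_const_smul (hwd x), nnnorm_smul, ← NNReal.coe_le_coe]
    push_cast
    rw [norm_of_nonneg hh.le]
    exact (mul_le_mul_of_nonneg_left (hwb x) hh.le).trans hs.lip
  have hF : ∀ x, stepHomeo h w x = x + h • w x :=
    stepHomeo_apply (by rw [← NNReal.coe_lt_coe]; norm_num) hlip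
  have hFeq : (stepHomeo h w : Plane → Plane) = fun x => x + h • w x := funext hF
  have hFd : ∀ x, HasFDerivAt (stepHomeo h w)
      (ContinuousLinearMap.id ℝ Plane + h • fderiv ℝ w x) x := fun x => by
    rw [hFeq]; exact (hasFDerivAt_id x).add ((hwd x).hasFDerivAt.const_smul h)
  have hdet : ∀ x ∈ innerPart n D.pts, exp (-(2 * (h * (B + 1)))) ≤
      (fderiv ℝ (stepHomeo h w) x).det := by
    intro x hx
    refine (exp_neg_two_mul_le (by positivity) hs.div).trans ?_
    have htr := abs_trace_fderiv_mollify_le n hU hu hM hM0 hB hx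
    have hent : ∀ i j, |entry (fderiv ℝ w x) i j| ≤ gradBound n * M := fun i j =>
      (abs_entry_le _ i j).trans (hwb x)
    have e : (ContinuousLinearMap.id ℝ Plane + h • fderiv ℝ w x).det =
        (1 + h * entry (fderiv ℝ w x) 0 0) * (1 + h * entry (fderiv ℝ w x) 1 1) -
          h * entry (fderiv ℝ w x) 0 1 * (h * entry (fderiv ℝ w x) 1 0) := by
      rw [det_eq_entry]; simp [entry]
    rw [(hFd x).fderiv, e]
    have ha := hent 0 0
    have hb := hent 1 1
    have hc := hent 0 1
    have hd := hent 1 0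
    rw [← hw] at htr
    generalize entry (fderiv ℝ w x) 0 0 = a at *
    generalize entry (fderiv ℝ w x) 1 1 = b at *
    generalize entry (fderiv ℝ w x) 0 1 = c at *
    generalize entry (fderiv ℝ w x) 1 0 = d at *
    have hK : 0 ≤ gradBound n * M := mul_nonneg (gradBound_nonneg n) hM0
    have h1 : |a * b| ≤ (gradBound n * M) ^ 2 := by
      rw [abs_mul, pow_two]; exact mul_le_mul ha hb (abs_nonneg _) hK
    have h2 : |c * d| ≤ (gradBound n * M) ^ 2 := by
      rw [abs_mul, pow_two]; exact mul_le_mul hc hd (abs_nonneg _) hK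
    have h3 : -(2 * (gradBound n * M) ^ 2) ≤ a * b - c * d := by
      linarith [(abs_le.1 h1).1, (abs_le.1 h2).2]
    have h4 := (abs_le.1 htr).1
    have h5 := hs.sq
    -- The determinant is `1 + h tr + h² det`. The trace is at least `-B` on the inner part, and the
    -- quadratic term is at least `-h` by `sq`, so the sum is at least `1 - h(B+1)`.
    have h6 : (1 + h * a) * (1 + h * b) - h * c * (h * d) =
        1 + h * (a + b) + h * (h * (a * b - c * d)) := by ring
    rw [h6]
    have h7 : h * (h * (-(2 * (gradBound n * M) ^ 2))) ≤ h * (h * (a * b - c * d)) := by gcongr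
    have h8 : h * (-B) ≤ h * (a + b) := by gcongr
    nlinarith
  have hJ : ∀ x ∈ innerPart n D.pts, (exp (2 * (h * (B + 1))))⁻¹ ≤
      |(fderiv ℝ (stepHomeo h w) x).det| := fun x hx => by
    rw [← exp_neg]; exact (hdet x hx).trans (le_abs_self _)
  have hwe : D.Descends w := descends_mollify n hud
  refine ⟨hF, ⟨fun x => (hFd x).differentiableAt, ?_, fun x => rfl, ?_, ?_, ?_,
    (isOpen_innerPart n hU).measurableSet, innerPart_subset n _, ?_, descends_innerPart n⟩, hJ⟩
  · cases D with
    | region Ω => trivial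
    | torus =>
      intro m x
      rw [hF, hF, hwe m x]; abel
  · have : (fun x => |(fderiv ℝ (stepHomeo h w) x).det|) =
        fun x => |(ContinuousLinearMap.id ℝ Plane + h • fderiv ℝ w x).det| := by
      ext x; rw [(hFd x).fderiv]
    rw [this]
    have hc : Continuous (fderiv ℝ w) := hwc.continuous_fderiv (by simp)
    exact (ContinuousLinearMap.continuous_det.comp
      (continuous_const.add (hc.const_smul h))).abs.measurable
  · exact fun x hx => lt_of_lt_of_le (by positivity) (hJ x hx)
  · have hfd : D.Descends (fderiv ℝ w) := by
      cases D with
      | region Ω => trivial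
      | torus =>
        intro m x
        rw [← fderiv_comp_add_right]
        congr 1
        ext1 y
        exact hwe m y
    have := hfd.comp fun A => |(ContinuousLinearMap.id ℝ Plane + h • A).det|
    convert this using 3
    rw [(hFd _).fderiv]
  · rintro _ ⟨x, hx, rfl⟩
    refine hx ?_
    rw [hF, mem_closedBall, dist_eq_norm, add_sub_cancel_left, norm_smul, norm_of_nonneg hh.le]
    exact (mul_le_mul_of_nonneg_left (norm_mollify_le n hM hM0 x) hh.le).trans hs.disp

/-! ### Uniformly local norms on large balls. -/

def covNum (R : ℝ) : ℝ := (4 * R + 2) ^ 2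

lemma one_le_covNum (hR : 0 ≤ R) : 1 ≤ covNum R := by
  unfold covNum; nlinarith

lemma lintegral_unit_le_ulNorm (hq : 1 ≤ q) (f : Plane → ℝ) (hx : x ∈ D.pts) :
    ∫⁻ z in {z | D.gdist x z < 1}, ‖f z‖ₑ ^ q ∂D.area ≤ D.ulNorm q f ^ q := by
  have h := ENNReal.rpow_le_rpow (rpow_lintegral_le_ulNorm hq f hx) (show 0 ≤ q by linarith)
  rwa [← rpow_mul, one_div_mul_cancel (by linarith), rpow_one] at h

lemma ulNorm_le_of_lintegral_le (hq : 1 ≤ q) {K : ℝ≥0∞}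
    (h : ∀ x ∈ D.pts, ∫⁻ z in {z | D.gdist x z < 1}, ‖f z‖ₑ ^ q ∂D.area ≤ K ^ q) :
    D.ulNorm q f ≤ K := by
  refine iSup₂_le fun x hx => ?_
  rw [eLpNorm_eq_lintegral_rpow_enorm_toReal
    (by simp only [ne_eq, ofReal_eq_zero, not_le]; linarith) ofReal_ne_top,
    toReal_ofReal (by linarith)]
  calc _ ≤ (K ^ q) ^ (1 / q) := by
        gcongr
        exact h x hx
    _ = K := by rw [← rpow_mul, mul_one_div_cancel (by linarith), rpow_one]

lemma dist_lt_one_of_floor_eq {y z : Plane} (h : ∀ i, ⌊2 * y i⌋ = ⌊2 * z i⌋) : dist y z < 1 := by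
  rw [← abs_of_nonneg (dist_nonneg (α := Plane))]
  refine abs_lt_of_sq_lt_sq ?_ zero_le_one
  rw [dist_sq_plane]
  have key : ∀ i : Fin 2, |y i - z i| ≤ 1 / 2 := by
    intro i
    have := Int.abs_sub_lt_one_of_floor_eq_floor (h i)
    rw [← mul_sub, abs_mul, abs_two] at this
    linarith
  have h0 := key 0
  have h1 := key 1
  nlinarith [abs_nonneg (y 0 - z 0), abs_nonneg (y 1 - z 1)]

/-- At most `(4R+2)²` squares of side `1/2` meet a ball of radius `R`. Such a square has diameter
below one, so if it meets `Ω` it lies in the unit ball about a point of `Ω`. On the torus one unit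
ball is already everything. -/
lemma lintegral_ball_le_ulNorm (hD : D.IsRegular) (hq : 1 ≤ q) (f : Plane → ℝ)
    (x : Plane) (hR : 0 ≤ R) : ∫⁻ z in {z | D.gdist x z < R}, ‖f z‖ₑ ^ q ∂D.area ≤
      ofReal (covNum R) * D.ulNorm q f ^ q := by
  have hN := one_le_covNum hR
  cases D with
  | torus =>
    have h := lintegral_unit_le_ulNorm (D := torus) hq f (mem_univ x)
    have e : {z | torus.gdist x z < 1} = univ := eq_univ_of_forall fun z => gdist_torus_lt_one x z
    rw [e, Measure.restrict_univ] at h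
    refine (setLIntegral_le_lintegral _ _).trans (h.trans ?_)
    exact le_mul_of_one_le_left zero_le (by rwa [← ofReal_one, ofReal_le_ofReal_iff (by linarith)])
  | region Ω =>
    set lo : Fin 2 → ℤ := fun i => ⌊2 * x i - 2 * R⌋ with hlo
    set hi : Fin 2 → ℤ := fun i => ⌊2 * x i + 2 * R⌋ with hhi
    set Q : (Fin 2 → ℤ) → Set Plane := fun m => {z | ∀ i, ⌊2 * z i⌋ = m i} with hQ
    have hcov : {z | (region Ω).gdist x z < R} ⊆ ⋃ m ∈ Finset.Icc lo hi, Q m := by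
      intro z hz
      have hz' : dist x z < R := hz
      have hzi : ∀ i, |x i - z i| < R := fun i => by
        have := PiLp.norm_apply_le (x - z) i
        rw [← dist_eq_norm] at this
        exact lt_of_le_of_lt this hz'
      simp only [mem_iUnion, exists_prop]
      refine ⟨fun i => ⌊2 * z i⌋, ?_, fun i => rfl⟩
      rw [Finset.mem_Icc]
      constructor <;> intro i <;> have := abs_lt.1 (hzi i)
      · exact Int.floor_le_floor (by linarith)
      · exact Int.floor_le_floor (by linarith)
    have hone : ∀ m, ∫⁻ z in Q m, ‖f z‖ₑ ^ q ∂(region Ω).area ≤ (region Ω).ulNorm q f ^ q := by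
      intro m
      by_cases hne : (Q m ∩ Ω).Nonempty
      · obtain ⟨y, hy, hyΩ⟩ := hne
        refine le_trans ?_ (lintegral_unit_le_ulNorm hq f (show y ∈ (region Ω).pts from hyΩ))
        exact lintegral_mono_set fun z hz =>
          dist_lt_one_of_floor_eq fun i => (hy i).trans (hz i).symm
      · have hm : MeasurableSet (Q m) := by
          have : Q m = ⋂ i, {z : Plane | ⌊2 * z i⌋ = m i} := by ext z; simp [hQ]
          rw [this]
          refine MeasurableSet.iInter fun i => ?_
          exact (Int.measurable_floor.comp (by fun_prop : Measurable fun z : Plane => 2 * z i))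
            (measurableSet_singleton (m i))
        rw [area, Measure.restrict_restrict hm]
        have : Q m ∩ (region Ω).cell = ∅ := not_nonempty_iff_eq_empty.1 hne
        rw [this]; simp
    calc ∫⁻ z in {z | (region Ω).gdist x z < R}, ‖f z‖ₑ ^ q ∂(region Ω).area
        ≤ ∫⁻ z in ⋃ m ∈ Finset.Icc lo hi, Q m, ‖f z‖ₑ ^ q ∂(region Ω).area :=
          lintegral_mono_set hcov
      _ ≤ ∑ m ∈ Finset.Icc lo hi, ∫⁻ z in Q m, ‖f z‖ₑ ^ q ∂(region Ω).area := by
          induction Finset.Icc lo hi using Finset.cons_induction with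
          | empty => simp
          | cons m s hm ih =>
            rw [Finset.sum_cons]
            simp only [Finset.mem_cons, iUnion_iUnion_eq_or_left]
            exact (lintegral_union_le _ _ _).trans (add_le_add le_rfl ih)
      _ ≤ ∑ m ∈ Finset.Icc lo hi, (region Ω).ulNorm q f ^ q := Finset.sum_le_sum fun m _ => hone m
      _ = ((Finset.Icc lo hi).card : ℝ≥0∞) * (region Ω).ulNorm q f ^ q := by
          rw [Finset.sum_const, nsmul_eq_mul]
      _ ≤ _ := by
          gcongr
          rw [← ENNReal.ofReal_natCast]
          refine ofReal_le_ofReal ?_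
          rw [Pi.card_Icc, Fin.prod_univ_two]
          push_cast
          rw [covNum, sq]
          have hc : ∀ i, ((Finset.Icc (lo i) (hi i)).card : ℝ) ≤ 4 * R + 2 := by
            intro i
            rw [Int.card_Icc]
            have h1 : lo i ≤ hi i := Int.floor_le_floor (by linarith)
            have h2 : (((hi i + 1 - lo i).toNat : ℤ) : ℝ) = hi i + 1 - lo i := by
              rw [Int.toNat_of_nonneg (by linarith)]; push_cast; ring
            rw [← Int.cast_natCast, h2]
            have h3 := Int.floor_le (2 * x i + 2 * R)
            have h4 := Int.lt_floor_add_one (2 * x i - 2 * R)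
            simp only [hlo, hhi]
            linarith
          exact mul_le_mul (hc 0) (hc 1) (by positivity) (by linarith)

/-! ### The approximation scheme and its a priori bounds. -/

/-- Standing assumptions of the existence theorem, with a measurable initial datum. -/
structure Setup (D : FlowDomain) (k : Plane → Plane → Plane) (C1 C2 C3 p : ℝ)
    (ω0 : Plane → ℝ) : Prop where
  reg : D.IsRegular
  C1_pos : 0 < C1
  C2_pos : 0 < C2
  C3_pos : 0 < C3
  two_lt : 2 < p
  kernel : D.KernelBounds k C1 C2
  op : D.OperatorBounds k p C3
  meas : Measurable ω0
  mem : D.MemL1Ul p ω0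

abbrev mass (D : FlowDomain) (f : Plane → ℝ) : ℝ := (eLpNorm f 1 D.area).toReal

lemma mass_nonneg (f : Plane → ℝ) : 0 ≤ D.mass f := toReal_nonneg

lemma descends_velocity (hk : D.KernelBounds k C1 C2) (f : Plane → ℝ) :
    D.Descends (D.velocity k f) := by
  cases D with
  | region Ω => trivial
  | torus =>
    intro m x
    simp only [velocity]
    refine integral_congr_ae (ae_of_all _ fun z => ?_)
    have := hk.descends_left z m x
    simp only at this
    simp only [this]

lemma continuousOn_velocity (hk : D.KernelBounds k C1 C2) (hD : D.IsRegular)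
    (hC1 : 0 ≤ C1) (hC2 : 0 ≤ C2) (hq : 2 < q) (hf : D.MemL1Ul q f) :
    ContinuousOn (D.velocity k f) D.pts := by
  have hα := one_sub_two_div_pos hq
  intro x hx
  rw [ContinuousWithinAt, tendsto_iff_norm_sub_tendsto_zero]
  set c := 2 * (2 * C1 + C2) *
    (holderConst q * (D.ulNorm q f).toReal + (eLpNorm f 1 D.area).toReal) with hc
  have hb : ∀ y ∈ D.pts, ‖D.velocity k f y - D.velocity k f x‖ ≤ c * dist y x ^ (1 - 2 / q) := by
    intro y hy
    refine (norm_velocity_sub_le_holder hk hD hC1 hC2 hq hf toReal_nonneg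
      toReal_nonneg (ofReal_toReal hf.memL1.2.ne).ge
      (ofReal_toReal hf.ul_finite.ne).ge hy hx).trans ?_
    have := holderConst_nonneg hq
    gcongr
    · exact gdist_nonneg _ _
    · exact gdist_le_dist _ _
  refine squeeze_zero' (.of_forall fun _ => norm_nonneg _) (eventually_mem_nhdsWithin.mono hb) ?_
  have h1 : Tendsto (fun y => dist y x) (𝓝[D.pts] x) (𝓝 0) := by
    have : Tendsto (fun y => dist y x) (𝓝 x) (𝓝 (dist x x)) :=
      (continuous_id.dist continuous_const).tendsto x
    rw [dist_self] at this
    exact this.mono_left nhdsWithin_le_nhds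
  have h2 := (h1.rpow_const (p := 1 - 2 / q) (Or.inr hα.le)).const_mul c
  rwa [zero_rpow hα.ne', mul_zero] at h2

lemma integrable_fderiv_apply {U : Set Plane}
    (hu : ContinuousOn u U) (hφ : ContDiff ℝ 1 φ) (hc : HasCompactSupport φ)
    (hs : tsupport φ ⊆ U) : Integrable fun x => fderiv ℝ φ x (u x) := by
  have h : IntegrableOn (fun x => fderiv ℝ φ x (u x)) (tsupport φ) :=
    ((hφ.continuous_fderiv (by simp)).continuousOn.clm_apply (hu.mono hs)).integrableOn_compact hc
  refine h.integrable_of_forall_notMem_eq_zero fun x hx => ?_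
  have : fderiv ℝ φ x = 0 :=
    image_eq_zero_of_notMem_tsupport fun h => hx (tsupport_fderiv_subset ℝ h)
  rw [this]; rfl

variable (D k) in
abbrev stepMap (n : ℕ) (h : ℝ) (ω : Plane → ℝ) : Plane ≃ₜ Plane :=
  stepHomeo h (mollify n D.pts (D.velocity k ω))

-- The vorticity outside the inner part is discarded: there the mollified field averages the
-- extension by zero as well, and its divergence is not controlled.
variable (D k) in
def schemeStep (n : ℕ) (h : ℝ) (ω : Plane → ℝ) : Plane → ℝ := transport (D.stepMap k n h ω)
    (fun x => |(fderiv ℝ (D.stepMap k n h ω) x).det|) (innerPart n D.pts) ω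

variable (D k) in
/-- The approximation scheme: vorticity after `j` steps of length `h`. -/
def scheme (n : ℕ) (h : ℝ) (ω0 : Plane → ℝ) : ℕ → Plane → ℝ
  | 0 => ω0
  | j + 1 => D.schemeStep k n h (scheme n h ω0 j)

/-- Vorticities to which the scheme can be applied. -/
structure Admissible (D : FlowDomain) (p : ℝ) (ω0 ω : Plane → ℝ) : Prop where
  meas : Measurable ω
  mem : D.MemL1Ul p ω
  mass : eLpNorm ω 1 D.area ≤ eLpNorm ω0 1 D.area

lemma WeakDivBound.mono {U : Set Plane} {B B' : ℝ} (h : WeakDivBound U u B)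
    (hB : B ≤ B') : WeakDivBound U u B' := fun φ h1 h2 h3 =>
  (h φ h1 h2 h3).trans (mul_le_mul_of_nonneg_right hB (integral_nonneg fun _ => abs_nonneg _))

lemma descends_gdist_lt (x : Plane) (R : ℝ) : D.Descends (· ∈ {z | D.gdist x z < R}) := by
  cases D with
  | region Ω => trivial
  | torus => intro m z; simp [gdist_torus_add_right]

lemma measurableSet_gdist_lt (x : Plane) (R : ℝ) : MeasurableSet {z | D.gdist x z < R} :=
  (isOpen_Iio.preimage (continuous_gdist x)).measurableSet

/-- The rate `a` in the inequality `V ≤ a(1 + S)` between the speed `V` and the displacement `S`;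
the `10` comes from `4(1+S) + 2 ≤ 10(1+S)`, the root of the covering number. -/
def growthRate (C1 C3 q T N1 N : ℝ) : ℝ :=
  C1 * (10 * holderConst q * exp (2 * T * (C3 * N1 + 1)) * N + N1)

lemma growthRate_nonneg (hC1 : 0 ≤ C1) (hq : 2 < q) (hN1 : 0 ≤ N1)
    (hN : 0 ≤ N) : 0 ≤ growthRate C1 C3 q T N1 N := by
  have := holderConst_nonneg hq
  unfold growthRate
  positivity

/-- The induction step is `1 + ah ≤ exp(ah)`. It says that `a exp(ahj)` is a supersolution of the
recursion `V_j = a(1 + h ∑ V_i)`, which is the discrete form of Gronwall's lemma needed here. -/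
lemma one_add_sum_exp_le {a h : ℝ} (j : ℕ) :
    1 + h * ∑ i ∈ Finset.range j, a * exp (a * (h * i)) ≤ exp (a * (h * j)) := by
  induction j with
  | zero => simp
  | succ j ih =>
    rw [Finset.sum_range_succ]
    have e : exp (a * (h * ((j + 1 : ℕ) : ℝ))) = exp (a * (h * j)) * exp (a * h) := by
      rw [← exp_add]; push_cast; ring_nf
    rw [e]
    nlinarith [add_one_le_exp (a * h), exp_pos (a * (h * j))]

def velBound (C1 C3 q T N1 N : ℝ) : ℝ :=
  growthRate C1 C3 q T N1 N * exp (growthRate C1 C3 q T N1 N * T)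

lemma velBound_nonneg (hC1 : 0 ≤ C1) (hq : 2 < q) (hN1 : 0 ≤ N1)
    (hN : 0 ≤ N) : 0 ≤ velBound C1 C3 q T N1 N :=
  mul_nonneg (growthRate_nonneg hC1 hq hN1 hN) (exp_nonneg _)

lemma exists_smallStep (n : ℕ) {M B : ℝ} (hM : 0 ≤ M) (hB : 0 ≤ B) :
    ∃ h, SmallStep n h M B ∧ h ≤ 1 / ((n : ℝ) + 1) := by
  have hg := gradBound_nonneg n
  -- `Z` is the sum of all quantities whose product with `h` must be at most one; `h = 1/Z` meets
  -- every condition at once.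
  set Z := 2 * (gradBound n * M) + ((n : ℝ) + 1) * M + 2 * (gradBound n * M) ^ 2 +
    2 * (B + 1) + ((n : ℝ) + 1) with hZ
  have hZ0 : 0 < Z := by positivity
  have key : ∀ c, 0 ≤ c → c ≤ Z → 1 / Z * c ≤ 1 := fun c h0 hc => by
    rw [one_div_mul_eq_div, div_le_one hZ0]; exact hc
  have p1 : 0 ≤ gradBound n * M := by positivity
  have p2 : 0 ≤ ((n : ℝ) + 1) * M := by positivity
  have p3 : 0 ≤ 2 * (gradBound n * M) ^ 2 := by positivity
  refine ⟨1 / Z, ⟨by positivity, ?_, ?_, ?_, ?_⟩, ?_⟩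
  · linarith [key (2 * (gradBound n * M)) (by positivity) (by rw [hZ]; linarith)]
  · have := key (((n : ℝ) + 1) * M) (by positivity) (by rw [hZ]; linarith)
    rw [le_div_iff₀ (by positivity)]
    linarith
  · exact key _ (by positivity) (by rw [hZ]; linarith)
  · linarith [key (2 * (B + 1)) (by positivity) (by rw [hZ]; linarith)]
  · exact one_div_le_one_div_of_le (by positivity) (by rw [hZ]; linarith)

section Scheme

variable (H : D.Setup k C1 C2 C3 p ω0) {h M : ℝ}
include H

lemma Setup.eLpNorm_eq :
    eLpNorm ω0 1 D.area = ofReal (D.mass ω0) := (ofReal_toReal H.mem.memL1.2.ne).symm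

lemma Setup.weakDivBound (hω : D.Admissible p ω0 ω) :
    WeakDivBound D.pts (D.velocity k ω) (C3 * D.mass ω0) := by
  have hB : 0 ≤ C3 * D.mass ω0 := mul_nonneg H.C3_pos.le (mass_nonneg _)
  obtain ⟨g, hg, hgB, h⟩ := (H.op ω hω.mem).1
  refine DivBounded.weakDivBound hB ⟨g, hg, hgB.trans ?_, h⟩ (descends_velocity H.kernel ω) ?_
  · rw [ofReal_mul H.C3_pos.le, ← H.eLpNorm_eq]
    gcongr
    exact hω.mass
  · exact fun φ hφ hφc hφs => integrable_fderiv_apply (continuousOn_velocity H.kernel H.reg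
      H.C1_pos.le H.C2_pos.le H.two_lt hω.mem) (hφ.of_le (by simp)) hφc hφs

lemma Setup.transportStep (hω : D.Admissible p ω0 ω) (hM0 : 0 ≤ M)
    (hM : ∀ x ∈ D.pts, ‖D.velocity k ω x‖ ≤ M) (hs : SmallStep n h M (C3 * D.mass ω0)) :
    (∀ x, D.stepMap k n h ω x =
      x + h • mollify n D.pts (D.velocity k ω) x) ∧
    D.TransportStep (D.stepMap k n h ω)
      (fun x => |(fderiv ℝ (D.stepMap k n h ω) x).det|)
      (innerPart n D.pts) ∧ ∀ x ∈ innerPart n D.pts, (exp (2 * (h * (C3 * D.mass ω0 + 1))))⁻¹ ≤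
      |(fderiv ℝ (D.stepMap k n h ω) x).det| :=
  transportStep_mollify H.reg (n := n)
    (continuousOn_velocity H.kernel H.reg H.C1_pos.le H.C2_pos.le H.two_lt hω.mem)
    (descends_velocity H.kernel ω) hM0 (mul_nonneg H.C3_pos.le (mass_nonneg ω0)) hM
    (H.weakDivBound hω) hs

/-- A point that lands within `R` of `x` started within `R + hV`, since the mollified field is no
faster than the field. -/
lemma Setup.lintegral_step_le (hω : D.Admissible p ω0 ω) {V : ℝ} (hV0 : 0 ≤ V) (hVM : V ≤ M)
    (hV : ∀ x ∈ D.pts, ‖D.velocity k ω x‖ ≤ V) (hs : SmallStep n h M (C3 * D.mass ω0)) (hq : 1 ≤ q)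
      (x : Plane) (R : ℝ) :
    ∫⁻ z in {z | D.gdist x z < R}, ‖D.schemeStep k n h ω z‖ₑ ^ q ∂D.area ≤
      ofReal (exp (2 * (h * (C3 * D.mass ω0 + 1))) ^ (q - 1)) *
        ∫⁻ z in {z | D.gdist x z < R + h * V}, ‖ω z‖ₑ ^ q ∂D.area := by
  obtain ⟨hF, hT, hJ⟩ := H.transportStep hω (hV0.trans hVM) (fun x hx => (hV x hx).trans hVM) hs
  refine (lintegral_transport_rpow_le hT H.reg hω.meas hω.mem.descends hq (exp_pos _) hJ
    (measurableSet_gdist_lt x R) (descends_gdist_lt x R)).trans ?_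
  gcongr
  rintro z ⟨-, hz⟩
  have h1 := gdist_triangle (D := D) x (D.stepMap k n h ω z) z
  have h2 := gdist_le_dist (D := D) (D.stepMap k n h ω z) z
  have h3 : dist (D.stepMap k n h ω z) z ≤ h * V := by
    rw [hF, dist_eq_norm, add_sub_cancel_left, norm_smul, norm_of_nonneg hs.pos.le]
    exact mul_le_mul_of_nonneg_left (norm_mollify_le n hV hV0 z) hs.pos.le
  have h4 : D.gdist x (D.stepMap k n h ω z) < R := hz
  show D.gdist x z < R + h * V
  linarith

lemma Setup.admissible_step (hω : D.Admissible p ω0 ω) (hM0 : 0 ≤ M)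
    (hM : ∀ x ∈ D.pts, ‖D.velocity k ω x‖ ≤ M) (hs : SmallStep n h M (C3 * D.mass ω0)) :
    D.Admissible p ω0 (D.schemeStep k n h ω) := by
  obtain ⟨hF, hT, hJ⟩ := H.transportStep hω hM0 hM hs
  have hp : 1 ≤ p := by linarith [H.two_lt]
  have hmeas : Measurable (D.schemeStep k n h ω) := measurable_transport hT hω.meas
  have hmass : eLpNorm (D.schemeStep k n h ω) 1 D.area ≤ eLpNorm ω 1 D.area := by
    have := lintegral_transport_rpow_le hT H.reg hω.meas hω.mem.descends le_rfl (exp_pos _)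
      hJ MeasurableSet.univ (Descends.const (D := D) True)
    simp only [rpow_one, sub_self, Real.rpow_zero, ofReal_one, one_mul,
      Measure.restrict_univ] at this
    rw [eLpNorm_one_eq_lintegral_enorm, eLpNorm_one_eq_lintegral_enorm]
    exact this.trans (setLIntegral_le_lintegral _ _)
  refine ⟨hmeas, ⟨descends_transport hT hω.mem.descends,
    ⟨hmeas.aestronglyMeasurable, hmass.trans_lt hω.mem.memL1.2⟩, ?_⟩, hmass.trans hω.mass⟩
  have hR : (0 : ℝ) ≤ 1 + h * M := by have := hs.pos; positivity
  set K : ℝ≥0∞ := ofReal (exp (2 * (h * (C3 * D.mass ω0 + 1))) ^ (p - 1)) *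
    (ofReal (covNum (1 + h * M)) * D.ulNorm p ω ^ p) with hK
  have hKt : K < ∞ := mul_lt_top ofReal_lt_top (mul_lt_top
    ofReal_lt_top (rpow_lt_top_of_nonneg (by linarith) hω.mem.ul_finite.ne))
  refine (ulNorm_le_of_lintegral_le hp (K := K ^ (1 / p)) fun x hx => ?_).trans_lt
    (rpow_lt_top_of_nonneg (by positivity) hKt.ne)
  rw [← rpow_mul, one_div_mul_cancel (by linarith), rpow_one]
  exact (H.lintegral_step_le hω hM0 le_rfl hM hs hp x 1).trans
    (mul_le_mul_right (lintegral_ball_le_ulNorm H.reg hp ω x hR) _)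

lemma Setup.admissible_scheme (hM0 : 0 ≤ M)
    (hs : SmallStep n h M (C3 * D.mass ω0)) (j : ℕ)
    (hM : ∀ i < j, ∀ x ∈ D.pts, ‖D.velocity k (D.scheme k n h ω0 i) x‖ ≤ M) :
    D.Admissible p ω0 (D.scheme k n h ω0 j) := by
  induction j with
  | zero => exact ⟨H.meas, H.mem, le_rfl⟩
  | succ j ih =>
    exact H.admissible_step (ih fun i hi => hM i (hi.trans (Nat.lt_succ_self j))) hM0
      (hM j (Nat.lt_succ_self j)) hs

/-- The Jacobian factors multiply to an exponential of the elapsed time and the radii add up to the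
distance travelled. Everything is referred back to `ω0` on one large ball, so the covering argument
is used once and its constant does not accumulate over the steps. -/
lemma Setup.lintegral_scheme_le (hM0 : 0 ≤ M)
    (hs : SmallStep n h M (C3 * D.mass ω0)) {V : ℕ → ℝ} (hV0 : ∀ i, 0 ≤ V i) (j : ℕ)
    (hVM : ∀ i < j, V i ≤ M)
    (hV : ∀ i < j, ∀ x ∈ D.pts, ‖D.velocity k (D.scheme k n h ω0 i) x‖ ≤ V i) (hq : 1 ≤ q)
      (x : Plane) (R : ℝ) :
    ∫⁻ z in {z | D.gdist x z < R}, ‖D.scheme k n h ω0 j z‖ₑ ^ q ∂D.area ≤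
      ofReal (exp (2 * (h * j * (C3 * D.mass ω0 + 1))) ^ (q - 1)) *
        ∫⁻ z in {z | D.gdist x z < R + h * ∑ i ∈ Finset.range j, V i}, ‖ω0 z‖ₑ ^ q ∂D.area := by
  induction j generalizing R with
  | zero => simp [scheme]
  | succ j ih =>
    have hlt : ∀ i < j, i < j + 1 := fun i hi => hi.trans (Nat.lt_succ_self j)
    have ha := H.admissible_scheme hM0 hs j fun i hi x hx =>
      (hV i (hlt i hi) x hx).trans (hVM i (hlt i hi))
    refine (H.lintegral_step_le ha (hV0 j) (hVM j (Nat.lt_succ_self j))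
      (hV j (Nat.lt_succ_self j)) hs hq x R).trans ?_
    refine (mul_le_mul_right (ih (fun i hi => hVM i (hlt i hi)) (fun i hi => hV i (hlt i hi)) _)
      _).trans_eq ?_
    rw [← mul_assoc, ← ofReal_mul (by positivity), ← mul_rpow (exp_nonneg _)
      (exp_nonneg _), ← exp_add, Finset.sum_range_succ]
    congr 3
    · congr 2; push_cast; ring
    · ext z; simp only [Set.mem_ofPred_eq]; rw [add_assoc]; congr! 2; ring

lemma Setup.ulNorm_scheme_le (hM0 : 0 ≤ M)
    (hs : SmallStep n h M (C3 * D.mass ω0)) {V : ℕ → ℝ} (hV0 : ∀ i, 0 ≤ V i) (j : ℕ)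
    (hVM : ∀ i < j, V i ≤ M)
    (hV : ∀ i < j, ∀ x ∈ D.pts, ‖D.velocity k (D.scheme k n h ω0 i) x‖ ≤ V i) (hq : 1 ≤ q)
      (hT : h * j ≤ T) (hR : h * ∑ i ∈ Finset.range j, V i ≤ R) :
    D.ulNorm q (D.scheme k n h ω0 j) ≤
      ofReal (exp (2 * T * (C3 * D.mass ω0 + 1)) * covNum (1 + R) ^ (1 / q)) * D.ulNorm q ω0 := by
  have hh := hs.pos
  have hB : 0 ≤ C3 * D.mass ω0 := mul_nonneg H.C3_pos.le (mass_nonneg _)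
  have hS0 : 0 ≤ h * ∑ i ∈ Finset.range j, V i :=
    mul_nonneg hh.le (Finset.sum_nonneg fun i _ => hV0 i)
  have hR0 : 0 ≤ R := hS0.trans hR
  have hT0 : 0 ≤ T := le_trans (by positivity) hT
  have hc1 := one_le_covNum (show 0 ≤ 1 + R by linarith)
  refine ulNorm_le_of_lintegral_le hq fun x hx => ?_
  refine (H.lintegral_scheme_le hM0 hs hV0 j hVM hV hq x 1).trans ?_
  have h1 : ∫⁻ z in {z | D.gdist x z < 1 + h * ∑ i ∈ Finset.range j, V i}, ‖ω0 z‖ₑ ^ q ∂D.area ≤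
      ofReal (covNum (1 + R)) * D.ulNorm q ω0 ^ q := by
    refine le_trans (lintegral_mono_set fun z hz => ?_)
      (lintegral_ball_le_ulNorm H.reg hq ω0 x (show 0 ≤ 1 + R by linarith))
    have hz' : D.gdist x z < 1 + h * ∑ i ∈ Finset.range j, V i := hz
    show D.gdist x z < 1 + R
    linarith
  rw [mul_rpow_of_nonneg _ _ (by linarith), ofReal_rpow_of_nonneg (by positivity) (by linarith),
    mul_rpow (exp_nonneg _) (by positivity), ← Real.rpow_mul (by linarith),
    one_div_mul_cancel (by linarith), Real.rpow_one, ofReal_mul (by positivity),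
    mul_assoc (ofReal (exp (2 * T * (C3 * D.mass ω0 + 1)) ^ q))]
  refine mul_le_mul' (ofReal_le_ofReal ?_) h1
  have h2 : exp (2 * (h * j * (C3 * D.mass ω0 + 1))) ≤ exp (2 * T * (C3 * D.mass ω0 + 1)) := by
    rw [exp_le_exp, ← mul_assoc]
    gcongr
  have h3 : 1 ≤ exp (2 * T * (C3 * D.mass ω0 + 1)) := Real.one_le_exp (by positivity)
  calc _ ≤ exp (2 * T * (C3 * D.mass ω0 + 1)) ^ (q - 1) :=
        rpow_le_rpow (exp_nonneg _) h2 (by linarith)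
    _ ≤ _ := Real.rpow_le_rpow_of_exponent_le h3 (by linarith)

/-- The covering number `(4(1+S)+2)²` enters with the power `1/q`. As `2/q ≤ 1`, the result is at
most linear in the displacement `S`, so the new speed is at most `a(1+S)`; the supersolution `a
exp(ahj)` then propagates. -/
lemma Setup.velocity_scheme_step (hM0 : 0 ≤ M) (hs : SmallStep n h M (C3 * D.mass ω0)) (hq : 2 < q)
    (hN : 0 ≤ N) (hqN : D.ulNorm q ω0 ≤ ofReal N) (j : ℕ) (hT : h * j ≤ T)
    (hM : ∀ i < j, ∀ x ∈ D.pts, ‖D.velocity k (D.scheme k n h ω0 i) x‖ ≤ M)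
    (hV : ∀ i < j, ∀ x ∈ D.pts, ‖D.velocity k (D.scheme k n h ω0 i) x‖ ≤
      growthRate C1 C3 q T (D.mass ω0) N * exp (growthRate C1 C3 q T (D.mass ω0) N * (h * i))) :
    ∀ x ∈ D.pts, ‖D.velocity k (D.scheme k n h ω0 j) x‖ ≤ growthRate C1 C3 q T (D.mass ω0) N *
        exp (growthRate C1 C3 q T (D.mass ω0) N * (h * j)) := by
  set a := growthRate C1 C3 q T (D.mass ω0) N with ha
  have hh := hs.pos
  have hm := mass_nonneg (D := D) ω0
  have ha0 : 0 ≤ a := growthRate_nonneg H.C1_pos.le hq hm hN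
  have hK := holderConst_nonneg hq
  intro x hx
  set S := h * ∑ i ∈ Finset.range j, a * exp (a * (h * i)) with hS
  have hadm := H.admissible_scheme hM0 hs j hM
  have hS0 : 0 ≤ S := mul_nonneg hh.le (Finset.sum_nonneg fun i _ => by positivity)
  have hsum : h * ∑ i ∈ Finset.range j, min M (a * exp (a * (h * i))) ≤ S :=
    mul_le_mul_of_nonneg_left (Finset.sum_le_sum fun i _ => min_le_right _ _) hh.le
  -- The bound by `M` keeps the step length admissible, the exponential bound gives the conclusion;
  -- their minimum is a speed bound that serves both purposes.
  have hul := H.ulNorm_scheme_le hM0 hs (V := fun i => min M (a * exp (a * (h * i))))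
    (fun i => le_min hM0 (by positivity)) j
    (fun i _ => min_le_left _ _) (fun i hi x hx => le_min (hM i hi x hx) (hV i hi x hx))
    (show 1 ≤ q by linarith) hT hsum
  have hcov : covNum (1 + S) ^ (1 / q) ≤ 4 * (1 + S) + 2 := by
    rw [covNum, ← Real.rpow_natCast, ← Real.rpow_mul (by linarith)]
    conv_rhs => rw [← Real.rpow_one (4 * (1 + S) + 2)]
    refine Real.rpow_le_rpow_of_exponent_le (by linarith) ?_
    push_cast
    rw [mul_one_div, div_le_one] <;> linarith
  set E := exp (2 * T * (C3 * D.mass ω0 + 1)) with hE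
  have hE0 : 0 < E := exp_pos _
  have hul2 : D.ulNorm q (D.scheme k n h ω0 j) ≤ ofReal (E * (4 * (1 + S) + 2) * N) := by
    refine hul.trans ?_
    rw [ofReal_mul (p := E * (4 * (1 + S) + 2)) (by positivity)]
    gcongr
  have hv := norm_velocity_le H.kernel H.reg H.C1_pos.le hq hadm.mem.memL1.1 hm
    (by positivity) (hadm.mass.trans_eq H.eLpNorm_eq) hul2 hx
  refine hv.trans ?_
  have h1 := one_add_sum_exp_le (a := a) (h := h) j
  rw [← hS] at h1
  calc _ ≤ a * (1 + S) := by
        rw [ha, growthRate, ← hE]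
        have h2 : holderConst q * (E * (4 * (1 + S) + 2) * N) ≤
            holderConst q * (E * (10 * (1 + S)) * N) := by gcongr; linarith
        have h3 : D.mass ω0 ≤ D.mass ω0 * (1 + S) := le_mul_of_one_le_right hm (by linarith)
        calc _ ≤ C1 * (holderConst q * (E * (10 * (1 + S)) * N) + D.mass ω0 * (1 + S)) :=
              mul_le_mul_of_nonneg_left (add_le_add h2 h3) H.C1_pos.le
          _ = _ := by ring
    _ ≤ _ := by gcongr

/-- `M` governs the step length, whereas the conclusion concerns an arbitrary exponent `q`. For `q =
p` and `M` equal to the asserted bound, `hM` is a tautology, and this closes the bootstrap; for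
other exponents `M` is the bound obtained in that way. -/
lemma Setup.velocity_scheme_le_of_imp (hM0 : 0 ≤ M) (hs : SmallStep n h M (C3 * D.mass ω0))
    (hq : 2 < q) (hN : 0 ≤ N) (hqN : D.ulNorm q ω0 ≤ ofReal N)
    (hM : ∀ i : ℕ, h * i ≤ T → ∀ x ∈ D.pts, ‖D.velocity k (D.scheme k n h ω0 i) x‖ ≤
      velBound C1 C3 q T (D.mass ω0) N → ‖D.velocity k (D.scheme k n h ω0 i) x‖ ≤ M)
    (j : ℕ) (hj : h * j ≤ T) : ∀ x ∈ D.pts, ‖D.velocity k (D.scheme k n h ω0 j) x‖ ≤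
      velBound C1 C3 q T (D.mass ω0) N := by
  have hh := hs.pos
  have ha0 : 0 ≤ growthRate C1 C3 q T (D.mass ω0) N :=
    growthRate_nonneg H.C1_pos.le hq (mass_nonneg _) hN
  have hle : ∀ i : ℕ, h * i ≤ T → growthRate C1 C3 q T (D.mass ω0) N *
      exp (growthRate C1 C3 q T (D.mass ω0) N * (h * i)) ≤
        velBound C1 C3 q T (D.mass ω0) N := fun i hi => by
    unfold velBound; gcongr
  suffices h' : ∀ x ∈ D.pts, ‖D.velocity k (D.scheme k n h ω0 j) x‖ ≤
      growthRate C1 C3 q T (D.mass ω0) N * exp (growthRate C1 C3 q T (D.mass ω0) N * (h * j)) from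
    fun x hx => (h' x hx).trans (hle j hj)
  induction j using Nat.strong_induction_on with
  | _ j ih =>
    have hlt : ∀ i < j, h * i ≤ T := fun i hi =>
      le_trans (mul_le_mul_of_nonneg_left (by exact_mod_cast hi.le) hh.le) hj
    exact H.velocity_scheme_step hM0 hs hq hN hqN j hj
      (fun i hi x hx => hM i (hlt i hi) x hx ((ih i hi (hlt i hi) x hx).trans (hle i (hlt i hi))))
      fun i hi => ih i hi (hlt i hi)

/-- The a priori bound that closes the scheme. -/
lemma Setup.velocity_scheme_le
    (hs : SmallStep n h (velBound C1 C3 p T (D.mass ω0) (D.ulNorm p ω0).toReal)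
      (C3 * D.mass ω0)) (j : ℕ) (hj : h * j ≤ T) :
    ∀ x ∈ D.pts, ‖D.velocity k (D.scheme k n h ω0 j) x‖ ≤
      velBound C1 C3 p T (D.mass ω0) (D.ulNorm p ω0).toReal :=
  H.velocity_scheme_le_of_imp (velBound_nonneg H.C1_pos.le H.two_lt (mass_nonneg _) toReal_nonneg)
    hs H.two_lt toReal_nonneg (ofReal_toReal H.mem.ul_finite.ne).ge (fun _ _ _ _ => id) j hj

end Scheme

end FlowDomain

/-! ### Weak compactness in a Hilbert space. -/

section WeakCompactness

lemma exists_tendsto_of_eventually_near {ι : Type*} {l : Filter ι} [l.NeBot] {f : ι → ℝ}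
    (h : ∀ ε > 0, ∃ c, ∀ᶠ i in l, dist (f i) c < ε) : ∃ c, Tendsto f l (𝓝 c) := by
  rw [← cauchy_map_iff_exists_tendsto, Metric.cauchy_iff]
  refine ⟨inferInstance, fun ε hε => ?_⟩
  obtain ⟨c, hc⟩ := h (ε / 2) (by positivity)
  refine ⟨ball c (ε / 2), hc, fun x hx y hy => ?_⟩
  have h1 := mem_ball.1 hx
  have h2 := Metric.mem_ball'.1 hy
  linarith [dist_triangle x c y]

variable {H : Type*} [NormedAddCommGroup H] [InnerProductSpace ℝ H] [CompleteSpace H]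

/-- Convergence against a total set of a bounded family is weak convergence. -/
lemma exists_weak_limit {ι : Type*} {l : Filter ι} [l.NeBot] {a : ι → H}
    (hC : ∀ᶠ i in l, ‖a i‖ ≤ C) {𝒯 : Set H} (h𝒯 : (Submodule.span ℝ 𝒯)ᗮ = ⊥)
    (hconv : ∀ φ ∈ 𝒯, ∃ c, Tendsto (fun i => inner ℝ φ (a i)) l (𝓝 c)) :
    ∃ b : H, ∀ ψ, Tendsto (fun i => inner ℝ ψ (a i)) l (𝓝 (inner ℝ ψ b)) := by
  have hC0 : 0 ≤ C := by
    obtain ⟨i, hi⟩ := hC.exists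
    exact (norm_nonneg _).trans hi
  have hspan : ∀ φ ∈ Submodule.span ℝ 𝒯, ∃ c, Tendsto (fun i => inner ℝ φ (a i)) l (𝓝 c) := by
    intro φ hφ
    induction hφ using Submodule.span_induction with
    | mem x hx => exact hconv x hx
    | zero => exact ⟨0, by simp⟩
    | add x y _ _ hx hy =>
      obtain ⟨c, hc⟩ := hx
      obtain ⟨d, hd⟩ := hy
      exact ⟨c + d, by simpa [inner_add_left] using hc.add hd⟩
    | smul r x _ hx =>
      obtain ⟨c, hc⟩ := hx
      exact ⟨r * c, by simpa [inner_smul_left] using hc.const_mul r⟩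
  have hdense : ∀ ψ : H, ψ ∈ closure (Submodule.span ℝ 𝒯 : Set H) := fun ψ => by
    rw [← Submodule.topologicalClosure_coe, Submodule.topologicalClosure_eq_top_iff.2 h𝒯]
    trivial
  have hall : ∀ ψ : H, ∃ c, Tendsto (fun i => inner ℝ ψ (a i)) l (𝓝 c) := by
    intro ψ
    refine exists_tendsto_of_eventually_near fun ε hε => ?_
    obtain ⟨φ, hφ, hφψ⟩ := Metric.mem_closure_iff.1 (hdense ψ) (ε / (4 * (C + 1))) (by positivity)
    obtain ⟨c, hc⟩ := hspan φ hφ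
    refine ⟨c, ?_⟩
    filter_upwards [hC, Metric.tendsto_nhds.1 hc (ε / 4) (by positivity)] with i hi hi2
    have h1 : dist (inner ℝ ψ (a i)) (inner ℝ φ (a i)) ≤ ε / 4 := by
      rw [Real.dist_eq, ← inner_sub_left]
      refine (abs_real_inner_le_norm _ _).trans ?_
      rw [← dist_eq_norm]
      calc dist ψ φ * ‖a i‖ ≤ ε / (4 * (C + 1)) * (C + 1) :=
            mul_le_mul hφψ.le (by linarith) (norm_nonneg _) (by positivity)
        _ = ε / 4 := by field_simp
    linarith [dist_triangle (inner ℝ ψ (a i)) (inner ℝ φ (a i)) c]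
  choose L hL using hall
  -- The limits of the pairings define a bounded linear functional, and its Riesz representative is
  -- the weak limit.
  let Λ : H →ₗ[ℝ] ℝ :=
    { toFun := L
      map_add' := fun x y => tendsto_nhds_unique (hL (x + y)) (by
        simpa [inner_add_left] using (hL x).add (hL y))
      map_smul' := fun r x => tendsto_nhds_unique (hL (r • x)) (by
        simpa [inner_smul_left] using (hL x).const_mul r) }
  have hΛ : ∀ x, ‖Λ x‖ ≤ C * ‖x‖ := fun x => by
    refine le_of_tendsto (hL x).norm (hC.mono fun i hi => ?_)
    rw [mul_comm]
    exact (norm_inner_le_norm _ _).trans (mul_le_mul_of_nonneg_left hi (norm_nonneg _))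
  refine ⟨(InnerProductSpace.toDual ℝ H).symm (Λ.mkContinuous C hΛ), fun ψ => ?_⟩
  rw [real_inner_comm, InnerProductSpace.toDual_symm_apply]
  exact hL ψ

/-- Weak compactness of a bounded family of curves that is nearly equicontinuous against a total
set of functionals; the convergence is locally uniform in time. -/
lemma exists_weak_limit_curve [SecondCountableTopology H] {a : ℕ → ℝ → H}
    (hb : ∀ T : ℝ, ∃ C, ∀ n, ∀ t ∈ Icc 0 T, ‖a n t‖ ≤ C)
    (hh : Tendsto h atTop (𝓝 0)) {𝒯 : Set H} (h𝒯 : (Submodule.span ℝ 𝒯)ᗮ = ⊥)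
    (he : ∀ φ ∈ 𝒯, ∀ T : ℝ, ∃ L, ∃ N : ℕ, ∀ n ≥ N, ∀ s ∈ Icc 0 T, ∀ t ∈ Icc 0 T,
      |inner ℝ φ (a n t) - inner ℝ φ (a n s)| ≤ L * (|t - s| + h n)) :
    ∃ σ : ℕ → ℕ, StrictMono σ ∧ ∃ A : ℝ → H, ∀ t0, 0 ≤ t0 → ∀ ψ : H,
      Tendsto (fun z : ℕ × ℝ => inner ℝ ψ (a (σ z.1) z.2)) (atTop ×ˢ 𝓝[Ici 0] t0)
        (𝓝 (inner ℝ ψ (A t0))) := by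
  classical
  choose C hC using hb
  set e := TopologicalSpace.denseSeq H with he_def
  -- extraction at nonnegative rational times
  set x : ℕ → (ℕ × ℚ) → ℝ := fun n i => if 0 ≤ i.2 then inner ℝ (e i.1) (a n i.2) else 0 with hx
  have hcomp : IsCompact (Set.pi univ fun i : ℕ × ℚ =>
      closedBall (0 : ℝ) (‖e i.1‖ * |C i.2|)) :=
    isCompact_univ_pi fun i => isCompact_closedBall _ _
  obtain ⟨y, -, σ, hσ, hy⟩ := hcomp.tendsto_subseq (x := x) (fun n i _ => by
    rw [mem_closedBall_zero_iff]
    by_cases hi : 0 ≤ i.2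
    · have h0 : ((i.2 : ℚ) : ℝ) ∈ Icc (0 : ℝ) i.2 := ⟨by exact_mod_cast hi, le_rfl⟩
      simp only [hx, if_pos hi]
      exact (norm_inner_le_norm _ _).trans
        (mul_le_mul_of_nonneg_left ((hC _ n _ h0).trans (le_abs_self _)) (norm_nonneg _))
    · simp only [hx, if_neg hi, norm_zero]
      positivity)
  refine ⟨σ, hσ, ?_⟩
  have hdense : (Submodule.span ℝ (range e))ᗮ = ⊥ := by
    rw [← Submodule.topologicalClosure_eq_top_iff, eq_top_iff]
    intro ψ _
    have : ψ ∈ closure (range e) := TopologicalSpace.denseRange_denseSeq H ψ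
    exact closure_mono Submodule.subset_span this
  have hrat : ∀ r : ℚ, 0 ≤ r → ∀ ψ, ∃ c, Tendsto (fun n => inner ℝ ψ (a (σ n) r)) atTop (𝓝 c) := by
    intro r hr ψ
    have h0 : (r : ℝ) ∈ Icc (0 : ℝ) r := ⟨by exact_mod_cast hr, le_rfl⟩
    obtain ⟨b, hb⟩ := exists_weak_limit (l := atTop) (a := fun n => a (σ n) r) (C := C r)
      (.of_forall fun n => hC _ _ _ h0) hdense (by
        rintro _ ⟨i, rfl⟩
        have := (tendsto_pi_nhds.1 hy) (i, r)
        simp only [hx, comp_def, if_pos hr] at this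
        exact ⟨_, this⟩)
    exact ⟨_, hb ψ⟩
  -- A time near `t0` is compared with a rational time slightly above `t0`, where convergence is
  -- known. Near-equicontinuity transfers it to all nearby times simultaneously, hence the product
  -- filter.
  have main : ∀ t0 : ℝ, 0 ≤ t0 → ∃ b : H, ∀ ψ : H,
      Tendsto (fun z : ℕ × ℝ => inner ℝ ψ (a (σ z.1) z.2)) (atTop ×ˢ 𝓝[Ici 0] t0)
        (𝓝 (inner ℝ ψ b)) := by
    intro t0 ht0
    have hne : (𝓝[Ici 0] t0).NeBot := mem_closure_iff_nhdsWithin_neBot.1 (subset_closure ht0)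
    have hnear : ∀ δ > 0, ∀ᶠ z : ℕ × ℝ in atTop ×ˢ 𝓝[Ici 0] t0, z.2 ∈ Icc 0 (t0 + 1) ∧
        |z.2 - t0| < δ := by
      intro δ hδ
      have h1 : ∀ᶠ t in 𝓝[Ici 0] t0, t ∈ Icc 0 (t0 + 1) ∧ |t - t0| < δ := by
        filter_upwards [self_mem_nhdsWithin, nhdsWithin_le_nhds (Iio_mem_nhds (lt_add_one t0)),
          nhdsWithin_le_nhds (Metric.ball_mem_nhds t0 hδ)] with t h1 h2 h3
        exact ⟨⟨h1, le_of_lt h2⟩, h3⟩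
      exact h1.prod_inr _
    refine exists_weak_limit (C := C (t0 + 1)) ?_ h𝒯 fun φ hφ => ?_
    · filter_upwards [hnear 1 one_pos] with z hz
      exact hC _ _ _ hz.1
    · obtain ⟨L, N, hL⟩ := he φ hφ (t0 + 1)
      refine exists_tendsto_of_eventually_near fun ε hε => ?_
      set δ := ε / (8 * (|L| + 1)) with hδ
      have hδ0 : 0 < δ := by positivity
      obtain ⟨r, hr1, hr2⟩ := exists_rat_btwn (show t0 < min (t0 + δ) (t0 + 1) by
        rw [lt_min_iff]; constructor <;> linarith)
      rw [lt_min_iff] at hr2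
      have hr0 : (0 : ℝ) ≤ r := ht0.trans hr1.le
      obtain ⟨c, hc⟩ := hrat r (by exact_mod_cast hr0) φ
      have hc' := Metric.tendsto_nhds.1 hc (ε / 2) (by positivity)
      have hh' := Metric.tendsto_nhds.1 (hh.comp hσ.tendsto_atTop) δ hδ0
      refine ⟨c, ?_⟩
      filter_upwards [hnear δ hδ0, (hc'.and (hh'.and (eventually_ge_atTop N))).prod_inl _]
        with z hz hz2
      obtain ⟨h1, h2, h3⟩ := hz2
      have h4 := hL (σ z.1) (h3.trans (hσ.id_le _)) r ⟨hr0, hr2.2.le⟩ z.2 hz.1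
      rw [Real.dist_eq] at h1 h2 ⊢
      simp only [comp_apply, sub_zero] at h2
      have h5 : |z.2 - r| < 2 * δ := by
        have := abs_sub_le z.2 t0 r
        have h6 : |t0 - r| < δ := by rw [abs_lt]; constructor <;> linarith
        linarith [hz.2]
      have h7 : L * (|z.2 - r| + h (σ z.1)) ≤ |L| * (3 * δ) := by
        have : |z.2 - r| + h (σ z.1) ≤ 3 * δ := by linarith [le_abs_self (h (σ z.1))]
        have h8 : -(3 * δ) ≤ |z.2 - r| + h (σ z.1) := by
          linarith [neg_abs_le (h (σ z.1)), abs_nonneg (z.2 - r)]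
        calc _ ≤ |L * (|z.2 - r| + h (σ z.1))| := le_abs_self _
          _ ≤ _ := by
            rw [abs_mul]; exact mul_le_mul_of_nonneg_left (abs_le.2 ⟨h8, this⟩) (abs_nonneg _)
      have h9 : |L| * (3 * δ) < ε / 2 := by
        have : (|L| + 1) * δ = ε / 8 := by rw [hδ]; field_simp
        nlinarith [abs_nonneg L]
      linarith [abs_sub_le (inner ℝ φ (a (σ z.1) z.2)) (inner ℝ φ (a (σ z.1) r)) c]
  choose! A hA using main
  exact ⟨A, hA⟩

end WeakCompactness

/-! ### The weighted `L²` space and its test functions. -/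

namespace FlowDomain

lemma eLpNorm_two_le_ulNorm (hp : 2 ≤ p) (hf : AEStronglyMeasurable f D.area) :
    D.ulNorm 2 f ≤ (1 + volume (ball (0 : Plane) 1)) * D.ulNorm p f := by
  refine iSup₂_le fun x hx => ?_
  have hpos : (0 : ℝ) < p := by linarith
  have h := eLpNorm_le_eLpNorm_mul_rpow_measure_univ (p := ofReal 2)
    (q := ofReal p) (ofReal_le_ofReal hp)
    (hf.mono_measure (Measure.restrict_le_self (s := {z | D.gdist x z < 1})))
  refine h.trans ?_
  rw [mul_comm]
  refine mul_le_mul' ?_ (le_iSup₂ (f := fun x _ => eLpNorm f (ofReal p)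
    (D.area.restrict {z | D.gdist x z < 1})) x hx)
  rw [Measure.restrict_apply_univ, toReal_ofReal zero_le_two, toReal_ofReal hpos.le]
  have hπ : D.area {z | D.gdist x z < 1} ≤ 1 + volume (ball (0 : Plane) 1) :=
    (area_gdist_lt_le (D := D) x 1).trans (le_add_left le_rfl)
  have he : (0 : ℝ) ≤ 1 / 2 - 1 / p := by
    have : 1 / p ≤ 1 / 2 := one_div_le_one_div_of_le two_pos hp
    linarith
  calc _ ≤ (1 + volume (ball (0 : Plane) 1)) ^ (1 / 2 - 1 / p : ℝ) := by gcongr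
    _ ≤ (1 + volume (ball (0 : Plane) 1)) ^ (1 : ℝ) := by
        refine ENNReal.rpow_le_rpow_of_exponent_le (le_add_right le_rfl) ?_
        have : 0 < 1 / p := by positivity
        linarith
    _ = _ := rpow_one _

def wt (x : Plane) : ℝ := exp (-‖x‖)

lemma wt_pos (x : Plane) : 0 < wt x := exp_pos _

lemma continuous_wt : Continuous wt := by unfold wt; fun_prop

/-- Decompose by the integer part of `‖x‖`: the squared weight decays like `exp(-2j)` while the
covering number of the ball of radius `j + 1` grows quadratically. So functions of finite uniformly
local norm, which need not be square integrable, become elements of one Hilbert space. -/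
lemma exists_eLpNorm_wt_mul_le (hD : D.IsRegular) (hp : 2 ≤ p) :
    ∃ W : ℝ≥0∞, W < ∞ ∧ ∀ f : Plane → ℝ, AEStronglyMeasurable f D.area →
      eLpNorm (fun x => wt x * f x) 2 D.area ≤ W * D.ulNorm p f := by
  set c : ℕ → ℝ := fun j => exp (-(2 * j)) * covNum (j + 1) with hc
  have hc0 : ∀ j, 0 ≤ c j := fun j => by
    have := one_le_covNum (show (0 : ℝ) ≤ j + 1 by positivity)
    positivity
  have hsum : Summable c := by
    have h0 := Real.summable_pow_mul_exp_neg_nat_mul 0 (show (0 : ℝ) < 2 by norm_num)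
    have h1 := Real.summable_pow_mul_exp_neg_nat_mul 1 (show (0 : ℝ) < 2 by norm_num)
    have h2 := Real.summable_pow_mul_exp_neg_nat_mul 2 (show (0 : ℝ) < 2 by norm_num)
    -- `covNum (j + 1) = (4j + 6)² = 16j² + 48j + 36`.
    refine (((h0.mul_left 36).add (h1.mul_left 48)).add (h2.mul_left 16)).congr fun j => ?_
    simp only [hc, covNum, neg_mul]
    ring
  set W2 : ℝ≥0∞ := ∑' j, ofReal (c j) with hW2
  have hW2t : W2 < ∞ := by
    rw [hW2, ← ENNReal.ofReal_tsum_of_nonneg hc0 hsum]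
    exact ofReal_lt_top
  refine ⟨W2 ^ (1 / 2 : ℝ) * (1 + volume (ball (0 : Plane) 1)), mul_lt_top
    (rpow_lt_top_of_nonneg (by norm_num) hW2t.ne)
    (add_lt_top.2 ⟨ENNReal.one_lt_top, measure_ball_lt_top⟩), fun f hf => ?_⟩
  have key : ∫⁻ x, ‖wt x * f x‖ₑ ^ (2 : ℝ) ∂D.area ≤ W2 * D.ulNorm 2 f ^ (2 : ℝ) := by
    have hpt : ∀ x, ‖wt x * f x‖ₑ ^ (2 : ℝ) ≤ ∑' j : ℕ, ofReal (exp (-(2 * j))) *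
        {z | D.gdist 0 z < j + 1}.indicator (fun z => ‖f z‖ₑ ^ (2 : ℝ)) x := by
      intro x
      refine le_trans ?_ (le_tsum ⌊‖x‖⌋₊)
      have hx : x ∈ {z | D.gdist 0 z < (⌊‖x‖⌋₊ : ℝ) + 1} := by
        have := gdist_le_dist (D := D) 0 x
        rw [dist_zero_left] at this
        exact this.trans_lt (Nat.lt_floor_add_one _)
      rw [indicator_of_mem hx, enorm_mul, mul_rpow_of_nonneg _ _ zero_le_two]
      gcongr
      rw [Real.enorm_of_nonneg (wt_pos x).le, ofReal_rpow_of_nonneg (wt_pos x).le zero_le_two]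
      refine ofReal_le_ofReal ?_
      rw [wt, ← Real.exp_mul, exp_le_exp]
      linarith [Nat.floor_le (norm_nonneg x)]
    have hms : ∀ j : ℕ, MeasurableSet {z | D.gdist 0 z < (j : ℝ) + 1} := fun j =>
      measurableSet_gdist_lt 0 _
    calc _ ≤ ∫⁻ x, ∑' j : ℕ, ofReal (exp (-(2 * j))) *
          {z | D.gdist 0 z < j + 1}.indicator (fun z => ‖f z‖ₑ ^ (2 : ℝ)) x ∂D.area :=
          lintegral_mono hpt
      _ = ∑' j : ℕ, ofReal (exp (-(2 * j))) *
          ∫⁻ x in {z | D.gdist 0 z < j + 1}, ‖f x‖ₑ ^ (2 : ℝ) ∂D.area := by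
          rw [lintegral_tsum fun j => ((hf.enorm.pow_const _).indicator (hms j)).const_mul _]
          congr 1 with j
          rw [lintegral_const_mul' _ _ ofReal_ne_top, lintegral_indicator (hms j)]
      _ ≤ ∑' j : ℕ, ofReal (c j) * D.ulNorm 2 f ^ (2 : ℝ) := by
          refine ENNReal.tsum_le_tsum fun j => ?_
          rw [hc, ofReal_mul (exp_nonneg _), mul_assoc]
          exact mul_le_mul_right (lintegral_ball_le_ulNorm hD one_le_two f 0 (by positivity)) _
      _ = _ := ENNReal.tsum_mul_right
  rw [eLpNorm_eq_lintegral_rpow_enorm_toReal two_ne_zero ofNat_ne_top]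
  simp only [ENNReal.toReal_ofNat]
  calc _ ≤ (W2 * D.ulNorm 2 f ^ (2 : ℝ)) ^ (1 / 2 : ℝ) := by gcongr
    _ = W2 ^ (1 / 2 : ℝ) * D.ulNorm 2 f := by
        rw [mul_rpow_of_nonneg _ _ (by norm_num), ← rpow_mul]
        norm_num
    _ ≤ _ := by
        rw [mul_assoc]
        exact mul_le_mul_right (eLpNorm_two_le_ulNorm hp hf) _

abbrev HSpace (D : FlowDomain) : Type := Lp ℝ 2 D.area

open Classical in
def toH (D : FlowDomain) (f : Plane → ℝ) : D.HSpace := if h : MemLp f 2 D.area then h.toLp f else 0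

lemma toH_coe (hf : MemLp f 2 D.area) : D.toH f =ᵐ[D.area] f := by
  rw [toH, dif_pos hf]
  exact hf.coeFn_toLp

lemma norm_toH (hf : MemLp f 2 D.area) : ‖D.toH f‖ = (eLpNorm f 2 D.area).toReal := by
  rw [toH, dif_pos hf, Lp.norm_toLp]

/-- The weight here and the inverse weight in `testVec` cancel in the inner product, so weak
convergence in `HSpace` means convergence of the integrals `∫ ψ ω`. -/
def vort (D : FlowDomain) (f : Plane → ℝ) : D.HSpace := D.toH fun x => wt x * f x

def testVec (D : FlowDomain) (ψ : Plane → ℝ) : D.HSpace := D.toH fun x => (wt x)⁻¹ * ψ x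

lemma inner_testVec (hψ : MemLp (fun x => (wt x)⁻¹ * ψ x) 2 D.area)
    (b : D.HSpace) : inner ℝ (D.testVec ψ) b = ∫ x, ψ x * ((wt x)⁻¹ * b x) ∂D.area := by
  rw [L2.inner_def]
  refine integral_congr_ae ?_
  filter_upwards [toH_coe hψ] with x hx
  rw [testVec, hx]
  simp only [RCLike.inner_apply, conj_trivial]
  ring

lemma inner_testVec_vort (hψ : MemLp (fun x => (wt x)⁻¹ * ψ x) 2 D.area)
    (hf : MemLp (fun x => wt x * f x) 2 D.area) :
    inner ℝ (D.testVec ψ) (D.vort f) = ∫ x, ψ x * f x ∂D.area := by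
  rw [inner_testVec hψ]
  refine integral_congr_ae ?_
  filter_upwards [toH_coe hf] with x hx
  rw [vort, hx, inv_mul_cancel_left₀ (wt_pos x).ne']

lemma memLp_testVec (hψ : AEStronglyMeasurable ψ D.area)
    (hM : ∀ x, |ψ x| ≤ M) (hR : ∀ x ∈ D.cell, R < ‖x‖ → ψ x = 0) (hD : D.IsRegular) :
    MemLp (fun x => (wt x)⁻¹ * ψ x) 2 D.area := by
  have hmeas : AEStronglyMeasurable (fun x => (wt x)⁻¹ * ψ x) D.area :=
    ((continuous_wt.inv₀ fun x => (wt_pos x).ne').aestronglyMeasurable).mul hψ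
  have hb : MemLp (fun x => (wt x)⁻¹ * ψ x) 2 (D.area.restrict (closedBall 0 R)) := by
    have : IsFiniteMeasure (D.area.restrict (closedBall 0 R)) := by
      constructor
      rw [Measure.restrict_apply_univ]
      exact (Measure.restrict_apply_le _ _).trans_lt measure_closedBall_lt_top
    refine MemLp.of_bound hmeas.restrict (exp R * M) ?_
    filter_upwards [ae_restrict_mem measurableSet_closedBall] with x hx
    rw [mem_closedBall_zero_iff] at hx
    rw [norm_mul, norm_eq_abs, norm_eq_abs, abs_of_pos (inv_pos.2 (wt_pos x)), wt,
      ← exp_neg, neg_neg]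
    exact mul_le_mul (exp_le_exp.2 hx) (hM x) (abs_nonneg _) (exp_nonneg _)
  refine ⟨hmeas, ?_⟩
  refine lt_of_le_of_lt (le_of_eq ?_) hb.2
  rw [← eLpNorm_indicator_eq_eLpNorm_restrict measurableSet_closedBall]
  refine eLpNorm_congr_ae ?_
  filter_upwards [ae_area_mem_cell hD] with x hx
  by_cases h : x ∈ closedBall (0 : Plane) R
  · rw [indicator_of_mem h]
  · rw [indicator_of_notMem h, hR x hx (by simpa using h), mul_zero]

/-- Continuous functions of time and space with compact support in space (periodic functions on the
torus). -/
def TestLike (D : FlowDomain) {E : Type} [TopologicalSpace E] [Zero E] (g : ℝ → Plane → E) : Prop :=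
  Continuous (uncurry g) ∧ match D with
    | region Ω => ∃ S : Set Plane, IsCompact S ∧ S ⊆ Ω ∧ ∀ t, ∀ x ∉ S, g t x = 0
    | torus => ∀ t, torus.Descends (g t)

section

variable {E : Type} [NormedAddCommGroup E] {g : ℝ → Plane → E}

/-- Pairs of nearby points can be moved into a fixed compact set without changing their distance or
the values of `g`: a thickening of the support for a region, and a ball around the cell after
translation for the torus. Boundedness and uniform continuity on all of the plane follow from this.
-/
lemma TestLike.exists_compact (hg : D.TestLike g) : ∃ K : Set Plane, IsCompact K ∧
    ∀ x y, dist x y < 1 →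
      (∃ x' ∈ K, ∃ y' ∈ K, dist x' y' = dist x y ∧ ∀ t, g t x = g t x' ∧ g t y = g t y') ∨
        ∀ t, g t x = 0 ∧ g t y = 0 := by
  obtain ⟨-, h⟩ := hg
  cases D with
  | region Ω =>
    obtain ⟨S, hS, -, h⟩ := h
    refine ⟨Metric.cthickening 1 S, hS.cthickening, fun x y hxy => ?_⟩
    by_cases hx : x ∈ S
    · refine Or.inl ⟨x, Metric.self_subset_cthickening S hx, y, ?_, rfl, fun t => ⟨rfl, rfl⟩⟩
      exact Metric.mem_cthickening_of_dist_le y x 1 S hx (by rw [dist_comm]; exact hxy.le)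
    · by_cases hy : y ∈ S
      · refine Or.inl ⟨x, ?_, y, Metric.self_subset_cthickening S hy, rfl, fun t => ⟨rfl, rfl⟩⟩
        exact Metric.mem_cthickening_of_dist_le x y 1 S hy hxy.le
      · exact Or.inr fun t => ⟨h t x hx, h t y hy⟩
  | torus =>
    refine ⟨closedBall 0 3, isCompact_closedBall _ _, fun x y hxy => Or.inl ?_⟩
    have hx := torus_cell_subset_closedBall (sub_floorVec_mem_cell x)
    have e : dist (x - latticeVec (floorVec x)) (y - latticeVec (floorVec x)) = dist x y :=
      dist_sub_right _ _ _
    have hy : y - latticeVec (floorVec x) ∈ closedBall (0 : Plane) 3 := by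
      rw [mem_closedBall] at hx ⊢
      have := dist_triangle (y - latticeVec (floorVec x)) (x - latticeVec (floorVec x)) 0
      rw [dist_comm (y - latticeVec (floorVec x)) (x - latticeVec (floorVec x)), e] at this
      linarith
    refine ⟨_, Metric.closedBall_subset_closedBall (by norm_num) hx, _, hy, e, fun t => ?_⟩
    have h1 := h t (-floorVec x) x
    have h2 := h t (-floorVec x) y
    rw [latticeVec_neg, ← sub_eq_add_neg] at h1 h2
    exact ⟨h1.symm, h2.symm⟩

lemma TestLike.bounded (hg : D.TestLike g) (T : ℝ) :
    ∃ M, 0 ≤ M ∧ ∀ t ∈ Icc 0 T, ∀ x, ‖g t x‖ ≤ M := by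
  obtain ⟨K, hK, h⟩ := hg.exists_compact
  obtain ⟨M, hM⟩ := (isCompact_Icc.prod hK).exists_bound_of_continuousOn
    (f := uncurry g) (s := Icc (0 : ℝ) T ×ˢ K) hg.1.continuousOn
  refine ⟨max M 0, le_max_right _ _, fun t ht x => ?_⟩
  rcases h x x (by simp) with ⟨x', hx', _, _, _, he⟩ | h0
  · rw [(he t).1]
    exact (hM (t, x') ⟨ht, hx'⟩).trans (le_max_left _ _)
  · rw [(h0 t).1, norm_zero]
    exact le_max_right _ _

lemma TestLike.uniform (hg : D.TestLike g) (T : ℝ) (hε : 0 < ε) :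
    ∃ δ > 0, ∀ s ∈ Icc 0 T, ∀ t ∈ Icc 0 T, ∀ x y, |s - t| < δ → dist x y < δ →
      ‖g s x - g t y‖ < ε := by
  obtain ⟨K, hK, h⟩ := hg.exists_compact
  have hu := (isCompact_Icc.prod hK).uniformContinuousOn_of_continuous
    (f := uncurry g) (s := Icc (0 : ℝ) T ×ˢ K) hg.1.continuousOn
  obtain ⟨δ, hδ, hd⟩ := Metric.uniformContinuousOn_iff.1 hu ε hε
  refine ⟨min δ 1, lt_min hδ one_pos, fun s hs t ht x y hst hxy => ?_⟩
  rcases h x y (hxy.trans_le (min_le_right _ _)) with ⟨x', hx', y', hy', hd', he⟩ | h0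
  · rw [(he s).1, (he t).2, ← dist_eq_norm]
    refine hd (s, x') ⟨hs, hx'⟩ (t, y') ⟨ht, hy'⟩ ?_
    rw [Prod.dist_eq, max_lt_iff]
    refine ⟨?_, ?_⟩
    · show dist s t < δ
      rw [Real.dist_eq]
      exact hst.trans_le (min_le_left _ _)
    · show dist x' y' < δ
      rw [hd']
      exact hxy.trans_le (min_le_left _ _)
  · rw [(h0 s).1, (h0 t).2, sub_zero, norm_zero]
    exact hε

/-- A compact subset of an open set has positive distance to the complement, so test functions
eventually do not notice the discarded boundary layer. -/
lemma TestLike.exists_innerPart (hg : D.TestLike g) (hD : D.IsRegular) :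
    ∃ N : ℕ, ∀ n ≥ N, ∀ t, ∀ x ∉ innerPart n D.pts, g t x = 0 := by
  obtain ⟨-, h⟩ := hg
  cases D with
  | region Ω =>
    obtain ⟨S, hS, hSΩ, h⟩ := h
    obtain ⟨δ, hδ, hsub⟩ := hS.exists_cthickening_subset_open hD.1 hSΩ
    obtain ⟨N, hN⟩ := exists_nat_one_div_lt hδ
    refine ⟨N, fun n hn t x hx => h t x fun hxS => hx fun y hy => hsub ?_⟩
    refine Metric.mem_cthickening_of_dist_le y x δ S hxS ?_
    refine (mem_closedBall.1 hy).trans (le_trans ?_ hN.le)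
    exact one_div_le_one_div_of_le (by positivity) (by exact_mod_cast Nat.succ_le_succ hn)
  | torus => exact ⟨0, fun n _ t x hx => absurd (fun _ _ => mem_univ _) hx⟩

lemma TestLike.exists_radius (hg : D.TestLike g) : ∃ R, ∀ t, ∀ x ∈ D.cell, R < ‖x‖ → g t x = 0 := by
  obtain ⟨-, h⟩ := hg
  cases D with
  | region Ω =>
    obtain ⟨S, hS, hSΩ, h⟩ := h
    obtain ⟨R, hR⟩ := hS.isBounded.subset_closedBall 0
    exact ⟨R, fun t x _ hx => h t x fun hxS => by
      have := mem_closedBall_zero_iff.1 (hR hxS); linarith⟩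
  | torus => exact ⟨2, fun t x hx hx2 => by
      have := mem_closedBall_zero_iff.1 (torus_cell_subset_closedBall hx); linarith⟩

lemma TestLike.descends (hg : D.TestLike g) (t : ℝ) : D.Descends (g t) := by
  cases D with
  | region Ω => trivial
  | torus => exact hg.2 t

lemma TestLike.continuous (hg : D.TestLike g) (t : ℝ) : Continuous (g t) :=
  hg.1.comp (by fun_prop : Continuous fun x : Plane => (t, x))

lemma TestLike.memLp {g : ℝ → Plane → ℝ} (hg : D.TestLike g) (hD : D.IsRegular)
    (ht : 0 ≤ t) : MemLp (fun x => (wt x)⁻¹ * g t x) 2 D.area := by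
  obtain ⟨M, -, hM⟩ := hg.bounded t
  obtain ⟨R, hR⟩ := hg.exists_radius
  exact memLp_testVec (hg.continuous t).aestronglyMeasurable (hM t ⟨ht, le_rfl⟩) (hR t) hD

end

lemma IsTest.testLike {n : ℕ∞} {φ : ℝ → Plane → ℝ} (hφ : D.IsTest n φ) : D.TestLike φ :=
  ⟨hφ.1.continuous, hφ.2⟩

lemma IsTest.testLike_fderiv {n : ℕ∞} (hn : 1 ≤ n) {φ : ℝ → Plane → ℝ} (hφ : D.IsTest n φ) :
    D.TestLike fun t x => fderiv ℝ (uncurry φ) (t, x) := by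
  have hn' : (1 : WithTop ℕ∞) ≤ n := by exact_mod_cast hn
  refine ⟨hφ.1.continuous_fderiv (by intro h; simp [h] at hn'), ?_⟩
  obtain ⟨-, h⟩ := hφ
  cases D with
  | region Ω =>
    obtain ⟨S, hS, hSΩ, h⟩ := h
    refine ⟨S, hS, hSΩ, fun t x hx => ?_⟩
    have : uncurry φ =ᶠ[𝓝 (t, x)] fun _ => 0 := by
      have ho : IsOpen {z : ℝ × Plane | z.2 ∉ S} := hS.isClosed.isOpen_compl.preimage continuous_snd
      filter_upwards [ho.mem_nhds hx] with z hz
      exact h z.1 z.2 hz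
    show fderiv ℝ (uncurry φ) (t, x) = 0
    rw [this.fderiv_eq, fderiv_fun_const]
    rfl
  | torus =>
    intro t m x
    have e : uncurry φ = fun z => uncurry φ (z + (0, latticeVec m)) := by
      ext ⟨s, y⟩
      simp only [Prod.mk_add_mk, add_zero, uncurry]
      exact (h s m y).symm
    have := fderiv_comp_add_right (𝕜 := ℝ) (f := uncurry φ) (x := (t, x)) ((0 : ℝ), latticeVec m)
    rw [← e] at this
    show fderiv ℝ (uncurry φ) (t, x + latticeVec m) = fderiv ℝ (uncurry φ) (t, x)
    rw [this]
    simp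

lemma IsSpaceTest.contDiff (hφ : D.IsSpaceTest φ) : ContDiff ℝ (⊤ : ℕ∞) φ :=
  hφ.1.comp (contDiff_const (c := (0 : ℝ)).prodMk contDiff_id)

lemma IsSpaceTest.memLp (hφ : D.IsSpaceTest φ) (hD : D.IsRegular) :
    MemLp (fun x => (wt x)⁻¹ * φ x) 2 D.area := hφ.testLike.memLp hD le_rfl

lemma convex_torus_cell : Convex ℝ torus.cell := by
  have : torus.cell = ⋂ i, {x : Plane | x i ∈ Ico (0 : ℝ) 1} := by
    ext x; simp [cell]
  rw [this]
  exact convex_iInter fun i => (convex_Ico (0 : ℝ) 1).is_linear_preimage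
    (f := fun x : Plane => x i) ⟨fun _ _ => rfl, fun _ _ => rfl⟩

lemma ae_area_mem_interior_cell (hD : D.IsRegular) : ∀ᵐ x ∂D.area, x ∈ interior D.cell := by
  cases D with
  | region Ω =>
    have := ae_area_mem_cell (D := region Ω) hD
    filter_upwards [this] with x hx
    exact hD.1.subset_interior_iff.2 le_rfl hx
  | torus =>
    have h0 : ∀ᵐ x, x ∉ frontier torus.cell :=
      measure_eq_zero_iff_ae_notMem.1 (convex_torus_cell.addHaar_frontier volume)
    filter_upwards [ae_area_mem_cell (D := torus) trivial, ae_restrict_of_ae h0] with x hx h0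
    by_contra h
    exact h0 ⟨subset_closure hx, h⟩

lemma exists_isSpaceTest (hφ : ContDiff ℝ (⊤ : ℕ∞) φ) (hc : HasCompactSupport φ)
    (hs : tsupport φ ⊆ interior D.cell) : ∃ Φ, D.IsSpaceTest Φ ∧ ∀ x ∈ D.cell, Φ x = φ x := by
  cases D with
  | region Ω =>
    refine ⟨φ, ⟨hφ.comp contDiff_snd, tsupport φ, hc, hs.trans interior_subset, fun _ x hx => ?_⟩,
      fun _ _ => rfl⟩
    exact image_eq_zero_of_notMem_tsupport hx
  | torus =>
    refine ⟨periodize φ, ⟨(contDiff_periodize hc hφ).comp contDiff_snd,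
      fun _ => periodize_descends φ⟩, fun x hx => ?_⟩
    rw [periodize, tsum_eq_single 0, latticeVec_zero, add_zero]
    intro m hm
    refine image_eq_zero_of_notMem_tsupport fun h => hm ?_
    have h1 := floorVec_eq_zero_iff.2 (interior_subset (hs h))
    rwa [floorVec_add_latticeVec, floorVec_eq_zero_iff.2 hx, zero_add] at h1

/-- The fundamental lemma of the calculus of variations, applied in the interior of the cell, which
has full measure. On the torus a test function supported there is periodized first, and this leaves
it unchanged on the cell. -/
lemma span_testVec_orthogonal (hD : D.IsRegular) :
    (Submodule.span ℝ {b | ∃ φ, D.IsSpaceTest φ ∧ D.testVec φ = b})ᗮ = ⊥ := by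
  rw [Submodule.eq_bot_iff]
  intro b hb
  have h0 : ∀ φ, D.IsSpaceTest φ → ∫ x, φ x * ((wt x)⁻¹ * b x) ∂D.area = 0 := fun φ hφ => by
    rw [← inner_testVec (hφ.memLp hD)]
    exact (Submodule.mem_orthogonal _ _).1 hb _ (Submodule.subset_span ⟨φ, hφ, rfl⟩)
  have hloc : LocallyIntegrableOn (fun x => (wt x)⁻¹ * b x) (interior D.cell) := by
    refine (MeasureTheory.locallyIntegrableOn_iff isOpen_interior.isLocallyClosed).2
      fun K hKU hK => ?_
    have h1 : IntegrableOn (fun x => b x) K := by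
      have h2 : MemLp b 2 (volume.restrict K) :=
        (Lp.memLp b).mono_measure (Measure.restrict_mono (hKU.trans interior_subset) le_rfl)
      have : IsFiniteMeasure (volume.restrict K) := ⟨by
        rw [Measure.restrict_apply_univ]; exact hK.measure_lt_top⟩
      exact h2.integrable one_le_two
    exact h1.continuousOn_mul ((continuous_wt.inv₀ fun x => (wt_pos x).ne').continuousOn) hK
  have hae := isOpen_interior.ae_eq_zero_of_integral_contDiff_smul_eq_zero hloc fun φ hφ hc hs => by
      obtain ⟨Φ, hΦ, he⟩ := exists_isSpaceTest hφ hc hs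
      rw [← h0 Φ hΦ]
      refine Eq.trans ?_ (integral_indicator (measurableSet_cell hD))
      congr 1 with x
      by_cases hx : x ∈ D.cell
      · rw [indicator_of_mem hx, he x hx, smul_eq_mul]
      · rw [indicator_of_notMem hx, image_eq_zero_of_notMem_tsupport fun h =>
          hx (interior_subset (hs h)), zero_smul]
  rw [Lp.eq_zero_iff_ae_eq_zero]
  filter_upwards [ae_area_mem_interior_cell hD, ae_restrict_of_ae hae] with x hx h
  have := h hx
  simpa [(wt_pos x).ne'] using this

/-! ### Stable step lengths and the discrete weak form. -/

lemma growthRate_mono (hC1 : 0 ≤ C1) (hC3 : 0 ≤ C3) (hq : 2 < q) (hN1 : 0 ≤ N1)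
    (hN : 0 ≤ N) (hst : s ≤ t) : growthRate C1 C3 q s N1 N ≤ growthRate C1 C3 q t N1 N := by
  have := holderConst_nonneg hq
  unfold growthRate
  gcongr

abbrev Setup.vBound (_ : D.Setup k C1 C2 C3 p ω0) (T : ℝ) : ℝ :=
  velBound C1 C3 p T (D.mass ω0) (D.ulNorm p ω0).toReal

/-- Step sizes for which the scheme is stable up to time `n`. -/
structure Setup.StepSeq (H : D.Setup k C1 C2 C3 p ω0) (h : ℕ → ℝ) : Prop where
  small : ∀ n : ℕ, SmallStep n (h n) (H.vBound n) (C3 * D.mass ω0)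
  le : ∀ n : ℕ, h n ≤ 1 / ((n : ℝ) + 1)

variable (D k) in
def approx (ω0 : Plane → ℝ) (h : ℕ → ℝ) (n : ℕ) (t : ℝ) : Plane → ℝ :=
  D.scheme k n (h n) ω0 ⌊t / h n⌋₊

section

variable (H : D.Setup k C1 C2 C3 p ω0)
include H

lemma Setup.mass_bound_nonneg : 0 ≤ C3 * D.mass ω0 := mul_nonneg H.C3_pos.le (mass_nonneg _)

lemma Setup.velBound_nonneg (T : ℝ) : 0 ≤ H.vBound T :=
  FlowDomain.velBound_nonneg H.C1_pos.le H.two_lt (mass_nonneg _) toReal_nonneg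

lemma Setup.exists_stepSeq : ∃ h : ℕ → ℝ, H.StepSeq h := by
  choose h hs hle using fun n : ℕ => exists_smallStep n (H.velBound_nonneg n) H.mass_bound_nonneg
  exact ⟨h, hs, hle⟩

lemma Setup.ulNorm_le_ofReal : D.ulNorm p ω0 ≤ ofReal (D.ulNorm p ω0).toReal :=
  (ofReal_toReal H.mem.ul_finite.ne).ge

omit H in
lemma Setup.StepSeq.tendsto {H : D.Setup k C1 C2 C3 p ω0} (hh : H.StepSeq h) :
    Tendsto h atTop (𝓝 0) :=
  squeeze_zero (fun n => (hh.small n).pos.le) hh.le tendsto_one_div_add_atTop_nhds_zero_nat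

omit H in
lemma Setup.StepSeq.floor_le {H : D.Setup k C1 C2 C3 p ω0} (hh : H.StepSeq h) (n : ℕ)
    (ht : 0 ≤ t) : h n * (⌊t / h n⌋₊ : ℝ) ≤ t := by
  have := (hh.small n).pos
  have := Nat.floor_le (div_nonneg ht this.le)
  rwa [le_div_iff₀' (hh.small n).pos] at this

/-- The steps are tuned to the speed bound on `[0, n]`, but the a priori estimate may be run with
the current time `h n * j` as its final time; monotonicity in time then yields a bound that depends
on `T` only. -/
lemma Setup.velocity_scheme_le_T (hh : H.StepSeq h) (hq : 2 < q) (hN : 0 ≤ N)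
    (hqN : D.ulNorm q ω0 ≤ ofReal N) (hjn : h n * j ≤ n) (hjT : h n * j ≤ T) :
    ∀ x ∈ D.pts, ‖D.velocity k (D.scheme k n (h n) ω0 j) x‖ ≤ velBound C1 C3 q T (D.mass ω0) N := by
  intro x hx
  have hm := mass_nonneg (D := D) ω0
  have h0 := growthRate_nonneg (T := T) (C3 := C3) H.C1_pos.le hq hm hN
  have hmono := growthRate_mono H.C1_pos.le H.C3_pos.le hq hm hN hjT
  have hj0 : 0 ≤ h n * j := mul_nonneg (hh.small n).pos.le (Nat.cast_nonneg j)
  refine (H.velocity_scheme_le_of_imp (H.velBound_nonneg n) (hh.small n) hq hN hqN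
    (fun i hi x hx _ =>
    H.velocity_scheme_le (hh.small n) i (hi.trans hjn) x hx) j le_rfl x hx).trans ?_
  unfold velBound
  gcongr

lemma Setup.admissible_scheme' (hh : H.StepSeq h) (hjn : h n * j ≤ n) :
    D.Admissible p ω0 (D.scheme k n (h n) ω0 j) :=
  H.admissible_scheme (H.velBound_nonneg n) (hh.small n) j fun i hi =>
    H.velocity_scheme_le (hh.small n) i
      ((mul_le_mul_of_nonneg_left (by exact_mod_cast hi.le) (hh.small n).pos.le).trans hjn)

def ulFactor (C3 T N1 V r : ℝ) : ℝ := exp (2 * T * (C3 * N1 + 1)) * covNum (1 + T * V) ^ (1 / r)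

lemma Setup.ulNorm_scheme_le_T (hh : H.StepSeq h) (hq : 2 < q) (hN : 0 ≤ N)
    (hqN : D.ulNorm q ω0 ≤ ofReal N) (hr : 1 ≤ r) (hjn : h n * j ≤ n)
    (hjT : h n * j ≤ T) : D.ulNorm r (D.scheme k n (h n) ω0 j) ≤ ofReal
      (ulFactor C3 T (D.mass ω0) (velBound C1 C3 q T (D.mass ω0) N) r) * D.ulNorm r ω0 := by
  have hpos := (hh.small n).pos
  have hV := FlowDomain.velBound_nonneg (C3 := C3) (T := T) H.C1_pos.le hq
    (mass_nonneg (D := D) ω0) hN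
  have hlt : ∀ i < j, h n * i ≤ h n * j := fun i hi =>
    mul_le_mul_of_nonneg_left (by exact_mod_cast hi.le) hpos.le
  refine H.ulNorm_scheme_le (H.velBound_nonneg n) (hh.small n) (V := fun _ => min (H.vBound n)
      (velBound C1 C3 q T (D.mass ω0) N)) (fun _ => le_min (H.velBound_nonneg n) hV) j
    (fun _ _ => min_le_left _ _) (fun i hi x hx => le_min
      (H.velocity_scheme_le (hh.small n) i ((hlt i hi).trans hjn) x hx)
      (H.velocity_scheme_le_T hh hq hN hqN ((hlt i hi).trans hjn) ((hlt i hi).trans hjT) x hx))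
    hr hjT ?_
  rw [Finset.sum_const, Finset.card_range, nsmul_eq_mul, ← mul_assoc]
  exact mul_le_mul hjT (min_le_right _ _) (le_min (H.velBound_nonneg n) hV)
    ((mul_nonneg hpos.le (Nat.cast_nonneg j)).trans hjT)

variable (D k) in
def stepVel (n : ℕ) (ω : Plane → ℝ) : Plane → Plane := mollify n D.pts (D.velocity k ω)

lemma Setup.integral_step (hh : H.StepSeq h) (hjn : h n * j ≤ n)
    (hg : Measurable g) (hgd : D.Descends g) (hM : ∀ x, |g x| ≤ M) :
    ∫ x, g x * D.scheme k n (h n) ω0 (j + 1) x ∂D.area =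
      ∫ x in innerPart n D.pts, g (x + h n • D.stepVel k n (D.scheme k n (h n) ω0 j) x) *
        D.scheme k n (h n) ω0 j x ∂D.area := by
  have ha := H.admissible_scheme' hh hjn
  obtain ⟨hF, hT, -⟩ := H.transportStep ha (H.velBound_nonneg n)
    (H.velocity_scheme_le (hh.small n) j hjn) (hh.small n)
  have := (integral_transport hT H.reg ha.meas ha.mem.descends (memLp_one_iff_integrable.1
    ha.mem.memL1) hg hgd hM).2
  simp only [hF] at this
  exact this

lemma Setup.norm_stepVel_le (hh : H.StepSeq h) (hjn : h n * j ≤ n)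
    (hjT : h n * j ≤ T) (x : Plane) : ‖D.stepVel k n (D.scheme k n (h n) ω0 j) x‖ ≤ H.vBound T :=
  norm_mollify_le n (H.velocity_scheme_le_T hh H.two_lt toReal_nonneg H.ulNorm_le_ofReal
    hjn hjT) (H.velBound_nonneg T) x

omit H in
lemma Admissible.integrable_mul (hω : D.Admissible p ω0 ω)
    (hg : AEStronglyMeasurable g D.area) (hM : ∀ x, |g x| ≤ M) :
    Integrable (fun x => g x * ω x) D.area :=
  (memLp_one_iff_integrable.1 hω.mem.memL1).bdd_mul (c := M) hg (.of_forall hM)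

lemma Setup.abs_integral_mul_le (hω : D.Admissible p ω0 ω) {c : ℝ}
    (hc : ∀ x, |g x| ≤ c) : |∫ x, g x * ω x ∂D.area| ≤ c * D.mass ω0 := by
  have hi := (memLp_one_iff_integrable.1 hω.mem.memL1)
  have hc0 : 0 ≤ c := (abs_nonneg _).trans (hc 0)
  calc |∫ x, g x * ω x ∂D.area| ≤ ∫ x, c * ‖ω x‖ ∂D.area := by
        rw [← norm_eq_abs]
        refine norm_integral_le_of_norm_le (hi.norm.const_mul c) (.of_forall fun x => ?_)
        rw [norm_mul]
        exact mul_le_mul_of_nonneg_right (hc x) (norm_nonneg _)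
    _ = c * (eLpNorm ω 1 D.area).toReal := by
        rw [integral_const_mul, eLpNorm_one_eq_lintegral_enorm, integral_norm_eq_lintegral_enorm
          hi.1]
    _ ≤ _ := mul_le_mul_of_nonneg_left (toReal_mono H.mem.memL1.2.ne hω.mass) hc0

lemma Setup.continuous_stepVel (hω : D.Admissible p ω0 ω) (n : ℕ) : Continuous (D.stepVel k n ω) :=
  (contDiff_mollify n (isOpen_pts H.reg) (continuousOn_velocity H.kernel H.reg H.C1_pos.le
    H.C2_pos.le H.two_lt hω.mem) fun _ hx => norm_velocity_le H.kernel H.reg H.C1_pos.le H.two_lt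
      hω.mem.memL1.1 toReal_nonneg toReal_nonneg (ofReal_toReal hω.mem.memL1.2.ne).ge
      (ofReal_toReal hω.mem.ul_finite.ne).ge hx).continuous

/-- The discrete weak form of the transport equation, up to a small error. -/
lemma Setup.exists_step_taylor (hh : H.StepSeq h) {φ : ℝ → Plane → ℝ} (hφ : D.IsTest 1 φ)
    (T : ℝ) (hε : 0 < ε) : ∃ N : ℕ, ∀ n ≥ N, T ≤ n ∧ ∀ j : ℕ, h n * (j + 1) ≤ T →
      |∫ x, φ (h n * (j + 1)) x * D.scheme k n (h n) ω0 (j + 1) x ∂D.area -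
        ∫ x, φ (h n * j) x * D.scheme k n (h n) ω0 j x ∂D.area -
        h n * ∫ x, fderiv ℝ (uncurry φ) (h n * j, x)
          (1, D.stepVel k n (D.scheme k n (h n) ω0 j) x) * D.scheme k n (h n) ω0 j x ∂D.area| ≤
      h n * (ε * (1 + H.vBound T) * D.mass ω0) := by
  set V := H.vBound T with hV
  have hV0 : 0 ≤ V := H.velBound_nonneg T
  have hdt := hφ.testLike_fderiv le_rfl
  obtain ⟨δ, hδ, hunif⟩ := hdt.uniform T hε
  obtain ⟨N1, hN1⟩ := hφ.testLike.exists_innerPart H.reg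
  obtain ⟨N2, hN2⟩ := hdt.exists_innerPart H.reg
  obtain ⟨N3, hN3⟩ := (Metric.tendsto_atTop.1 hh.tendsto) (δ / (1 + V)) (by positivity)
  obtain ⟨M, hM0, hM⟩ := hφ.testLike.bounded T
  obtain ⟨M', hM'0, hM'⟩ := hdt.bounded T
  refine ⟨max (max N1 N2) (max N3 ⌈T⌉₊), fun n hn => ?_⟩
  have hnT : T ≤ n := (Nat.le_ceil T).trans (by
    exact_mod_cast (le_max_right _ _).trans ((le_max_right _ _).trans hn))
  have hin := hN1 n ((le_max_left _ _).trans ((le_max_left _ _).trans hn))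
  have hin' := hN2 n ((le_max_right _ _).trans ((le_max_left _ _).trans hn))
  have hhδ := hN3 n ((le_max_left _ _).trans ((le_max_right _ _).trans hn))
  have hpos := (hh.small n).pos
  rw [Real.dist_eq, sub_zero, abs_of_pos hpos, lt_div_iff₀ (by positivity)] at hhδ
  refine ⟨hnT, fun j hj => ?_⟩
  have hjT : h n * j ≤ T := le_trans (by nlinarith) hj
  have hjn : h n * j ≤ n := hjT.trans hnT
  have hj0 : 0 ≤ h n * j := by positivity
  have hj1 : 0 ≤ h n * ((j : ℝ) + 1) := by positivity
  set ω := D.scheme k n (h n) ω0 j with hω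
  set w := D.stepVel k n ω with hw
  have ha : D.Admissible p ω0 ω := H.admissible_scheme' hh hjn
  have hwV : ∀ x, ‖w x‖ ≤ V := H.norm_stepVel_le hh hjn hjT
  have hw1 : ∀ x, ‖((1 : ℝ), w x)‖ ≤ 1 + V := fun x => by
    rw [Prod.norm_def, norm_one]
    exact max_le (by linarith) (by linarith [hwV x])
  have hwc : Continuous w := H.continuous_stepVel ha n
  have hSm : MeasurableSet (innerPart n D.pts) :=
    (isOpen_innerPart n (isOpen_pts H.reg)).measurableSet
  have e1 := H.integral_step hh hjn (hφ.testLike.continuous (h n * (j + 1))).measurable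
    (hφ.testLike.descends _) (hM _ ⟨hj1, hj⟩)
  rw [e1, ← integral_indicator hSm, ← integral_const_mul]
  have hc1 : Continuous fun x => φ (h n * (j + 1)) (x + h n • w x) :=
    (hφ.testLike.continuous _).comp (by fun_prop)
  have hc3 : Continuous fun x => fderiv ℝ (uncurry φ) (h n * j, x) (1, w x) :=
    (hdt.continuous (h n * j)).clm_apply (by fun_prop)
  have hb3 : ∀ x, |fderiv ℝ (uncurry φ) (h n * j, x) (1, w x)| ≤ M' * (1 + V) := by
    intro x
    refine ((fderiv ℝ (uncurry φ) (h n * j, x)).le_opNorm (1, w x)).trans ?_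
    exact mul_le_mul (hM' _ ⟨hj0, hjT⟩ x) (hw1 x) (norm_nonneg _) hM'0
  have i1 : Integrable (fun x => (innerPart n D.pts).indicator
      (fun x => φ (h n * (j + 1)) (x + h n • w x) * ω x) x) D.area :=
    (ha.integrable_mul hc1.aestronglyMeasurable fun x => hM _ ⟨hj1, hj⟩ _).indicator hSm
  have i2 : Integrable (fun x => φ (h n * j) x * ω x) D.area :=
    ha.integrable_mul (hφ.testLike.continuous _).aestronglyMeasurable (hM _ ⟨hj0, hjT⟩)
  have i3 : Integrable (fun x => fderiv ℝ (uncurry φ) (h n * j, x) (1, w x) * ω x)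
      D.area := ha.integrable_mul hc3.aestronglyMeasurable hb3
  have i12 : Integrable (fun x => (innerPart n D.pts).indicator
      (fun x => φ (h n * (j + 1)) (x + h n • w x) * ω x) x - φ (h n * j) x * ω x) D.area :=
    i1.sub i2
  rw [← integral_sub i1 i2, ← integral_sub i12 (i3.const_mul _)]
  -- For large `n` both `φ` and its derivative vanish off the inner part, so one indicator can be
  -- put in front of all three terms; the vorticity that is dropped contributes nothing.
  have e2 : ∀ x, (innerPart n D.pts).indicator
      (fun x => φ (h n * (j + 1)) (x + h n • w x) * ω x) x - φ (h n * j) x * ω x -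
        h n * (fderiv ℝ (uncurry φ) (h n * j, x) (1, w x) * ω x) =
      (innerPart n D.pts).indicator (fun x => φ (h n * (j + 1)) (x + h n • w x) - φ (h n * j) x -
        h n * fderiv ℝ (uncurry φ) (h n * j, x) (1, w x)) x * ω x := by
    intro x
    by_cases hx : x ∈ innerPart n D.pts
    · rw [indicator_of_mem hx, indicator_of_mem hx]; ring
    · rw [indicator_of_notMem hx, indicator_of_notMem hx, hin _ x hx, hin' _ x hx]; simp
  refine (congrArg abs (integral_congr_ae (ae_of_all _ e2))).trans_le ?_
  rw [← mul_assoc]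
  refine H.abs_integral_mul_le ha fun x => ?_
  by_cases hx : x ∈ innerPart n D.pts
  swap
  · rw [indicator_of_notMem hx, abs_zero]; positivity
  rw [indicator_of_mem hx]
  -- Taylor's formula
  set s : Set (ℝ × Plane) := segment ℝ (h n * j, x) (h n * (j + 1), x + h n • w x) with hs
  have hdiff : Differentiable ℝ (uncurry φ) := hφ.1.differentiable (by simp)
  have hbound : ∀ z ∈ s, ‖fderiv ℝ (uncurry φ) z - fderiv ℝ (uncurry φ) (h n * j, x)‖ ≤ ε := by
    intro z hz
    rw [hs, segment_eq_image'] at hz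
    obtain ⟨θ, ⟨hθ0, hθ1⟩, rfl⟩ := hz
    have hhV : h n * ‖w x‖ ≤ h n * V := mul_le_mul_of_nonneg_left (hwV x) hpos.le
    have h1 : h n * j + θ * (h n * (j + 1) - h n * j) ∈ Icc 0 T := by
      constructor <;> nlinarith
    refine (hunif _ h1 _ ⟨hj0, hjT⟩ (x + θ • (x + h n • w x - x)) x ?_ ?_).le
    · rw [show h n * j + θ * (h n * (j + 1) - h n * j) - h n * j = θ * h n by ring,
        abs_of_nonneg (by positivity)]
      nlinarith
    · rw [dist_eq_norm, add_sub_cancel_left, add_sub_cancel_left, norm_smul, norm_smul,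
        norm_of_nonneg hθ0, norm_of_nonneg hpos.le]
      nlinarith [mul_nonneg hpos.le (norm_nonneg (w x))]
  have := (convex_segment _ _).norm_image_sub_le_of_norm_fderiv_le' (f := uncurry φ)
    (fun z _ => hdiff z) hbound (left_mem_segment ℝ _ _) (right_mem_segment ℝ _ _)
  have e3 : ((h n * ((j : ℝ) + 1), x + h n • w x) : ℝ × Plane) - (h n * j, x) =
      h n • ((1 : ℝ), w x) := by
    ext1
    · simp; ring
    · simp
  rw [e3, map_smul, norm_smul, norm_of_nonneg hpos.le, smul_eq_mul] at this
  refine this.trans ?_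
  rw [mul_left_comm]
  exact mul_le_mul_of_nonneg_left (mul_le_mul_of_nonneg_left (hw1 x) hε.le) hpos.le

end

end FlowDomain

/-! ### Constraints that survive weak limits, and measurable representatives. -/

/-- Testing the convergence with `b - v`, where `v` is the projection of `b` onto `C`, gives `‖b -
v‖² ≤ 0` in the limit. -/
lemma mem_of_weak_limit {H : Type*} [NormedAddCommGroup H] [InnerProductSpace ℝ H]
    [CompleteSpace H] {C : Set H} (hC : Convex ℝ C) (hcl : IsClosed C) {ι : Type*} {l : Filter ι}
    [l.NeBot] {a : ι → H} {b : H} (ha : ∀ᶠ i in l, a i ∈ C)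
    (hb : ∀ ψ : H, Tendsto (fun i => inner ℝ ψ (a i)) l (𝓝 (inner ℝ ψ b))) : b ∈ C := by
  obtain ⟨i, hi⟩ := ha.exists
  obtain ⟨v, hv, hmin⟩ := exists_norm_eq_iInf_of_complete_convex ⟨_, hi⟩ hcl.isComplete hC b
  rw [norm_eq_iInf_iff_real_inner_le_zero hC hv] at hmin
  have h1 : inner ℝ (b - v) (b - v) ≤ 0 := by
    have ht : Tendsto (fun i => inner ℝ (b - v) (a i - v)) l (𝓝 (inner ℝ (b - v) (b - v))) := by
      simp only [inner_sub_right]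
      exact ((hb (b - v)).sub tendsto_const_nhds)
    exact le_of_tendsto ht (ha.mono fun i hi => hmin _ hi)
  have h2 : b - v = 0 := real_inner_self_nonpos.1 h1
  rwa [sub_eq_zero.1 h2]

namespace FlowDomain

lemma convex_eLpNorm_le (r : ℝ≥0∞) (hr : 1 ≤ r) (E : Set Plane) (K : ℝ≥0∞) :
    Convex ℝ {f : D.HSpace | eLpNorm (fun x => (wt x)⁻¹ * f x) r (D.area.restrict E) ≤ K} := by
  have hm : ∀ f : D.HSpace, AEStronglyMeasurable (fun x => (wt x)⁻¹ * f x) (D.area.restrict E) :=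
    fun f => ((continuous_wt.inv₀ fun x => (wt_pos x).ne').aestronglyMeasurable).mul
      (Lp.aestronglyMeasurable f).restrict
  intro f hf g hg a b ha hb hab
  have hf' : eLpNorm (fun x => (wt x)⁻¹ * f x) r (D.area.restrict E) ≤ K := hf
  have hg' : eLpNorm (fun x => (wt x)⁻¹ * g x) r (D.area.restrict E) ≤ K := hg
  show eLpNorm (fun x => (wt x)⁻¹ * (a • f + b • g : D.HSpace) x) r (D.area.restrict E) ≤ K
  have e : (fun x => (wt x)⁻¹ * (a • f + b • g : D.HSpace) x) =ᵐ[D.area.restrict E]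
      a • (fun x => (wt x)⁻¹ * f x) + b • fun x => (wt x)⁻¹ * g x := by
    refine ae_restrict_of_ae ?_
    filter_upwards [Lp.coeFn_add (a • f) (b • g), Lp.coeFn_smul a f, Lp.coeFn_smul b g]
      with x h1 h2 h3
    simp only [h1, Pi.add_apply, h2, h3, Pi.smul_apply, smul_eq_mul]
    ring
  rw [eLpNorm_congr_ae e]
  refine (eLpNorm_add_le ((hm f).const_smul a) ((hm g).const_smul b) hr).trans ?_
  rw [eLpNorm_const_smul, eLpNorm_const_smul, Real.enorm_of_nonneg ha, Real.enorm_of_nonneg hb]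
  calc _ ≤ ofReal a * K + ofReal b * K := by gcongr
    _ = K := by rw [← add_mul, ← ofReal_add ha hb, hab, ofReal_one, one_mul]

/-- Convergence in `L²` gives a subsequence that converges almost everywhere, and Fatou's lemma
handles every exponent `r`. Together with convexity this carries `L^r` bounds on sets through weak
`L²` limits. -/
lemma isClosed_eLpNorm_le (r : ℝ≥0∞) (E : Set Plane) (K : ℝ≥0∞) :
    IsClosed {f : D.HSpace | eLpNorm (fun x => (wt x)⁻¹ * f x) r (D.area.restrict E) ≤ K} := by
  refine isClosed_of_closure_subset fun f hf => ?_
  obtain ⟨u, hu, hlim⟩ := mem_closure_iff_seq_limit.1 hf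
  have hin : TendstoInMeasure D.area (fun n => u n) atTop f := tendstoInMeasure_of_tendsto_Lp hlim
  obtain ⟨ns, -, hae⟩ := hin.exists_seq_tendsto_ae
  have := Lp.eLpNorm_lim_le_liminf_eLpNorm (p := r) (μ := D.area.restrict E)
    (f := fun i x => (wt x)⁻¹ * u (ns i) x)
    (fun i => ((continuous_wt.inv₀ fun x => (wt_pos x).ne').aestronglyMeasurable).mul
      (Lp.aestronglyMeasurable (u (ns i))).restrict) (fun x => (wt x)⁻¹ * f x) (by
        filter_upwards [ae_restrict_of_ae hae] with x hx
        exact hx.const_mul _)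
  refine this.trans ?_
  refine (liminf_le_liminf (.of_forall fun i => (hu (ns i) : _ ≤ K))).trans ?_
  rw [liminf_const]

instance : SigmaFinite D.area := by unfold area; infer_instance

lemma locallyIntegrable_cell_indicator (hD : D.IsRegular) (b : D.HSpace) :
    LocallyIntegrable (D.cell.indicator fun y => (wt y)⁻¹ * b y) := by
  refine locallyIntegrable_iff.2 fun K hK => ?_
  have h1 : IntegrableOn b K D.area := by
    have : IsFiniteMeasure (D.area.restrict K) := ⟨by
      rw [Measure.restrict_apply_univ]
      exact (Measure.restrict_apply_le _ _).trans_lt hK.measure_lt_top⟩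
    exact ((Lp.memLp b).mono_measure Measure.restrict_le_self).integrable one_le_two
  have h2 : IntegrableOn (fun y => (wt y)⁻¹ * b y) K D.area :=
    h1.continuousOn_mul ((continuous_wt.inv₀ fun x => (wt_pos x).ne').continuousOn) hK
  refine (integrable_indicator_iff (measurableSet_cell hD)).2 ?_
  rw [IntegrableOn, Measure.restrict_restrict (measurableSet_cell hD), inter_comm,
    ← Measure.restrict_restrict hK.measurableSet]
  exact h2

lemma average_cell_indicator (hD : D.IsRegular) (F : Plane → ℝ) (x : Plane) (r : ℝ) :
    ⨍ y in closedBall x r, D.cell.indicator F y = (volume.real (closedBall (0 : Plane) r))⁻¹ *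
        ∫ y, (closedBall x r).indicator (fun _ => 1) y * F y ∂D.area := by
  rw [setAverage_eq, smul_eq_mul, measureReal_def, measureReal_def,
    Measure.addHaar_closedBall_center]
  congr 1
  rw [← integral_indicator measurableSet_closedBall]
  refine Eq.trans ?_ (integral_indicator (measurableSet_cell hD))
  refine integral_congr_ae (ae_of_all _ fun y => ?_)
  by_cases h1 : y ∈ closedBall x r <;> by_cases h2 : y ∈ D.cell <;> simp [h1, h2]

/-- A weakly continuous curve has a jointly measurable representative. -/
lemma exists_measurable_curve (hD : D.IsRegular) {A : ℝ → D.HSpace}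
    (hA : ∀ ψ : D.HSpace, Continuous fun t => inner ℝ ψ (A t)) :
    ∃ ω : ℝ → Plane → ℝ, Measurable (uncurry ω) ∧
      ∀ t, ω t =ᵐ[D.area] fun x => (wt x)⁻¹ * A t x := by
  set B : ℕ → Plane → Set Plane := fun n x => closedBall x (1 / ((n : ℝ) + 1)) with hB
  set c : ℕ → ℝ := fun n => (volume.real (closedBall (0 : Plane) (1 / ((n : ℝ) + 1))))⁻¹
  set ψ : ℕ → Plane → Plane → ℝ := fun n x => (B n x).indicator fun _ => 1 with hψ
  have hψL : ∀ n x, MemLp (fun y => (wt y)⁻¹ * ψ n x y) 2 D.area := fun n x => by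
    refine memLp_testVec (M := 1) (R := ‖x‖ + 1 / ((n : ℝ) + 1))
      ((measurable_const.indicator measurableSet_closedBall).aestronglyMeasurable) (fun y => ?_)
      (fun y _ hy => indicator_of_notMem (fun h => ?_) _) hD
    · by_cases hy : y ∈ B n x <;> simp [hψ, hy]
    · have h1 := mem_closedBall_iff_norm.1 h
      have h2 := norm_le_norm_add_norm_sub' y x
      linarith
  set F : ℝ → Plane → ℝ := fun t y => (wt y)⁻¹ * A t y with hF
  have hFm : ∀ t, StronglyMeasurable (F t) := fun t =>
    ((continuous_wt.inv₀ fun x => (wt_pos x).ne').stronglyMeasurable).mul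
      (Lp.stronglyMeasurable (A t))
  -- `g n t x` is the mean over the ball of radius `1/(n+1)` about `x` of the function extended by
  -- zero from the cell, written as an inner product. It is continuous in `t` and measurable in `x`,
  -- hence jointly measurable; Lebesgue's differentiation theorem identifies the upper limit.
  set g : ℕ → ℝ → Plane → ℝ := fun n t x => c n * inner ℝ (D.testVec (ψ n x)) (A t) with hg
  have hinner : ∀ n t x, inner ℝ (D.testVec (ψ n x)) (A t) = ∫ y, ψ n x y * F t y ∂D.area :=
    fun n t x => inner_testVec (hψL n x) (A t)
  have hgm : ∀ n, Measurable (uncurry (g n)) := by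
    intro n
    refine measurable_uncurry_of_continuous_of_measurable
      (fun x => (hA (D.testVec (ψ n x))).const_mul (c n)) fun t => ?_
    simp only [hg, hinner]
    have : StronglyMeasurable fun x => ∫ y, ψ n x y * F t y ∂D.area := by
      refine StronglyMeasurable.integral_prod_right' (f := fun z : Plane × Plane =>
        ψ n z.1 z.2 * F t z.2) ?_
      refine StronglyMeasurable.mul ?_ ((hFm t).comp_measurable measurable_snd)
      have : (fun z : Plane × Plane => ψ n z.1 z.2) =
          {z : Plane × Plane | dist z.2 z.1 ≤ 1 / ((n : ℝ) + 1)}.indicator fun _ => 1 := by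
        ext ⟨x, y⟩
        simp only [hψ, hB, indicator, mem_closedBall, Set.mem_ofPred_eq]
      rw [this]
      exact stronglyMeasurable_const.indicator (measurableSet_le (by fun_prop) measurable_const)
    exact (this.const_mul (c n)).measurable
  set f : ℝ → Plane → ℝ := fun t x => limsup (fun n => g n t x) atTop with hf
  have hfm : Measurable (uncurry f) := Measurable.limsup hgm
  have hfae : ∀ t, f t =ᵐ[D.area] F t := by
    intro t
    filter_upwards [ae_restrict_of_ae (IsUnifLocDoublingMeasure.ae_tendsto_average
      volume (locallyIntegrable_cell_indicator hD (A t)) 1), ae_area_mem_cell hD] with x hx hxc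
    have hδ : Tendsto (fun n : ℕ => 1 / ((n : ℝ) + 1)) atTop (𝓝[>] 0) :=
      tendsto_nhdsWithin_iff.2 ⟨tendsto_one_div_add_atTop_nhds_zero_nat,
        Eventually.of_forall fun n => show (0 : ℝ) < 1 / ((n : ℝ) + 1) by positivity⟩
    have := hx (fun _ => x) (fun n : ℕ => 1 / ((n : ℝ) + 1)) hδ (.of_forall fun n => by
      simp only [one_mul]; exact mem_closedBall_self (by positivity))
    rw [indicator_of_mem hxc] at this
    have e : ∀ n : ℕ, ⨍ y in closedBall x (1 / ((n : ℝ) + 1)), D.cell.indicator (F t) y =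
        g n t x := fun n => by
      rw [average_cell_indicator hD (F t)]
      exact congrArg (c n * ·) (hinner n t x).symm
    have h2 : Tendsto (fun n => g n t x) atTop (𝓝 (F t x)) := Tendsto.congr e this
    exact h2.limsup_eq
  exact ⟨f, hfm, hfae⟩

lemma exists_measurable_representative (hD : D.IsRegular) {A : ℝ → D.HSpace}
    (hA : ∀ ψ : D.HSpace, Continuous fun t => inner ℝ ψ (A t)) :
    ∃ ω : ℝ → Plane → ℝ, Measurable (uncurry ω) ∧ (∀ t, D.Descends (ω t)) ∧
      ∀ t, ω t =ᵐ[D.area] fun x => (wt x)⁻¹ * A t x := by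
  obtain ⟨f, hfm, hfae⟩ := exists_measurable_curve hD hA
  cases D with
  | region Ω => exact ⟨f, hfm, fun _ => trivial, hfae⟩
  | torus =>
    refine ⟨fun t x => f t (x - latticeVec (floorVec x)), ?_, fun t m x => ?_, fun t => ?_⟩
    · exact hfm.comp (measurable_fst.prodMk (measurable_snd.sub
        (measurable_latticeVec.comp (measurable_floorVec.comp measurable_snd))))
    · simp only [floorVec_add_latticeVec, latticeVec_add, add_sub_add_right_eq_sub]
    · filter_upwards [hfae t, ae_area_mem_cell (D := torus) trivial] with x hx hxc
      rw [floorVec_eq_zero_iff.2 hxc, latticeVec_zero, sub_zero, hx]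

/-- Bounded functions with bounded support, the functionals used for weak convergence. -/
structure BoundedTest (D : FlowDomain) (ψ : Plane → ℝ) : Prop where
  meas : AEStronglyMeasurable ψ D.area
  bound : ∃ M, ∀ x, |ψ x| ≤ M
  radius : ∃ R, ∀ x ∈ D.cell, R < ‖x‖ → ψ x = 0

lemma BoundedTest.memLp (hψ : D.BoundedTest ψ) (hD : D.IsRegular) :
    MemLp (fun x => (wt x)⁻¹ * ψ x) 2 D.area := by
  obtain ⟨M, hM⟩ := hψ.bound
  obtain ⟨R, hR⟩ := hψ.radius
  exact memLp_testVec hψ.meas hM hR hD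

/-! ### From weak convergence of vorticities to pointwise convergence of velocities. -/

lemma tendsto_plane {ι : Type*} {l : Filter ι} {f : ι → Plane} {a : Plane}
    (h : ∀ i, Tendsto (fun z => f z i) l (𝓝 (a i))) : Tendsto f l (𝓝 a) :=
  ((PiLp.continuous_toLp 2 (fun _ : Fin 2 => ℝ)).tendsto _).comp (tendsto_pi_nhds.2 h)

def midSet (D : FlowDomain) (x : Plane) (δ : ℝ) : Set Plane :=
  {z | z ∈ D.pts ∧ δ ≤ D.gdist x z ∧ D.gdist x z ≤ 1 / δ}

lemma measurableSet_midSet (hD : D.IsRegular) (x : Plane) (δ : ℝ) : MeasurableSet (D.midSet x δ) :=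
  (measurableSet_pts hD).inter ((measurableSet_le measurable_const
    (continuous_gdist x).measurable).inter (measurableSet_le (continuous_gdist x).measurable
      measurable_const))

section

variable (hk : D.KernelBounds k C1 C2) (hD : D.IsRegular) (hC1 : 0 ≤ C1)
include hk hD hC1

lemma boundedTest_midSet
    (hx : x ∈ D.pts) {δ : ℝ} (hδ : 0 < δ) (i : Fin 2) :
    D.BoundedTest ((D.midSet x δ).indicator fun z => k x z i) := by
  refine ⟨?_, ⟨C1 / δ, fun z => ?_⟩, ⟨max 2 (‖x‖ + 1 / δ), fun z hz hR => ?_⟩⟩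
  · have := hk.aestronglyMeasurable hD hx
    exact ((EuclideanSpace.proj (𝕜 := ℝ) i).continuous.comp_aestronglyMeasurable this).indicator
      (measurableSet_midSet hD x δ)
  · by_cases hz : z ∈ D.midSet x δ
    · rw [indicator_of_mem hz]
      refine (PiLp.norm_apply_le (k x z) i).trans ?_
      exact (hk.size x hx z hz.1 (hδ.trans_le hz.2.1).ne').trans
        (div_le_div_of_nonneg_left hC1 hδ hz.2.1)
    · rw [indicator_of_notMem hz, abs_zero]; positivity
  · refine indicator_of_notMem (fun h => ?_) _
    rw [max_lt_iff] at hR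
    cases D with
    | region Ω =>
      have h1 : dist x z ≤ 1 / δ := h.2.2
      rw [dist_comm, dist_eq_norm] at h1
      linarith [norm_le_norm_add_norm_sub' z x]
    | torus =>
      have := mem_closedBall_zero_iff.1 (torus_cell_subset_closedBall hz)
      linarith [hR.1]

/-- The truncated kernel is bounded with compact support, so it can be paired with weakly convergent
vorticities; the rest is small uniformly. For `r < δ` one has `1/r = kerMod δ r`, which gives
`δ^{1-2/q}`, and for `r > 1/δ` the kernel is below `C1 δ`. -/
lemma norm_velocity_sub_mid_le
    (hq : 2 < q) (hf : D.MemL1Ul q f) (hN1 : 0 ≤ N1)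
    (hN : 0 ≤ N) (h1 : eLpNorm f 1 D.area ≤ ofReal N1)
    (h2 : D.ulNorm q f ≤ ofReal N) (hx : x ∈ D.pts) {δ : ℝ} (hδ : 0 < δ) (hδ1 : δ < 1) :
    ‖D.velocity k f x - ∫ z, (D.midSet x δ).indicator (fun z => f z • k x z) z ∂D.area‖ ≤
      C1 * (holderConst q * δ ^ (1 - 2 / q) * N + δ * N1) := by
  have hhc := holderConst_nonneg hq
  set S : Set ℝ := {r | δ ≤ r ∧ r ≤ 1 / δ} with hS
  have hSm : MeasurableSet S := measurableSet_Icc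
  set G : ℝ → ℝ≥0∞ := Sᶜ.indicator fun r => ofReal (1 / r) with hG
  have hGm : Measurable G := by
    refine Measurable.indicator ?_ hSm.compl
    fun_prop
  have hδ2 : 1 < 1 / δ := by rw [lt_div_iff₀ hδ]; linarith
  have hA : ∫⁻ y : Plane in ball 0 1, G ‖y‖ ^ (q / (q - 1)) ≤
      ofReal (holderConst q * δ ^ (1 - 2 / q)) ^ (q / (q - 1)) := by
    refine le_trans (lintegral_mono_ae ?_) ((setLIntegral_le_lintegral _ _).trans
      (lintegral_kerMod_le hq hδ.le))
    filter_upwards [ae_restrict_mem isOpen_ball.measurableSet] with y hy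
    rw [mem_ball_zero_iff] at hy
    have hq' := (conj_bounds hq).1
    refine ENNReal.rpow_le_rpow ?_ (by linarith)
    by_cases hyS : ‖y‖ ∈ S
    · simp [hG, hyS]
    · rw [hG, indicator_of_mem (show ‖y‖ ∈ Sᶜ from hyS)]
      refine ofReal_le_ofReal (le_min le_rfl ?_)
      have hyδ : ‖y‖ < δ := by
        by_contra h
        exact hyS ⟨not_lt.1 h, by linarith⟩
      rcases (norm_nonneg y).eq_or_lt with h0 | h0
      · rw [← h0]; simp
      · rw [div_le_div_iff₀ h0 (by positivity)]
        nlinarith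
  have hb : ∀ r, 1 ≤ r → G r ≤ ofReal δ := by
    intro r hr
    by_cases hrS : r ∈ S
    · simp [hG, hrS]
    · rw [hG, indicator_of_mem (show r ∈ Sᶜ from hrS)]
      refine ofReal_le_ofReal ?_
      have : 1 / δ < r := by
        by_contra h
        exact hrS ⟨by linarith, not_lt.1 h⟩
      rw [div_lt_iff₀ hδ] at this
      rw [div_le_iff₀ (by linarith)]
      linarith
  have hpot := lintegral_potential_le (show 1 < q by linarith) hf.memL1.1 hx hGm hA hb
  have hi := integrable_velocity hk hD hC1 hq hf hx
  have hm := measurableSet_midSet hD x δ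
  rw [velocity, ← integral_sub hi (hi.indicator hm), ← ofReal_le_ofReal_iff
    (by positivity), ofReal_norm]
  refine (enorm_integral_le_lintegral_enorm _).trans ?_
  calc _ ≤ ∫⁻ z, ofReal C1 * (G (D.gdist x z) * ‖f z‖ₑ) ∂D.area := by
        refine lintegral_mono_ae ?_
        filter_upwards [ae_gdist_ne_zero (D := D) x, ae_area_mem_pts hD] with z hxz hz
        by_cases hzm : z ∈ D.midSet x δ
        · simp [indicator_of_mem hzm]
        · have hzS : D.gdist x z ∈ Sᶜ := fun h => hzm ⟨hz, h.1, h.2⟩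
          rw [indicator_of_notMem hzm, sub_zero, enorm_smul, hG, indicator_of_mem hzS, ← mul_assoc,
            ← ofReal_mul hC1, mul_comm]
          gcongr
          rw [← ofReal_norm, mul_one_div]
          exact ofReal_le_ofReal (hk.size x hx z hz hxz)
    _ = ofReal C1 * ∫⁻ z, G (D.gdist x z) * ‖f z‖ₑ ∂D.area := lintegral_const_mul' _ _ ofReal_ne_top
    _ ≤ ofReal C1 * (ofReal (holderConst q * δ ^ (1 - 2 / q)) * ofReal N +
          ofReal δ * ofReal N1) := by
        refine mul_le_mul_right (hpot.trans ?_) _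
        gcongr
    _ = _ := by
        rw [← ofReal_mul (by positivity), ← ofReal_mul hδ.le,
          ← ofReal_add (by positivity) (by positivity), ← ofReal_mul hC1]

/-- Weak convergence of bounded vorticities implies pointwise convergence of the velocities. -/
lemma tendsto_velocity (hq : 2 < q)
    {ι : Type*} {l : Filter ι} {f : ι → Plane → ℝ} (hN1 : 0 ≤ N1) (hN : 0 ≤ N)
    (hf : ∀ᶠ i in l, D.MemL1Ul q (f i) ∧ eLpNorm (f i) 1 D.area ≤ ofReal N1 ∧
      D.ulNorm q (f i) ≤ ofReal N) (hg : D.MemL1Ul q g ∧ eLpNorm g 1 D.area ≤ ofReal N1 ∧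
      D.ulNorm q g ≤ ofReal N)
    (hconv : ∀ ψ, D.BoundedTest ψ → Tendsto (fun i => ∫ x, ψ x * f i x ∂D.area) l
      (𝓝 (∫ x, ψ x * g x ∂D.area))) (hx : x ∈ D.pts) :
    Tendsto (fun i => D.velocity k (f i) x) l (𝓝 (D.velocity k g x)) := by
  have hα := one_sub_two_div_pos hq
  have hmid : ∀ δ, 0 < δ → ∀ F : Plane → ℝ, D.MemL1Ul q F → ∀ i : Fin 2,
      (∫ z, (D.midSet x δ).indicator (fun z => F z • k x z) z ∂D.area) i =
        ∫ z, (D.midSet x δ).indicator (fun z => k x z i) z * F z ∂D.area := by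
    intro δ hδ F hF i
    have hint := (integrable_velocity hk hD hC1 hq hF hx).indicator (measurableSet_midSet hD x δ)
    have := (EuclideanSpace.proj (𝕜 := ℝ) i).integral_comp_comm hint
    refine this.symm.trans (integral_congr_ae (ae_of_all _ fun z => ?_))
    by_cases hz : z ∈ D.midSet x δ
    · simp [hz, mul_comm]
    · simp [hz]
  have herr : Tendsto (fun δ : ℝ => C1 * (holderConst q * δ ^ (1 - 2 / q) * N + δ * N1))
      (𝓝[>] 0) (𝓝 0) := by
    have h1 : ContinuousAt (fun δ : ℝ => C1 * (holderConst q * δ ^ (1 - 2 / q) * N + δ * N1)) 0 :=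
      (((((continuousAt_id.rpow_const (Or.inr hα.le)).const_mul _).mul_const _).add
        (continuousAt_id.mul_const _))).const_mul _
    have h2 := h1.tendsto.mono_left (nhdsWithin_le_nhds (s := Ioi 0))
    simpa [zero_rpow hα.ne'] using h2
  rw [Metric.tendsto_nhds]
  intro ε hε
  have hδ1' : ∀ᶠ δ : ℝ in 𝓝[>] 0, δ < 1 := nhdsWithin_le_nhds (Iio_mem_nhds one_pos)
  obtain ⟨δ, ⟨hδe, hδ1⟩, hδ0⟩ := (((herr.eventually (Iio_mem_nhds (show (0 : ℝ) < ε / 3 by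
    positivity))).and hδ1').and self_mem_nhdsWithin).exists
  have hδ0' : 0 < δ := hδ0
  have hm : Tendsto (fun i => ∫ z, (D.midSet x δ).indicator (fun z => f i z • k x z) z ∂D.area) l
      (𝓝 (∫ z, (D.midSet x δ).indicator (fun z => g z • k x z) z ∂D.area)) := by
    refine tendsto_plane fun i => ?_
    rw [hmid δ hδ0' g hg.1 i]
    refine (hconv _ (boundedTest_midSet hk hD hC1 hx hδ0' i)).congr' ?_
    filter_upwards [hf] with j hj
    exact (hmid δ hδ0' _ hj.1 i).symm
  filter_upwards [hf, Metric.tendsto_nhds.1 hm (ε / 3) (by positivity)] with i hi hmi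
  have e1 := norm_velocity_sub_mid_le hk hD hC1 hq hi.1 hN1 hN hi.2.1 hi.2.2 hx hδ0' hδ1
  have e2 := norm_velocity_sub_mid_le hk hD hC1 hq hg.1 hN1 hN hg.2.1 hg.2.2 hx hδ0' hδ1
  rw [← dist_eq_norm] at e1 e2
  have hδe' : C1 * (holderConst q * δ ^ (1 - 2 / q) * N + δ * N1) < ε / 3 := hδe
  rw [dist_comm] at e2
  have t1 := dist_triangle4 (D.velocity k (f i) x)
    (∫ z, (D.midSet x δ).indicator (fun z => f i z • k x z) z ∂D.area)
    (∫ z, (D.midSet x δ).indicator (fun z => g z • k x z) z ∂D.area) (D.velocity k g x)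
  linarith

end

/-! ### Extraction of a limit and its bounds. -/

section

variable (H : D.Setup k C1 C2 C3 p ω0)
include H

/-- By the discrete weak form, with error parameter one, a single step changes the integral by at
most `h L`. Between the times `s` and `t` there are at most `|t - s|/h + 1` steps, whence the extra
`h n`. -/
lemma Setup.equicontinuous (hh : H.StepSeq h) (hφ : D.IsSpaceTest φ) (T : ℝ) :
    ∃ L, ∃ N : ℕ, ∀ n ≥ N, T ≤ n ∧ ∀ s ∈ Icc 0 T, ∀ t ∈ Icc 0 T,
      |∫ x, φ x * D.approx k ω0 h n t x ∂D.area - ∫ x, φ x * D.approx k ω0 h n s x ∂D.area| ≤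
        L * (|t - s| + h n) := by
  have hφ1 : D.IsTest 1 fun _ => φ := ⟨hφ.1.of_le (by exact_mod_cast le_top), hφ.2⟩
  have hdt := hφ1.testLike_fderiv le_rfl
  obtain ⟨M, hM0, hM⟩ := hdt.bounded T
  set V := H.vBound T with hV
  have hV0 : 0 ≤ V := H.velBound_nonneg T
  obtain ⟨N, hN⟩ := H.exists_step_taylor hh hφ1 T one_pos
  set L := (M + 1) * (1 + V) * D.mass ω0 with hL
  have hL0 : 0 ≤ L := by have := mass_nonneg (D := D) ω0; positivity
  refine ⟨L, N, fun n hn => ⟨(hN n hn).1, ?_⟩⟩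
  have hpos := (hh.small n).pos
  set b : ℕ → ℝ := fun j => ∫ x, φ x * D.scheme k n (h n) ω0 j x ∂D.area with hb
  have hstep : ∀ j : ℕ, h n * (j + 1) ≤ T → dist (b j) (b (j + 1)) ≤ h n * L := by
    intro j hj
    have h1 := (hN n hn).2 j hj
    have hjT : h n * j ≤ T := le_trans (by nlinarith) hj
    have hj0 : 0 ≤ h n * j := by positivity
    have hjn := hjT.trans (hN n hn).1
    have h2 := H.abs_integral_mul_le (H.admissible_scheme' hh hjn)
      (g := fun x => fderiv ℝ (uncurry fun _ : ℝ => φ) (h n * j, x)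
        (1, D.stepVel k n (D.scheme k n (h n) ω0 j) x)) (c := M * (1 + V)) fun x => by
      refine ((fderiv ℝ (uncurry fun _ : ℝ => φ) (h n * j, x)).le_opNorm _).trans ?_
      refine mul_le_mul (hM _ ⟨hj0, hjT⟩ x) ?_ (norm_nonneg _) hM0
      rw [Prod.norm_def, norm_one]
      exact max_le (by linarith) (by linarith [H.norm_stepVel_le hh hjn hjT x])
    rw [dist_comm, Real.dist_eq]
    have h3 := mul_le_mul_of_nonneg_left h2 hpos.le
    rw [← abs_of_pos hpos, ← abs_mul, abs_of_pos hpos] at h3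
    refine (le_of_eq_of_le (congrArg abs (sub_add_cancel _ (h n * _)).symm)
      ((abs_add_le _ _).trans (add_le_add h1 h3))).trans_eq ?_
    rw [hL]; ring
  have key : ∀ s ∈ Icc 0 T, ∀ t ∈ Icc 0 T, s ≤ t →
      dist (b ⌊s / h n⌋₊) (b ⌊t / h n⌋₊) ≤ L * (t - s + h n) := by
    intro s hs t ht hst
    have hle : ⌊s / h n⌋₊ ≤ ⌊t / h n⌋₊ := Nat.floor_mono (by gcongr)
    have ht' := hh.floor_le n ht.1
    have h1 := dist_le_Ico_sum_of_dist_le hle (d := fun _ => h n * L) (f := b) fun {j} _ hj => by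
      refine hstep j (le_trans ?_ (ht'.trans ht.2))
      exact mul_le_mul_of_nonneg_left (by exact_mod_cast hj) hpos.le
    refine h1.trans ?_
    rw [Finset.sum_const, Nat.card_Ico, nsmul_eq_mul, Nat.cast_sub hle, ← mul_assoc, mul_comm L]
    refine mul_le_mul_of_nonneg_right ?_ hL0
    have hs' : s < h n * (⌊s / h n⌋₊ + 1) := by
      have := Nat.lt_floor_add_one (s / h n)
      rwa [div_lt_iff₀' hpos] at this
    linarith
  intro s hs t ht
  rcases le_total s t with hst | hst
  · rw [abs_sub_comm, abs_of_nonneg (sub_nonneg.2 hst)]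
    exact key s hs t ht hst
  · rw [abs_sub_comm t s, abs_of_nonneg (sub_nonneg.2 hst)]
    exact key t ht s hs hst

lemma Setup.admissible_approx (hh : H.StepSeq h) (ht : 0 ≤ t) (htn : t ≤ n) :
    D.Admissible p ω0 (D.approx k ω0 h n t) :=
  H.admissible_scheme' hh ((hh.floor_le n ht).trans htn)

lemma Setup.ulNorm_approx_le (hh : H.StepSeq h) (hq : 2 < q) (hN : 0 ≤ N)
    (hqN : D.ulNorm q ω0 ≤ ofReal N) (hr : 1 ≤ r)
    (ht : t ∈ Icc 0 T) (htn : t ≤ n) : D.ulNorm r (D.approx k ω0 h n t) ≤ ofReal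
      (ulFactor C3 T (D.mass ω0) (velBound C1 C3 q T (D.mass ω0) N) r) * D.ulNorm r ω0 :=
  H.ulNorm_scheme_le_T hh hq hN hqN hr ((hh.floor_le n ht.1).trans htn)
    ((hh.floor_le n ht.1).trans ht.2)

lemma Setup.exists_wt_bound : ∃ W : ℝ, 0 ≤ W ∧ ∀ f, D.MemL1Ul p f →
    MemLp (fun x => wt x * f x) 2 D.area ∧ ‖D.vort f‖ ≤ W * (D.ulNorm p f).toReal := by
  obtain ⟨W, hW, h⟩ := exists_eLpNorm_wt_mul_le H.reg H.two_lt.le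
  refine ⟨W.toReal, toReal_nonneg, fun f hf => ?_⟩
  have h1 := h f hf.memL1.1
  have h2 : W * D.ulNorm p f < ∞ := mul_lt_top hW hf.ul_finite
  have hm : MemLp (fun x => wt x * f x) 2 D.area :=
    ⟨continuous_wt.aestronglyMeasurable.mul hf.memL1.1, h1.trans_lt h2⟩
  refine ⟨hm, ?_⟩
  rw [vort, norm_toH hm, ← ENNReal.toReal_mul]
  exact toReal_mono h2.ne h1

end

/-- `ω` is a limit of the scheme along the subsequence `σ`. -/
structure Setup.IsLimit (H : D.Setup k C1 C2 C3 p ω0) (h : ℕ → ℝ) (σ : ℕ → ℕ)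
    (ω : ℝ → Plane → ℝ) : Prop where
  steps : H.StepSeq h
  mono : StrictMono σ
  meas : Measurable (uncurry ω)
  descends : ∀ t, D.Descends (ω t)
  memLp : ∀ t, 0 ≤ t → MemLp (fun x => wt x * ω t x) 2 D.area
  conv : ∀ t0, 0 ≤ t0 → ∀ ψ : D.HSpace,
    Tendsto (fun z : ℕ × ℝ => inner ℝ ψ (D.vort (D.approx k ω0 h (σ z.1) z.2)))
      (atTop ×ˢ 𝓝[Ici 0] t0) (𝓝 (inner ℝ ψ (D.vort (ω t0))))

def eLpBall (D : FlowDomain) (r : ℝ≥0∞) (E : Set Plane) (K : ℝ≥0∞) : Set D.HSpace :=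
  {f | eLpNorm (fun x => (wt x)⁻¹ * f x) r (D.area.restrict E) ≤ K}

lemma eLpNorm_vort (hf : MemLp (fun x => wt x * f x) 2 D.area) (r : ℝ≥0∞)
    (E : Set Plane) : eLpNorm (fun x => (wt x)⁻¹ * D.vort f x) r (D.area.restrict E) =
      eLpNorm f r (D.area.restrict E) := by
  have e : (fun x => (wt x)⁻¹ * D.vort f x) =ᵐ[D.area] f := by
    filter_upwards [toH_coe hf] with x hx
    rw [vort, hx, inv_mul_cancel_left₀ (wt_pos x).ne']
  have e' : (fun x => (wt x)⁻¹ * D.vort f x) =ᵐ[D.area.restrict E] f := ae_restrict_of_ae e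
  exact eLpNorm_congr_ae e'

lemma vort_mem_eLpBall (hf : MemLp (fun x => wt x * f x) 2 D.area) (r : ℝ≥0∞)
    (E : Set Plane) (K : ℝ≥0∞) :
    D.vort f ∈ D.eLpBall r E K ↔ eLpNorm f r (D.area.restrict E) ≤ K := by
  rw [eLpBall, Set.mem_ofPred_eq, eLpNorm_vort hf]

instance neBot_nhdsWithin_Ici_zero (t : Ici (0 : ℝ)) : (𝓝[Ici 0] (t : ℝ)).NeBot :=
  mem_closure_iff_nhdsWithin_neBot.1 (subset_closure t.2)

lemma eventually_time (hσ : StrictMono σ) (t0 : ℝ) :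
    ∀ᶠ z : ℕ × ℝ in atTop ×ˢ 𝓝[Ici 0] t0, z.2 ∈ Icc 0 (t0 + 1) ∧ z.2 ≤ σ z.1 := by
  have h1 : ∀ᶠ t in 𝓝[Ici 0] t0, t ∈ Icc 0 (t0 + 1) := by
    filter_upwards [self_mem_nhdsWithin, nhdsWithin_le_nhds (Iio_mem_nhds (lt_add_one t0))]
      with t h1 h2
    exact ⟨h1, le_of_lt h2⟩
  filter_upwards [h1.prod_inr _, (eventually_ge_atTop ⌈t0 + 1⌉₊).prod_inl _] with z hz hn
  refine ⟨hz, hz.2.trans ((Nat.le_ceil _).trans ?_)⟩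
  exact_mod_cast hn.trans (hσ.id_le _)

lemma tendsto_prodMk_time (ht : 0 ≤ t) :
    Tendsto (fun n : ℕ => (n, t)) atTop (atTop ×ˢ 𝓝[Ici 0] t) :=
  tendsto_id.prodMk (tendsto_const_pure.mono_right (pure_le_nhdsWithin ht))

/-- Convergence along the product filter already contains local uniformity in time, so the limit is
continuous although the approximations jump at grid times. -/
lemma continuousWithinAt_of_tendsto_prod {α : Type*} [PseudoMetricSpace α] {f : ℕ → ℝ → α}
    {F : ℝ → α}
    (hf : ∀ t0, 0 ≤ t0 → Tendsto (fun z : ℕ × ℝ => f z.1 z.2) (atTop ×ˢ 𝓝[Ici 0] t0) (𝓝 (F t0)))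
    {t0 : ℝ} (ht0 : 0 ≤ t0) : ContinuousWithinAt F (Ici 0) t0 := by
  rw [ContinuousWithinAt, Metric.tendsto_nhds]
  intro ε hε
  have h1 := Metric.tendsto_nhds.1 (hf t0 ht0) (ε / 2) (by positivity)
  rw [prod_comm, eventually_map] at h1
  filter_upwards [h1.curry, self_mem_nhdsWithin] with t ht ht0
  have h2 : Tendsto (fun n => f n t) atTop (𝓝 (F t)) := (hf t ht0).comp (tendsto_prodMk_time ht0)
  have h3 := le_of_tendsto (h2.dist tendsto_const_nhds) (ht.mono fun n hn => hn.le)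
  linarith

lemma Setup.exists_limit (H : D.Setup k C1 C2 C3 p ω0) : ∃ h σ ω, H.IsLimit h σ ω := by
  classical
  obtain ⟨h, hh⟩ := H.exists_stepSeq
  obtain ⟨W, hW0, hW⟩ := H.exists_wt_bound
  -- The scheme with index `n` is controlled on `[0, n]` only. Setting the curve to zero afterwards
  -- is harmless, because every bounded time interval is eventually covered.
  set a : ℕ → ℝ → D.HSpace := fun n t => if t ≤ n then D.vort (D.approx k ω0 h n t) else 0 with ha
  have hb : ∀ T : ℝ, ∃ C, ∀ n, ∀ t ∈ Icc 0 T, ‖a n t‖ ≤ C := by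
    intro T
    set N := (D.ulNorm p ω0).toReal with hN
    set K := ofReal (ulFactor C3 T (D.mass ω0)
      (velBound C1 C3 p T (D.mass ω0) N) p) * D.ulNorm p ω0 with hK
    have hKt : K < ∞ := mul_lt_top ofReal_lt_top H.mem.ul_finite
    refine ⟨W * K.toReal, fun n t ht => ?_⟩
    by_cases htn : t ≤ n
    · simp only [ha, if_pos htn]
      refine (hW _ (H.admissible_approx hh ht.1 htn).mem).2.trans ?_
      refine mul_le_mul_of_nonneg_left (toReal_mono hKt.ne ?_) hW0
      exact H.ulNorm_approx_le hh H.two_lt toReal_nonneg H.ulNorm_le_ofReal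
        (by linarith [H.two_lt]) ht htn
    · simp only [ha, if_neg htn, norm_zero]; positivity
  have he : ∀ φ ∈ {b | ∃ φ, D.IsSpaceTest φ ∧ D.testVec φ = b}, ∀ T : ℝ, ∃ L, ∃ N : ℕ, ∀ n ≥ N,
      ∀ s ∈ Icc 0 T, ∀ t ∈ Icc 0 T,
      |inner ℝ φ (a n t) - inner ℝ φ (a n s)| ≤ L * (|t - s| + h n) := by
    rintro _ ⟨φ, hφ, rfl⟩ T
    obtain ⟨L, N, hN⟩ := H.equicontinuous hh hφ T
    refine ⟨L, N, fun n hn s hs t ht => ?_⟩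
    have hsn := hs.2.trans (hN n hn).1
    have htn := ht.2.trans (hN n hn).1
    simp only [ha, if_pos hsn, if_pos htn]
    rw [inner_testVec_vort (hφ.memLp H.reg) (hW _ (H.admissible_approx hh ht.1 htn).mem).1,
      inner_testVec_vort (hφ.memLp H.reg) (hW _ (H.admissible_approx hh hs.1 hsn).mem).1]
    exact (hN n hn).2 s hs t ht
  have : Fact ((1 : ℝ≥0∞) ≤ 2) := ⟨one_le_two⟩
  have : SecondCountableTopology D.HSpace := by
    have : Fact ((2 : ℝ≥0∞) ≠ ∞) := ⟨ofNat_ne_top⟩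
    exact Lp.SecondCountableTopology
  obtain ⟨σ, hσ, A, hA⟩ := exists_weak_limit_curve hb hh.tendsto (span_testVec_orthogonal H.reg) he
  -- Negative times are clamped to zero, which makes the curve weakly continuous on the whole line
  -- as the measurability lemma requires.
  have hAc : ∀ ψ : D.HSpace, Continuous fun t => inner ℝ ψ (A (max t 0)) := by
    intro ψ
    have h1 : ContinuousOn (fun t => inner ℝ ψ (A t)) (Ici 0) := fun t ht =>
      continuousWithinAt_of_tendsto_prod (f := fun n t => inner ℝ ψ (a (σ n) t))
        (fun t0 ht0 => hA t0 ht0 ψ) ht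
    exact h1.comp_continuous (continuous_id.max continuous_const) fun t => le_max_right t 0
  obtain ⟨ω, hωm, hωd, hωe⟩ := exists_measurable_representative H.reg hAc
  have hae : ∀ t, 0 ≤ t → (fun x => wt x * ω t x) =ᵐ[D.area] A t := by
    intro t ht
    filter_upwards [hωe t] with x hx
    rw [hx, max_eq_left ht, mul_inv_cancel_left₀ (wt_pos x).ne']
  have hL : ∀ t, 0 ≤ t → MemLp (fun x => wt x * ω t x) 2 D.area := fun t ht =>
    (memLp_congr_ae (hae t ht)).2 (Lp.memLp (A t))
  refine ⟨h, σ, ω, hh, hσ, hωm, hωd, hL, fun t0 ht0 ψ => ?_⟩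
  have hv : D.vort (ω t0) = A t0 := Lp.ext ((toH_coe (hL t0 ht0)).trans (hae t0 ht0))
  rw [hv]
  refine (hA t0 ht0 ψ).congr' ?_
  filter_upwards [eventually_time hσ t0] with z hz
  simp only [ha, if_pos hz.2]

section Limit

variable {H : D.Setup k C1 C2 C3 p ω0} {ω : ℝ → Plane → ℝ}
  (hL : H.IsLimit h σ ω)
include hL

lemma Setup.IsLimit.memLp_approx (ht : 0 ≤ t) (htn : t ≤ n) :
    MemLp (fun x => wt x * D.approx k ω0 h n t x) 2 D.area := by
  obtain ⟨W, -, hW⟩ := H.exists_wt_bound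
  exact (hW _ (H.admissible_approx hL.steps ht htn).mem).1

lemma Setup.IsLimit.eventually_le (_ht : 0 ≤ t) : ∀ᶠ n in atTop, t ≤ σ n := by
  filter_upwards [eventually_ge_atTop ⌈t⌉₊] with n hn
  exact (Nat.le_ceil t).trans (by exact_mod_cast hn.trans (hL.mono.id_le n))

lemma Setup.IsLimit.tendsto_integral {t0 : ℝ} (ht0 : 0 ≤ t0) (hψ : D.BoundedTest ψ) :
    Tendsto (fun z : ℕ × ℝ => ∫ x, ψ x * D.approx k ω0 h (σ z.1) z.2 x ∂D.area)
      (atTop ×ˢ 𝓝[Ici 0] t0) (𝓝 (∫ x, ψ x * ω t0 x ∂D.area)) := by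
  have := hL.conv t0 ht0 (D.testVec ψ)
  rw [inner_testVec_vort (hψ.memLp H.reg) (hL.memLp t0 ht0)] at this
  refine this.congr' ?_
  filter_upwards [eventually_time hL.mono t0] with z hz
  exact inner_testVec_vort (hψ.memLp H.reg) (hL.memLp_approx hz.1.1 hz.2)

lemma Setup.IsLimit.eLpNorm_le (ht : 0 ≤ t) {r : ℝ≥0∞} (hr : 1 ≤ r) {E : Set Plane}
    {K : ℝ≥0∞} (hK : ∀ᶠ n in atTop, eLpNorm (D.approx k ω0 h (σ n) t) r (D.area.restrict E) ≤ K) :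
    eLpNorm (ω t) r (D.area.restrict E) ≤ K := by
  have hconv : ∀ ψ : D.HSpace, Tendsto (fun n => inner ℝ ψ (D.vort (D.approx k ω0 h (σ n) t)))
      atTop (𝓝 (inner ℝ ψ (D.vort (ω t)))) := fun ψ => by
    have h1 := tendsto_prodMk_time ht
    have h2 := hL.conv t ht ψ
    have h3 := h2.comp h1
    exact h3
  have hmem : ∀ᶠ n in atTop, D.vort (D.approx k ω0 h (σ n) t) ∈ D.eLpBall r E K :=
    (hK.and (hL.eventually_le ht)).mono fun n hn =>
      (vort_mem_eLpBall (hL.memLp_approx ht hn.2) r E K).2 hn.1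
  exact (vort_mem_eLpBall (hL.memLp t ht) r E K).1
    (mem_of_weak_limit (C := D.eLpBall r E K) (convex_eLpNorm_le r hr E K)
      (isClosed_eLpNorm_le r E K) hmem hconv)

lemma Setup.IsLimit.mass_le (ht : 0 ≤ t) : eLpNorm (ω t) 1 D.area ≤ eLpNorm ω0 1 D.area := by
  have := hL.eLpNorm_le ht le_rfl (E := univ) (K := eLpNorm ω0 1 D.area) (by
    filter_upwards [hL.eventually_le ht] with n hn
    rw [Measure.restrict_univ]
    exact (H.admissible_approx hL.steps ht hn).mass)
  rwa [Measure.restrict_univ] at this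

lemma Setup.IsLimit.ulNorm_le (hq : 2 < q) (hN : 0 ≤ N)
    (hqN : D.ulNorm q ω0 ≤ ofReal N) (hr : 1 ≤ r) (ht : t ∈ Icc 0 T) : D.ulNorm r (ω t) ≤ ofReal
      (ulFactor C3 T (D.mass ω0) (velBound C1 C3 q T (D.mass ω0) N) r) * D.ulNorm r ω0 := by
  refine iSup₂_le fun x hx => hL.eLpNorm_le ht.1 (ENNReal.one_le_ofReal.2 hr) ?_
  filter_upwards [hL.eventually_le ht.1] with n hn
  exact (le_iSup₂ (f := fun x _ => eLpNorm (D.approx k ω0 h (σ n) t) (ofReal r)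
    (D.area.restrict {z | D.gdist x z < 1})) x hx).trans
    (H.ulNorm_approx_le hL.steps hq hN hqN hr ht hn)

lemma Setup.IsLimit.memL1Ul (ht : 0 ≤ t) : D.MemL1Ul p (ω t) := by
  refine ⟨hL.descends t, ⟨(hL.meas.comp measurable_prodMk_left).aestronglyMeasurable,
    (hL.mass_le ht).trans_lt H.mem.memL1.2⟩, ?_⟩
  exact (hL.ulNorm_le H.two_lt toReal_nonneg H.ulNorm_le_ofReal
    (by linarith [H.two_lt]) ⟨ht, le_rfl⟩).trans_lt (mul_lt_top ofReal_lt_top H.mem.ul_finite)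

end Limit

def ulBound (C1 C3 p T N1 N : ℝ) : ℝ := ulFactor C3 T N1 (velBound C1 C3 p T N1 N) p * N

lemma ulFactor_nonneg {T V r : ℝ} : 0 ≤ ulFactor C3 T p V r :=
  mul_nonneg (exp_nonneg _) (rpow_nonneg (sq_nonneg _) _)

lemma ulBound_nonneg (hN : 0 ≤ N) : 0 ≤ ulBound C1 C3 p T N1 N := mul_nonneg ulFactor_nonneg hN

section

variable (H : D.Setup k C1 C2 C3 p ω0)
include H

lemma Setup.ulNorm_approx_le_ulBound (hh : H.StepSeq h)
    (ht : t ∈ Icc 0 T) (htn : t ≤ n) : D.ulNorm p (D.approx k ω0 h n t) ≤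
      ofReal (ulBound C1 C3 p T (D.mass ω0) (D.ulNorm p ω0).toReal) := by
  refine (H.ulNorm_approx_le hh H.two_lt toReal_nonneg H.ulNorm_le_ofReal
    (by linarith [H.two_lt]) ht htn).trans ?_
  rw [ulBound, ofReal_mul ulFactor_nonneg]
  exact mul_le_mul_right H.ulNorm_le_ofReal _

lemma Setup.velocity_approx_le (hh : H.StepSeq h) (hq : 2 < q) (hN : 0 ≤ N)
    (hqN : D.ulNorm q ω0 ≤ ofReal N) (ht : t ∈ Icc 0 T) (htn : t ≤ n) :
    ∀ x ∈ D.pts, ‖D.velocity k (D.approx k ω0 h n t) x‖ ≤ velBound C1 C3 q T (D.mass ω0) N :=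
  H.velocity_scheme_le_T hh hq hN hqN ((hh.floor_le n ht.1).trans htn)
    ((hh.floor_le n ht.1).trans ht.2)

end

section Limit

variable {H : D.Setup k C1 C2 C3 p ω0} {ω : ℝ → Plane → ℝ}
  (hL : H.IsLimit h σ ω)
include hL

lemma Setup.IsLimit.ulNorm_le_ulBound (ht : t ∈ Icc 0 T) : D.ulNorm p (ω t) ≤
    ofReal (ulBound C1 C3 p T (D.mass ω0) (D.ulNorm p ω0).toReal) := by
  refine (hL.ulNorm_le H.two_lt toReal_nonneg H.ulNorm_le_ofReal
    (by linarith [H.two_lt]) ht).trans ?_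
  rw [ulBound, ofReal_mul ulFactor_nonneg]
  exact mul_le_mul_right H.ulNorm_le_ofReal _

lemma Setup.IsLimit.tendsto_velocity {t0 : ℝ} (ht0 : 0 ≤ t0) (hx : x ∈ D.pts) :
    Tendsto (fun z : ℕ × ℝ => D.velocity k (D.approx k ω0 h (σ z.1) z.2) x)
      (atTop ×ˢ 𝓝[Ici 0] t0) (𝓝 (D.velocity k (ω t0) x)) := by
  refine FlowDomain.tendsto_velocity H.kernel H.reg H.C1_pos.le H.two_lt toReal_nonneg
    (ulBound_nonneg (C1 := C1) (C3 := C3) (p := p) (T := t0 + 1) (N1 := D.mass ω0)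
      (N := (D.ulNorm p ω0).toReal) toReal_nonneg)
    ?_ ⟨hL.memL1Ul ht0, (hL.mass_le ht0).trans_eq H.eLpNorm_eq, hL.ulNorm_le_ulBound
      ⟨ht0, by linarith⟩⟩ (fun ψ hψ => hL.tendsto_integral ht0 hψ) hx
  filter_upwards [eventually_time hL.mono t0] with z hz
  have ha := H.admissible_approx hL.steps hz.1.1 hz.2
  exact ⟨ha.mem, ha.mass.trans_eq H.eLpNorm_eq, H.ulNorm_approx_le_ulBound hL.steps hz.1 hz.2⟩

lemma Setup.IsLimit.velocity_le (hq : 2 < q) (hN : 0 ≤ N)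
    (hqN : D.ulNorm q ω0 ≤ ofReal N) (ht : t ∈ Icc 0 T) (hx : x ∈ D.pts) :
    ‖D.velocity k (ω t) x‖ ≤ velBound C1 C3 q T (D.mass ω0) N := by
  refine le_of_tendsto ((hL.tendsto_velocity ht.1 hx).comp (tendsto_prodMk_time ht.1)).norm ?_
  filter_upwards [hL.eventually_le ht.1] with n hn
  exact H.velocity_approx_le hL.steps hq hN hqN ht hn x hx

end Limit

end FlowDomain

/-! ### The weak form in the limit. -/

lemma integral_step_fun {E : Type*} [NormedAddCommGroup E] [NormedSpace ℝ E] [CompleteSpace E]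
    {h : ℝ} (hh : 0 < h) (G : ℕ → E) (J : ℕ) :
    IntervalIntegrable (fun t => G ⌊t / h⌋₊) volume 0 (h * J) ∧
      ∫ t in (0 : ℝ)..h * J, G ⌊t / h⌋₊ = ∑ j ∈ Finset.range J, h • G j := by
  have hae : ∀ j : ℕ, ∀ᵐ t, t ∈ uIoc (h * j) (h * (j + 1 : ℕ)) → G ⌊t / h⌋₊ = G j := by
    intro j
    filter_upwards [(measure_eq_zero_iff_ae_notMem.1 (measure_singleton (h * ((j + 1 : ℕ) : ℝ))) :
      ∀ᵐ t : ℝ, t ∉ ({h * ((j + 1 : ℕ) : ℝ)} : Set ℝ))] with t ht hmem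
    rw [uIoc_of_le (by push_cast; nlinarith)] at hmem
    have h2 : t < h * (j + 1 : ℕ) := lt_of_le_of_ne hmem.2 ht
    congr 1
    rw [Nat.floor_eq_iff (div_nonneg (le_trans (by positivity) hmem.1.le) hh.le)]
    constructor
    · rw [le_div_iff₀' hh]; exact hmem.1.le
    · rw [div_lt_iff₀' hh]; exact_mod_cast h2
  have hint : ∀ j < J, IntervalIntegrable (fun t => G ⌊t / h⌋₊) volume (h * j)
      (h * (j + 1 : ℕ)) := by
    intro j _
    refine (intervalIntegrable_const (c := G j)).congr_ae ?_
    exact (ae_restrict_iff' measurableSet_uIoc).2 ((hae j).mono fun t ht hm => (ht hm).symm)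
  constructor
  · have := IntervalIntegrable.trans_iterate (a := fun j : ℕ => h * j) hint
    simpa using this
  · have := intervalIntegral.sum_integral_adjacent_intervals (a := fun j : ℕ => h * j) hint
    simp only [Nat.cast_zero, mul_zero] at this
    rw [← this]
    refine Finset.sum_congr rfl fun j _ => ?_
    rw [intervalIntegral.integral_congr_ae (hae j), intervalIntegral.integral_const]
    congr 1
    push_cast
    ring

namespace FlowDomain

lemma TestLike.boundedTest {g : ℝ → Plane → ℝ} (hg : D.TestLike g) (ht : 0 ≤ t) :
    D.BoundedTest (g t) := by
  obtain ⟨M, -, hM⟩ := hg.bounded t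
  obtain ⟨R, hR⟩ := hg.exists_radius
  exact ⟨(hg.continuous t).aestronglyMeasurable, ⟨M, hM t ⟨ht, le_rfl⟩⟩, R, hR t⟩

lemma norm_testVec_sq (hψ : MemLp (fun x => (wt x)⁻¹ * ψ x) 2 D.area) :
    ‖D.testVec ψ‖ ^ 2 = ∫ x, ((wt x)⁻¹ * ψ x) ^ 2 ∂D.area := by
  rw [← real_inner_self_eq_norm_sq, inner_testVec hψ]
  refine integral_congr_ae ?_
  filter_upwards [toH_coe hψ] with x hx
  rw [testVec, hx]
  ring

/-- Common bounds and a common bounded support give a dominating function, even with the inverse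
weight. Norm convergence of the test vectors is what a merely weak limit of vorticities needs on the
other side of the pairing. -/
lemma tendsto_testVec_zero (hD : D.IsRegular) {ψ : ℕ → Plane → ℝ}
    (hm : ∀ n, AEStronglyMeasurable (ψ n) D.area) (hM : ∀ n x, |ψ n x| ≤ M)
    (hR : ∀ n, ∀ x ∈ D.cell, R < ‖x‖ → ψ n x = 0)
    (hlim : ∀ x ∈ D.pts, Tendsto (fun n => ψ n x) atTop (𝓝 0)) :
    Tendsto (fun n => ‖D.testVec (ψ n)‖) atTop (𝓝 0) := by
  have hL : ∀ n, MemLp (fun x => (wt x)⁻¹ * ψ n x) 2 D.area := fun n =>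
    memLp_testVec (hm n) (hM n) (hR n) hD
  have hsq : Tendsto (fun n => ‖D.testVec (ψ n)‖ ^ 2) atTop (𝓝 0) := by
    simp only [norm_testVec_sq (hL _)]
    rw [← integral_zero Plane ℝ (μ := D.area)]
    refine tendsto_integral_of_dominated_convergence
      ((closedBall (0 : Plane) R).indicator fun _ => (exp R * M) ^ 2)
      (fun n => ((hL n).1.pow 2)) ?_ (fun n => ?_) ?_
    · refine (integrable_indicator_iff measurableSet_closedBall).2 (integrableOn_const ?_)
      exact ((Measure.restrict_apply_le _ _).trans_lt measure_closedBall_lt_top).ne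
    · filter_upwards [ae_area_mem_cell hD] with x hx
      by_cases hxR : x ∈ closedBall (0 : Plane) R
      · rw [indicator_of_mem hxR, norm_of_nonneg (sq_nonneg _), ← sq_abs]
        rw [mem_closedBall_zero_iff] at hxR
        gcongr
        rw [abs_mul, abs_of_pos (inv_pos.2 (wt_pos x)), wt, ← exp_neg, neg_neg]
        exact mul_le_mul (exp_le_exp.2 hxR) (hM n x) (abs_nonneg _) (exp_nonneg _)
      · rw [indicator_of_notMem hxR, hR n x hx (by simpa using hxR)]
        simp
    · filter_upwards [ae_area_mem_pts hD] with x hx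
      simpa using ((hlim x hx).const_mul (wt x)⁻¹).pow 2
  have := hsq.sqrt
  simpa [Real.sqrt_sq (norm_nonneg _)] using this

def holdBound (C1 C2 C3 p T N1 N : ℝ) : ℝ :=
  2 * (2 * C1 + C2) * (holderConst p * ulBound C1 C3 p T N1 N + N1)

abbrev Setup.hBound (_ : D.Setup k C1 C2 C3 p ω0) (T : ℝ) : ℝ :=
  holdBound C1 C2 C3 p T (D.mass ω0) (D.ulNorm p ω0).toReal

section Limit

variable {H : D.Setup k C1 C2 C3 p ω0} {ω : ℝ → Plane → ℝ}

lemma Setup.holder_pos (H : D.Setup k C1 C2 C3 p ω0) : 0 < 1 - 2 / p := by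
  have h2 := H.two_lt
  have : 2 / p < 1 := by rw [div_lt_one] <;> linarith
  linarith

lemma Setup.holdBound_nonneg (H : D.Setup k C1 C2 C3 p ω0) (T : ℝ) : 0 ≤ H.hBound T := by
  have h1 := H.C1_pos
  have h2 := H.C2_pos
  have h3 := holderConst_nonneg H.two_lt
  have h4 := mass_nonneg (D := D) ω0
  have h5 := ulBound_nonneg (C1 := C1) (C3 := C3) (p := p) (T := T) (N1 := D.mass ω0)
    (N := (D.ulNorm p ω0).toReal) toReal_nonneg
  unfold Setup.hBound holdBound
  positivity

lemma Setup.velocity_approx_holder (H : D.Setup k C1 C2 C3 p ω0) (hh : H.StepSeq h)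
    (ht : t ∈ Icc 0 T) (htn : t ≤ n) (hx : x ∈ D.pts)
    (hy : y ∈ D.pts) : ‖D.velocity k (D.approx k ω0 h n t) x - D.velocity k (D.approx k ω0 h n t) y‖
      ≤ H.hBound T * D.gdist x y ^ (1 - 2 / p) := by
  have ha := H.admissible_approx hh ht.1 htn
  exact norm_velocity_sub_le_holder H.kernel H.reg H.C1_pos.le H.C2_pos.le H.two_lt ha.mem
    (mass_nonneg _) (ulBound_nonneg toReal_nonneg) (ha.mass.trans_eq H.eLpNorm_eq)
    (H.ulNorm_approx_le_ulBound hh ht htn) hx hy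

variable (hL : H.IsLimit h σ ω)
include hL

lemma Setup.IsLimit.velocity_holder (ht : t ∈ Icc 0 T) (hx : x ∈ D.pts)
    (hy : y ∈ D.pts) : ‖D.velocity k (ω t) x - D.velocity k (ω t) y‖
      ≤ H.hBound T * D.gdist x y ^ (1 - 2 / p) :=
  norm_velocity_sub_le_holder H.kernel H.reg H.C1_pos.le H.C2_pos.le H.two_lt (hL.memL1Ul ht.1)
    (mass_nonneg _) (ulBound_nonneg toReal_nonneg)
    ((hL.mass_le ht.1).trans_eq H.eLpNorm_eq) (hL.ulNorm_le_ulBound ht) hx hy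

/-- At a fixed point continuity in time comes from convergence along the product filter; the Hölder
bound in space, uniform on bounded time intervals, upgrades this to joint continuity. -/
lemma Setup.IsLimit.continuousOn_velocity :
    ContinuousOn (fun z : ℝ × Plane => D.velocity k (ω z.1) z.2) (Ici 0 ×ˢ D.pts) := by
  rintro ⟨t0, x0⟩ ⟨ht0, hx0⟩
  have ht0' : 0 ≤ t0 := ht0
  have hα := H.holder_pos
  have h1 : ContinuousWithinAt (fun t => D.velocity k (ω t) x0) (Ici 0) t0 :=
    continuousWithinAt_of_tendsto_prod (f := fun n t => D.velocity k (D.approx k ω0 h (σ n) t) x0)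
      (fun t ht => hL.tendsto_velocity ht hx0) ht0
  set c := H.hBound (t0 + 1) with hc
  have hc0 : 0 ≤ c := H.holdBound_nonneg _
  have hfst : Tendsto (fun z : ℝ × Plane => z.1) (𝓝[Ici 0 ×ˢ D.pts] (t0, x0)) (𝓝[Ici 0] t0) :=
    tendsto_nhdsWithin_iff.2 ⟨(continuous_fst.tendsto _).mono_left nhdsWithin_le_nhds,
      eventually_mem_nhdsWithin.mono fun z hz => hz.1⟩
  have hsnd : Tendsto (fun z : ℝ × Plane => D.gdist z.2 x0 ^ (1 - 2 / p))
      (𝓝[Ici 0 ×ˢ D.pts] (t0, x0)) (𝓝 0) := by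
    have h2 : Tendsto (fun z : ℝ × Plane => D.gdist x0 z.2) (𝓝 (t0, x0)) (𝓝 (D.gdist x0 x0)) :=
      ((continuous_gdist x0).comp continuous_snd).tendsto _
    rw [gdist_self] at h2
    have h3 := (h2.mono_left (nhdsWithin_le_nhds (s := Ici (0 : ℝ) ×ˢ D.pts))).rpow_const
      (p := 1 - 2 / p) (Or.inr hα.le)
    rw [zero_rpow hα.ne'] at h3
    simpa only [gdist_comm] using h3
  have hsum : Tendsto (fun z : ℝ × Plane => c * D.gdist z.2 x0 ^ (1 - 2 / p) +
      dist (D.velocity k (ω z.1) x0) (D.velocity k (ω t0) x0)) (𝓝[Ici 0 ×ˢ D.pts] (t0, x0))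
      (𝓝 0) := by
    have := (hsnd.const_mul c).add (tendsto_iff_dist_tendsto_zero.1 (h1.tendsto.comp hfst))
    simpa using this
  rw [ContinuousWithinAt, tendsto_iff_dist_tendsto_zero]
  refine squeeze_zero' (.of_forall fun _ => dist_nonneg) ?_ hsum
  filter_upwards [self_mem_nhdsWithin, nhdsWithin_le_nhds
    ((continuous_fst.tendsto (t0, x0)).eventually (Iio_mem_nhds (lt_add_one t0)))] with z hz hz1
  have := hL.velocity_holder (T := t0 + 1) ⟨hz.1, le_of_lt hz1⟩ hz.2 hx0
  rw [← dist_eq_norm] at this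
  exact (dist_triangle _ (D.velocity k (ω z.1) x0) _).trans (add_le_add_left this _)

/-- The mollification error at scale `1/(σ n + 1)` is controlled by the Hölder bound of the
approximate velocity itself, and this bound does not depend on `n`. -/
lemma Setup.IsLimit.tendsto_stepVel (ht : 0 ≤ t) (hx : x ∈ D.pts) :
    Tendsto (fun n => D.stepVel k (σ n) (D.approx k ω0 h (σ n) t) x) atTop
      (𝓝 (D.velocity k (ω t) x)) := by
  have hα := H.holder_pos
  have h1 := (hL.tendsto_velocity ht hx).comp (tendsto_prodMk_time ht)
  set c := H.hBound t with hc
  have hc0 : 0 ≤ c := H.holdBound_nonneg _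
  have hr : Tendsto (fun n => 1 / ((σ n : ℝ) + 1)) atTop (𝓝 0) :=
    tendsto_one_div_add_atTop_nhds_zero_nat.comp hL.mono.tendsto_atTop
  have h2 : Tendsto (fun n => c * (1 / ((σ n : ℝ) + 1)) ^ (1 - 2 / p)) atTop (𝓝 0) := by
    have := (hr.rpow_const (p := 1 - 2 / p) (Or.inr hα.le)).const_mul c
    rwa [zero_rpow hα.ne', mul_zero] at this
  obtain ⟨δ, hδ, hball⟩ := Metric.nhds_basis_closedBall.mem_iff.1 ((isOpen_pts H.reg).mem_nhds hx)
  refine h1.congr_dist (squeeze_zero' (.of_forall fun _ => dist_nonneg) ?_ h2)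
  filter_upwards [hL.eventually_le ht, hr.eventually (Iic_mem_nhds hδ)] with n hn hnδ
  have hsub : closedBall x (1 / ((σ n : ℝ) + 1)) ⊆ D.pts :=
    (Metric.closedBall_subset_closedBall hnδ).trans hball
  have ha := H.admissible_approx hL.steps ht hn
  rw [dist_comm, dist_eq_norm]
  refine norm_mollify_sub_le (σ n) (isOpen_pts H.reg) (FlowDomain.continuousOn_velocity H.kernel
    H.reg H.C1_pos.le H.C2_pos.le H.two_lt ha.mem) hsub fun z hz => ?_
  refine (H.velocity_approx_holder hL.steps ⟨ht, le_rfl⟩ hn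
    (hsub (Metric.ball_subset_closedBall hz)) hx).trans ?_
  refine mul_le_mul_of_nonneg_left (rpow_le_rpow (gdist_nonneg _ _) ?_ hα.le) hc0
  exact (gdist_le_dist _ _).trans (mem_ball.1 hz).le

end Limit

section Limit

variable {H : D.Setup k C1 C2 C3 p ω0} {ω : ℝ → Plane → ℝ}

variable (D k) in
/-- The time integrand of the discrete weak form. -/
def discreteRate (ω0 : Plane → ℝ) (h : ℕ → ℝ) (φ : ℝ → Plane → ℝ) (n j : ℕ) : ℝ :=
  ∫ x, fderiv ℝ (uncurry φ) (h n * j, x) (1, D.stepVel k n (D.scheme k n (h n) ω0 j) x) *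
    D.scheme k n (h n) ω0 j x ∂D.area

lemma Setup.exists_abs_fderiv_le (H : D.Setup k C1 C2 C3 p ω0) (hh : H.StepSeq h)
    {φ : ℝ → Plane → ℝ} (hφ : D.IsTest 1 φ) (T : ℝ) : ∃ M, 0 ≤ M ∧ ∀ n : ℕ, T ≤ n →
      ∀ j : ℕ, h n * j ≤ T → ∀ x, |fderiv ℝ (uncurry φ) (h n * j, x)
        (1, D.stepVel k n (D.scheme k n (h n) ω0 j) x)| ≤ M := by
  obtain ⟨M, hM0, hM⟩ := (hφ.testLike_fderiv le_rfl).bounded T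
  set V := H.vBound T with hV
  have hV0 : 0 ≤ V := H.velBound_nonneg T
  refine ⟨M * (1 + V), by positivity, fun n hn j hj x => ?_⟩
  have hj0 : 0 ≤ h n * j := mul_nonneg (hh.small n).pos.le (Nat.cast_nonneg j)
  refine ((fderiv ℝ (uncurry φ) (h n * j, x)).le_opNorm _).trans ?_
  refine mul_le_mul (hM _ ⟨hj0, hj⟩ x) ?_ (norm_nonneg _) hM0
  rw [Prod.norm_def, norm_one]
  exact max_le (by linarith) (by linarith [H.norm_stepVel_le hh (hj.trans hn) hj x])

/-- The one-step identities telescope. Their errors add up to at most `T` times the single-step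
rate, which uses half of `ε`; the other half pays for the last incomplete step, whose length is
below `h n`. -/
lemma Setup.sum_step_taylor (H : D.Setup k C1 C2 C3 p ω0) (hh : H.StepSeq h)
    {φ : ℝ → Plane → ℝ} (hφ : D.IsTest 1 φ) (hT : 0 < T) (hε : 0 < ε) : ∃ N : ℕ, ∀ n ≥ N, T ≤ n ∧
      |∫ x, φ (h n * (⌊T / h n⌋₊ : ℝ)) x * D.approx k ω0 h n T x ∂D.area -
        ∫ x, φ 0 x * ω0 x ∂D.area - ∫ t in Icc 0 T, D.discreteRate k ω0 h φ n ⌊t / h n⌋₊| ≤ ε := by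
  obtain ⟨M, hM0, hM⟩ := H.exists_abs_fderiv_le hh hφ T
  set c := (1 + H.vBound T) * D.mass ω0 with hc
  have hm := mass_nonneg (D := D) ω0
  have hc0 : 0 ≤ c := by have := H.velBound_nonneg T; positivity
  set ε' := ε / (2 * (T * c + 1)) with hε'
  have hε'0 : 0 < ε' := by positivity
  obtain ⟨N, hN⟩ := H.exists_step_taylor hh hφ T hε'0
  obtain ⟨N', hN'⟩ := (Metric.tendsto_atTop.1 hh.tendsto) (ε / (2 * (M * D.mass ω0 + 1)))
    (by positivity)
  refine ⟨max N N', fun n hn => ⟨(hN n ((le_max_left _ _).trans hn)).1, ?_⟩⟩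
  obtain ⟨hTn, hstep⟩ := hN n ((le_max_left _ _).trans hn)
  have hpos := (hh.small n).pos
  have hsmall := hN' n ((le_max_right _ _).trans hn)
  rw [Real.dist_eq, sub_zero, abs_of_pos hpos, lt_div_iff₀ (by positivity)] at hsmall
  set J := ⌊T / h n⌋₊ with hJ
  have hJT : h n * J ≤ T := hh.floor_le n hT.le
  have hTJ : T < h n * (J + 1) := by
    have := Nat.lt_floor_add_one (T / h n)
    rwa [div_lt_iff₀' hpos] at this
  have hJ0 : 0 ≤ h n * J := by positivity
  set G := D.discreteRate k ω0 h φ n with hG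
  have hGb : ∀ j : ℕ, h n * j ≤ T → |G j| ≤ M * D.mass ω0 := fun j hj =>
    H.abs_integral_mul_le (H.admissible_scheme' hh (hj.trans hTn)) (hM n hTn j hj)
  set b : ℕ → ℝ := fun j => ∫ x, φ (h n * j) x * D.scheme k n (h n) ω0 j x ∂D.area with hb
  have hind : ∀ i : ℕ, i ≤ J → |b i - b 0 - ∑ j ∈ Finset.range i, h n * G j| ≤
      h n * i * (ε' * c) := by
    intro i
    induction i with
    | zero => intro _; simp
    | succ i ih =>
      intro hi
      have h1 := ih (Nat.le_of_succ_le hi)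
      have hiT : h n * ((i : ℝ) + 1) ≤ T := le_trans
        (mul_le_mul_of_nonneg_left (by exact_mod_cast hi) hpos.le) hJT
      have h2 : |b (i + 1) - b i - h n * G i| ≤ h n * (ε' * c) := by
        have := hstep i hiT
        simp only [hb, hG, discreteRate, hc]
        push_cast
        rwa [← mul_assoc ε']
      rw [Finset.sum_range_succ, show b (i + 1) - b 0 -
        (∑ j ∈ Finset.range i, h n * G j + h n * G i)
        = (b i - b 0 - ∑ j ∈ Finset.range i, h n * G j) + (b (i + 1) - b i - h n * G i) by ring]
      refine (abs_add_le _ _).trans ((add_le_add h1 h2).trans_eq ?_)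
      push_cast; ring
  have hmain := hind J le_rfl
  obtain ⟨hi1, hi2⟩ := integral_step_fun hpos G J
  obtain ⟨hi3, -⟩ := integral_step_fun hpos G (J + 1)
  have hi4 : IntervalIntegrable (fun t => G ⌊t / h n⌋₊) volume (h n * J) T := by
    refine hi3.mono_set ?_
    rw [uIcc_of_le hJT, uIcc_of_le (by positivity)]
    exact Icc_subset_Icc hJ0 (by push_cast; exact hTJ.le)
  have hrem : |∫ t in (h n * J)..T, G ⌊t / h n⌋₊| ≤ M * D.mass ω0 * h n := by
    have := intervalIntegral.norm_integral_le_of_norm_le_const (a := h n * J) (b := T)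
      (f := fun t => G ⌊t / h n⌋₊) (C := M * D.mass ω0) fun t ht => by
        rw [uIoc_of_le hJT] at ht
        exact hGb _ ((hh.floor_le n (hJ0.trans ht.1.le)).trans ht.2)
    rw [norm_eq_abs] at this
    refine this.trans (mul_le_mul_of_nonneg_left ?_ (by positivity))
    rw [abs_of_nonneg (by linarith)]
    linarith
  rw [integral_Icc_eq_integral_Ioc, ← intervalIntegral.integral_of_le hT.le,
    ← intervalIntegral.integral_add_adjacent_intervals hi1 hi4, hi2]
  have hb0 : b 0 = ∫ x, φ 0 x * ω0 x ∂D.area := by simp [hb, scheme]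
  rw [← hb0, ← sub_sub]
  refine (abs_sub _ _).trans ((add_le_add hmain hrem).trans ?_)
  have e1 : h n * J * (ε' * c) ≤ ε / 2 := by
    calc h n * J * (ε' * c) ≤ T * (ε' * c) := by gcongr
      _ ≤ ε' * (T * c + 1) := by nlinarith
      _ = ε / 2 := by rw [hε']; field_simp
  nlinarith [mul_nonneg hM0 hm]

variable (hL : H.IsLimit h σ ω)
include hL

/-- Weak convergence of the vorticities tested against pointwise converging functions. -/
lemma Setup.IsLimit.tendsto_integral_of_tendsto (ht : 0 ≤ t) {ψ : ℕ → Plane → ℝ}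
    {ψ0 : Plane → ℝ} (hm : ∀ᶠ n in atTop, AEStronglyMeasurable (ψ n) D.area)
    (hM : ∀ᶠ n in atTop, ∀ x, |ψ n x| ≤ M)
    (hR : ∀ n, ∀ x ∈ D.cell, R < ‖x‖ → ψ n x = 0) (hψ0 : AEStronglyMeasurable ψ0 D.area)
    (hMψ : ∀ x, |ψ0 x| ≤ M) (hRψ : ∀ x ∈ D.cell, R < ‖x‖ → ψ0 x = 0)
    (hlim : ∀ x ∈ D.pts, Tendsto (fun n => ψ n x) atTop (𝓝 (ψ0 x))) :
    Tendsto (fun n => ∫ x, ψ n x * D.approx k ω0 h (σ n) t x ∂D.area) atTop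
      (𝓝 (∫ x, ψ0 x * ω t x ∂D.area)) := by
  classical
  obtain ⟨W, hW0, hW⟩ := H.exists_wt_bound
  set K := ulBound C1 C3 p t (D.mass ω0) (D.ulNorm p ω0).toReal with hK
  have hK0 : 0 ≤ K := ulBound_nonneg toReal_nonneg
  have hM0 : 0 ≤ M := (abs_nonneg _).trans (hMψ 0)
  have hψB : D.BoundedTest ψ0 := ⟨hψ0, ⟨M, hMψ⟩, R, hRψ⟩
  have h1 := (hL.tendsto_integral ht hψB).comp (tendsto_prodMk_time ht)
  obtain ⟨N, hN⟩ := eventually_atTop.1 (hm.and hM)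
  set d : ℕ → Plane → ℝ := fun n x => if N ≤ n then ψ n x - ψ0 x else 0 with hd
  have hdm : ∀ n, AEStronglyMeasurable (d n) D.area := fun n => by
    by_cases hn : N ≤ n
    · simp only [hd, if_pos hn]; exact (hN n hn).1.sub hψ0
    · simp only [hd, if_neg hn]; exact aestronglyMeasurable_const
  have hdM : ∀ n x, |d n x| ≤ M + M := fun n x => by
    by_cases hn : N ≤ n
    · simp only [hd, if_pos hn]
      exact (abs_sub _ _).trans (add_le_add ((hN n hn).2 x) (hMψ x))
    · simp only [hd, if_neg hn, abs_zero]; positivity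
  have hdR : ∀ n, ∀ x ∈ D.cell, R < ‖x‖ → d n x = 0 := fun n x hx hxR => by
    simp only [hd, hR n x hx hxR, hRψ x hx hxR, sub_zero, ite_self]
  have hd0 : ∀ x ∈ D.pts, Tendsto (fun n => d n x) atTop (𝓝 0) := fun x hx => by
    have := (hlim x hx).sub_const (ψ0 x)
    rw [sub_self] at this
    refine this.congr' ?_
    filter_upwards [eventually_ge_atTop N] with n hn
    simp only [hd, if_pos hn]
  have h2 := tendsto_testVec_zero H.reg hdm hdM hdR hd0
  have h3 : Tendsto (fun n => ‖D.testVec (d n)‖ * (W * K)) atTop (𝓝 0) := by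
    simpa using h2.mul_const (W * K)
  refine h1.congr_dist (squeeze_zero' (.of_forall fun _ => dist_nonneg) ?_ h3)
  filter_upwards [eventually_ge_atTop N, hL.eventually_le ht] with n hn htn
  have ha := H.admissible_approx hL.steps ht htn
  have i1 := ha.integrable_mul hψ0 hMψ
  have i2 := ha.integrable_mul (hN n hn).1 (hN n hn).2
  simp only [comp_apply]
  rw [dist_comm, Real.dist_eq, ← integral_sub i2 i1]
  have e : ∫ x, (ψ n x * D.approx k ω0 h (σ n) t x - ψ0 x * D.approx k ω0 h (σ n) t x) ∂D.area =
      inner ℝ (D.testVec (d n)) (D.vort (D.approx k ω0 h (σ n) t)) := by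
    rw [inner_testVec_vort (memLp_testVec (hdm n) (hdM n) (hdR n) H.reg) (hW _ ha.mem).1]
    refine integral_congr_ae (ae_of_all _ fun x => ?_)
    simp only [hd, if_pos hn]; ring
  rw [e]
  refine (abs_real_inner_le_norm _ _).trans (mul_le_mul_of_nonneg_left ?_ (norm_nonneg _))
  refine (hW _ ha.mem).2.trans (mul_le_mul_of_nonneg_left ?_ hW0)
  exact ENNReal.toReal_le_of_le_ofReal hK0 (H.ulNorm_approx_le_ulBound hL.steps ⟨ht, le_rfl⟩ htn)

omit hL in
lemma fderiv_uncurry_apply {φ : ℝ → Plane → ℝ} (hφ : D.IsTest 1 φ) (t : ℝ) (x v : Plane) :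
    deriv (fun s => φ s x) t + fderiv ℝ (φ t) x v = fderiv ℝ (uncurry φ) (t, x) (1, v) := by
  have hd : HasFDerivAt (uncurry φ) (fderiv ℝ (uncurry φ) (t, x)) (t, x) :=
    (hφ.1.differentiable (by simp) (t, x)).hasFDerivAt
  have h1 : HasDerivAt (fun s => φ s x) (fderiv ℝ (uncurry φ) (t, x) (1, 0)) t :=
    hd.comp_hasDerivAt (f := fun s => (s, x)) t ((hasDerivAt_id t).prodMk (hasDerivAt_const t x))
  have h2 : HasFDerivAt (φ t) ((fderiv ℝ (uncurry φ) (t, x)).comp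
      ((0 : Plane →L[ℝ] ℝ).prod (ContinuousLinearMap.id ℝ Plane))) x :=
    hd.comp (f := fun y => (t, y)) x ((hasFDerivAt_const t x).prodMk (hasFDerivAt_id x))
  rw [h1.deriv, h2.fderiv]
  simp only [ContinuousLinearMap.comp_apply, ContinuousLinearMap.prod_apply, zero_apply,
    ContinuousLinearMap.id_apply]
  rw [← map_add]
  simp

/-- A strong-weak pairing: derivatives of `φ` along the mollified velocities are bounded with common
support and converge pointwise, while the vorticities converge weakly. The frozen grid time `h
⌊t/h⌋` tends to `t`. -/
lemma Setup.IsLimit.tendsto_discreteRate {φ : ℝ → Plane → ℝ} (hφ : D.IsTest 1 φ)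
    (ht : 0 ≤ t) : Tendsto (fun n => D.discreteRate k ω0 h φ (σ n) ⌊t / h (σ n)⌋₊) atTop
      (𝓝 (∫ x, fderiv ℝ (uncurry φ) (t, x) (1, D.pts.indicator (D.velocity k (ω t)) x) *
        ω t x ∂D.area)) := by
  classical
  have hdt := hφ.testLike_fderiv le_rfl
  obtain ⟨M, hM0, hM⟩ := H.exists_abs_fderiv_le hL.steps hφ t
  obtain ⟨M', hM'0, hM'⟩ := hdt.bounded t
  obtain ⟨R, hR⟩ := hdt.exists_radius
  have hV0 := H.velBound_nonneg t
  set V := H.vBound t with hV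
  have hpos : ∀ n, 0 < h (σ n) := fun n => (hL.steps.small _).pos
  have hfl : ∀ n, h (σ n) * (⌊t / h (σ n)⌋₊ : ℝ) ≤ t := fun n => hL.steps.floor_le _ ht
  have hτ : Tendsto (fun n => h (σ n) * (⌊t / h (σ n)⌋₊ : ℝ)) atTop (𝓝 t) := by
    have h0 := hL.steps.tendsto.comp hL.mono.tendsto_atTop
    have h1 : Tendsto (fun n => t - h (σ n)) atTop (𝓝 t) := by simpa using h0.const_sub t
    refine tendsto_of_tendsto_of_tendsto_of_le_of_le h1 tendsto_const_nhds (fun n => ?_) hfl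
    have := Nat.lt_floor_add_one (t / h (σ n))
    rw [div_lt_iff₀' (hpos n)] at this
    show t - h (σ n) ≤ _
    linarith
  have hvc : ContinuousOn (D.velocity k (ω t)) D.pts := FlowDomain.continuousOn_velocity H.kernel
    H.reg H.C1_pos.le H.C2_pos.le H.two_lt (hL.memL1Ul ht)
  refine hL.tendsto_integral_of_tendsto ht (M := max M (M' * (1 + V))) (R := R) ?_ ?_
    (fun n x hx hxR => ?_) ?_ (fun x => ?_) (fun x hx hxR => ?_) fun x hx => ?_
  · filter_upwards [hL.eventually_le ht] with n hn
    have ha := H.admissible_scheme' hL.steps (n := σ n) ((hfl n).trans hn)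
    exact ((hdt.continuous (h (σ n) * (⌊t / h (σ n)⌋₊ : ℝ))).clm_apply (continuous_const.prodMk
      (H.continuous_stepVel ha (σ n)))).aestronglyMeasurable
  · filter_upwards [hL.eventually_le ht] with n hn x
    exact (hM (σ n) hn _ (hfl n) x).trans (le_max_left _ _)
  · rw [hR _ x hx hxR]; rfl
  · refine Continuous.comp_aestronglyMeasurable₂ (g := fun (A : ℝ × Plane →L[ℝ] ℝ) (v : Plane) =>
      A (1, v)) (by fun_prop) (hdt.continuous t).aestronglyMeasurable ?_
    exact (aestronglyMeasurable_indicator_iff (measurableSet_pts H.reg)).2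
      ((hvc.aestronglyMeasurable (measurableSet_pts H.reg)).mono_measure
        (Measure.restrict_mono_measure Measure.restrict_le_self _))
  · refine le_trans ?_ (le_max_right _ _)
    refine ((fderiv ℝ (uncurry φ) (t, x)).le_opNorm _).trans ?_
    refine mul_le_mul (hM' _ ⟨ht, le_rfl⟩ x) ?_ (norm_nonneg _) hM'0
    rw [Prod.norm_def, norm_one]
    refine max_le (by linarith) ?_
    by_cases hx : x ∈ D.pts
    · simp only [indicator_of_mem hx]
      linarith [hL.velocity_le H.two_lt toReal_nonneg H.ulNorm_le_ofReal
        (⟨ht, le_rfl⟩ : t ∈ Icc 0 t) hx]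
    · simp only [indicator_of_notMem hx, norm_zero]; linarith
  · rw [hR _ x hx hxR]; rfl
  · rw [indicator_of_mem hx]
    have hc : Continuous fun z : ℝ × Plane => fderiv ℝ (uncurry φ) (z.1, x) (1, z.2) :=
      (hdt.1.comp (by fun_prop : Continuous fun z : ℝ × Plane => (z.1, x))).clm_apply (by fun_prop)
    exact (hc.tendsto (t, D.velocity k (ω t) x)).comp (hτ.prodMk_nhds (hL.tendsto_stepVel ht hx))

lemma Setup.IsLimit.weak_form (hT : 0 < T) {φ : ℝ → Plane → ℝ} (hφ : D.IsTest 1 φ) :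
    ∫ x, φ T x * ω T x ∂D.area - ∫ x, φ 0 x * ω0 x ∂D.area = ∫ t in Icc 0 T, ∫ x, ω t x *
        (deriv (fun s => φ s x) t + fderiv ℝ (φ t) x (D.velocity k (ω t) x)) ∂D.area := by
  obtain ⟨M, hM0, hM⟩ := H.exists_abs_fderiv_le hL.steps hφ T
  have hrhs : ∫ t in Icc 0 T, ∫ x, ω t x *
        (deriv (fun s => φ s x) t + fderiv ℝ (φ t) x (D.velocity k (ω t) x)) ∂D.area =
      ∫ t in Icc 0 T, ∫ x, fderiv ℝ (uncurry φ) (t, x)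
        (1, D.pts.indicator (D.velocity k (ω t)) x) * ω t x ∂D.area := by
    refine integral_congr_ae (ae_of_all _ fun t => integral_congr_ae ?_)
    filter_upwards [ae_area_mem_pts H.reg] with x hx
    rw [fderiv_uncurry_apply hφ, indicator_of_mem hx, mul_comm]
  have hI : Tendsto (fun n => ∫ t in Icc 0 T, D.discreteRate k ω0 h φ (σ n) ⌊t / h (σ n)⌋₊) atTop
      (𝓝 (∫ t in Icc 0 T, ∫ x, fderiv ℝ (uncurry φ) (t, x)
        (1, D.pts.indicator (D.velocity k (ω t)) x) * ω t x ∂D.area)) := by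
    refine tendsto_integral_filter_of_dominated_convergence (fun _ => M * D.mass ω0)
      (.of_forall fun n => ?_) ?_ (integrable_const _) ?_
    · have : Measurable fun t : ℝ => D.discreteRate k ω0 h φ (σ n) ⌊t / h (σ n)⌋₊ :=
        (measurable_from_nat (f := D.discreteRate k ω0 h φ (σ n))).comp
          (Nat.measurable_floor.comp (measurable_id.div_const _))
      exact this.aestronglyMeasurable
    · filter_upwards [hL.eventually_le hT.le] with n hn
      filter_upwards [ae_restrict_mem measurableSet_Icc] with t ht
      have hj := (hL.steps.floor_le (σ n) ht.1).trans ht.2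
      exact H.abs_integral_mul_le (H.admissible_scheme' hL.steps (hj.trans hn)) (hM (σ n) hn _ hj)
    · filter_upwards [ae_restrict_mem measurableSet_Icc] with t ht
      exact hL.tendsto_discreteRate hφ ht.1
  -- In the discrete identity `φ` is evaluated at the last grid time before `T`; uniform continuity
  -- of `φ` and the mass bound allow `T` itself to be used.
  have hX : Tendsto (fun n => ∫ x, φ (h (σ n) * (⌊T / h (σ n)⌋₊ : ℝ)) x *
      D.approx k ω0 h (σ n) T x ∂D.area) atTop (𝓝 (∫ x, φ T x * ω T x ∂D.area)) := by
    have h1 := (hL.tendsto_integral hT.le (hφ.testLike.boundedTest hT.le)).comp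
      (tendsto_prodMk_time hT.le)
    refine h1.congr_dist ?_
    rw [Metric.tendsto_nhds]
    intro ε hε
    have hm := mass_nonneg (D := D) ω0
    set ε' := ε / (D.mass ω0 + 1) with hε'
    have hε'0 : 0 < ε' := by positivity
    obtain ⟨δ, hδ, hunif⟩ := hφ.testLike.uniform T hε'0
    obtain ⟨B, hB0, hB⟩ := hφ.testLike.bounded T
    filter_upwards [hL.eventually_le hT.le, Metric.tendsto_nhds.1
      (hL.steps.tendsto.comp hL.mono.tendsto_atTop) δ hδ] with n hn hnδ
    have hpos := (hL.steps.small (σ n)).pos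
    rw [comp_apply, Real.dist_eq, sub_zero, abs_of_pos hpos] at hnδ
    have hfl := hL.steps.floor_le (σ n) hT.le
    have hfl0 : 0 ≤ h (σ n) * (⌊T / h (σ n)⌋₊ : ℝ) := by positivity
    have hlt := Nat.lt_floor_add_one (T / h (σ n))
    rw [div_lt_iff₀' hpos] at hlt
    have ha := H.admissible_approx hL.steps hT.le hn
    have i1 := ha.integrable_mul (hφ.testLike.continuous T).aestronglyMeasurable
      (hB T ⟨hT.le, le_rfl⟩)
    have i2 := ha.integrable_mul (hφ.testLike.continuous
      (h (σ n) * (⌊T / h (σ n)⌋₊ : ℝ))).aestronglyMeasurable (hB _ ⟨hfl0, hfl⟩)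
    rw [Real.dist_0_eq_abs, abs_of_nonneg dist_nonneg, comp_apply, Real.dist_eq,
      ← integral_sub i1 i2]
    simp only [← sub_mul]
    refine (H.abs_integral_mul_le ha fun x => (hunif T ⟨hT.le, le_rfl⟩ _ ⟨hfl0, hfl⟩ x x ?_
      (by rwa [dist_self])).le).trans_lt ?_
    · rw [abs_of_nonneg (by linarith)]; linarith
    · rw [hε', div_mul_eq_mul_div, div_lt_iff₀ (by positivity)]
      nlinarith
  rw [hrhs]
  have hlim := ((hX.sub_const (∫ x, φ 0 x * ω0 x ∂D.area)).sub hI).abs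
  have hle : ∀ ε > 0, |∫ x, φ T x * ω T x ∂D.area - ∫ x, φ 0 x * ω0 x ∂D.area -
      ∫ t in Icc 0 T, ∫ x, fderiv ℝ (uncurry φ) (t, x)
        (1, D.pts.indicator (D.velocity k (ω t)) x) * ω t x ∂D.area| ≤ 0 + ε := by
    intro ε hε
    rw [zero_add]
    obtain ⟨N, hN⟩ := H.sum_step_taylor hL.steps hφ hT hε
    refine le_of_tendsto hlim ?_
    filter_upwards [eventually_ge_atTop N] with n hn
    exact (hN (σ n) (hn.trans (hL.mono.id_le n))).2
  exact sub_eq_zero.1 (abs_eq_zero.1 (le_antisymm (le_of_forall_pos_le_add hle) (abs_nonneg _)))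

lemma Setup.IsLimit.isWeakSolution : D.IsWeakSolution k p ω0 ω fun t => D.velocity k (ω t) where
  ω_descends t _ := hL.descends t
  ω_measurable := hL.meas.aestronglyMeasurable
  ω_slice t ht := (hL.memL1Ul ht).memL1
  ω_bounded T hT := by
    refine ⟨max (D.mass ω0) (ulBound C1 C3 p T (D.mass ω0) (D.ulNorm p ω0).toReal), ?_⟩
    filter_upwards [ae_restrict_mem measurableSet_Icc] with t ht
    exact ⟨((hL.mass_le ht.1).trans_eq H.eLpNorm_eq).trans (ofReal_le_ofReal (le_max_left _ _)),
      (hL.ulNorm_le_ulBound ht).trans (ofReal_le_ofReal (le_max_right _ _))⟩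
  v_descends t _ := descends_velocity H.kernel (ω t)
  v_measurable := by
    have h1 := hL.continuousOn_velocity.mono
      (prod_mono (le_refl (Ici (0 : ℝ))) (cell_subset_pts (D := D)))
    have h2 := h1.aestronglyMeasurable (μ := volume)
      (measurableSet_Ici.prod (measurableSet_cell H.reg))
    rw [Measure.volume_eq_prod, ← Measure.prod_restrict] at h2
    exact h2
  v_eq := by
    filter_upwards [ae_restrict_mem measurableSet_Ici] with t ht x hx
    exact ⟨integrable_velocity H.kernel H.reg H.C1_pos.le H.two_lt (hL.memL1Ul ht) hx, rfl⟩
  v_continuous := by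
    filter_upwards [ae_restrict_mem measurableSet_Ici] with t ht
    exact FlowDomain.continuousOn_velocity H.kernel H.reg H.C1_pos.le H.C2_pos.le H.two_lt
      (hL.memL1Ul ht)
  v_bounded T hT := by
    refine ⟨H.vBound T, ?_⟩
    filter_upwards [ae_restrict_mem measurableSet_Icc] with t ht x hx
    exact hL.velocity_le H.two_lt toReal_nonneg H.ulNorm_le_ofReal ht hx
  weak_form T hT φ hφ := hL.weak_form hT hφ

end Limit

/-! ### Yudovich norms and the modulus of continuity. -/

lemma ulNorm_le_yulNorm (hΘ : IsGrowth Θ) (hq : 1 ≤ q) :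
    D.ulNorm q f ≤ ofReal (Θ q) * D.yulNorm Θ f := by
  have h : D.ulNorm q f / ofReal (Θ q) ≤ D.yulNorm Θ f :=
    le_iSup₂ (f := fun p (_ : p ∈ Ici (1 : ℝ)) => D.ulNorm p f / ofReal (Θ p)) q hq
  rw [mul_comm]
  exact (div_le_iff (by simpa using hΘ.2 q hq) ofReal_ne_top).1 h

lemma ulNorm_le_ofReal_yulNorm (hΘ : IsGrowth Θ) (hf : D.yulNorm Θ f < ∞) (hq : 1 ≤ q) :
    D.ulNorm q f ≤ ofReal ((D.yulNorm Θ f).toReal * Θ q) := by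
  rw [ofReal_mul toReal_nonneg, ofReal_toReal hf.ne, mul_comm]
  exact ulNorm_le_yulNorm hΘ hq

/-- The speed is estimated with the single exponent `3`, so the growth function enters the constants
only through `Θ 3`. -/
def yulVel (C1 C3 T N1 Y Θ3 : ℝ) : ℝ := velBound C1 C3 3 T N1 (Y * Θ3)

/-- The covering number appears with power one instead of `1/r`: this bounds the growth of all
`L^r_ul` norms, `r ≥ 1`, by the same factor. -/
def yulFactor (C1 C3 T N1 Y Θ3 : ℝ) : ℝ :=
  exp (2 * T * (C3 * N1 + 1)) * covNum (1 + T * yulVel C1 C3 T N1 Y Θ3)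

def modConst (C1 C2 C3 T N1 Y Θ3 : ℝ) : ℝ :=
  2 * (2 * C1 + C2) * (8 * π * (yulFactor C1 C3 T N1 Y Θ3 * Y) + N1 / (3 * Θ3))

abbrev Setup.growthFactor (_ : D.Setup k C1 C2 C3 p ω0) (Θ : ℝ → ℝ) (T : ℝ) : ℝ :=
  yulFactor C1 C3 T (D.mass ω0) (D.yulNorm Θ ω0).toReal (Θ 3)

abbrev Setup.modBound (_ : D.Setup k C1 C2 C3 p ω0) (Θ : ℝ → ℝ) (T : ℝ) : ℝ :=
  modConst C1 C2 C3 T (D.mass ω0) (D.yulNorm Θ ω0).toReal (Θ 3)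

section Const

variable {T N1 Y Θ3 : ℝ}

lemma yulVel_nonneg (hC1 : 0 ≤ C1) (hN1 : 0 ≤ N1) (hY : 0 ≤ Y) (hΘ3 : 0 < Θ3) :
    0 ≤ yulVel C1 C3 T N1 Y Θ3 := velBound_nonneg hC1 (by norm_num) hN1 (by positivity)

lemma yulFactor_nonneg : 0 ≤ yulFactor C1 C3 T N1 Y Θ3 := mul_nonneg (exp_nonneg _) (sq_nonneg _)

lemma modConst_nonneg (hC1 : 0 ≤ C1) (hC2 : 0 ≤ C2) (hN1 : 0 ≤ N1) (hY : 0 ≤ Y) (hΘ3 : 0 < Θ3) :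
    0 ≤ modConst C1 C2 C3 T N1 Y Θ3 := by
  have := yulFactor_nonneg (C1 := C1) (C3 := C3) (T := T) (N1 := N1) (Y := Y) (Θ3 := Θ3)
  unfold modConst
  positivity

lemma ulFactor_le_yulFactor (hC1 : 0 ≤ C1) (hT : 0 ≤ T) (hN1 : 0 ≤ N1) (hY : 0 ≤ Y)
    (hΘ3 : 0 < Θ3) (hr : 1 ≤ r) :
    ulFactor C3 T N1 (velBound C1 C3 3 T N1 (Y * Θ3)) r ≤ yulFactor C1 C3 T N1 Y Θ3 := by
  have hV := yulVel_nonneg (C3 := C3) (T := T) hC1 hN1 hY hΘ3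
  have hc := one_le_covNum (R := 1 + T * yulVel C1 C3 T N1 Y Θ3) (by positivity)
  refine mul_le_mul_of_nonneg_left ?_ (exp_nonneg _)
  conv_rhs => rw [← Real.rpow_one (covNum _)]
  exact Real.rpow_le_rpow_of_exponent_le hc (by rw [div_le_one] <;> linarith)

end Const

lemma phiMod_eq_of_small (h0 : 0 < r) (hr : r ≤ exp (-2)) :
    phiMod Θ r = r * (1 - log r) * Θ (1 - log r) := by
  rw [phiMod, if_neg h0.not_ge, if_pos hr]

/-- For `q ≥ 3` everything is absorbed into `q Θ(q)`: `holderConst q` is linear in `q`, and the mass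
term satisfies `N1 ≤ N1/(3 Θ 3) · q Θ(q)` because `Θ` is nondecreasing. -/
lemma norm_velocity_sub_le_growth (hk : D.KernelBounds k C1 C2) (hD : D.IsRegular) (hC1 : 0 ≤ C1)
    (hC2 : 0 ≤ C2) (hΘ : IsGrowth Θ) (hf : D.MemL1Ul p f) {N1 B : ℝ}
    (hN1 : 0 ≤ N1) (hB : 0 ≤ B) (h1 : eLpNorm f 1 D.area ≤ ofReal N1)
    (h2 : ∀ q, 3 ≤ q → D.ulNorm q f ≤ ofReal (B * Θ q)) (hx : x ∈ D.pts)
    (hy : y ∈ D.pts) (hq : 3 ≤ q) : ‖D.velocity k f x - D.velocity k f y‖ ≤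
      2 * (2 * C1 + C2) * (8 * π * B + N1 / (3 * Θ 3)) * (q * Θ q) * D.gdist x y ^ (1 - 2 / q) := by
  have hq1 : 1 ≤ q := by linarith
  have hΘq := hΘ.2 q hq1
  have hΘ3 := hΘ.2 3 (by norm_num)
  have hmono : Θ 3 ≤ Θ q := hΘ.1 (show (1 : ℝ) ≤ 3 by norm_num) hq1 hq
  have hfq : D.MemL1Ul q f := ⟨hf.descends, hf.memL1, (h2 q hq).trans_lt ofReal_lt_top⟩
  refine (norm_velocity_sub_le_holder hk hD hC1 hC2 (by linarith) hfq hN1 (by positivity) h1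
    (h2 q hq) hx
    hy).trans ?_
  refine mul_le_mul_of_nonneg_right ?_ (rpow_nonneg (gdist_nonneg _ _) _)
  rw [mul_assoc _ _ (q * Θ q)]
  refine mul_le_mul_of_nonneg_left ?_ (by positivity)
  have h3 : N1 ≤ N1 / (3 * Θ 3) * (q * Θ q) := by
    rw [div_mul_eq_mul_div, le_div_iff₀ (by positivity)]
    exact mul_le_mul_of_nonneg_left (mul_le_mul hq hmono hΘ3.le (by linarith)) hN1
  nlinarith [mul_le_mul_of_nonneg_right (holderConst_le hq) (mul_nonneg hB hΘq.le)]

section Limit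

variable {H : D.Setup k C1 C2 C3 p ω0} {ω : ℝ → Plane → ℝ}

lemma Setup.ulNorm_approx_le_growth (H : D.Setup k C1 C2 C3 p ω0) (hh : H.StepSeq h)
    (hΘ : IsGrowth Θ) (hY : D.yulNorm Θ ω0 < ∞) (hr : 1 ≤ r)
    (ht : t ∈ Icc 0 T) (htn : t ≤ n) : D.ulNorm r (D.approx k ω0 h n t) ≤ ofReal
      (H.growthFactor Θ T * (D.yulNorm Θ ω0).toReal * Θ r) := by
  have hΘ3 := hΘ.2 3 (by norm_num)
  have h := H.ulNorm_approx_le hh (q := 3) (by norm_num) (mul_nonneg toReal_nonneg hΘ3.le)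
    (ulNorm_le_ofReal_yulNorm hΘ hY (by norm_num)) hr ht htn
  refine h.trans ?_
  rw [mul_assoc, ofReal_mul yulFactor_nonneg]
  exact mul_le_mul' (ofReal_le_ofReal (ulFactor_le_yulFactor H.C1_pos.le
    (ht.1.trans ht.2) (mass_nonneg _) toReal_nonneg hΘ3 hr)) (ulNorm_le_ofReal_yulNorm hΘ hY hr)

variable (hL : H.IsLimit h σ ω)
include hL

lemma Setup.IsLimit.ulNorm_le_growth (hΘ : IsGrowth Θ) (hY : D.yulNorm Θ ω0 < ∞)
    (hr : 1 ≤ r) (ht : t ∈ Icc 0 T) : D.ulNorm r (ω t) ≤ ofReal (H.growthFactor Θ T *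
        (D.yulNorm Θ ω0).toReal * Θ r) := by
  refine iSup₂_le fun x hx => hL.eLpNorm_le ht.1 (ENNReal.one_le_ofReal.2 hr) ?_
  filter_upwards [hL.eventually_le ht.1] with n hn
  exact (le_iSup₂ (f := fun x _ => eLpNorm (D.approx k ω0 h (σ n) t) (ofReal r)
    (D.area.restrict {z | D.gdist x z < 1})) x hx).trans
    (H.ulNorm_approx_le_growth hL.steps hΘ hY hr ht hn)

lemma Setup.IsLimit.yulNorm_le (hΘ : IsGrowth Θ) (hY : D.yulNorm Θ ω0 < ∞)
    (ht : t ∈ Icc 0 T) : D.yulNorm Θ (ω t) ≤ ofReal (H.growthFactor Θ T *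
        (D.yulNorm Θ ω0).toReal) := by
  refine iSup₂_le fun r hr => ?_
  have hr1 : (1 : ℝ) ≤ r := hr
  have hΘr := hΘ.2 r hr1
  rw [div_le_iff (by simpa using hΘr) ofReal_ne_top,
    ← ofReal_mul (mul_nonneg yulFactor_nonneg toReal_nonneg)]
  exact hL.ulNorm_le_growth hΘ hY hr1 ht

lemma Setup.IsLimit.velocity_le_growth (hΘ : IsGrowth Θ) (hY : D.yulNorm Θ ω0 < ∞)
    (ht : t ∈ Icc 0 T) (hx : x ∈ D.pts) : ‖D.velocity k (ω t) x‖ ≤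
      yulVel C1 C3 T (D.mass ω0) (D.yulNorm Θ ω0).toReal (Θ 3) :=
  hL.velocity_le (by norm_num) (mul_nonneg toReal_nonneg (hΘ.2 3 (by norm_num)).le)
    (ulNorm_le_ofReal_yulNorm hΘ hY (by norm_num)) ht hx

lemma Setup.IsLimit.velocity_phiMod (hΘ : IsGrowth Θ) (hY : D.yulNorm Θ ω0 < ∞)
    (ht : t ∈ Icc 0 T) (hx : x ∈ D.pts) (hy : y ∈ D.pts) (hC1 : H.modBound Θ T * exp 2 ≤ C)
    (hC2 : 2 * yulVel C1 C3 T (D.mass ω0) (D.yulNorm Θ ω0).toReal (Θ 3) /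
      (exp (-2) * 3 * Θ 3) ≤ C) :
    ‖D.velocity k (ω t) x - D.velocity k (ω t) y‖ ≤ C * phiMod Θ (D.gdist x y) := by
  have hΘ3 := hΘ.2 3 (by norm_num)
  have hd := gdist_nonneg (D := D) x y
  rcases hd.eq_or_lt with hd0 | hd0
  · have := hL.velocity_holder ht hx hy
    rw [← hd0, zero_rpow H.holder_pos.ne', mul_zero] at this
    rw [← hd0, phiMod, if_pos le_rfl, mul_zero]
    exact this
  by_cases hs : D.gdist x y ≤ exp (-2)
  · set d := D.gdist x y with hd_def
    -- With `log d = 1 - q` the loss is `d^{-2/q} = exp(2(q-1)/q) ≤ e²`, independent of `d`; and `d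
    -- ≤ e^{-2}` is exactly the condition `q ≥ 3`.
    set q := 1 - log d with hq
    have hlog : log d ≤ -2 := by
      rw [← Real.log_exp (-2)]
      exact Real.log_le_log hd0 hs
    have hq3 : 3 ≤ q := by linarith
    have hΘq := hΘ.2 q (by linarith)
    have hmain := norm_velocity_sub_le_growth H.kernel H.reg H.C1_pos.le H.C2_pos.le hΘ
      (hL.memL1Ul ht.1) toReal_nonneg (mul_nonneg yulFactor_nonneg toReal_nonneg)
      ((hL.mass_le ht.1).trans_eq H.eLpNorm_eq)
      (fun r hr => hL.ulNorm_le_growth hΘ hY (by linarith) ht) hx hy hq3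
    have hpow : d ^ (1 - 2 / q) ≤ exp 2 * d := by
      rw [rpow_sub hd0, Real.rpow_one, div_le_iff₀ (Real.rpow_pos_of_pos hd0 _),
        Real.rpow_def_of_pos hd0, show exp 2 * d * exp (log d * (2 / q)) =
          d * exp (2 + log d * (2 / q)) by rw [exp_add]; ring]
      refine le_mul_of_one_le_right hd0.le (Real.one_le_exp ?_)
      have e : log d = 1 - q := by rw [hq]; ring
      rw [e, show 2 + (1 - q) * (2 / q) = 2 / q by field_simp; ring]
      positivity
    rw [phiMod_eq_of_small hd0 hs, ← hq]
    have hm0 : 0 ≤ H.modBound Θ T := modConst_nonneg H.C1_pos.le H.C2_pos.le toReal_nonneg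
      toReal_nonneg hΘ3
    refine hmain.trans ?_
    rw [← hd_def]
    change H.modBound Θ T * (q * Θ q) * d ^ (1 - 2 / q) ≤ _
    calc _ ≤ H.modBound Θ T * (q * Θ q) * (exp 2 * d) := by gcongr
      _ = H.modBound Θ T * exp 2 * (d * q * Θ q) := by ring
      _ ≤ _ := by gcongr
  · rw [phiMod, if_neg hd0.not_ge, if_neg hs]
    have h1 := hL.velocity_le_growth hΘ hY ht hx
    have h2 := hL.velocity_le_growth hΘ hY ht hy
    rw [div_le_iff₀ (by positivity)] at hC2
    refine (norm_sub_le _ _).trans (le_trans ?_ hC2)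
    linarith

end Limit

end FlowDomain

/-! ### Osgood's criterion. -/

/-- A modulus of continuity satisfying Osgood's condition. -/
structure OsgoodModulus (ψ : ℝ → ℝ) : Prop where
  mono : MonotoneOn ψ (Ici 0)
  pos : ∀ r, 0 < r → 0 < ψ r
  zero : 0 ≤ ψ 0
  diverges : ∀ ε > 0, ∫⁻ r in Ioc 0 ε, ofReal (1 / ψ r) = ∞

namespace OsgoodModulus

variable {ψ : ℝ → ℝ}

lemma nonneg (hψ : OsgoodModulus ψ) (hr : 0 ≤ r) : 0 ≤ ψ r := by
  rcases hr.eq_or_lt with rfl | h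
  exacts [hψ.zero, (hψ.pos r h).le]

lemma exists_lt_lintegral (hψ : OsgoodModulus ψ) (hε : 0 < ε) (T : ℝ) :
    ∃ a > 0, ofReal T < ∫⁻ r in Ioc a ε, ofReal (1 / ψ r) := by
  have hU : (⋃ n : ℕ, Ioc (1 / ((n : ℝ) + 1)) ε) = Ioc 0 ε := by
    ext r
    simp only [mem_iUnion, mem_Ioc]
    constructor
    · rintro ⟨n, h1, h2⟩
      exact ⟨lt_trans (by positivity) h1, h2⟩
    · rintro ⟨h1, h2⟩
      obtain ⟨n, hn⟩ := exists_nat_one_div_lt h1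
      exact ⟨n, hn, h2⟩
  have hdir : Directed (· ⊆ ·) fun n : ℕ => Ioc (1 / ((n : ℝ) + 1)) ε := by
    refine directed_of_isDirected_le fun m n hmn => Ioc_subset_Ioc_left ?_
    exact one_div_le_one_div_of_le (by positivity) (by gcongr)
  have h := setLIntegral_iUnion_of_directed (μ := volume) (fun r => ofReal (1 / ψ r)) hdir
  rw [hU, hψ.diverges ε hε] at h
  have h2 : ofReal T < ⨆ n : ℕ, ∫⁻ r in Ioc (1 / ((n : ℝ) + 1)) ε, ofReal (1 / ψ r) := by
    rw [← h]; exact ofReal_lt_top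
  obtain ⟨n, hn⟩ := lt_iSup_iff.1 h2
  exact ⟨_, by positivity, hn⟩

/-- A discrete form of Osgood's uniqueness criterion. -/
lemma discrete (hψ : OsgoodModulus ψ) (hT : 0 ≤ T) (hε : 0 < ε) :
    ∃ a > 0, ∀ (δ : ℝ) (N : ℕ) (R : ℕ → ℝ), 0 ≤ δ → δ * N ≤ T → (∀ i ≤ N, 0 ≤ R i) → R 0 ≤ a →
      (∀ i < N, R (i + 1) ≤ R i + δ * (ψ (R i) + a)) → R N < ε := by
  obtain ⟨a1, ha1, hlt⟩ := hψ.exists_lt_lintegral hε T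
  -- The initial value `a` and the accumulated forcing, at most `T a`, together fit under `a1 = a +
  -- T a`.
  refine ⟨a1 / (1 + T), by positivity, fun δ N R hδ hN hR h0 hstep => ?_⟩
  set a := a1 / (1 + T) with ha
  have haa : a + T * a = a1 := by rw [ha]; field_simp
  have ha0 : 0 < a := by positivity
  -- `F` majorizes `R` and is monotone, with increments `δ ψ(R i) ≤ δ ψ(F i)`. So each step consumes
  -- at most `δ` of the integral of `1/ψ`, and getting from `a1` to `ε` would need more than `T`.
  set F : ℕ → ℝ := fun i => a1 + ∑ l ∈ Finset.range i, δ * ψ (R l) with hF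
  have hFs : ∀ i, F (i + 1) = F i + δ * ψ (R i) := fun i => by
    simp only [hF, Finset.sum_range_succ]; ring
  have hRi : ∀ i ≤ N, R i ≤ F i - T * a + i * δ * a := by
    intro i
    induction i with
    | zero => intro _; simp only [hF, Finset.sum_range_zero]; push_cast; linarith
    | succ i ih =>
      intro hi
      have h1 := ih (by omega)
      have h2 := hstep i (by omega)
      rw [hFs]; push_cast; linarith
  have hRF : ∀ i ≤ N, R i ≤ F i := by
    intro i hi
    have h1 := hRi i hi
    have h2 : (i : ℝ) * δ * a ≤ T * a := by
      refine mul_le_mul_of_nonneg_right ?_ ha0.le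
      have : (i : ℝ) ≤ N := by exact_mod_cast hi
      nlinarith
    linarith
  have hFmono : ∀ i ≤ N, a1 ≤ F i := fun i hi => by
    have : 0 ≤ ∑ l ∈ Finset.range i, δ * ψ (R l) := Finset.sum_nonneg fun l hl =>
      mul_nonneg hδ (hψ.nonneg (hR l (by have := Finset.mem_range.1 hl; omega)))
    simp only [hF]; linarith
  have hint : ∀ i ≤ N, ∫⁻ r in Ioc a1 (F i), ofReal (1 / ψ r) ≤ ofReal (i * δ) := by
    intro i
    induction i with
    | zero => intro _; simp [hF]
    | succ i ih =>
      intro hi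
      have hFi := hFmono i (by omega)
      have hpos := hψ.pos (F i) (by linarith)
      have hle : F i ≤ F (i + 1) := by
        rw [hFs]; linarith [mul_nonneg hδ (hψ.nonneg (hR i (by omega)))]
      rw [← Ioc_union_Ioc_eq_Ioc hFi hle]
      refine (lintegral_union_le _ _ _).trans ?_
      have h2 : ∫⁻ r in Ioc (F i) (F (i + 1)), ofReal (1 / ψ r) ≤ ofReal δ := by
        calc _ ≤ ∫⁻ r in Ioc (F i) (F (i + 1)), ofReal (1 / ψ (F i)) := by
              refine setLIntegral_mono measurable_const fun r hr => ofReal_le_ofReal ?_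
              exact one_div_le_one_div_of_le hpos
                (hψ.mono (mem_Ici.2 (by linarith)) (mem_Ici.2 (by linarith [hr.1])) hr.1.le)
          _ = ofReal (1 / ψ (F i) * (δ * ψ (R i))) := by
              rw [setLIntegral_const, Real.volume_Ioc, hFs, add_sub_cancel_left,
                ← ofReal_mul (by positivity)]
          _ ≤ ofReal δ := by
              refine ofReal_le_ofReal ?_
              rw [one_div_mul_eq_div, div_le_iff₀ hpos]
              exact mul_le_mul_of_nonneg_left (hψ.mono (mem_Ici.2 (hR i (by omega)))
                (mem_Ici.2 (by linarith)) (hRF i (by omega))) hδ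
      refine (add_le_add (ih (by omega)) h2).trans_eq ?_
      rw [← ofReal_add (by positivity) hδ]
      congr 1; push_cast; ring
  by_contra! hcon
  refine absurd (hlt.trans_le (?_ : _ ≤ ofReal T)) (lt_irrefl _)
  refine (lintegral_mono_set (Ioc_subset_Ioc_right (hcon.trans (hRF N le_rfl)))).trans
    ((hint N le_rfl).trans (ofReal_le_ofReal (by linarith [mul_comm δ N])))

end OsgoodModulus

/-- The best modulus of continuity obtained from the Hölder estimates with all exponents. -/
def growthMod (Θ : ℝ → ℝ) (r : ℝ) : ℝ := ⨅ q : Ici (3 : ℝ), (q : ℝ) * Θ q * r ^ (1 - 2 / (q : ℝ))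

section growthMod

lemma growthMod_bddBelow (hΘ : IsGrowth Θ) (hr : 0 ≤ r) :
    BddBelow (range fun q : Ici (3 : ℝ) => (q : ℝ) * Θ q * r ^ (1 - 2 / (q : ℝ))) := by
  refine ⟨0, ?_⟩
  rintro _ ⟨⟨q, hq⟩, rfl⟩
  have hq' : (3 : ℝ) ≤ q := hq
  have := hΘ.2 q (by linarith)
  positivity

lemma growthMod_le (hΘ : IsGrowth Θ) (hr : 0 ≤ r) (hq : 3 ≤ q) :
    growthMod Θ r ≤ q * Θ q * r ^ (1 - 2 / q) :=
  ciInf_le (growthMod_bddBelow hΘ hr) (⟨q, hq⟩ : Ici (3 : ℝ))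

lemma growthMod_monotoneOn (hΘ : IsGrowth Θ) : MonotoneOn (growthMod Θ) (Ici 0) := by
  intro r hr s hs hrs
  refine ciInf_mono (growthMod_bddBelow hΘ hr) fun ⟨q, hq⟩ => ?_
  have hq' : (3 : ℝ) ≤ q := hq
  have := hΘ.2 q (by linarith)
  have h1 : 0 ≤ 1 - 2 / q := by
    rw [sub_nonneg, div_le_one (by linarith)]; linarith
  exact mul_le_mul_of_nonneg_left (rpow_le_rpow hr hrs h1) (by positivity)

lemma growthMod_nonneg (hΘ : IsGrowth Θ) (hr : 0 ≤ r) : 0 ≤ growthMod Θ r := by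
  refine le_ciInf fun ⟨q, hq⟩ => ?_
  have hq' : (3 : ℝ) ≤ q := hq
  have := hΘ.2 q (by linarith)
  positivity

lemma growthMod_pos (hΘ : IsGrowth Θ) (hr : 0 < r) : 0 < growthMod Θ r := by
  have h3 := hΘ.2 3 (by norm_num)
  refine lt_of_lt_of_le (b := 3 * Θ 3 * min 1 r) (by positivity) (le_ciInf fun ⟨q, hq⟩ => ?_)
  have hq' : (3 : ℝ) ≤ q := hq
  have hΘq : Θ 3 ≤ Θ q := hΘ.1 (by simp) (mem_Ici.2 (by linarith)) hq'
  have h0 : 0 ≤ 1 - 2 / q := by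
    rw [sub_nonneg, div_le_one (by linarith)]; linarith
  have h1 : 1 - 2 / q ≤ 1 := by
    have : 0 ≤ 2 / q := by positivity
    linarith
  have hpow : min 1 r ≤ r ^ (1 - 2 / q) := by
    rcases le_total r 1 with h | h
    · calc min 1 r ≤ r ^ (1 : ℝ) := by rw [Real.rpow_one]; exact min_le_right _ _
        _ ≤ _ := Real.rpow_le_rpow_of_exponent_ge hr h h1
    · exact (min_le_left _ _).trans (Real.one_le_rpow h h0)
  have h4 : 0 ≤ q * Θ q := mul_nonneg (by linarith) (h3.le.trans hΘq)
  have : 0 < min 1 r := by positivity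
  dsimp only
  gcongr

/-- Put `r = exp(1 - s)` and use the exponent `q = s` in the infimum: `growthMod Θ r ≤ e² s Θ(s) r`,
while `dr = -r ds`. Hence the Osgood integral dominates a multiple of `∫ ds/(s Θ(s))`. Being an
infimum of monotone functions, `growthMod` is monotone for every `Θ`, whereas `phiMod` may fail to
be when `Θ` jumps. -/
lemma osgoodModulus_growthMod (hΘ : IsGrowth Θ) (hO : OsgoodGrowth Θ) (hC : 0 < C) :
    OsgoodModulus fun r => C * growthMod Θ r where
  mono r hr s hs hrs := mul_le_mul_of_nonneg_left (growthMod_monotoneOn hΘ hr hs hrs) hC.le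
  pos r hr := mul_pos hC (growthMod_pos hΘ hr)
  zero := mul_nonneg hC.le (growthMod_nonneg hΘ le_rfl)
  diverges ε hε := by
    obtain ⟨s0, h3, hs0⟩ : ∃ s0 : ℝ, 3 ≤ s0 ∧ exp (1 - s0) ≤ ε := by
      refine ⟨max 3 (1 - log ε), le_max_left _ _, ?_⟩
      rw [← Real.le_log_iff_exp_le hε]
      linarith [le_max_right 3 (1 - log ε)]
    have htail : ∫⁻ s in Ioi s0, ofReal (1 / (s * Θ s)) = ∞ := by
      have h1 : ∫⁻ s in Ioc 1 s0, ofReal (1 / (s * Θ s)) < ∞ := by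
        refine lt_of_le_of_lt (setLIntegral_mono (g := fun _ => ofReal (1 / Θ 1))
          measurable_const fun s hs => ofReal_le_ofReal ?_) ?_
        · have hp := hΘ.2 1 le_rfl
          have hle : Θ 1 ≤ Θ s := hΘ.1 (by simp) (mem_Ici.2 hs.1.le) hs.1.le
          refine one_div_le_one_div_of_le hp ?_
          nlinarith [hs.1]
        · rw [setLIntegral_const]
          exact mul_lt_top ofReal_lt_top (by simp)
      have h2 : ∫⁻ s in Ioi (1 : ℝ), ofReal (1 / (s * Θ s)) = ∞ := hO
      rw [← Ioc_union_Ioi_eq_Ioi (show (1 : ℝ) ≤ s0 by linarith)] at h2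
      have h4 := lintegral_union_le (μ := volume) (fun s => ofReal (1 / (s * Θ s)))
        (Ioc 1 s0) (Ioi s0)
      rw [h2, top_le_iff, ENNReal.add_eq_top] at h4
      exact h4.resolve_left h1.ne
    have hsub : (fun s => exp (1 - s)) '' Ioi s0 ⊆ Ioc 0 ε := by
      rintro _ ⟨s, hs, rfl⟩
      exact ⟨exp_pos _, (exp_le_exp.2 (by linarith [mem_Ioi.1 hs])).trans hs0⟩
    refine top_le_iff.1 (le_trans ?_ (lintegral_mono_set hsub))
    rw [lintegral_image_eq_lintegral_abs_deriv_mul (f := fun s => exp (1 - s)) measurableSet_Ioi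
      (f' := fun s => exp (1 - s) * (-1))
      (fun s _ => (((hasDerivAt_id s).const_sub 1).exp).hasDerivWithinAt)
      (fun a _ b _ hab => by have := Real.exp_injective hab; linarith)]
    have hlow : ∀ s ∈ Ioi s0, ofReal (1 / (C * exp 2)) *
        ofReal (1 / (s * Θ s)) ≤ ofReal |exp (1 - s) * (-1)| *
          ofReal (1 / (C * growthMod Θ (exp (1 - s)))) := by
      intro s hs
      have hs3 : 3 < s := lt_of_le_of_lt h3 hs
      have hp := hΘ.2 s (by linarith)
      have hE := exp_pos (1 - s)
      have hg := growthMod_pos hΘ hE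
      have hle := growthMod_le hΘ hE.le hs3.le
      have hpow : exp (1 - s) ^ (1 - 2 / s) ≤ exp (1 - s) * exp 2 := by
        rw [← Real.exp_mul, ← exp_add, exp_le_exp]
        have : (1 - s) * (1 - 2 / s) = 1 - s + 2 - 2 / s := by field_simp; ring
        rw [this]
        have : 0 ≤ 2 / s := by positivity
        linarith
      have hle2 : growthMod Θ (exp (1 - s)) ≤ s * Θ s * (exp (1 - s) * exp 2) :=
        hle.trans (mul_le_mul_of_nonneg_left hpow (by positivity))
      rw [← ofReal_mul (by positivity), ← ofReal_mul (by positivity)]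
      refine ofReal_le_ofReal ?_
      rw [mul_neg_one, abs_neg, abs_of_pos hE, one_div_mul_one_div, mul_one_div,
        div_le_div_iff₀ (by positivity) (by positivity), one_mul]
      calc C * growthMod Θ (exp (1 - s))
          ≤ C * (s * Θ s * (exp (1 - s) * exp 2)) := by gcongr
        _ = _ := by ring
    refine le_trans ?_ (setLIntegral_mono' measurableSet_Ioi hlow)
    rw [lintegral_const_mul' _ _ ofReal_ne_top, htail, ENNReal.mul_top]
    rw [Ne, ofReal_eq_zero, not_le]
    positivity

end growthMod

/-! ### Trajectories near the boundary. -/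

/-- Balls inside `Ω` touching the boundary determine the inner normal. -/
lemma isInnerNormal_of_ball {Ω : Set Plane} (hΩ : IsOpen Ω) {y Z : Plane} (hy : y ∈ frontier Ω)
    {ρ : Plane → ℝ} (hρ : IsLocalDefining Ω y ρ) (hr : 0 < dist Z y)
    (hball : ball Z (dist Z y) ⊆ Ω) : IsInnerNormal Ω y ((dist Z y)⁻¹ • (Z - y)) := by
  obtain ⟨hC, hne, hloc⟩ := hρ
  set r := dist Z y with hrdef
  have hrn : ‖Z - y‖ = r := (dist_eq_norm _ _).symm
  set ν : Plane := r⁻¹ • (Z - y) with hν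
  have hνn : ‖ν‖ = 1 := by
    rw [hν, norm_smul, hrn, norm_inv, norm_of_nonneg hr.le, inv_mul_cancel₀ hr.ne']
  have hyΩ : y ∉ Ω := fun h => (hΩ.frontier_eq ▸ hy).2 h
  have hy0 : ρ y = 0 := by
    refine le_antisymm (not_lt.1 fun h => hyΩ (hloc.self_of_nhds.2 h)) ?_
    have hcl : ∃ᶠ z in 𝓝 y, z ∈ Ω := mem_closure_iff_frequently.1 hy.1
    refine ge_of_tendsto_of_frequently hC.continuousAt ?_
    exact (hcl.and_eventually hloc).mono fun z hz => (hz.2.1 hz.1).le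
  have hdiff : DifferentiableAt ℝ ρ y := hC.differentiableAt (by simp)
  have hgrad : ∀ e, fderiv ℝ ρ y e = inner ℝ (gradient ρ y) e := fun e => by
    rw [gradient, InnerProductSpace.toDual_symm_apply]
  -- A direction with positive component along `ν` enters the interior ball, where `ρ > 0`; as `ρ y
  -- = 0`, the directional derivative is nonnegative.
  have hpos : ∀ e : Plane, 0 < inner ℝ ν e → 0 ≤ inner ℝ (gradient ρ y) e := by
    intro e he
    rw [← hgrad]
    have hl : HasDerivAt (fun s : ℝ => ρ (y + s • e)) (fderiv ℝ ρ y e) 0 := by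
      have h1 : HasDerivAt (fun s : ℝ => y + s • e) e 0 := by
        simpa using ((hasDerivAt_id (0 : ℝ)).smul_const e).const_add y
      have h2 : HasFDerivAt ρ (fderiv ℝ ρ y) (y + (0 : ℝ) • e) := by simpa using hdiff.hasFDerivAt
      exact h2.comp_hasDerivAt 0 h1
    have hslope := hl.tendsto_slope_zero_right
    refine ge_of_tendsto hslope ?_
    have hcont : Tendsto (fun s : ℝ => y + s • e) (𝓝[>] 0) (𝓝 y) := by
      have : Continuous fun s : ℝ => y + s • e := by fun_prop
      simpa using (this.tendsto 0).mono_left nhdsWithin_le_nhds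
    have hsmall : ∀ᶠ s : ℝ in 𝓝[>] 0, s * ‖e‖ ^ 2 < 2 * r * inner ℝ ν e := by
      have : Tendsto (fun s : ℝ => s * ‖e‖ ^ 2) (𝓝[>] 0) (𝓝 0) := by
        have : Continuous fun s : ℝ => s * ‖e‖ ^ 2 := by fun_prop
        simpa using (this.tendsto 0).mono_left nhdsWithin_le_nhds
      exact this.eventually (gt_mem_nhds (by positivity))
    filter_upwards [hcont.eventually hloc, hsmall, self_mem_nhdsWithin] with s h1 h2 h3
    have hs : 0 < s := h3
    have hin : y + s • e ∈ Ω := by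
      refine hball (mem_ball.2 ?_)
      rw [dist_eq_norm, ← abs_of_nonneg (norm_nonneg _), ← abs_of_pos hr, ← sq_lt_sq]
      have hZ : Z - y = r • ν := by rw [hν, smul_inv_smul₀ hr.ne']
      have : y + s • e - Z = s • e - r • ν := by rw [← hZ]; abel
      rw [this, norm_sub_sq_real, norm_smul, norm_smul, hνn, inner_smul_left, inner_smul_right,
        norm_of_nonneg hs.le, norm_of_nonneg hr.le, real_inner_comm]
      simp only [conj_trivial]
      nlinarith
    have := h1.1 hin
    simp only [zero_add, zero_smul, add_zero, hy0, sub_zero, smul_eq_mul]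
    positivity
  set g := gradient ρ y with hg
  have hg0 : g ≠ 0 := by
    intro h0
    refine hne (ContinuousLinearMap.ext fun e => ?_)
    rw [hgrad, h0, inner_zero_left]; rfl
  set c := inner ℝ ν g with hc
  have hννn : inner ℝ ν ν = (1 : ℝ) := by rw [real_inner_self_eq_norm_sq, hνn, one_pow]
  have hc0 : 0 ≤ c := by
    have := hpos ν (by rw [hννn]; norm_num)
    rwa [real_inner_comm] at this
  have hgc : g = c • ν := by
    -- The vector `ε ν - (g - c ν)` has normal component `ε`, so it is an admissible direction;
    -- letting `ε → 0` kills the tangential part of the gradient.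
    have hperp : ∀ ε > 0, ‖g - c • ν‖ ^ 2 ≤ ε * c := by
      intro ε hε
      have h1 : inner ℝ ν (ε • ν - (g - c • ν)) = ε := by
        rw [inner_sub_right, inner_sub_right, real_inner_smul_right ν ν ε,
          real_inner_smul_right ν ν c, hννn, ← hc]
        ring
      have h2 := hpos (ε • ν - (g - c • ν)) (by rw [h1]; exact hε)
      have h3 : inner ℝ g (g - c • ν) = ‖g - c • ν‖ ^ 2 := by
        rw [norm_sub_sq_real, inner_sub_right, inner_smul_right, real_inner_self_eq_norm_sq,
          norm_smul, hνn, real_inner_comm, ← hc, norm_eq_abs, mul_one, sq_abs]; ring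
      rw [inner_sub_right, h3, inner_smul_right, real_inner_comm, ← hc] at h2
      linarith
    have hz : ‖g - c • ν‖ ^ 2 ≤ 0 := by
      have ht : Tendsto (fun ε : ℝ => ε * c) (𝓝[>] 0) (𝓝 0) := by
        have : Continuous fun ε : ℝ => ε * c := by fun_prop
        simpa using (this.tendsto 0).mono_left nhdsWithin_le_nhds
      refine ge_of_tendsto ht ?_
      filter_upwards [self_mem_nhdsWithin] with ε hε using hperp ε hε
    have : ‖g - c • ν‖ = 0 := by
      have := norm_nonneg (g - c • ν); nlinarith
    exact sub_eq_zero.1 (norm_eq_zero.1 this)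
  refine ⟨hνn, ρ, ⟨hC, hne, hloc⟩, c, lt_of_le_of_ne hc0 fun h0 => hg0 ?_, hgc⟩
  rw [hgc, ← h0, zero_smul]

lemma exists_mem_frontier_infDist {Ω : Set Plane} (hΩ : IsOpen Ω) (hne : Ωᶜ.Nonempty) {Z : Plane}
    (hZ : Z ∈ Ω) : ∃ y ∈ frontier Ω, infDist Z Ωᶜ = dist Z y ∧ 0 < dist Z y ∧
      ball Z (dist Z y) ⊆ Ω := by
  obtain ⟨y, hy, hd⟩ := hΩ.isClosed_compl.exists_infDist_eq_dist hne Z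
  have hpos : 0 < dist Z y := dist_pos.2 fun h => hy (h ▸ hZ)
  have hball : ball Z (dist Z y) ⊆ Ω := by
    intro z hz
    by_contra hzc
    have := infDist_le_dist_of_mem (x := Z) (show z ∈ Ωᶜ from hzc)
    rw [hd, dist_comm Z z] at this
    exact absurd (mem_ball.1 hz) (not_lt.2 this)
  refine ⟨y, ?_, hd, hpos, hball⟩
  rw [hΩ.frontier_eq]
  refine ⟨closure_mono hball ?_, hy⟩
  rw [closure_ball _ hpos.ne', mem_closedBall, dist_comm]

namespace FlowDomain

lemma IsRegular.exists_localDefining (hD : D.IsRegular) (hy : y ∈ frontier D.pts) :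
    ∃ ρ, IsLocalDefining D.pts y ρ := by
  cases D with
  | region Ω => exact hD.2 y hy
  | torus => simp [pts] at hy

lemma NoFlow.tendsto (hu : D.NoFlow u) {y ν : Plane}
    (hy : y ∈ frontier D.pts) (hν : IsInnerNormal D.pts y ν) :
    Tendsto (fun z => inner ℝ ν (u z)) (𝓝[D.pts] y) (𝓝 0) := by
  cases D with
  | region Ω => exact hu y hy ν hν
  | torus => simp [pts] at hy

/-- A vector field without flow through the boundary points outwards at most by its modulus of
continuity. -/
lemma NoFlow.inner_ge (hD : D.IsRegular) (hu : D.NoFlow u) {ψ : ℝ → ℝ}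
    (hψ : MonotoneOn ψ (Ici 0)) (hmod : ∀ x ∈ D.pts, ∀ y ∈ D.pts, ‖u x - u y‖ ≤ ψ (dist x y))
    {y Z : Plane} (hy : y ∈ frontier D.pts) (hr : 0 < dist Z y)
    (hball : ball Z (dist Z y) ⊆ D.pts) : -(dist Z y * ψ (dist Z y)) ≤ inner ℝ (Z - y) (u Z) := by
  obtain ⟨ρ, hρ⟩ := hD.exists_localDefining hy
  have hν := isInnerNormal_of_ball (isOpen_pts hD) hy hρ hr hball
  have hlim := hu.tendsto hy hν
  set r := dist Z y with hrdef
  have hrn : ‖Z - y‖ = r := (dist_eq_norm _ _).symm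
  set ν : Plane := r⁻¹ • (Z - y) with hνd
  have hνn : ‖ν‖ = 1 := hν.1
  have hZ : Z - y = r • ν := by rw [hνd, smul_inv_smul₀ hr.ne']
  have hseg : ∀ s ∈ Ioo (0 : ℝ) 1, dist Z (y + s • (Z - y)) < r := by
    intro s hs
    have : Z - (y + s • (Z - y)) = (1 - s) • (Z - y) := by rw [sub_smul, one_smul]; abel
    rw [dist_eq_norm, this, norm_smul, hrn, norm_of_nonneg (by linarith [hs.2])]
    nlinarith [hs.1]
  have hmem : ∀ s ∈ Ioo (0 : ℝ) 1, y + s • (Z - y) ∈ D.pts := fun s hs =>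
    hball (by rw [mem_ball, dist_comm]; exact hseg s hs)
  have hIoo : Ioo (0 : ℝ) 1 ∈ 𝓝[>] (0 : ℝ) := Ioo_mem_nhdsGT one_pos
  have hpath : Tendsto (fun s : ℝ => y + s • (Z - y)) (𝓝[>] 0) (𝓝[D.pts] y) := by
    refine tendsto_nhdsWithin_iff.2 ⟨?_, ?_⟩
    · have : Continuous fun s : ℝ => y + s • (Z - y) := by fun_prop
      simpa using (this.tendsto 0).mono_left nhdsWithin_le_nhds
    · filter_upwards [hIoo] with s hs using hmem s hs
  have hZm : Z ∈ D.pts := hball (Metric.mem_ball_self hr)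
  -- Along the segment from `y` to `Z` the normal component tends to zero at `y`, and it differs
  -- from its value at `Z` by at most `ψ r`.
  have h1 : -ψ r ≤ inner ℝ ν (u Z) := by
    have h2 := (hlim.comp hpath).sub_const (ψ r)
    rw [zero_sub] at h2
    refine le_of_tendsto h2 ?_
    filter_upwards [hIoo] with s hs
    have h3 : inner ℝ ν (u (y + s • (Z - y))) - inner ℝ ν (u Z) ≤ ψ r := by
      rw [← inner_sub_right]
      refine (real_inner_le_norm _ _).trans ?_
      rw [hνn, one_mul, norm_sub_rev]
      exact (hmod _ hZm _ (hmem s hs)).trans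
        (hψ (mem_Ici.2 dist_nonneg) (mem_Ici.2 hr.le) (hseg s hs).le)
    simp only [comp_apply]
    linarith
  rw [hZ, inner_smul_left, conj_trivial]
  nlinarith

/-- One Euler step cannot reduce the distance to the boundary by more than the modulus of
continuity allows. -/
lemma infDist_le_of_step (hD : D.IsRegular) (hne : D.ptsᶜ.Nonempty)
    (hu : D.NoFlow u) {ψ : ℝ → ℝ} (hψ : OsgoodModulus ψ)
    (hmod : ∀ x ∈ D.pts, ∀ y ∈ D.pts, ‖u x - u y‖ ≤ ψ (dist x y)) {X w : Plane} {h V δ a : ℝ}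
    (hh : 0 ≤ h) (hV : ‖w‖ ≤ V) (ha : a < infDist X D.ptsᶜ)
    (hδ : ‖w - u (X + h • w)‖ ≤ δ) (hδa : δ ≤ a / 2) (hhV : h * V ≤ a / 2)
    (hhV2 : h * V ^ 2 ≤ a ^ 2 / 2) (ha0 : 0 < a) :
    X + h • w ∈ D.pts ∧ infDist X D.ptsᶜ ≤ infDist (X + h • w) D.ptsᶜ +
      h * (ψ (infDist (X + h • w) D.ptsᶜ) + a) := by
  set Z := X + h • w with hZ
  have hnorm : ‖h • w‖ ≤ h * V := by
    rw [norm_smul, norm_of_nonneg hh]; exact mul_le_mul_of_nonneg_left hV hh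
  have hXZ : dist X Z ≤ h * V := by
    rw [dist_eq_norm, show X - Z = -(h • w) by rw [hZ]; abel, norm_neg]; exact hnorm
  have hZm : Z ∈ D.pts := by
    by_contra hc
    have := infDist_le_dist_of_mem (x := X) (show Z ∈ D.ptsᶜ from hc)
    linarith
  refine ⟨hZm, ?_⟩
  -- The boundary point is nearest to the new position `Z`, not to the old one, since the interior
  -- ball must be centred where the velocity is evaluated. The inequality therefore bounds the old
  -- distance by the new one and is read backwards in time.
  obtain ⟨y, hy, hd, hr, hball⟩ := exists_mem_frontier_infDist (isOpen_pts hD) hne hZm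
  have hin := hu.inner_ge hD hψ.mono hmod hy hr hball
  have hρZ : a / 2 ≤ dist Z y := by
    have h1 := Metric.infDist_le_infDist_add_dist (s := D.ptsᶜ) (x := X) (y := Z)
    rw [hd] at h1; linarith
  rw [hd]
  set r := dist Z y with hrdef
  have hyc : y ∈ D.ptsᶜ := ((isOpen_pts hD).frontier_eq ▸ hy).2
  have hψr := hψ.nonneg hr.le
  have hV0 : 0 ≤ V := (norm_nonneg _).trans hV
  refine (infDist_le_dist_of_mem hyc).trans ?_
  refine le_of_sq_le_sq ?_ (by positivity)
  have hXy : X - y = (Z - y) - h • w := by rw [hZ]; abel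
  rw [dist_eq_norm, hXy, norm_sub_sq_real, inner_smul_right, norm_smul, mul_pow,
    ← dist_eq_norm, ← hrdef, norm_of_nonneg hh]
  have h1 : -(r * (ψ r + δ)) ≤ inner ℝ (Z - y) w := by
    have h2 : inner ℝ (Z - y) (u Z) - inner ℝ (Z - y) w ≤ r * δ := by
      rw [← inner_sub_right]
      refine (real_inner_le_norm _ _).trans ?_
      rw [← dist_eq_norm, ← hrdef, norm_sub_rev]
      exact mul_le_mul_of_nonneg_left hδ hr.le
    linarith
  have h3 : ‖w‖ ^ 2 ≤ V ^ 2 := pow_le_pow_left₀ (norm_nonneg _) hV 2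
  have h4 : h * (h * ‖w‖ ^ 2) ≤ h * (a ^ 2 / 2) :=
    mul_le_mul_of_nonneg_left ((mul_le_mul_of_nonneg_left h3 hh).trans hhV2) hh
  -- Both `r` and `a - δ` are at least `a/2`; the slack `a - δ` pays for the quadratic term
  -- `h²‖w‖²`.
  have h5 : a ^ 2 / 2 ≤ 2 * r * (a - δ) := by nlinarith
  have h6 : h * (a ^ 2 / 2) ≤ h * (2 * r * (a - δ)) := mul_le_mul_of_nonneg_left h5 hh
  have h7 : h * -(r * (ψ r + δ)) ≤ h * inner ℝ (Z - y) w := mul_le_mul_of_nonneg_left h1 hh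
  nlinarith [sq_nonneg (h * (ψ r + a))]

variable (D k) in
def traj (n : ℕ) (h : ℝ) (ω0 : Plane → ℝ) : ℕ → Plane → Plane
  | 0, x => x
  | j + 1, x => traj n h ω0 j x + h • D.stepVel k n (D.scheme k n h ω0 j) (traj n h ω0 j x)

/-- A common modulus of continuity of the approximate velocities on `[0, T]`. -/
structure Setup.HasModulus (_H : D.Setup k C1 C2 C3 p ω0) (h : ℕ → ℝ) (T : ℝ) (ψ : ℝ → ℝ) :
    Prop where
  osgood : OsgoodModulus ψ
  velocity_le : ∀ (n : ℕ) (t : ℝ), t ∈ Icc 0 T → t ≤ n → ∀ x ∈ D.pts, ∀ y ∈ D.pts,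
    ‖D.velocity k (D.approx k ω0 h n t) x - D.velocity k (D.approx k ω0 h n t) y‖ ≤ ψ (dist x y)

section

variable (H : D.Setup k C1 C2 C3 p ω0)
include H

/-- The growth estimate holds with one constant for all `q ≥ 3`, so the infimum over `q` may be
taken. The constant is `c + 1` rather than `c` because an Osgood modulus must be strictly positive.
-/
lemma Setup.hasModulus (hh : H.StepSeq h) (hΘ : IsGrowth Θ) (hO : OsgoodGrowth Θ)
    (hY : D.yulNorm Θ ω0 < ∞) (T : ℝ) : ∃ ψ, H.HasModulus h T ψ := by
  set c := H.modBound Θ T with hc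
  have hΘ3 := hΘ.2 3 (by norm_num)
  have hc0 : 0 ≤ c := modConst_nonneg H.C1_pos.le H.C2_pos.le toReal_nonneg
    toReal_nonneg hΘ3
  refine ⟨fun r => (c + 1) * growthMod Θ r, osgoodModulus_growthMod hΘ hO (by linarith),
    fun n t ht htn x hx y hy => ?_⟩
  have ha := H.admissible_approx hh ht.1 htn
  have hg := growthMod_nonneg hΘ (dist_nonneg (x := x) (y := y))
  suffices h1 : ‖D.velocity k (D.approx k ω0 h n t) x - D.velocity k (D.approx k ω0 h n t) y‖ ≤
      c * growthMod Θ (dist x y) by linarith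
  rw [growthMod, Real.mul_iInf_of_nonneg hc0]
  refine le_ciInf fun ⟨q, hq⟩ => ?_
  have hq' : (3 : ℝ) ≤ q := hq
  have hΘq := hΘ.2 q (by linarith)
  refine (norm_velocity_sub_le_growth H.kernel H.reg H.C1_pos.le H.C2_pos.le hΘ ha.mem
    toReal_nonneg (mul_nonneg yulFactor_nonneg toReal_nonneg)
    (ha.mass.trans_eq H.eLpNorm_eq) (fun r hr => H.ulNorm_approx_le_growth hh hΘ hY
      (by linarith) ht htn) hx hy hq').trans ?_
  have h0 : 0 ≤ 1 - 2 / q := by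
    rw [sub_nonneg, div_le_one] <;> linarith
  rw [← mul_assoc c]
  exact mul_le_mul_of_nonneg_left (rpow_le_rpow (gdist_nonneg _ _) (gdist_le_dist _ _) h0)
    (mul_nonneg hc0 (by positivity))

lemma Setup.approx_step (hh : H.StepSeq h) (n j : ℕ) :
    D.approx k ω0 h n (h n * j) = D.scheme k n (h n) ω0 j := by
  rw [approx, mul_div_cancel_left₀ _ (hh.small n).pos.ne', Nat.floor_natCast]

lemma Setup.norm_stepVel_sub_le (hh : H.StepSeq h) (ht : t ∈ Icc 0 T)
    (htn : t ≤ n) (hx : closedBall x (1 / ((n : ℝ) + 1)) ⊆ D.pts) :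
    ‖D.stepVel k n (D.approx k ω0 h n t) x - D.velocity k (D.approx k ω0 h n t) x‖ ≤ H.hBound T *
        (1 / ((n : ℝ) + 1)) ^ (1 - 2 / p) := by
  have ha := H.admissible_approx hh ht.1 htn
  refine norm_mollify_sub_le n (isOpen_pts H.reg) (FlowDomain.continuousOn_velocity H.kernel
    H.reg H.C1_pos.le H.C2_pos.le H.two_lt ha.mem) hx fun z hz => ?_
  refine (H.velocity_approx_holder hh ht htn (hx (Metric.ball_subset_closedBall hz))
    (hx (mem_closedBall_self (by positivity)))).trans ?_
  refine mul_le_mul_of_nonneg_left (rpow_le_rpow (gdist_nonneg _ _) ?_ H.holder_pos.le)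
    (H.holdBound_nonneg _)
  exact (gdist_le_dist _ _).trans (mem_ball.1 hz).le

lemma Setup.tendsto_holder_rate (c V : ℝ) :
    Tendsto (fun n : ℕ => c * (V / ((n : ℝ) + 1)) ^ (1 - 2 / p)) atTop (𝓝 0) := by
  have h1 : Tendsto (fun n : ℕ => V / ((n : ℝ) + 1)) atTop (𝓝 0) := by
    have := tendsto_one_div_add_atTop_nhds_zero_nat (𝕜 := ℝ).const_mul V
    simpa [div_eq_mul_inv] using this
  have := (h1.rpow_const (p := 1 - 2 / p) (Or.inr H.holder_pos.le)).const_mul c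
  rwa [zero_rpow H.holder_pos.ne', mul_zero] at this

/-- Suppose that a trajectory comes within `a` of the complement at step `j`. Read from `j` down to
`0`, the distances satisfy the recursion of `OsgoodModulus.discrete` with initial value at most `a`,
so the distance at step `0` would be smaller than itself. Strong induction provides the distance
above `a` at the earlier steps, where the one-step inequality is applied. -/
lemma Setup.exists_traj_safe (hh : H.StepSeq h) {ψ : ℝ → ℝ} (hm : H.HasModulus h T ψ)
    (hT : 0 ≤ T) (hx : x ∈ D.pts) : ∃ η > 0, ∀ᶠ n : ℕ in atTop, T ≤ n ∧
      ∀ j : ℕ, h n * j ≤ T → closedBall (D.traj k n (h n) ω0 j x) η ⊆ D.pts := by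
  have hTn : ∀ᶠ n : ℕ in atTop, T ≤ n := tendsto_natCast_atTop_atTop.eventually_ge_atTop T
  rcases D.ptsᶜ.eq_empty_or_nonempty with hne | hne
  · refine ⟨1, one_pos, hTn.mono fun n hn => ⟨hn, fun j _ => ?_⟩⟩
    rw [compl_empty_iff.1 hne]; exact subset_univ _
  have hinf : ∀ y, y ∉ D.pts → infDist y D.ptsᶜ = 0 := fun y hy =>
    Metric.infDist_zero_of_mem hy
  have hε : 0 < infDist x D.ptsᶜ := by
    obtain ⟨y, -, h1, h2, -⟩ := exists_mem_frontier_infDist (isOpen_pts H.reg) hne hx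
    rw [h1]; exact h2
  obtain ⟨a, ha, hdisc⟩ := hm.osgood.discrete hT hε
  have hsub : ∀ y b, b < a → a < infDist y D.ptsᶜ → closedBall y b ⊆ D.pts := by
    intro y b hb hy z hz
    by_contra hzc
    have := infDist_le_dist_of_mem (x := y) (show z ∈ D.ptsᶜ from hzc)
    rw [mem_closedBall, dist_comm] at hz
    linarith
  refine ⟨a / 2, by positivity, ?_⟩
  set V := H.vBound T with hV
  have hV0 : 0 ≤ V := H.velBound_nonneg T
  set c := H.hBound T with hc
  have hc0 : 0 ≤ c := H.holdBound_nonneg T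
  have hr := tendsto_one_div_add_atTop_nhds_zero_nat (𝕜 := ℝ)
  have hδ : Tendsto (fun n : ℕ => c * (1 / ((n : ℝ) + 1)) ^ (1 - 2 / p) +
      c * (V / ((n : ℝ) + 1)) ^ (1 - 2 / p)) atTop (𝓝 0) := by
    simpa using (H.tendsto_holder_rate c 1).add (H.tendsto_holder_rate c V)
  have hV1 : Tendsto (fun n : ℕ => 1 / ((n : ℝ) + 1) * V) atTop (𝓝 0) := by
    simpa using hr.mul_const V
  have hV2 : Tendsto (fun n : ℕ => 1 / ((n : ℝ) + 1) * V ^ 2) atTop (𝓝 0) := by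
    simpa using hr.mul_const (V ^ 2)
  filter_upwards [hTn, hδ.eventually (Iic_mem_nhds (half_pos ha)),
    hV1.eventually (Iic_mem_nhds (half_pos ha)),
    hV2.eventually (Iic_mem_nhds (show 0 < a ^ 2 / 2 by positivity)),
    hr.eventually (Iio_mem_nhds ha)] with n h1 h2 h3 h4 h5
  have hpos := (hh.small n).pos
  have hhn := hh.le n
  have hmain : ∀ j : ℕ, h n * j ≤ T → a < infDist (D.traj k n (h n) ω0 j x) D.ptsᶜ := by
    intro j
    induction j using Nat.strong_induction_on with
    | _ j ih =>
    intro hj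
    by_contra! hcon
    have hlt := hdisc (h n) j (fun i => infDist (D.traj k n (h n) ω0 (j - i) x) D.ptsᶜ)
      hpos.le hj (fun i _ => Metric.infDist_nonneg) (by simpa using hcon) ?_
    · simp [traj] at hlt
    intro i hi
    obtain ⟨l, hl⟩ : ∃ l, j - i = l + 1 := ⟨j - i - 1, by omega⟩
    have hl' : j - (i + 1) = l := by omega
    simp only [hl, hl']
    have hlj : h n * (l : ℝ) ≤ T := by
      refine le_trans (mul_le_mul_of_nonneg_left ?_ hpos.le) hj
      have : l ≤ j := by omega
      exact_mod_cast this
    have hlI : h n * (l : ℝ) ∈ Icc 0 T := ⟨by positivity, hlj⟩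
    have hln : h n * (l : ℝ) ≤ n := hlj.trans h1
    have hX := ih l (by omega) hlj
    set X := D.traj k n (h n) ω0 l x with hXd
    have hXb := hsub X _ h5 hX
    have hXm : X ∈ D.pts := hXb (mem_closedBall_self (by positivity))
    have hw := H.norm_stepVel_le hh hln hlj X
    have hap := H.approx_step hh n l
    have hadm := H.admissible_scheme' hh hln
    have hmod := hm.velocity_le n _ hlI hln
    have herr := H.norm_stepVel_sub_le hh hlI hln hXb
    have hhol := fun (y : Plane) (hy : y ∈ D.pts) =>
      H.velocity_approx_holder hh hlI hln hXm hy
    rw [hap] at hmod herr hhol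
    set w := D.stepVel k n (D.scheme k n (h n) ω0 l) X with hwd
    have hhV : h n * V ≤ 1 / ((n : ℝ) + 1) * V := mul_le_mul_of_nonneg_right hhn hV0
    have hdist : dist X (X + h n • w) ≤ V / ((n : ℝ) + 1) := by
      rw [dist_self_add_right, norm_smul, norm_of_nonneg hpos.le]
      refine (mul_le_mul_of_nonneg_left hw hpos.le).trans (hhV.trans_eq ?_)
      ring
    have hZm : X + h n • w ∈ D.pts := by
      refine hsub X (a / 2) (by linarith) hX ?_
      rw [mem_closedBall, dist_comm]
      refine hdist.trans (le_trans (le_of_eq ?_) h3)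
      ring
    refine (infDist_le_of_step H.reg hne ((H.op _ hadm.mem).2) hm.osgood hmod hpos.le hw hX
      (δ := c * (1 / ((n : ℝ) + 1)) ^ (1 - 2 / p) + c * (V / ((n : ℝ) + 1)) ^ (1 - 2 / p))
      ?_ h2 (hhV.trans h3) ((mul_le_mul_of_nonneg_right hhn (by positivity)).trans h4) ha).2
    refine (norm_sub_le_norm_sub_add_norm_sub _ (D.velocity k (D.scheme k n (h n) ω0 l) X)
      _).trans (add_le_add herr ((hhol _ hZm).trans ?_))
    exact mul_le_mul_of_nonneg_left (rpow_le_rpow (gdist_nonneg _ _)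
      ((gdist_le_dist _ _).trans hdist) H.holder_pos.le) hc0
  exact ⟨h1, fun j hj => hsub _ _ (by linarith) (hmain j hj)⟩

omit H in
lemma traj_eq_sum (n : ℕ) (h : ℝ) (J : ℕ) (x : Plane) :
    D.traj k n h ω0 J x = x + ∑ j ∈ Finset.range J,
      h • D.stepVel k n (D.scheme k n h ω0 j) (D.traj k n h ω0 j x) := by
  induction J with
  | zero => simp [traj]
  | succ J ih => rw [Finset.sum_range_succ, ← add_assoc, ← ih]; rfl

end

/-! ### Convergence of the Euler polygons. -/

variable (D k) in
def polygon (ω0 : Plane → ℝ) (h : ℕ → ℝ) (n : ℕ) (t : ℝ) (x : Plane) : Plane :=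
  D.traj k n (h n) ω0 ⌊t / h n⌋₊ x

section polygon

variable (H : D.Setup k C1 C2 C3 p ω0) (hh : H.StepSeq h)
include hh

lemma Setup.StepSeq.floor_gt (n : ℕ) : t < h n * (⌊t / h n⌋₊ + 1) := by
  have := Nat.lt_floor_add_one (t / h n)
  rwa [div_lt_iff₀' (hh.small n).pos] at this

lemma Setup.dist_polygon_le (hs : 0 ≤ s) (hst : s ≤ t) (htT : t ≤ T)
    (htn : t ≤ n) (x : Plane) : dist (D.polygon k ω0 h n t x) (D.polygon k ω0 h n s x) ≤
      H.vBound T * (t - s + h n) := by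
  have hpos := (hh.small n).pos
  set V := H.vBound T with hV
  have hV0 : 0 ≤ V := H.velBound_nonneg T
  have key : ∀ m : ℕ, ∀ i : ℕ, h n * (i + m : ℕ) ≤ t →
      dist (D.traj k n (h n) ω0 (i + m) x) (D.traj k n (h n) ω0 i x) ≤ V * (h n * m) := by
    intro m i
    induction m with
    | zero => simp
    | succ m ih =>
      intro hm
      have hle : h n * ((i + m : ℕ) : ℝ) ≤ t := by
        refine le_trans (mul_le_mul_of_nonneg_left ?_ hpos.le) hm
        push_cast; linarith
      refine (dist_triangle _ (D.traj k n (h n) ω0 (i + m) x) _).trans ?_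
      have h1 := H.norm_stepVel_le hh (hle.trans htn) (hle.trans htT)
        (D.traj k n (h n) ω0 (i + m) x)
      have h2 : dist (D.traj k n (h n) ω0 (i + (m + 1)) x) (D.traj k n (h n) ω0 (i + m) x) ≤
          h n * V := by
        rw [← add_assoc, traj, dist_self_add_left, norm_smul, norm_of_nonneg hpos.le]
        exact mul_le_mul_of_nonneg_left h1 hpos.le
      have h3 := ih hle
      push_cast
      linarith
  have hfl : ⌊s / h n⌋₊ ≤ ⌊t / h n⌋₊ := Nat.floor_mono (by gcongr)
  obtain ⟨m, hm⟩ := Nat.exists_eq_add_of_le hfl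
  have h1 := key m ⌊s / h n⌋₊ (by rw [← hm]; exact hh.floor_le n (hs.trans hst))
  rw [← hm] at h1
  refine h1.trans (mul_le_mul_of_nonneg_left ?_ hV0)
  have h2 := hh.floor_le n (hs.trans hst)
  have h3 := Setup.StepSeq.floor_gt H hh n (t := s)
  rw [hm] at h2
  push_cast at h2
  linarith

omit hh in
lemma polygon_zero (n : ℕ) (x : Plane) : D.polygon k ω0 h n 0 x = x := by simp [polygon, traj]

/-- The polygons satisfy the integral equation of their velocities up to a small error. -/
lemma Setup.polygon_integral (ht : 0 ≤ t) (htT : t ≤ T) (htn : t ≤ n)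
    (x : Plane) : IntervalIntegrable
        (fun s => D.stepVel k n (D.approx k ω0 h n s) (D.polygon k ω0 h n s x)) volume 0 t ∧
      ‖D.polygon k ω0 h n t x - x -
        ∫ s in (0 : ℝ)..t, D.stepVel k n (D.approx k ω0 h n s) (D.polygon k ω0 h n s x)‖ ≤
      H.vBound T * h n := by
  have hpos := (hh.small n).pos
  set G : ℕ → Plane := fun j => D.stepVel k n (D.scheme k n (h n) ω0 j)
    (D.traj k n (h n) ω0 j x) with hG
  have hGs : (fun s => D.stepVel k n (D.approx k ω0 h n s) (D.polygon k ω0 h n s x)) =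
      fun s => G ⌊s / h n⌋₊ := rfl
  set J := ⌊t / h n⌋₊ with hJ
  have hJ1 : h n * J ≤ t := hh.floor_le n ht
  have hJ2 : t < h n * (J + 1) := Setup.StepSeq.floor_gt H hh n
  have hint : IntervalIntegrable (fun s => G ⌊s / h n⌋₊) volume 0 t := by
    refine (integral_step_fun hpos G (J + 1)).1.mono_set ?_
    rw [uIcc_of_le ht, uIcc_of_le (by positivity)]
    exact Icc_subset_Icc_right (by push_cast; exact hJ2.le)
  rw [hGs]
  refine ⟨hint, ?_⟩
  have hJ0 : (0 : ℝ) ≤ h n * J := by positivity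
  have hi1 : IntervalIntegrable (fun s => G ⌊s / h n⌋₊) volume 0 (h n * J) :=
    (integral_step_fun hpos G J).1
  have h1 : D.polygon k ω0 h n t x - x = ∫ s in (0 : ℝ)..h n * J, G ⌊s / h n⌋₊ := by
    rw [(integral_step_fun hpos G J).2, polygon, traj_eq_sum, add_sub_cancel_left]
  rw [h1, ← norm_neg, neg_sub, intervalIntegral.integral_interval_sub_left hint hi1]
  refine (intervalIntegral.norm_integral_le_of_norm_le_const (C := H.vBound T) fun s hs => ?_).trans
    ?_
  · rw [uIoc_of_le hJ1] at hs
    have hs0 : 0 ≤ s := hJ0.trans hs.1.le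
    have := hh.floor_le n hs0
    exact H.norm_stepVel_le hh (by linarith [hs.2]) (by linarith [hs.2]) _
  · rw [abs_of_nonneg (by linarith)]
    exact mul_le_mul_of_nonneg_left (by linarith) (H.velBound_nonneg T)

end polygon

section

variable {H : D.Setup k C1 C2 C3 p ω0} {ω : ℝ → Plane → ℝ}
  (hL : H.IsLimit h σ ω)
include hL

/-- On a compact set uniform convergence to a continuous limit can be checked as continuous
convergence at each point. In time this is the product filter, in space the Hölder bound common to
all approximations. -/
lemma Setup.IsLimit.tendstoUniformlyOn_velocity (T : ℝ) {K : Set Plane} (hK : IsCompact K)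
    (hKD : K ⊆ D.pts) :
    TendstoUniformlyOn (fun (n : ℕ) (z : ℝ × Plane) => D.velocity k (D.approx k ω0 h (σ n) z.1) z.2)
      (fun z => D.velocity k (ω z.1) z.2) atTop (Icc 0 T ×ˢ K) := by
  rw [← tendstoLocallyUniformlyOn_iff_tendstoUniformlyOn_of_compact (isCompact_Icc.prod hK),
    tendstoLocallyUniformlyOn_iff_forall_tendsto]
  rintro ⟨t0, x0⟩ ⟨ht0, hx0⟩
  have hsub : Icc 0 T ×ˢ K ⊆ Ici 0 ×ˢ D.pts := prod_mono Icc_subset_Ici_self hKD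
  have hcont := (hL.continuousOn_velocity.mono hsub) (t0, x0) ⟨ht0, hx0⟩
  have hlim1 : Tendsto (fun y : ℕ × ℝ × Plane => D.velocity k (ω y.2.1) y.2.2)
      (atTop ×ˢ 𝓝[Icc 0 T ×ˢ K] (t0, x0)) (𝓝 (D.velocity k (ω t0) x0)) := by
    have h1 : Tendsto (fun z : ℝ × Plane => D.velocity k (ω z.1) z.2)
      (𝓝[Icc 0 T ×ˢ K] (t0, x0)) (𝓝 (D.velocity k (ω t0) x0)) := hcont
    have h2 := h1.comp (tendsto_snd (f := (atTop : Filter ℕ)))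
    exact h2
  have hfst : Tendsto (fun y : ℕ × ℝ × Plane => (y.1, y.2.1))
      (atTop ×ˢ 𝓝[Icc 0 T ×ˢ K] (t0, x0)) (atTop ×ˢ 𝓝[Ici 0] t0) := by
    refine tendsto_fst.prodMk (Tendsto.comp ?_ tendsto_snd)
    rw [nhdsWithin_prod_eq]
    exact tendsto_fst.mono_right (nhdsWithin_mono _ Icc_subset_Ici_self)
  have hpt := hL.tendsto_velocity ht0.1 (hKD hx0)
  have hpt2 := hpt.comp hfst
  set c := H.hBound T with hc
  have hc0 : 0 ≤ c := H.holdBound_nonneg _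
  have hdist : Tendsto (fun y : ℕ × ℝ × Plane => c * dist y.2.2 x0 ^ (1 - 2 / p))
      (atTop ×ˢ 𝓝[Icc 0 T ×ˢ K] (t0, x0)) (𝓝 0) := by
    have h1 : Tendsto (fun y : ℕ × ℝ × Plane => y.2.2) (atTop ×ˢ 𝓝[Icc 0 T ×ˢ K] (t0, x0))
        (𝓝 x0) := by
      refine Tendsto.comp ?_ tendsto_snd
      exact (continuous_snd.tendsto (t0, x0)).mono_left nhdsWithin_le_nhds
    have h2 := tendsto_iff_dist_tendsto_zero.1 h1
    have h3 := (h2.rpow_const (p := 1 - 2 / p) (Or.inr H.holder_pos.le)).const_mul c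
    rwa [zero_rpow H.holder_pos.ne', mul_zero] at h3
  have hlim2 : Tendsto (fun y : ℕ × ℝ × Plane => D.velocity k (D.approx k ω0 h (σ y.1) y.2.1) y.2.2)
      (atTop ×ˢ 𝓝[Icc 0 T ×ˢ K] (t0, x0)) (𝓝 (D.velocity k (ω t0) x0)) := by
    refine hpt2.congr_dist (squeeze_zero' (.of_forall fun _ => dist_nonneg) ?_ hdist)
    have hev1 : ∀ᶠ y : ℕ × ℝ × Plane in atTop ×ˢ 𝓝[Icc 0 T ×ˢ K] (t0, x0),
        y.2 ∈ Icc 0 T ×ˢ K := tendsto_snd.eventually self_mem_nhdsWithin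
    have hev2 : ∀ᶠ y : ℕ × ℝ × Plane in atTop ×ˢ 𝓝[Icc 0 T ×ˢ K] (t0, x0), T ≤ σ y.1 :=
      tendsto_fst.eventually (hL.eventually_le (ht0.1.trans ht0.2))
    filter_upwards [hev1, hev2] with y hy1 hy2
    simp only [comp_apply]
    rw [dist_eq_norm, norm_sub_rev]
    refine (H.velocity_approx_holder hL.steps hy1.1 (hy1.1.2.trans hy2) (hKD hy1.2)
      (hKD hx0)).trans (mul_le_mul_of_nonneg_left (rpow_le_rpow (gdist_nonneg _ _)
        (gdist_le_dist _ _) H.holder_pos.le) hc0)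
  exact (hlim1.prodMk_nhds hlim2).mono_right (nhds_le_uniformity _)

variable (hm : ∀ T, ∃ ψ, H.HasModulus h T ψ)
include hm

abbrev Setup.IsLimit.path (_ : H.IsLimit h σ ω) (x : Plane) (n : ℕ) (s : ℝ) : Plane :=
  D.polygon k ω0 h (σ n) s x

/-- Uniform convergence of the velocities on compact sets can be used along the moving polygons,
because these stay in a fixed compact subset of the domain. -/
lemma Setup.IsLimit.eventually_polygon (hT : 0 ≤ T) (hx : x ∈ D.pts) :
    ∃ η > 0, ∀ ε > 0, ∀ᶠ n in atTop, T ≤ σ n ∧ ∀ s ∈ Icc 0 T,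
      closedBall (hL.path x n s) η ⊆ D.pts ∧
      ‖D.stepVel k (σ n) (D.approx k ω0 h (σ n) s) (hL.path x n s) -
        D.velocity k (ω s) (hL.path x n s)‖ ≤ ε := by
  obtain ⟨ψ, hψ⟩ := hm T
  obtain ⟨η, hη, hsafe⟩ := H.exists_traj_safe hL.steps hψ hT hx
  refine ⟨η, hη, fun ε hε => ?_⟩
  set V := H.vBound T with hV
  have hV0 : 0 ≤ V := H.velBound_nonneg T
  -- The polygons travel at most `V (T + 1)` and keep a distance `η` from the complement; both
  -- conditions are closed, and the first gives boundedness.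
  set K : Set Plane := closedBall x (V * (T + 1)) ∩ ⋂ w ∈ D.ptsᶜ, {z | η ≤ dist w z} with hK
  have hKc : IsCompact K := (isCompact_closedBall _ _).inter_right
    (isClosed_biInter fun w _ => isClosed_le continuous_const (continuous_const.dist continuous_id))
  have hKD : K ⊆ D.pts := by
    intro z hz
    by_contra hzc
    have := mem_iInter₂.1 hz.2 z hzc
    rw [mem_ofPred_eq, dist_self] at this
    linarith
  have hunif := Metric.tendstoUniformlyOn_iff.1 (hL.tendstoUniformlyOn_velocity T hKc hKD) (ε / 2)
    (half_pos hε)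
  have hrate := ((H.tendsto_holder_rate (H.hBound T) 1).comp hL.mono.tendsto_atTop).eventually
    (Iic_mem_nhds (half_pos hε))
  have hr := ((tendsto_one_div_add_atTop_nhds_zero_nat (𝕜 := ℝ)).comp
    hL.mono.tendsto_atTop).eventually (Iic_mem_nhds hη)
  filter_upwards [hunif, hrate, hr, hL.mono.tendsto_atTop.eventually hsafe] with n h1 h2 h3 h4
  refine ⟨h4.1, fun s hs => ?_⟩
  have hsub : closedBall (hL.path x n s) η ⊆ D.pts :=
    h4.2 _ ((hL.steps.floor_le _ hs.1).trans hs.2)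
  refine ⟨hsub, ?_⟩
  have hmem : hL.path x n s ∈ K := by
    refine ⟨?_, mem_iInter₂.2 fun w hw => ?_⟩
    · have h5 := H.dist_polygon_le hL.steps le_rfl hs.1 hs.2 (hs.2.trans h4.1) x
      rw [polygon_zero] at h5
      refine mem_closedBall.2 (h5.trans (mul_le_mul_of_nonneg_left ?_ hV0))
      have h6 := hL.steps.le (σ n)
      have h7 : 1 / ((σ n : ℝ) + 1) ≤ 1 := by
        rw [div_le_one (by positivity)]; linarith [Nat.cast_nonneg (α := ℝ) (σ n)]
      linarith [hs.2]
    · rw [mem_ofPred_eq]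
      by_contra! hlt
      exact hw (hsub (mem_closedBall.2 hlt.le))
  refine (norm_sub_le_norm_sub_add_norm_sub _
    (D.velocity k (D.approx k ω0 h (σ n) s) (hL.path x n s)) _).trans ?_
  have h5 := H.norm_stepVel_sub_le hL.steps hs (hs.2.trans h4.1)
    ((Metric.closedBall_subset_closedBall h3).trans hsub)
  have h6 := h1 (s, hL.path x n s) ⟨hs, hmem⟩
  rw [dist_eq_norm, norm_sub_rev] at h6
  have h7 : _ ≤ ε / 2 := h2
  simp only [comp_apply] at h6 h7
  linarith

omit hm in
lemma Setup.IsLimit.velocity_modulus {ψ : ℝ → ℝ} (hψ : H.HasModulus h T ψ)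
    (ht : t ∈ Icc 0 T) (hx : x ∈ D.pts) (hy : y ∈ D.pts) :
    ‖D.velocity k (ω t) x - D.velocity k (ω t) y‖ ≤ ψ (dist x y) := by
  have h1 := (hL.tendsto_velocity ht.1 hx).comp (tendsto_prodMk_time ht.1)
  have h2 := (hL.tendsto_velocity ht.1 hy).comp (tendsto_prodMk_time ht.1)
  refine le_of_tendsto (h1.sub h2).norm ?_
  filter_upwards [hL.eventually_le ht.1] with n hn
  exact hψ.velocity_le _ t ht hn x hx y hy

/-- Two polygons with different step lengths are compared on a coarse grid of mesh `δ` that depends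
on neither of them. Their distance satisfies Osgood's discrete inequality with arbitrarily small
errors, starting from zero distance. -/
lemma Setup.IsLimit.cauchySeq_polygon (hT : 0 < T) (hx : x ∈ D.pts) :
    CauchySeq fun n => hL.path x n T := by
  obtain ⟨ψ, hψ⟩ := hm T
  obtain ⟨η, hη, hev⟩ := hL.eventually_polygon hm hT.le hx
  rw [Metric.cauchySeq_iff]
  intro ε hε
  obtain ⟨a, ha, hdisc⟩ := hψ.osgood.discrete hT.le hε
  set V := H.vBound T with hV
  have hV0 : 0 ≤ V := H.velBound_nonneg T
  obtain ⟨m, hm1⟩ := exists_nat_gt (max 1 (4 * V * T / a))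
  have hm0 : (0 : ℝ) < m := lt_trans one_pos (lt_of_le_of_lt (le_max_left _ _) hm1)
  set δ := T / m with hδ
  have hδ0 : 0 < δ := by positivity
  have hδa : 4 * V * δ ≤ a := by
    have := (lt_of_le_of_lt (le_max_right _ _) hm1).le
    rw [div_le_iff₀ ha] at this
    rw [hδ, mul_div_assoc', div_le_iff₀ hm0]; linarith
  have hδm : δ * m = T := div_mul_cancel₀ _ hm0.ne'
  have hh0 : Tendsto (fun n => V * h (σ n)) atTop (𝓝 0) := by
    have h1 := hL.steps.tendsto.comp hL.mono.tendsto_atTop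
    have h2 := h1.const_mul V
    rw [mul_zero] at h2
    exact h2
  have hh1 : ∀ᶠ n in atTop, h (σ n) ≤ δ :=
    (hL.steps.tendsto.comp hL.mono.tendsto_atTop).eventually (Iic_mem_nhds hδ0)
  -- The error budget over one coarse interval is `δ a`: twice `δ a/4` from replacing the mollified
  -- velocities by the limit velocity, and four times `δ a/8` from the integral equations of two
  -- polygons at two times.
  obtain ⟨N, hN⟩ := eventually_atTop.1 ((hev (a / 4) (by positivity)).and
    ((hh0.eventually (Iic_mem_nhds (show 0 < δ * a / 8 by positivity))).and hh1))
  refine ⟨N, fun n hn l hl => ?_⟩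
  obtain ⟨⟨hn1, hn2⟩, hn3, hn4⟩ := hN n hn
  obtain ⟨⟨hl1, hl2⟩, hl3, hl4⟩ := hN l hl
  have hi : ∀ i : ℕ, i ≤ m → δ * i ≤ T := fun i hi => by
    rw [← hδm]; exact mul_le_mul_of_nonneg_left (by exact_mod_cast hi) hδ0.le
  -- Within a coarse interval each polygon moves by at most `V (δ + h) ≤ 2Vδ`, so `R i` bounds the
  -- distance during the whole interval.
  set R : ℕ → ℝ := fun i => dist (hL.path x n (δ * i))
    (hL.path x l (δ * i)) + 4 * V * δ with hR
  have hlt := hdisc δ m R hδ0.le hδm.le (fun i _ => add_nonneg dist_nonneg (by positivity)) ?_ ?_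
  · have : R m < ε := hlt
    simp only [hR, hδm] at this
    linarith [show 0 ≤ 4 * V * δ by positivity]
  · simp only [hR, Nat.cast_zero, mul_zero, polygon_zero, dist_self, zero_add]
    exact hδa
  intro i him
  set s := δ * (i : ℝ) with hs
  set t := δ * ((i + 1 : ℕ) : ℝ) with ht
  have hts : t = s + δ := by rw [ht, hs]; push_cast; ring
  have hs0 : 0 ≤ s := by positivity
  have htT : t ≤ T := hi _ him
  have hsT : s ≤ T := by linarith
  have hRi : 0 ≤ R i := add_nonneg dist_nonneg (by positivity)
  obtain ⟨hin, hen⟩ := H.polygon_integral hL.steps (by linarith) htT (htT.trans hn1) x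
  obtain ⟨hil, hel⟩ := H.polygon_integral hL.steps (by linarith) htT (htT.trans hl1) x
  obtain ⟨hin', hen'⟩ := H.polygon_integral hL.steps hs0 hsT (hsT.trans hn1) x
  obtain ⟨hil', hel'⟩ := H.polygon_integral hL.steps hs0 hsT (hsT.trans hl1) x
  have hsub_n := intervalIntegral.integral_interval_sub_left hin hin'
  have hsub_l := intervalIntegral.integral_interval_sub_left hil hil'
  have hst_n := hin'.symm.trans hin
  have hst_l := hil'.symm.trans hil
  set w : ℕ → ℝ → Plane := fun n r => D.stepVel k (σ n) (D.approx k ω0 h (σ n) r)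
    (hL.path x n r) with hw
  have hbound : ‖(∫ r in s..t, w n r) - ∫ r in s..t, w l r‖ ≤ (ψ (R i) + a / 2) * |t - s| := by
    rw [← intervalIntegral.integral_sub hst_n hst_l]
    refine intervalIntegral.norm_integral_le_of_norm_le_const fun r hr => ?_
    rw [uIoc_of_le (by linarith)] at hr
    have hrI : r ∈ Icc 0 T := ⟨by linarith [hr.1], by linarith [hr.2]⟩
    obtain ⟨hbn, hdn⟩ := hn2 r hrI
    obtain ⟨hbl, hdl⟩ := hl2 r hrI
    have hmod := hL.velocity_modulus hψ hrI (hbn (mem_closedBall_self hη.le))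
      (hbl (mem_closedBall_self hη.le))
    have h1 := H.dist_polygon_le hL.steps hs0 hr.1.le hrI.2 (hrI.2.trans hn1) x
    have h2 := H.dist_polygon_le hL.steps hs0 hr.1.le hrI.2 (hrI.2.trans hl1) x
    have h3 : dist (hL.path x n r) (hL.path x l r) ≤ R i := by
      have h4 := dist_triangle4 (hL.path x n r) (hL.path x n s)
        (hL.path x l s) (hL.path x l r)
      rw [dist_comm (hL.path x l s) (hL.path x l r)] at h4
      have h5 : V * (r - s + h (σ n)) ≤ V * (2 * δ) :=
        mul_le_mul_of_nonneg_left (by linarith [hr.2]) hV0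
      have h6 : V * (r - s + h (σ l)) ≤ V * (2 * δ) :=
        mul_le_mul_of_nonneg_left (by linarith [hr.2]) hV0
      simp only [hR]
      linarith
    have h4 := hψ.osgood.mono (mem_Ici.2 dist_nonneg) (mem_Ici.2 hRi) h3
    have h5 : ‖w n r - w l r‖ ≤ _ := (congrArg norm (by abel)).trans_le
      (norm_sub_le_of_le (norm_add_le_of_le hdn hmod) hdl)
    linarith
  rw [show |t - s| = δ by rw [hts, add_sub_cancel_left, abs_of_pos hδ0], ← hsub_n, ← hsub_l]
    at hbound
  have hfin : ‖hL.path x n t - hL.path x l t‖ ≤ _ := (congrArg norm (by abel)).trans_le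
    (norm_add_le_of_le (norm_sub_le_of_le (norm_sub_le_of_le (norm_add_le_of_le (norm_add_le_of_le
      (le_refl ‖hL.path x n s - hL.path x l s‖) hbound) hen) hen') hel) hel')
  rw [← dist_eq_norm, ← dist_eq_norm] at hfin
  simp only [hR]
  linarith

end

variable (D k) in
def flowMap (ω0 : Plane → ℝ) (h : ℕ → ℝ) (σ : ℕ → ℕ) (t : ℝ) (x : Plane) : Plane :=
  limUnder atTop fun n => D.polygon k ω0 h (σ n) t x

lemma SelfMap.of_mapsTo {X : Plane → Plane} (hX : MapsTo X D.pts D.pts) (he : D.Equivariant X) :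
    D.SelfMap X := by
  cases D with
  | region Ω => exact hX
  | torus => exact he

lemma equivariant_add_smul {X w : Plane → Plane} (hX : D.Equivariant X) (hw : D.Descends w)
    (h : ℝ) : D.Equivariant fun x => X x + h • w (X x) := by
  cases D with
  | region Ω => trivial
  | torus =>
    intro m x
    simp only [hX m x, hw m (X x)]
    abel

lemma equivariant_of_tendsto {X : ℕ → Plane → Plane} {Y : Plane → Plane}
    (hX : ∀ n, D.Equivariant (X n))
    (hY : ∀ x ∈ D.pts, Tendsto (fun n => X n x) atTop (𝓝 (Y x))) : D.Equivariant Y := by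
  cases D with
  | region Ω => trivial
  | torus =>
    intro m x
    refine tendsto_nhds_unique (hY _ (mem_univ _)) ?_
    simp only [hX _ m x]
    exact (hY x (mem_univ _)).add_const _

lemma equivariant_id : D.Equivariant fun x => x := by
  cases D with
  | region Ω => trivial
  | torus => exact fun m x => rfl

lemma Setup.equivariant_traj (H : D.Setup k C1 C2 C3 p ω0) (n : ℕ) (h : ℝ) (j : ℕ) :
    D.Equivariant (D.traj k n h ω0 j) := by
  induction j with
  | zero => exact equivariant_id
  | succ j ih =>
    exact equivariant_add_smul ih (descends_mollify n (descends_velocity H.kernel _)) h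

lemma Setup.continuous_traj (H : D.Setup k C1 C2 C3 p ω0) (hh : H.StepSeq h)
    (j : ℕ) (hj : h n * j ≤ n) : Continuous (D.traj k n (h n) ω0 j) := by
  induction j with
  | zero => exact continuous_id
  | succ j ih =>
    have hle : h n * (j : ℝ) ≤ n := by
      refine le_trans (mul_le_mul_of_nonneg_left ?_ (hh.small n).pos.le) hj
      push_cast; linarith
    have hc := ih hle
    have h1 : Continuous fun x => D.stepVel k n (D.scheme k n (h n) ω0 j)
        (D.traj k n (h n) ω0 j x) := (H.continuous_stepVel (H.admissible_scheme' hh hle) n).comp hc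
    exact hc.add (h1.const_smul (h n))

open Classical in
/-- The scheme transports the vorticity along the polygons that stay inside the domain. -/
lemma Setup.integral_scheme (H : D.Setup k C1 C2 C3 p ω0) (hh : H.StepSeq h)
    (J : ℕ) (hJ : h n * J ≤ n) (hg : Measurable g) (hgd : D.Descends g)
    (hM : ∀ x, |g x| ≤ M) : ∫ x, g x * D.scheme k n (h n) ω0 J x ∂D.area =
      ∫ x, (if ∀ i < J, D.traj k n (h n) ω0 i x ∈ innerPart n D.pts then
        g (D.traj k n (h n) ω0 J x) else 0) * ω0 x ∂D.area := by
  induction J generalizing g with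
  | zero => simp [scheme, traj]
  | succ J ih =>
    have hle : h n * (J : ℝ) ≤ n := by
      refine le_trans (mul_le_mul_of_nonneg_left ?_ (hh.small n).pos.le) hJ
      push_cast; linarith
    set w := D.stepVel k n (D.scheme k n (h n) ω0 J) with hw
    have hwc : Continuous w := H.continuous_stepVel (H.admissible_scheme' hh hle) n
    have hwd : D.Descends w := descends_mollify n (descends_velocity H.kernel _)
    have hS : MeasurableSet (innerPart n D.pts) :=
      (isOpen_innerPart n (isOpen_pts H.reg)).measurableSet
    have hF : D.Equivariant fun x => x + h n • w x := equivariant_add_smul equivariant_id hwd _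
    rw [H.integral_step hh hle hg hgd hM, ← integral_indicator hS]
    have h1 := ih hle (g := (innerPart n D.pts).indicator fun x => g (x + h n • w x))
      ((hg.comp (by fun_prop : Measurable fun x => x + h n • w x)).indicator hS)
      ((descends_innerPart n).indicator (hgd.comp_equivariant hF)) (fun x => by
        by_cases hx : x ∈ innerPart n D.pts
        · rw [indicator_of_mem hx]; exact hM _
        · rw [indicator_of_notMem hx, abs_zero]; exact (abs_nonneg _).trans (hM x))
    have h2 : ∀ x, (innerPart n D.pts).indicator (fun x => g (x + h n • w x) *
        D.scheme k n (h n) ω0 J x) x = (innerPart n D.pts).indicator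
          (fun x => g (x + h n • w x)) x * D.scheme k n (h n) ω0 J x := fun x => by
      by_cases hx : x ∈ innerPart n D.pts <;> simp [hx]
    rw [integral_congr_ae (ae_of_all _ h2), h1]
    refine integral_congr_ae (ae_of_all _ fun x => ?_)
    dsimp only
    congr 1
    have h3 : (∀ i < J + 1, D.traj k n (h n) ω0 i x ∈ innerPart n D.pts) ↔
        (∀ i < J, D.traj k n (h n) ω0 i x ∈ innerPart n D.pts) ∧
          D.traj k n (h n) ω0 J x ∈ innerPart n D.pts := Nat.forall_lt_succ_right
    by_cases ha : ∀ i < J, D.traj k n (h n) ω0 i x ∈ innerPart n D.pts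
    · by_cases hb : D.traj k n (h n) ω0 J x ∈ innerPart n D.pts
      · rw [if_pos ha, if_pos (h3.2 ⟨ha, hb⟩), indicator_of_mem hb]; rfl
      · rw [if_pos ha, if_neg (fun hc => hb (h3.1 hc).2), indicator_of_notMem hb]
    · rw [if_neg ha, if_neg (fun hc => ha (h3.1 hc).1)]

/-! ### The limit flow and the transport of vorticity. -/

section

variable {H : D.Setup k C1 C2 C3 p ω0} {ω : ℝ → Plane → ℝ}
  (hL : H.IsLimit h σ ω) (hm : ∀ T, ∃ ψ, H.HasModulus h T ψ)
include hL hm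

lemma Setup.IsLimit.tendsto_polygon (ht : 0 ≤ t) (hx : x ∈ D.pts) :
    Tendsto (fun n => hL.path x n t) atTop (𝓝 (D.flowMap k ω0 h σ t x)) := by
  refine tendsto_nhds_limUnder ?_
  rcases ht.eq_or_lt with rfl | ht
  · exact ⟨x, by simp only [polygon_zero]; exact tendsto_const_nhds⟩
  · exact cauchySeq_tendsto_of_complete (hL.cauchySeq_polygon hm ht hx)

lemma Setup.IsLimit.mapsTo_flowMap (ht : 0 ≤ t) : MapsTo (D.flowMap k ω0 h σ t) D.pts D.pts := by
  intro x hx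
  obtain ⟨η, hη, hev⟩ := hL.eventually_polygon hm ht hx
  obtain ⟨n, hn1, hn2⟩ := ((hev 1 one_pos).and ((hL.tendsto_polygon hm ht hx).eventually
    (Metric.closedBall_mem_nhds _ hη))).exists
  refine (hn1.2 t ⟨ht, le_rfl⟩).1 ?_
  rw [mem_closedBall, dist_comm]
  exact hn2

lemma Setup.IsLimit.dist_flowMap_le (hs : 0 ≤ s) (hst : s ≤ t) (htT : t ≤ T) (hx : x ∈ D.pts) : dist
    (D.flowMap k ω0 h σ t x) (D.flowMap k ω0 h σ s x) ≤
      H.vBound T * (t - s) := by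
  have h1 := (hL.tendsto_polygon hm (hs.trans hst) hx).dist (hL.tendsto_polygon hm hs hx)
  have h2 : Tendsto (fun n => H.vBound T * (t - s + h (σ n))) atTop (𝓝 (H.vBound T *
        (t - s + 0))) := ((hL.steps.tendsto.comp hL.mono.tendsto_atTop).const_add _).const_mul _
  rw [add_zero] at h2
  refine le_of_tendsto_of_tendsto h1 h2 ?_
  filter_upwards [hL.eventually_le (hs.trans hst)] with n hn
  exact H.dist_polygon_le hL.steps hs hst htT hn x

lemma Setup.IsLimit.continuousOn_flowMap (hx : x ∈ D.pts) :
    ContinuousOn (fun t => D.flowMap k ω0 h σ t x) (Ici 0) := by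
  intro t ht
  set V := H.vBound (t + 1) with hV
  have hlip : ∀ s ∈ Icc 0 (t + 1), dist (D.flowMap k ω0 h σ s x) (D.flowMap k ω0 h σ t x) ≤
      V * |s - t| := by
    intro s hs
    rcases le_total s t with hst | hst
    · rw [dist_comm, abs_sub_comm, abs_of_nonneg (sub_nonneg.2 hst)]
      exact hL.dist_flowMap_le hm hs.1 hst (by linarith) hx
    · rw [abs_of_nonneg (sub_nonneg.2 hst)]
      exact hL.dist_flowMap_le hm ht hst hs.2 hx
  refine tendsto_iff_dist_tendsto_zero.2 (squeeze_zero' (g := fun s => V * |s - t|)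
    (.of_forall fun _ => dist_nonneg) ?_ ?_)
  · filter_upwards [self_mem_nhdsWithin, mem_nhdsWithin_of_mem_nhds (Iio_mem_nhds
      (show t < t + 1 by linarith))] with s h1 h2 using hlip s ⟨h1, (mem_Iio.1 h2).le⟩
  · have : Continuous fun s => V * |s - t| := by fun_prop
    simpa using (this.tendsto t).mono_left nhdsWithin_le_nhds

/-- The polygons solve the integral equation up to `V h`. The integrands converge pointwise by
convergence of the velocities along the polygons and continuity of the limit velocity, and they are
bounded by `V`. -/
lemma Setup.IsLimit.flowMap_integral (ht : 0 ≤ t) (hx : x ∈ D.pts) :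
    D.flowMap k ω0 h σ t x = x + ∫ s in (0 : ℝ)..t, D.velocity k (ω s) (D.flowMap k ω0 h σ s x) :=
      by
  obtain ⟨η, hη, hev⟩ := hL.eventually_polygon hm ht hx
  set V := H.vBound t with hV
  have hint : Tendsto (fun n => ∫ s in (0 : ℝ)..t, D.stepVel k (σ n) (D.approx k ω0 h (σ n) s)
      (hL.path x n s)) atTop
      (𝓝 (∫ s in (0 : ℝ)..t, D.velocity k (ω s) (D.flowMap k ω0 h σ s x))) := by
    refine intervalIntegral.tendsto_integral_filter_of_dominated_convergence (fun _ => V)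
      ?_ ?_ intervalIntegrable_const ?_
    · filter_upwards [hL.eventually_le ht] with n hn
      have := (H.polygon_integral hL.steps ht le_rfl hn x).1.aestronglyMeasurable
      rwa [uIoc_of_le ht]
    · filter_upwards [hL.eventually_le ht] with n hn
      refine Eventually.of_forall fun s hs => ?_
      rw [uIoc_of_le ht] at hs
      have := hL.steps.floor_le (σ n) hs.1.le
      exact H.norm_stepVel_le hL.steps (by linarith [hs.2]) (by linarith [hs.2]) _
    · refine Eventually.of_forall fun s hs => ?_
      rw [uIoc_of_le ht] at hs
      have hX := hL.mapsTo_flowMap hm hs.1.le hx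
      have hXp := hL.tendsto_polygon hm hs.1.le hx
      have hcont : Tendsto (fun n => D.velocity k (ω s) (hL.path x n s)) atTop
          (𝓝 (D.velocity k (ω s) (D.flowMap k ω0 h σ s x))) := by
        have h1 : ContinuousAt (D.velocity k (ω s)) (D.flowMap k ω0 h σ s x) :=
          (FlowDomain.continuousOn_velocity H.kernel H.reg H.C1_pos.le H.C2_pos.le H.two_lt
            (hL.memL1Ul hs.1.le)).continuousAt ((isOpen_pts H.reg).mem_nhds hX)
        have h2 := h1.tendsto.comp hXp
        exact h2
      refine hcont.congr_dist (Metric.tendsto_atTop.2 fun ε hε => ?_)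
      obtain ⟨N, hN⟩ := eventually_atTop.1 (hev (ε / 2) (half_pos hε))
      refine ⟨N, fun n hn => ?_⟩
      have := ((hN n hn).2 s ⟨hs.1.le, hs.2⟩).2
      rw [Real.dist_0_eq_abs, abs_of_nonneg dist_nonneg, dist_comm, dist_eq_norm]
      linarith
  have herr : Tendsto (fun n => V * h (σ n)) atTop (𝓝 0) := by
    have h1 := (hL.steps.tendsto.comp hL.mono.tendsto_atTop).const_mul V
    rw [mul_zero] at h1
    exact h1
  have hpol := ((hL.tendsto_polygon hm ht hx).sub_const x).sub hint
  have hzero : Tendsto (fun n => hL.path x n t - x - ∫ s in (0 : ℝ)..t,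
      D.stepVel k (σ n) (D.approx k ω0 h (σ n) s) (hL.path x n s)) atTop (𝓝 0) := by
    refine squeeze_zero_norm' ?_ herr
    filter_upwards [hL.eventually_le ht] with n hn
    exact (H.polygon_integral hL.steps ht le_rfl hn x).2
  have := tendsto_nhds_unique hpol hzero
  rw [sub_sub, sub_eq_zero] at this
  exact this

lemma Setup.IsLimit.isFlow : D.IsFlow (fun t => D.velocity k (ω t)) (D.flowMap k ω0 h σ) where
  selfMap t ht := SelfMap.of_mapsTo (hL.mapsTo_flowMap hm ht)
    (equivariant_of_tendsto (fun n => H.equivariant_traj _ _ _)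
      fun x hx => hL.tendsto_polygon hm ht hx)
  initial x hx := by
    have := hL.flowMap_integral hm le_rfl hx
    rwa [intervalIntegral.integral_same, add_zero] at this
  continuous x hx := hL.continuousOn_flowMap hm hx
  ode x hx t ht := by
    set f : ℝ → Plane := fun s => D.velocity k (ω s) (D.flowMap k ω0 h σ s x) with hf
    have hfc : ContinuousOn f (Ici 0) := by
      have h1 : ContinuousOn (fun s => (s, D.flowMap k ω0 h σ s x)) (Ici 0) :=
        continuousOn_id.prodMk (hL.continuousOn_flowMap hm hx)
      exact hL.continuousOn_velocity.comp h1 fun s hs => ⟨hs, hL.mapsTo_flowMap hm hs hx⟩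
    have hfi : IntervalIntegrable f volume 0 t :=
      (hfc.mono (by rw [uIcc_of_le ht.le]; exact Icc_subset_Ici_self)).intervalIntegrable
    have hIci : Ici (0 : ℝ) ∈ 𝓝 t := Ici_mem_nhds ht
    have hder := intervalIntegral.integral_hasDerivAt_right hfi
      (ContinuousOn.stronglyMeasurableAtFilter_nhdsWithin (hfc.mono Ioi_subset_Ici_self)
        measurableSet_Ioi t |>.filter_mono (by rw [isOpen_Ioi.nhdsWithin_eq ht]))
      (hfc.continuousAt hIci)
    refine (hder.const_add x).congr_of_eventuallyEq ?_
    filter_upwards [hIci] with s hs using hL.flowMap_integral hm hs hx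

lemma Setup.IsLimit.measurable_flowMap (ht : 0 ≤ t) :
    Measurable fun x : D.pts => D.flowMap k ω0 h σ t x := by
  obtain ⟨N, hN⟩ := eventually_atTop.1 (hL.eventually_le ht)
  refine measurable_of_tendsto_metrizable
    (f := fun n => fun x : D.pts => D.polygon k ω0 h (σ (n + N)) t x) (fun n => ?_)
    (tendsto_pi_nhds.2 fun x => ?_)
  · exact (H.continuous_traj hL.steps _ ((hL.steps.floor_le _ ht).trans
      (hN _ (by omega)))).measurable.comp measurable_subtype_coe
  · exact (tendsto_add_atTop_iff_nat N).2 (hL.tendsto_polygon hm ht x.2)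

lemma Setup.IsLimit.aemeasurable_flowMap (ht : 0 ≤ t) :
    AEMeasurable (D.flowMap k ω0 h σ t) D.area := by
  have h1 : Measurable (D.pts.indicator (D.flowMap k ω0 h σ t)) :=
    measurable_of_restrict_of_restrict_compl (f := D.pts.indicator (D.flowMap k ω0 h σ t))
    (measurableSet_pts H.reg) ?_ ?_
  · refine ⟨_, h1, ?_⟩
    filter_upwards [ae_area_mem_pts H.reg] with x hx
    rw [indicator_of_mem hx]
  · convert hL.measurable_flowMap hm ht using 1
    ext1 x
    simp
  · convert measurable_const (a := (0 : Plane)) using 1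
    ext1 x
    exact indicator_of_notMem x.2 _

/-- The scheme transports the vorticity along polygons that have never left the inner part. For each
starting point this cutoff is eventually inactive, since polygons keep a positive distance from the
boundary; by dominated convergence nothing is lost in the limit. -/
lemma Setup.IsLimit.integral_eq_flowMap (ht : 0 ≤ t) (hg : Continuous g)
    (hgd : D.Descends g) (hgb : D.BoundedTest g) :
    ∫ x, g x * ω t x ∂D.area = ∫ x, g (D.flowMap k ω0 h σ t x) * ω0 x ∂D.area := by
  classical
  obtain ⟨M, hM⟩ := hgb.bound
  have hM0 : 0 ≤ M := (abs_nonneg _).trans (hM 0)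
  have h1 := (hL.tendsto_integral ht hgb).comp (tendsto_prodMk_time ht)
  set F : ℕ → Plane → ℝ := fun n x =>
    (if ∀ i < ⌊t / h (σ n)⌋₊, D.traj k (σ n) (h (σ n)) ω0 i x ∈ innerPart (σ n) D.pts then
      g (hL.path x n t) else 0) * ω0 x with hF
  have hFe : ∀ᶠ n in atTop, ∫ x, g x * D.approx k ω0 h (σ n) t x ∂D.area = ∫ x, F n x ∂D.area := by
    filter_upwards [hL.eventually_le ht] with n hn
    exact H.integral_scheme hL.steps _ ((hL.steps.floor_le _ ht).trans hn) hg.measurable hgd hM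
  have hω0 : Integrable ω0 D.area := memLp_one_iff_integrable.1 H.mem.memL1
  have h2 : Tendsto (fun n => ∫ x, F n x ∂D.area) atTop
      (𝓝 (∫ x, g (D.flowMap k ω0 h σ t x) * ω0 x ∂D.area)) := by
    refine tendsto_integral_filter_of_dominated_convergence (fun x => M * ‖ω0 x‖) ?_ ?_
      (hω0.norm.const_mul M) ?_
    · filter_upwards [hL.eventually_le ht] with n hn
      have hc : ∀ i ≤ ⌊t / h (σ n)⌋₊, Continuous (D.traj k (σ n) (h (σ n)) ω0 i) := fun i hi => by
        refine H.continuous_traj hL.steps i (le_trans (mul_le_mul_of_nonneg_left ?_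
          (hL.steps.small _).pos.le) ((hL.steps.floor_le _ ht).trans hn))
        exact_mod_cast hi
      refine (Measurable.mul (Measurable.ite ?_ (hg.comp (hc _ le_rfl)).measurable
        measurable_const) H.meas).aestronglyMeasurable
      have : {x | ∀ i < ⌊t / h (σ n)⌋₊, D.traj k (σ n) (h (σ n)) ω0 i x ∈ innerPart (σ n) D.pts} =
          ⋂ i ∈ Finset.range ⌊t / h (σ n)⌋₊,
            D.traj k (σ n) (h (σ n)) ω0 i ⁻¹' innerPart (σ n) D.pts := by
        ext x; simp
      rw [this]
      exact Finset.measurableSet_biInter _ fun i hi => (hc i (Finset.mem_range.1 hi).le).measurable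
        (isOpen_innerPart _ (isOpen_pts H.reg)).measurableSet
    · refine Eventually.of_forall fun n => Eventually.of_forall fun x => ?_
      simp only [hF, norm_mul]
      refine mul_le_mul_of_nonneg_right ?_ (norm_nonneg _)
      split_ifs
      · exact hM _
      · simpa using hM0
    · filter_upwards [ae_area_mem_pts H.reg] with x hx
      obtain ⟨η, hη, hev⟩ := hL.eventually_polygon hm ht hx
      have h3 : Tendsto (fun n => g (hL.path x n t) * ω0 x) atTop
          (𝓝 (g (D.flowMap k ω0 h σ t x) * ω0 x)) := by
        have := ((hg.tendsto _).comp (hL.tendsto_polygon hm ht hx)).mul_const (ω0 x)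
        exact this
      refine h3.congr' ?_
      have hr := ((tendsto_one_div_add_atTop_nhds_zero_nat (𝕜 := ℝ)).comp
        hL.mono.tendsto_atTop).eventually (Iic_mem_nhds hη)
      filter_upwards [hev 1 one_pos, hr] with n h4 h5
      have hpos := (hL.steps.small (σ n)).pos
      have halive : ∀ i < ⌊t / h (σ n)⌋₊,
          D.traj k (σ n) (h (σ n)) ω0 i x ∈ innerPart (σ n) D.pts := by
        intro i hi
        have hit : h (σ n) * (i : ℝ) ≤ t := by
          refine le_trans (mul_le_mul_of_nonneg_left ?_ hpos.le) (hL.steps.floor_le (σ n) ht)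
          exact_mod_cast hi.le
        have h6 := (h4.2 (h (σ n) * i) ⟨by positivity, hit⟩).1
        rw [Setup.IsLimit.path, polygon, mul_div_cancel_left₀ _ hpos.ne', Nat.floor_natCast] at h6
        exact (Metric.closedBall_subset_closedBall h5).trans h6
      simp only [hF]
      rw [if_pos halive]
  exact tendsto_nhds_unique h1 (h2.congr' (hFe.mono fun n hn => hn.symm))

end

end FlowDomain

/-! ### From continuous to Borel test functions. -/

section Extension

variable {X Y : Type*} [MeasurableSpace X] {μ : Measure X} [MeasurableSpace Y]

lemma integral_map_withDensity_ofReal {A : X → Y} (hA : AEMeasurable A μ) {f : X → ℝ}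
    (hf : Integrable f μ) {Φ : Y → ℝ} (hΦ : Measurable Φ) :
    ∫ y, Φ y ∂((μ.withDensity fun x => ofReal (f x)).map A) = ∫ x, Φ (A x) * max (f x) 0 ∂μ := by
  rw [integral_map (hA.mono_ac (withDensity_absolutelyContinuous _ _)) hΦ.aestronglyMeasurable,
    integral_withDensity_eq_integral_toReal_smul₀ hf.aemeasurable.ennreal_ofReal
      (.of_forall fun _ => ofReal_lt_top)]
  refine integral_congr_ae (ae_of_all _ fun x => ?_)
  simp only [ENNReal.toReal_ofReal', smul_eq_mul, mul_comm]

/-- Equality of two weighted push-forwards can be tested on continuous functions of compact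
support. -/
lemma integral_comp_mul_eq_of_continuous [MetricSpace Y] [ProperSpace Y] [BorelSpace Y]
    {A B : X → Y} (hA : AEMeasurable A μ) (hB : AEMeasurable B μ) {f1 f2 : X → ℝ}
    (hf1 : Integrable f1 μ) (hf2 : Integrable f2 μ)
    (heq : ∀ g : Y → ℝ, Continuous g → HasCompactSupport g →
      ∫ x, g (A x) * f1 x ∂μ = ∫ x, g (B x) * f2 x ∂μ)
    {Φ : Y → ℝ} (hΦ : Measurable Φ) (hM : ∀ y, |Φ y| ≤ M) :
    ∫ x, Φ (A x) * f1 x ∂μ = ∫ x, Φ (B x) * f2 x ∂μ := by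
  set ν : (X → ℝ) → (X → Y) → Measure Y := fun f A =>
    (μ.withDensity fun x => ofReal (f x)).map A with hν
  have hfin : ∀ {f : X → ℝ}, Integrable f μ → ∀ A, IsFiniteMeasure (ν f A) := fun {f} hf A => by
    have := isFiniteMeasure_withDensity_ofReal hf.2
    exact Measure.isFiniteMeasure_map _ _
  have := hfin hf1 A
  have := hfin hf2 B
  have := hfin hf1.neg A
  have := hfin hf2.neg B
  have hint : ∀ {ρ : Measure Y} [IsFiniteMeasure ρ] {Ψ : Y → ℝ} {L : ℝ}, Measurable Ψ →
      (∀ y, |Ψ y| ≤ L) → Integrable Ψ ρ := fun h1 h2 =>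
    Integrable.of_bound h1.aestronglyMeasurable _ (.of_forall h2)
  have hdiff : ∀ {f : X → ℝ} {C : X → Y}, Integrable f μ → AEMeasurable C μ → ∀ {Ψ : Y → ℝ} {L : ℝ},
      Measurable Ψ → (∀ y, |Ψ y| ≤ L) → ∫ y, Ψ y ∂(ν f C) - ∫ y, Ψ y ∂(ν (-f) C) =
        ∫ x, Ψ (C x) * f x ∂μ := by
    intro f C hf hC Ψ L h1 h2
    have hi : ∀ {e : X → ℝ}, Integrable e μ → Integrable (fun x => Ψ (C x) * max (e x) 0) μ :=
      fun he => he.pos_part.bdd_mul (c := L) (h1.comp_aemeasurable hC).aestronglyMeasurable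
        (.of_forall fun x => h2 _)
    simp only [hν]
    rw [integral_map_withDensity_ofReal hC hf h1, integral_map_withDensity_ofReal hC hf.neg h1,
      ← integral_sub (hi hf) (hi hf.neg)]
    refine integral_congr_ae (ae_of_all _ fun x => ?_)
    simp only [Pi.neg_apply]
    rw [← mul_sub, max_zero_sub_max_neg_zero_eq_self]
  -- Negative parts are moved to the other side, so that the identity to be proved is between finite
  -- positive measures; these are determined by their integrals of compactly supported continuous
  -- functions.
  have hmeas : ν f1 A + ν (-f2) B = ν (-f1) A + ν f2 B := by
    refine Measure.ext_of_integral_eq_on_compactlySupported fun g => ?_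
    obtain ⟨L, hL⟩ := g.hasCompactSupport.exists_bound_of_continuous g.continuous
    have hgm : Measurable (g : Y → ℝ) := g.continuous.measurable
    rw [integral_add_measure (hint hgm hL) (hint hgm hL),
      integral_add_measure (hint hgm hL) (hint hgm hL)]
    have h1 := hdiff hf1 hA hgm hL
    have h2 := hdiff hf2 hB hgm hL
    have h3 := heq g g.continuous g.hasCompactSupport
    linarith
  have h1 := hdiff hf1 hA hΦ hM
  have h2 := hdiff hf2 hB hΦ hM
  have h3 := congrArg (fun ρ => ∫ y, Φ y ∂ρ) hmeas
  rw [integral_add_measure (hint hΦ hM) (hint hΦ hM),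
    integral_add_measure (hint hΦ hM) (hint hΦ hM)] at h3
  linarith

end Extension

/-- Realizes the torus inside `ℂ × ℂ`. A continuous function there pulls back to a continuous
periodic function, and a Borel periodic function factors through this map by means of
`flatTorusSection`; so periodic test functions are reduced to the general extension lemma. -/
def flatTorusMap (x : Plane) : ℂ × ℂ := (Complex.exp (((2 * π * x 0 : ℝ) : ℂ) * Complex.I),
    Complex.exp (((2 * π * x 1 : ℝ) : ℂ) * Complex.I))

def flatTorusSection (z : ℂ × ℂ) : Plane := !₂[Complex.arg z.1 / (2 * π), Complex.arg z.2 / (2 * π)]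

lemma continuous_flatTorusMap : Continuous flatTorusMap := by
  unfold flatTorusMap
  fun_prop

lemma measurable_flatTorusSection : Measurable flatTorusSection := by
  unfold flatTorusSection
  refine (MeasurableEquiv.toLp 2 (Fin 2 → ℝ)).measurable.comp (measurable_pi_iff.2 fun i => ?_)
  fin_cases i
  · exact (Complex.measurable_arg.comp measurable_fst).div_const _
  · exact (Complex.measurable_arg.comp measurable_snd).div_const _

lemma flatTorusMap_add_latticeVec (x : Plane) (m : Fin 2 → ℤ) :
    flatTorusMap (x + latticeVec m) = flatTorusMap x := by
  have h : ∀ (a : ℝ) (n : ℤ), Complex.exp (((2 * π * (a + n) : ℝ) : ℂ) * Complex.I) =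
      Complex.exp (((2 * π * a : ℝ) : ℂ) * Complex.I) := fun a n => by
    refine Eq.trans (congrArg Complex.exp ?_) (Complex.exp_periodic.int_mul n _)
    push_cast
    ring
  simp only [flatTorusMap, PiLp.add_apply, latticeVec_apply, h]

lemma exists_flatTorusSection_flatTorusMap (x : Plane) :
    ∃ m, x = flatTorusSection (flatTorusMap x) + latticeVec m := by
  have h : ∀ a : ℝ, ∃ n : ℤ, a = Complex.arg (Complex.exp (((2 * π * a : ℝ) : ℂ) *
      Complex.I)) / (2 * π) + n := fun a => by
    refine ⟨toIocDiv (mul_pos two_pos pi_pos) (-π) (2 * π * a), ?_⟩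
    rw [Complex.arg_exp_mul_I, toIocMod, zsmul_eq_mul]
    have := Real.pi_ne_zero
    field_simp
    ring
  choose n hn using h
  refine ⟨fun i => n (x i), ?_⟩
  ext i
  fin_cases i
  · exact hn (x 0)
  · exact hn (x 1)

namespace FlowDomain

lemma integral_mul_eq_of_continuous (hD : D.IsRegular) {X : Plane → Plane}
    (hX : AEMeasurable X D.area) {f1 f2 : Plane → ℝ} (hf1 : Integrable f1 D.area)
    (hf2 : Integrable f2 D.area)
    (heq : ∀ g : Plane → ℝ, Continuous g → D.Descends g → D.BoundedTest g →
      ∫ x, g x * f1 x ∂D.area = ∫ x, g (X x) * f2 x ∂D.area) (hφ : Measurable φ)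
        (hM : ∀ x, |φ x| ≤ M) (hd : D.Descends φ) :
    ∫ x, φ x * f1 x ∂D.area = ∫ x, φ (X x) * f2 x ∂D.area := by
  cases D with
  | region Ω =>
    refine integral_comp_mul_eq_of_continuous (A := fun x => x) aemeasurable_id hX hf1 hf2
      (fun g hg hgc => heq g hg trivial ⟨hg.aestronglyMeasurable,
        hgc.exists_bound_of_continuous hg, ?_⟩) hφ hM
    obtain ⟨R, hR⟩ := hgc.isCompact.isBounded.subset_closedBall (0 : Plane)
    refine ⟨R, fun x _ hx => image_eq_zero_of_notMem_tsupport fun hc => ?_⟩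
    have := hR hc
    rw [mem_closedBall_zero_iff] at this
    linarith
  | torus =>
    have hφe : ∀ x, φ x = φ (flatTorusSection (flatTorusMap x)) := fun x => by
      obtain ⟨m, hm⟩ := exists_flatTorusSection_flatTorusMap x
      conv_lhs => rw [hm]
      exact hd m _
    have key := integral_comp_mul_eq_of_continuous (A := flatTorusMap)
      (B := fun x => flatTorusMap (X x))
      continuous_flatTorusMap.aemeasurable (continuous_flatTorusMap.measurable.comp_aemeasurable hX)
      hf1 hf2 (fun g hg hgc => ?_) (hφ.comp measurable_flatTorusSection) (fun _ => hM _)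
    · simp only [comp_apply, ← hφe] at key
      exact key
    · have hc : Continuous fun x => g (flatTorusMap x) := hg.comp continuous_flatTorusMap
      obtain ⟨L, hL⟩ := hgc.exists_bound_of_continuous hg
      obtain ⟨R, hR⟩ := (Metric.isBounded_closedBall.subset
        torus_cell_subset_closedBall).subset_closedBall (0 : Plane)
      refine heq _ hc (fun m x => by simp only [flatTorusMap_add_latticeVec])
        ⟨hc.aestronglyMeasurable, ⟨L, fun x => hL _⟩, R, fun x hx hRx => ?_⟩
      have := hR hx
      rw [mem_closedBall_zero_iff] at this
      linarith

lemma Setup.IsLimit.isLagrangian {H : D.Setup k C1 C2 C3 p ω0}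
    {ω : ℝ → Plane → ℝ} (hL : H.IsLimit h σ ω) (hm : ∀ T, ∃ ψ, H.HasModulus h T ψ) :
    D.IsLagrangian ω0 ω fun t => D.velocity k (ω t) := by
  refine ⟨D.flowMap k ω0 h σ, hL.isFlow hm, fun t ht => hL.measurable_flowMap hm ht, ?_⟩
  refine (ae_restrict_iff' measurableSet_Ici).2 (.of_forall fun t ht φ hφ hM hd => ?_)
  obtain ⟨M, hM⟩ := hM
  have h0 : (0 : ℝ) ≤ t := ht
  have := integral_mul_eq_of_continuous H.reg (hL.aemeasurable_flowMap hm h0)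
    (memLp_one_iff_integrable.1 (hL.memL1Ul h0).memL1) (memLp_one_iff_integrable.1 H.mem.memL1)
    (fun g hg hgd hgb => hL.integral_eq_flowMap hm h0 hg hgd hgb) hφ hM hd
  simpa only [mul_comm] using this

/-! ### Assembly of the existence theorem. -/

lemma ulNorm_congr (h : f =ᵐ[D.area] g) (q : ℝ) : D.ulNorm q f = D.ulNorm q g := by
  simp only [ulNorm, eLpNorm_congr_ae (ae_restrict_of_ae h)]

lemma yulNorm_congr (h : f =ᵐ[D.area] g) (Θ : ℝ → ℝ) : D.yulNorm Θ f = D.yulNorm Θ g := by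
  simp only [yulNorm, ulNorm_congr h]

/-- The scheme composes the datum with homeomorphisms, so a genuinely measurable representative is
wanted. On the torus it is also made periodic, by evaluating it at the representative of the point
in the cell. -/
lemma MemL1Ul.exists_measurable (hD : D.IsRegular) (hf : D.MemL1Ul p f) :
    ∃ g, Measurable g ∧ D.MemL1Ul p g ∧ g =ᵐ[D.area] f := by
  suffices h : ∃ g, Measurable g ∧ D.Descends g ∧ g =ᵐ[D.area] f by
    obtain ⟨g, h1, h2, h3⟩ := h
    exact ⟨g, h1, ⟨h2, (memLp_congr_ae h3).2 hf.memL1, by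
      rw [ulNorm_congr h3]; exact hf.ul_finite⟩, h3⟩
  have hm := hf.memL1.aestronglyMeasurable
  cases D with
  | region Ω => exact ⟨_, hm.stronglyMeasurable_mk.measurable, trivial, hm.ae_eq_mk.symm⟩
  | torus =>
    refine ⟨fun x => hm.mk f (x - latticeVec (floorVec x)), hm.stronglyMeasurable_mk.measurable.comp
      (measurable_id.sub (measurable_latticeVec.comp measurable_floorVec)), fun m x => ?_, ?_⟩
    · simp only [floorVec_add_latticeVec, latticeVec_add, add_sub_add_right_eq_sub]
    · filter_upwards [hm.ae_eq_mk, ae_area_mem_cell hD] with x h1 h2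
      rw [floorVec_eq_zero_iff.2 h2, latticeVec_zero, sub_zero, h1]

/-- The constant may depend on `p`, so `holderConst p` is part of it; the prefactor `max 1 (1/(p-2))
* p` in the final estimate is used only through being at least one. -/
def holderSolConst (C1 C2 C3 p T N1 N : ℝ) : ℝ :=
  velBound C1 C3 p T N1 N + ulBound C1 C3 p T N1 N + holdBound C1 C2 C3 p T N1 N

def yudovichSolConst (C1 C2 C3 T N1 Y Θ3 : ℝ) : ℝ :=
  yulFactor C1 C3 T N1 Y Θ3 * Y + yulVel C1 C3 T N1 Y Θ3 + (modConst C1 C2 C3 T N1 Y Θ3 * exp 2 +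
      2 * yulVel C1 C3 T N1 Y Θ3 / (exp (-2) * 3 * Θ3))

lemma exists_solution (hD : D.IsRegular) (hC1 : 0 < C1) (hC2 : 0 < C2) (hC3 : 0 < C3) (hp : 2 < p)
    (hk : D.KernelBounds k C1 C2) (hK : D.OperatorBounds k p C3) (ω0 : Plane → ℝ)
    (hω0 : D.MemL1Ul p ω0) :
    ∃ (ω : ℝ → Plane → ℝ) (v : ℝ → Plane → Plane), D.IsWeakSolution k p ω0 ω v ∧
      (∀ T > 0, ∀ C, C = holderSolConst C1 C2 C3 p T (eLpNorm ω0 1 D.area).toReal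
          (D.ulNorm p ω0).toReal → ∀ᵐ t ∂(volume.restrict (Icc 0 T)),
          eLpNorm (ω t) 1 D.area ≤ eLpNorm ω0 1 D.area ∧ D.ulNorm p (ω t) ≤ ofReal C ∧
          (∀ x ∈ D.pts, ‖v t x‖ ≤ C) ∧ (∀ x ∈ D.pts, ∀ y ∈ D.pts, ‖v t x - v t y‖ ≤
              max 1 (1 / (p - 2)) * (C * p) * D.gdist x y ^ (1 - 2 / p))) ∧
      (∀ Θ : ℝ → ℝ, IsGrowth Θ → D.yulNorm Θ ω0 < ∞ →
        (∀ T > 0, ∀ C, C = yudovichSolConst C1 C2 C3 T (eLpNorm ω0 1 D.area).toReal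
            (D.yulNorm Θ ω0).toReal (Θ 3) → ∀ᵐ t ∂(volume.restrict (Icc 0 T)),
            D.yulNorm Θ (ω t) ≤ ofReal C ∧ (∀ x ∈ D.pts, ‖v t x‖ ≤ C) ∧
            (∀ x ∈ D.pts, ∀ y ∈ D.pts, ‖v t x - v t y‖ ≤ C * phiMod Θ (D.gdist x y))) ∧
        (OsgoodGrowth Θ → D.IsLagrangian ω0 ω v)) := by
  obtain ⟨ω1, hm, hmem, hae⟩ := hω0.exists_measurable hD
  have H : D.Setup k C1 C2 C3 p ω1 := ⟨hD, hC1, hC2, hC3, hp, hk, hK, hm, hmem⟩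
  obtain ⟨h, σ, ω, hL⟩ := H.exists_limit
  have hN1 : eLpNorm ω1 1 D.area = eLpNorm ω0 1 D.area := eLpNorm_congr_ae hae
  refine ⟨ω, fun t => D.velocity k (ω t), ?_, ?_, fun Θ hΘ hY => ⟨?_, fun hO => ?_⟩⟩
  · refine { hL.isWeakSolution with weak_form := fun T hT φ hφ => ?_ }
    rw [← hL.isWeakSolution.weak_form T hT φ hφ]
    congr 1
    exact integral_congr_ae (hae.mono fun x hx => by simp only [hx])
  · rintro T - C rfl
    rw [← ulNorm_congr hae, ← hN1]
    change ∀ᵐ t ∂(volume.restrict (Icc 0 T)), eLpNorm (ω t) 1 D.area ≤ eLpNorm ω1 1 D.area ∧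
      D.ulNorm p (ω t) ≤ ofReal (holderSolConst C1 C2 C3 p T (D.mass ω1) (D.ulNorm p ω1).toReal) ∧ _
    have hV := H.velBound_nonneg T
    have hU : 0 ≤ ulBound C1 C3 p T (D.mass ω1) (D.ulNorm p ω1).toReal :=
      ulBound_nonneg toReal_nonneg
    have hB := H.holdBound_nonneg T
    refine ae_restrict_of_forall_mem measurableSet_Icc fun t ht => ⟨hL.mass_le ht.1, ?_,
      fun x hx => ?_, fun x hx y hy => ?_⟩
    · refine (hL.ulNorm_le_ulBound ht).trans (ofReal_le_ofReal ?_)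
      unfold holderSolConst; linarith
    · refine (hL.velocity_le hp toReal_nonneg H.ulNorm_le_ofReal ht hx).trans ?_
      unfold holderSolConst; linarith
    · refine (hL.velocity_holder ht hx hy).trans ?_
      refine mul_le_mul_of_nonneg_right ?_ (rpow_nonneg (gdist_nonneg _ _) _)
      have h1 : (1 : ℝ) ≤ max 1 (1 / (p - 2)) := le_max_left _ _
      set C := holderSolConst C1 C2 C3 p T (D.mass ω1) (D.ulNorm p ω1).toReal with hC
      have h2 : holdBound C1 C2 C3 p T (D.mass ω1) (D.ulNorm p ω1).toReal ≤ C := by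
        rw [hC]; unfold holderSolConst; linarith
      have h3 : C ≤ C * p := le_mul_of_one_le_right (hB.trans h2) (by linarith)
      exact h2.trans (h3.trans (le_mul_of_one_le_left ((hB.trans h2).trans h3) h1))
  · rintro T - C rfl
    rw [← yulNorm_congr hae] at hY ⊢
    rw [← hN1]
    have hΘ3 := hΘ.2 3 (by norm_num)
    have hY0 := toReal_nonneg (a := D.yulNorm Θ ω1)
    have hM0 := mass_nonneg (D := D) ω1
    have h1 := yulVel_nonneg (C3 := C3) (T := T) hC1.le hM0 hY0 hΘ3
    have h2 := modConst_nonneg (C3 := C3) (T := T) hC1.le hC2.le hM0 hY0 hΘ3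
    have h3 := mul_nonneg (yulFactor_nonneg (C1 := C1) (C3 := C3) (T := T)
      (N1 := D.mass ω1) (Y := (D.yulNorm Θ ω1).toReal) (Θ3 := Θ 3)) hY0
    have h4 := mul_nonneg h2 (exp_pos 2).le
    have h5 : 0 ≤ 2 * yulVel C1 C3 T (D.mass ω1) (D.yulNorm Θ ω1).toReal (Θ 3) /
      (exp (-2) * 3 * Θ 3) := by positivity
    refine ae_restrict_of_forall_mem measurableSet_Icc fun t ht => ⟨?_, fun x hx => ?_,
      fun x hx y hy => hL.velocity_phiMod hΘ hY ht hx hy ?_ ?_⟩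
    · refine (hL.yulNorm_le hΘ hY ht).trans (ofReal_le_ofReal ?_)
      unfold yudovichSolConst; linarith
    · refine (hL.velocity_le_growth hΘ hY ht hx).trans ?_
      unfold yudovichSolConst; linarith
    · unfold yudovichSolConst; linarith
    · unfold yudovichSolConst; linarith
  · rw [← yulNorm_congr hae] at hY
    obtain ⟨X, hX, hXm, hXp⟩ := hL.isLagrangian fun T => H.hasModulus hL.steps hΘ hO hY T
    refine ⟨X, hX, hXm, hXp.mono fun t ht φ h1 h2 h3 => (ht φ h1 h2 h3).trans ?_⟩
    exact integral_congr_ae (hae.mono fun x hx => by simp only [hx])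

end FlowDomain

/-! ### The Biot–Savart kernel of the plane. -/

def perpL : Plane →L[ℝ] Plane := LinearMap.toContinuousLinearMap
    { toFun := perp
      map_add' := fun x y => by ext i; fin_cases i <;> simp [perp, add_comm]
      map_smul' := fun c x => by ext i; fin_cases i <;> simp [perp] }

lemma perpL_apply (x : Plane) : perpL x = perp x := rfl

lemma norm_perp (x : Plane) : ‖perp x‖ = ‖x‖ := by
  simp [EuclideanSpace.norm_eq, perp, Fin.sum_univ_two, add_comm]

lemma perp_perp (x : Plane) : perp (perp x) = -x := by
  ext i; fin_cases i <;> simp [perp]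

lemma perp_neg (x : Plane) : perp (-x) = -perp x := perpL.map_neg x

lemma perp_smul (c : ℝ) (x : Plane) : perp (c • x) = c • perp x := perpL.map_smul c x

def mkPlane (q : ℝ × ℝ) : Plane := !₂[q.1, q.2]

lemma measurableEmbedding_mkPlane : MeasurableEmbedding mkPlane :=
  ((MeasurableEquiv.finTwoArrow (α := ℝ)).symm.trans (MeasurableEquiv.toLp 2 _)).measurableEmbedding

lemma measurePreserving_mkPlane : MeasurePreserving mkPlane := by
  have h1 := (volume_preserving_finTwoArrow ℝ).symm
  have h2 := PiLp.volume_preserving_toLp (Fin 2)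
  exact h2.comp h1

lemma continuous_mkPlane : Continuous mkPlane := by
  unfold mkPlane; fun_prop

lemma integral_plane_eq_polar {E : Type*} [NormedAddCommGroup E] [NormedSpace ℝ E] (f : Plane → E) :
    ∫ x, f x = ∫ q in Ioi (0 : ℝ) ×ˢ Ioo (-π) π,
      q.1 • f (mkPlane (q.1 * cos q.2, q.1 * sin q.2)) := by
  rw [← measurePreserving_mkPlane.integral_comp measurableEmbedding_mkPlane,
    ← integral_comp_polarCoord_symm]
  rfl

lemma hasDerivAt_mkPlane {f g : ℝ → ℝ} {f' g' t : ℝ} (hf : HasDerivAt f f' t)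
    (hg : HasDerivAt g g' t) : HasDerivAt (fun t => mkPlane (f t, g t)) (mkPlane (f', g')) t :=
  (LinearMap.toContinuousLinearMap
    { toFun := mkPlane
      map_add' := fun x y => by ext i; fin_cases i <;> simp [mkPlane]
      map_smul' := fun c x => by ext i; fin_cases i <;> simp
        [mkPlane] }).hasFDerivAt.comp_hasDerivAt
    t (hf.prodMk hg)

lemma hasDerivAt_polar_angle (hφ : Differentiable ℝ φ) (r θ : ℝ) :
    HasDerivAt (fun θ => φ (mkPlane (r * cos θ, r * sin θ)))
      (fderiv ℝ φ (mkPlane (r * cos θ, r * sin θ)) (perp (mkPlane (r * cos θ, r * sin θ)))) θ := by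
  have e : perp (mkPlane (r * cos θ, r * sin θ)) = mkPlane (r * -sin θ, r * cos θ) := by
    ext i; fin_cases i <;> simp [mkPlane, perp]
  have h1 := hasDerivAt_mkPlane ((Real.hasDerivAt_cos θ).const_mul r)
    ((Real.hasDerivAt_sin θ).const_mul r)
  rw [e]
  exact (hφ _).hasFDerivAt.comp_hasDerivAt θ h1

lemma hasDerivAt_polar_radius (hφ : Differentiable ℝ φ) (r θ : ℝ) :
    HasDerivAt (fun r => φ (mkPlane (r * cos θ, r * sin θ)))
      (fderiv ℝ φ (mkPlane (r * cos θ, r * sin θ)) (mkPlane (cos θ, sin θ))) r := by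
  have h1 := hasDerivAt_mkPlane ((hasDerivAt_id r).mul_const (cos θ))
    ((hasDerivAt_id r).mul_const (sin θ))
  simp only [id, one_mul] at h1
  exact (hφ _).hasFDerivAt.comp_hasDerivAt r h1

lemma norm_mkPlane_polar (r θ : ℝ) : ‖mkPlane (r * cos θ, r * sin θ)‖ = |r| := by
  rw [EuclideanSpace.norm_eq, ← Real.sqrt_sq_eq_abs]
  congr 1
  simp only [mkPlane, Fin.sum_univ_two, norm_eq_abs, sq_abs]
  simp
  linear_combination r ^ 2 * Real.cos_sq_add_sin_sq θ

/-- Since `perp x` points in the angular direction, in polar coordinates the integrand is a function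
of the radius times an angular derivative, which integrates to zero over each circle. If it is not
integrable the integral is zero by convention. -/
lemma integral_radial_mul_fderiv_perp (hφ : ContDiff ℝ 1 φ) (η : ℝ → ℝ) :
    ∫ x, η ‖x‖ * fderiv ℝ φ x (perp x) = 0 := by
  rw [integral_plane_eq_polar]
  by_cases h : IntegrableOn (fun q : ℝ × ℝ =>
      q.1 • (η ‖mkPlane (q.1 * cos q.2, q.1 * sin q.2)‖ *
        fderiv ℝ φ (mkPlane (q.1 * cos q.2, q.1 * sin q.2))
          (perp (mkPlane (q.1 * cos q.2, q.1 * sin q.2)))))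
      (Ioi (0 : ℝ) ×ˢ Ioo (-π) π)
  · rw [Measure.volume_eq_prod, setIntegral_prod _ h]
    refine integral_eq_zero_of_ae (.of_forall fun r => ?_)
    simp only [norm_mkPlane_polar, smul_eq_mul, Pi.zero_apply]
    rw [← integral_Ioc_eq_integral_Ioo, ← intervalIntegral.integral_of_le (by linarith [pi_pos]),
      intervalIntegral.integral_const_mul, intervalIntegral.integral_const_mul,
      intervalIntegral.integral_eq_sub_of_hasDerivAt
        (fun θ _ => hasDerivAt_polar_angle (hφ.differentiable (by simp)) r θ)]
    · simp
    · have h1 : Continuous fun θ => mkPlane (r * cos θ, r * sin θ) :=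
        continuous_mkPlane.comp (by fun_prop)
      exact (((hφ.continuous_fderiv (by simp)).comp h1).clm_apply
        (perpL.continuous.comp h1)).intervalIntegrable _ _
  · exact integral_undef h

/-- Normalized to be its own Fourier transform, so that Poisson summation carries no constants. -/
def gauss (x : Plane) : ℝ := exp (-(π * ‖x‖ ^ 2))

lemma integrable_one_add_mul_exp : Integrable fun r : ℝ => (1 + r) * exp (-(π * r ^ 2)) := by
  have := (integrable_exp_neg_mul_sq pi_pos).add (integrable_mul_exp_neg_mul_sq pi_pos)
  refine this.congr (.of_forall fun r => ?_)
  simp only [Pi.add_apply, neg_mul]; ring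

lemma integrableOn_polar_of_gauss {f : ℝ × ℝ → ℝ} (hf : ContinuousOn f (Ioi 0 ×ˢ univ))
    (hC : ∀ r > 0, ∀ θ, |f (r, θ)| ≤ C * ((1 + r) * exp (-(π * r ^ 2)))) :
    IntegrableOn f (Ioi (0 : ℝ) ×ˢ Ioo (-π) π) := by
  have h2 : Integrable (fun q : ℝ × ℝ => C * ((1 + q.1) * exp (-(π * q.1 ^ 2))))
      ((volume.restrict (Ioi 0)).prod (volume.restrict (Ioo (-π) π))) :=
    ((integrable_one_add_mul_exp.const_mul C).restrict).comp_fst _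
  rw [Measure.prod_restrict, ← Measure.volume_eq_prod] at h2
  have hm : MeasurableSet (Ioi (0 : ℝ) ×ˢ Ioo (-π) π) := measurableSet_Ioi.prod measurableSet_Ioo
  refine h2.mono' ((hf.mono (prod_mono le_rfl (subset_univ _))).aestronglyMeasurable hm) ?_
  exact (ae_restrict_mem hm).mono fun q hq => hC q.1 hq.1 q.2

/-- The Gaussian multiple of the fundamental vector field `x / (2π |x|²)` has divergence
`δ - gauss`. -/
lemma integral_gauss_radial (hφ : ContDiff ℝ 1 φ)
    (h0 : ∀ x, |φ x| ≤ M) (h1 : ∀ x, ‖fderiv ℝ φ x‖ ≤ M) :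
    ∫ x, (gauss x * φ x - gauss x / (2 * π * ‖x‖ ^ 2) * fderiv ℝ φ x x) = φ 0 := by
  have hd : Differentiable ℝ φ := hφ.differentiable (by simp)
  have hM : 0 ≤ M := (abs_nonneg _).trans (h0 0)
  set P : ℝ × ℝ → Plane := fun q => mkPlane (q.1 * cos q.2, q.1 * sin q.2) with hP
  have hPc : Continuous P := continuous_mkPlane.comp (by fun_prop)
  -- In polar coordinates, including the Jacobian, the integrand is the radial derivative of
  -- `-exp(-πr²) φ / (2π)`; each ray contributes `φ 0 / (2π)`.
  set g : ℝ × ℝ → ℝ := fun q => -(1 / (2 * π)) *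
    (exp (-(π * q.1 ^ 2)) * (fderiv ℝ φ (P q) (mkPlane (cos q.2, sin q.2))) -
      2 * π * q.1 * exp (-(π * q.1 ^ 2)) * φ (P q)) with hg
  have hgc : Continuous g := by
    have h2 := (hφ.continuous_fderiv (by simp)).comp hPc
    have h3 : Continuous fun q : ℝ × ℝ => mkPlane (cos q.2, sin q.2) :=
      continuous_mkPlane.comp (by fun_prop)
    have h4 := h2.clm_apply h3
    have h5 := hφ.continuous.comp hPc
    simp only [comp_def] at h4 h5
    fun_prop
  have hπ := pi_pos
  rw [integral_plane_eq_polar]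
  have hm : MeasurableSet (Ioi (0 : ℝ) ×ˢ Ioo (-π) π) := measurableSet_Ioi.prod measurableSet_Ioo
  rw [setIntegral_congr_fun (g := g) hm]
  rotate_left
  · rintro ⟨r, θ⟩ ⟨hr, -⟩
    have hr : 0 < r := hr
    have e : mkPlane (r * cos θ, r * sin θ) = r • mkPlane (cos θ, sin θ) := by
      ext i; fin_cases i <;> simp [mkPlane]
    have e2 : gauss (mkPlane (r * cos θ, r * sin θ)) =
        exp (-(π * r ^ 2)) := by simp [gauss, norm_mkPlane_polar]
    simp only [hg, hP, e2, norm_mkPlane_polar, sq_abs, smul_eq_mul]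
    nth_rw 3 [e]
    rw [map_smul, smul_eq_mul]
    field_simp
    ring
  have hb : ∀ r > 0, ∀ θ, |g (r, θ)| ≤ (3 * M) * ((1 + r) * exp (-(π * r ^ 2))) := by
    intro r hr θ
    have hE := exp_pos (-(π * r ^ 2))
    set E := exp (-(π * r ^ 2))
    have n1 : ‖mkPlane (cos θ, sin θ)‖ = 1 := by simpa using norm_mkPlane_polar 1 θ
    have a1 : |fderiv ℝ φ (P (r, θ)) (mkPlane (cos θ, sin θ))| ≤ M := by
      have := (fderiv ℝ φ (P (r, θ))).le_opNorm (mkPlane (cos θ, sin θ))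
      rw [n1, mul_one] at this
      exact this.trans (h1 _)
    have a2 := h0 (P (r, θ))
    have a3 : 1 / (2 * π) ≤ 1 := by
      rw [div_le_one (by positivity)]; linarith [pi_gt_three]
    have e1 : g (r, θ) = r * E * φ (P (r, θ)) - (1 / (2 * π)) *
        (E * fderiv ℝ φ (P (r, θ)) (mkPlane (cos θ, sin θ))) := by
      simp only [hg]; field_simp; ring
    rw [e1]
    refine (abs_sub _ _).trans ?_
    rw [abs_mul, abs_mul, abs_mul, abs_mul, abs_of_pos hr, abs_of_pos hE,
      abs_of_pos (by positivity : 0 < 1 / (2 * π))]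
    have b1 : r * E * |φ (P (r, θ))| ≤ r * E * M := by gcongr
    have b2 : 1 / (2 * π) * (E * |fderiv ℝ φ (P (r, θ)) (mkPlane (cos θ, sin θ))|)
        ≤ 1 * (E * M) := by gcongr
    nlinarith [mul_nonneg hM (mul_nonneg hr.le hE.le), mul_nonneg hM hE.le]
  have hgi := integrableOn_polar_of_gauss hgc.continuousOn hb
  rw [Measure.volume_eq_prod, ← Measure.prod_restrict, integral_prod_symm _
    (by rwa [Measure.prod_restrict, ← Measure.volume_eq_prod])]
  have key : ∀ θ, ∫ r in Ioi (0 : ℝ), g (r, θ) = 1 / (2 * π) * φ 0 := by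
    intro θ
    have hder : ∀ r, HasDerivAt (fun r => -(1 / (2 * π)) *
        (exp (-(π * r ^ 2)) * φ (P (r, θ)))) (g (r, θ)) r := by
      intro r
      have d1 : HasDerivAt (fun r : ℝ => exp (-(π * r ^ 2)))
          (exp (-(π * r ^ 2)) * (-(π * (2 * r)))) r := by
        have := (((hasDerivAt_pow 2 r).const_mul π).neg).exp
        simpa using this
      have d2 := (d1.mul (hasDerivAt_polar_radius hd r θ)).const_mul (-(1 / (2 * π)))
      refine d2.congr_deriv ?_
      simp only [hg, hP]; ring
    have hint : IntegrableOn (fun r => g (r, θ)) (Ioi 0) := by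
      refine (integrable_one_add_mul_exp.const_mul (3 * M)).integrableOn.mono'
        (hgc.comp (by fun_prop)).aestronglyMeasurable ?_
      exact (ae_restrict_mem measurableSet_Ioi).mono fun r hr => hb r hr θ
    have hlim : Tendsto (fun r => -(1 / (2 * π)) *
        (exp (-(π * r ^ 2)) * φ (P (r, θ)))) atTop (𝓝 0) := by
      have l1 : Tendsto (fun r : ℝ => exp (-(π * r ^ 2))) atTop (𝓝 0) :=
        Real.tendsto_exp_neg_atTop_nhds_zero.comp
          ((tendsto_pow_atTop two_ne_zero).const_mul_atTop hπ)
      have l2 : Tendsto (fun r : ℝ => exp (-(π * r ^ 2)) * φ (P (r, θ))) atTop (𝓝 0) :=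
        l1.zero_mul_isBoundedUnder_le (isBoundedUnder_of ⟨M, fun r => by simpa using h0 (P (r, θ))⟩)
      simpa using l2.const_mul (-(1 / (2 * π)))
    rw [integral_Ioi_of_hasDerivAt_of_tendsto' (fun r _ => hder r) hint hlim]
    have : P (0, θ) = 0 := by
      simp only [hP]; ext i; fin_cases i <;> simp [mkPlane]
    simp [this]
  simp_rw [key]
  rw [setIntegral_const, Measure.real, Real.volume_Ioo, toReal_ofReal (by linarith)]
  simp only [smul_eq_mul]
  field_simp
  ring

/-- The Biot–Savart kernel `x^⊥ / (2π |x|²)` of the plane as a function of one variable. -/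
def biotSavart (x : Plane) : Plane := (1 / (2 * π * ‖x‖ ^ 2)) • perp x

lemma biotSavart_neg (x : Plane) : biotSavart (-x) = -biotSavart x := by simp [biotSavart, perp_neg]

lemma norm_biotSavart (x : Plane) : ‖biotSavart x‖ = 1 / (2 * π) / ‖x‖ := by
  rw [biotSavart, norm_smul, norm_perp, norm_of_nonneg (by have := pi_pos; positivity)]
  by_cases h : ‖x‖ = 0
  · simp [h]
  · field_simp

/-- Up to a rotation and a constant the kernel is the inversion `x ↦ x/‖x‖²`, for which the
oscillation bound is an identity. -/
lemma norm_biotSavart_sub (hx : x ≠ 0) (hy : y ≠ 0) :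
    ‖biotSavart x - biotSavart y‖ = 1 / (2 * π) * (‖x - y‖ / (‖x‖ * ‖y‖)) := by
  have e : ∀ z : Plane, biotSavart z = (1 / (2 * π)) • perp ((1 / ‖z‖) ^ 2 • z) := fun z => by
    rw [biotSavart, perp_smul, smul_smul]
    congr 1
    by_cases h : ‖z‖ = 0
    · simp [h]
    · have := pi_pos; field_simp
  have h1 := dist_div_norm_sq_smul hx hy 1
  rw [e, e, ← smul_sub, norm_smul, ← perpL_apply, ← perpL_apply, ← map_sub, perpL_apply, norm_perp,
    ← dist_eq_norm, h1, dist_eq_norm, norm_of_nonneg (by have := pi_pos; positivity)]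
  ring

lemma measurable_biotSavart : Measurable biotSavart := by
  have h := perpL.continuous.measurable
  exact (measurable_const.div ((measurable_norm.pow_const 2).const_mul _)).smul h

lemma planeKernel_eq (x y : Plane) : planeKernel x y = biotSavart (x - y) := rfl

lemma kernelBounds_planeKernel : (FlowDomain.region univ).KernelBounds planeKernel
    (1 / (2 * π)) (1 / (2 * π)) where
  measurable := by
    have h : Measurable fun q : Plane × Plane => q.1 - q.2 := measurable_fst.sub measurable_snd
    exact measurable_biotSavart.comp (h.comp ((measurable_subtype_coe.comp measurable_fst).prodMk
        (measurable_subtype_coe.comp measurable_snd)))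
  descends_left := fun _ => trivial
  descends_right := fun _ => trivial
  size := fun x _ y _ _ => by
    rw [planeKernel_eq, norm_biotSavart, ← dist_eq_norm]; rfl
  oscillation := fun x _ y _ z _ hx hy => by
    have hx : x - z ≠ 0 := sub_ne_zero.2 (dist_ne_zero.1 hx)
    have hy : y - z ≠ 0 := sub_ne_zero.2 (dist_ne_zero.1 hy)
    rw [planeKernel_eq, planeKernel_eq, norm_biotSavart_sub hx hy, sub_sub_sub_cancel_right]
    simp [FlowDomain.gdist, dist_eq_norm]

namespace FlowDomain

lemma ulNorm_lt_top_of_le {F : Plane → ℝ} (hq : 0 < q) (hM : ∀ x, |F x| ≤ M) :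
    D.ulNorm q F < ∞ := by
  refine lt_of_le_of_lt (b := ofReal M * volume (ball (0 : Plane) 1) ^ (1 / q)) ?_ ?_
  · refine iSup₂_le fun x _ => ?_
    refine (eLpNorm_le_of_ae_bound (C := M) (.of_forall hM)).trans ?_
    rw [toReal_ofReal hq.le, mul_comm, Measure.restrict_apply_univ, one_div]
    exact mul_le_mul_right (ENNReal.rpow_le_rpow (area_gdist_lt_le x 1) (by positivity)) _
  · exact mul_lt_top ofReal_lt_top (rpow_lt_top_of_nonneg (by positivity) measure_ball_lt_top.ne)

/-- Fubini's theorem. Absolute integrability comes from the velocity estimate with the roles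
exchanged: by oddness of the kernel, `∫ ‖L x‖ ‖k x z‖ dx` is a potential at `z` with the bounded
integrable density `‖L‖`. -/
lemma integral_clm_velocity (hk : D.KernelBounds k C1 C2)
    (hD : D.IsRegular) (hC1 : 0 ≤ C1) (hp : D.pts = univ) (hodd : ∀ x z, k z x = -k x z)
    {L : Plane → Plane →L[ℝ] ℝ} (hL : Continuous L) (hM : ∀ x, ‖L x‖ ≤ M)
    (hLi : Integrable L D.area) (hp2 : 2 < p) (hω : D.MemL1Ul p ω) :
    ∫ x, L x (D.velocity k ω x) ∂D.area = ∫ z, ω z * ∫ x, L x (k x z) ∂D.area ∂D.area := by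
  have : SFinite D.area := by unfold area; infer_instance
  have hx : ∀ x, x ∈ D.pts := fun x => hp ▸ mem_univ x
  have hkm : Measurable (uncurry k) := by
    have h1 : Measurable fun q : Plane × Plane => ((⟨q.1, hx _⟩, ⟨q.2, hx _⟩) : D.pts × D.pts) :=
      (measurable_fst.subtype_mk).prodMk (measurable_snd.subtype_mk)
    exact hk.measurable.comp h1
  have hB : ∀ z, ∫⁻ x, ‖L x (k x z)‖ₑ ∂D.area ≤ ofReal C1 *
      (ofReal (holderConst 3) * D.ulNorm 3 (fun x => ‖L x‖) +
        eLpNorm (fun x => ‖L x‖) 1 D.area) := fun z => by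
    refine le_trans (lintegral_mono fun x => ?_) (lintegral_velocity_le hk hD hC1 (by norm_num)
      hL.norm.aestronglyMeasurable (hx z))
    rw [enorm_smul, enorm_norm, hodd x z, enorm_neg]
    exact (L x).le_opENorm _
  set B := ofReal C1 * (ofReal (holderConst 3) * D.ulNorm 3 (fun x => ‖L x‖) +
        eLpNorm (fun x => ‖L x‖) 1 D.area)
  have hBt : B < ∞ := by
    refine mul_lt_top ofReal_lt_top (add_lt_top.2 ⟨mul_lt_top
      ofReal_lt_top (ulNorm_lt_top_of_le (by norm_num) (M := M) fun x => ?_), ?_⟩)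
    · rw [abs_norm]; exact hM x
    · rw [eLpNorm_norm]; exact (memLp_one_iff_integrable.2 hLi).2
  have hint : Integrable (uncurry fun x z => ω z * L x (k x z)) (D.area.prod D.area) := by
    have hm : AEStronglyMeasurable (uncurry fun x z => ω z * L x (k x z)) (D.area.prod D.area) := by
      refine hω.memL1.1.comp_snd.mul (Continuous.comp_aestronglyMeasurable₂
        (g := fun (A : Plane →L[ℝ] ℝ) (v : Plane) => A v) (by fun_prop)
        (hL.comp continuous_fst).aestronglyMeasurable hkm.aestronglyMeasurable)
    refine ⟨hm, ?_⟩
    rw [hasFiniteIntegral_iff_enorm, lintegral_prod_symm _ hm.enorm]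
    calc ∫⁻ z, ∫⁻ x, ‖ω z * L x (k x z)‖ₑ ∂D.area ∂D.area
        ≤ ∫⁻ z, ‖ω z‖ₑ * B ∂D.area := lintegral_mono fun z => by
          simp_rw [enorm_mul]
          rw [lintegral_const_mul' _ _ enorm_ne_top]
          gcongr
          exact hB z
      _ = (∫⁻ z, ‖ω z‖ₑ ∂D.area) * B := lintegral_mul_const'' _ hω.memL1.1.enorm
      _ < ∞ := mul_lt_top (memLp_one_iff_integrable.1 hω.memL1).2 hBt
  calc ∫ x, L x (D.velocity k ω x) ∂D.area
      = ∫ x, ∫ z, ω z * L x (k x z) ∂D.area ∂D.area := by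
        refine integral_congr_ae (ae_of_all _ fun x => ?_)
        simp only [velocity]
        rw [← ContinuousLinearMap.integral_comp_comm _
          (integrable_velocity hk hD hC1 hp2 hω (hx x))]
        simp
    _ = _ := by
        rw [integral_integral_swap hint]
        exact integral_congr_ae (ae_of_all _ fun z => integral_const_mul _ _)

end FlowDomain

lemma operatorBounds_planeKernel (hp : 2 < p) :
    (FlowDomain.region univ).OperatorBounds planeKernel p 1 := by
  have hr : (FlowDomain.region univ).IsRegular := ⟨isOpen_univ, by simp⟩
  refine fun ω hω => ⟨⟨0, aestronglyMeasurable_zero, by simp, fun φ hφ => ?_⟩,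
    fun x hx => by simp at hx⟩
  have hφ1 : ContDiff ℝ 1 φ := by
    have := hφ.1.comp (f := fun x : Plane => ((0 : ℝ), x)) (by fun_prop)
    exact this.of_le (by simp)
  obtain ⟨S, hS, -, hS0⟩ := hφ.2
  have hc : HasCompactSupport (fderiv ℝ φ) :=
    (HasCompactSupport.intro hS fun x hx => hS0 0 x hx).fderiv (𝕜 := ℝ)
  have hcont := hφ1.continuous_fderiv (by simp)
  obtain ⟨M, hM⟩ := hc.exists_bound_of_continuous hcont
  rw [FlowDomain.integral_clm_velocity kernelBounds_planeKernel hr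
    (by have := pi_pos; positivity) rfl
    (fun x z => by rw [planeKernel_eq, planeKernel_eq, ← biotSavart_neg, neg_sub])
    hcont hM ((hcont.integrable_of_hasCompactSupport hc).restrict) hp hω]
  have key : ∀ z, ∫ x, fderiv ℝ φ x (planeKernel x z) ∂(FlowDomain.region univ).area = 0 := by
    intro z
    have h1 := integral_radial_mul_fderiv_perp (φ := fun x => φ (x + z))
      (hφ1.comp (by fun_prop)) (fun r => 1 / (2 * π * r ^ 2))
    simp only [FlowDomain.area, FlowDomain.cell, Measure.restrict_univ]
    rw [← integral_add_right_eq_self _ z, ← h1]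
    refine integral_congr_ae (ae_of_all _ fun x => ?_)
    simp only [planeKernel_eq, add_sub_cancel_right, biotSavart, map_smul, smul_eq_mul,
      fderiv_comp_add_right]
  simp [key]

/-! ### The Biot–Savart kernel of the torus by Ewald splitting. -/

/-- The short-range part, with curl `δ - gauss`. Its values at lattice points are also the
coefficients of the Fourier series that restores the long-range part; the one at zero vanishes since
division by zero gives zero. -/
def gaussKer (x : Plane) : Plane := gauss x • biotSavart x

lemma gaussKer_neg (x : Plane) : gaussKer (-x) = -gaussKer x := by
  simp [gaussKer, biotSavart_neg, gauss]

lemma gauss_pos (x : Plane) : 0 < gauss x := exp_pos _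

lemma gauss_le (x : Plane) : gauss x ≤ exp (-‖x‖ ^ 2) := by
  refine exp_le_exp.2 ?_
  nlinarith [pi_gt_three, sq_nonneg ‖x‖]

lemma norm_mul_norm_gaussKer_le (x : Plane) : ‖x‖ * ‖gaussKer x‖ ≤ exp (-‖x‖ ^ 2) := by
  have h1 : 1 / (2 * π) ≤ 1 := by
    rw [div_le_one (by positivity)]; linarith [pi_gt_three]
  rw [gaussKer, norm_smul, norm_biotSavart, norm_of_nonneg (gauss_pos x).le]
  by_cases h : ‖x‖ = 0
  · simp [h]
  · calc ‖x‖ * (gauss x * (1 / (2 * π) / ‖x‖)) = gauss x * (1 / (2 * π)) := by field_simp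
      _ ≤ gauss x * 1 := mul_le_mul_of_nonneg_left h1 (gauss_pos x).le
      _ ≤ _ := by rw [mul_one]; exact gauss_le x

/-- With `r = ‖y‖ ≤ s = ‖x‖`: if `s ≤ 2r`, the factor `s(s + r) ≤ 6r²` from the difference of
squares is absorbed by the Gaussian; if `s ≥ 2r`, then `s ≤ 2(s - r)` and no derivative is needed.
-/
lemma norm_mul_gauss_sub_le (h : ‖y‖ ≤ ‖x‖) :
    ‖x‖ * (gauss y - gauss x) ≤ 6 * π * (‖x - y‖ * exp (-‖y‖ ^ 2)) := by
  have hxy : ‖x‖ - ‖y‖ ≤ ‖x - y‖ := norm_sub_norm_le x y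
  have hy := norm_nonneg y
  have hπ := pi_gt_three
  have hE := exp_pos (-‖y‖ ^ 2)
  have hG := gauss_pos y
  refine le_trans ?_ (mul_le_mul_of_nonneg_left (mul_le_mul_of_nonneg_right hxy hE.le)
    (by positivity))
  set r := ‖y‖
  set s := ‖x‖
  have hg : gauss y - gauss x ≤ gauss y * (π * (s ^ 2 - r ^ 2)) := by
    have e : gauss x = gauss y * exp (-(π * (s ^ 2 - r ^ 2))) := by
      rw [gauss, gauss, ← exp_add]; congr 1; ring
    rw [e]
    have := add_one_le_exp (-(π * (s ^ 2 - r ^ 2)))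
    nlinarith [gauss_pos y]
  rcases le_total s (2 * r) with hs | hs
  · have h2 : r ^ 2 * gauss y ≤ exp (-r ^ 2) := by
      have h3 : r ^ 2 ≤ exp (r ^ 2) := by linarith [add_one_le_exp (r ^ 2)]
      have h4 : gauss y ≤ exp (-r ^ 2) * exp (-r ^ 2) := by
        rw [gauss, ← exp_add]
        refine exp_le_exp.2 ?_
        nlinarith [sq_nonneg r]
      calc r ^ 2 * gauss y ≤ exp (r ^ 2) * (exp (-r ^ 2) * exp (-r ^ 2)) := by gcongr
        _ = exp (-r ^ 2) := by rw [← exp_add, ← exp_add]; congr 1; ring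
    calc s * (gauss y - gauss x) ≤ s * (gauss y * (π * (s ^ 2 - r ^ 2))) := by gcongr
      _ = s * (s + r) * (gauss y * (π * (s - r))) := by ring
      _ ≤ (2 * r) * (2 * r + r) * (gauss y * (π * (s - r))) := by
          have : 0 ≤ s - r := by linarith
          gcongr
      _ = 6 * π * ((s - r) * (r ^ 2 * gauss y)) := by ring
      _ ≤ _ := by
          have : 0 ≤ s - r := by linarith
          gcongr
  · have h1 : gauss y - gauss x ≤ exp (-r ^ 2) := by
      have := gauss_le y
      linarith [gauss_pos x]
    calc s * (gauss y - gauss x) ≤ (2 * (s - r)) * exp (-r ^ 2) :=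
          (mul_le_mul_of_nonneg_left h1 (hy.trans h)).trans (by gcongr; linarith)
      _ ≤ _ := by nlinarith [mul_nonneg (sub_nonneg.2 h) hE.le]

/-- Let `y` be the shorter vector and put the difference of the Gaussians in front of the kernel at
`y`. The factor `‖x‖` gained in `norm_mul_gauss_sub_le` then supplies the missing `1/‖x‖`. -/
lemma norm_gaussKer_sub_le (hx : x ≠ 0) (hy : y ≠ 0) : ‖gaussKer x - gaussKer y‖ ≤
      4 * (‖x - y‖ / (‖x‖ * ‖y‖)) * (exp (-‖x‖ ^ 2) + exp (-‖y‖ ^ 2)) := by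
  wlog h : ‖y‖ ≤ ‖x‖ generalizing x y
  · have := this hy hx (le_of_not_ge h)
    rwa [norm_sub_rev, norm_sub_rev y x, mul_comm ‖y‖, add_comm] at this
  have hx0 := norm_pos_iff.2 hx
  have hy0 := norm_pos_iff.2 hy
  have hπ := pi_gt_three
  have e : gaussKer x - gaussKer y =
      gauss x • (biotSavart x - biotSavart y) - (gauss y - gauss x) • biotSavart y := by
    simp only [gaussKer]; module
  have hg : 0 ≤ gauss y - gauss x := by
    refine sub_nonneg.2 (exp_le_exp.2 ?_)
    have := pow_le_pow_left₀ hy0.le h 2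
    nlinarith
  have h1 := norm_mul_gauss_sub_le h
  rw [e]
  refine (norm_sub_le _ _).trans ?_
  rw [norm_smul, norm_smul, norm_biotSavart_sub hx hy, norm_biotSavart, norm_of_nonneg hg,
    norm_of_nonneg (gauss_pos x).le]
  set d := ‖x - y‖
  have hd : 0 ≤ d := norm_nonneg _
  have b1 : gauss x * (1 / (2 * π) * (d / (‖x‖ * ‖y‖))) ≤
      exp (-‖x‖ ^ 2) * (1 * (d / (‖x‖ * ‖y‖))) := by
    have := gauss_le x
    have h3 : 1 / (2 * π) ≤ 1 := by rw [div_le_one (by positivity)]; linarith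
    gcongr
  have b2 : (gauss y - gauss x) * (1 / (2 * π) / ‖y‖) ≤ 3 * (d / (‖x‖ * ‖y‖)) * exp (-‖y‖ ^ 2) := by
    calc (gauss y - gauss x) * (1 / (2 * π) / ‖y‖)
        = (‖x‖ * (gauss y - gauss x)) * (1 / (2 * π * (‖x‖ * ‖y‖))) := by field_simp
      _ ≤ (6 * π * (d * exp (-‖y‖ ^ 2))) * (1 / (2 * π * (‖x‖ * ‖y‖))) := by gcongr
      _ = _ := by field_simp; ring
  have := mul_nonneg (div_nonneg hd (mul_nonneg hx0.le hy0.le)) (exp_pos (-‖x‖ ^ 2)).le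
  have := mul_nonneg (div_nonneg hd (mul_nonneg hx0.le hy0.le)) (exp_pos (-‖y‖ ^ 2)).le
  nlinarith

lemma one_le_norm_latticeVec {m : Fin 2 → ℤ} (hm : m ≠ 0) : 1 ≤ ‖m‖ ∧ ‖m‖ ≤ ‖latticeVec m‖ := by
  constructor
  · obtain ⟨i, hi⟩ := Function.ne_iff.1 hm
    refine le_trans ?_ (norm_le_pi_norm m i)
    rw [Int.norm_eq_abs]
    exact_mod_cast Int.one_le_abs hi
  · refine (pi_norm_le_iff_of_nonneg (norm_nonneg _)).2 fun i => ?_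
    exact PiLp.norm_apply_le (latticeVec m) i

def latticeWeight (m : Fin 2 → ℤ) : ℝ := exp (-(‖latticeVec m‖ ^ 2 / 2))

lemma summable_latticeWeight : Summable latticeWeight := by
  have h1 := (EisensteinSeries.summable_one_div_norm_rpow (k := 3) (by norm_num)).mul_left 8
  refine Summable.of_norm_bounded_eventually h1 ?_
  filter_upwards [(finite_singleton (0 : Fin 2 → ℤ)).compl_mem_cofinite] with m hm
  obtain ⟨h2, h3⟩ := one_le_norm_latticeVec hm
  set t := ‖latticeVec m‖
  have h4 : t ^ 4 / 8 ≤ exp (t ^ 2 / 2) := by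
    have := Real.quadratic_le_exp_of_nonneg (x := t ^ 2 / 2) (by positivity)
    nlinarith [sq_nonneg t]
  rw [latticeWeight, norm_of_nonneg (exp_pos _).le, exp_neg, rpow_neg (by positivity)]
  have h5 : ‖m‖ ^ (3 : ℝ) ≤ t ^ 4 := by
    rw [show (3 : ℝ) = (3 : ℕ) by norm_num, Real.rpow_natCast]
    calc ‖m‖ ^ 3 ≤ ‖m‖ ^ 4 := pow_le_pow_right₀ h2 (by norm_num)
      _ ≤ t ^ 4 := by gcongr
  have h6 : 0 < ‖m‖ ^ (3 : ℝ) := Real.rpow_pos_of_pos (by linarith) _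
  calc (exp (t ^ 2 / 2))⁻¹ ≤ (‖m‖ ^ (3 : ℝ) / 8)⁻¹ := by gcongr; linarith
    _ = _ := by rw [inv_div]; rfl

/-- This is `‖m‖² ≤ 2‖w + m‖² + 2‖w‖²`, and it gives one summable majorant for all lattice sums over
bounded `w`. -/
lemma exp_neg_norm_add_latticeVec_le {w : Plane} (hw : ‖w‖ ≤ R) (m : Fin 2 → ℤ) :
    exp (-‖w + latticeVec m‖ ^ 2) ≤ exp (R ^ 2) * latticeWeight m := by
  rw [latticeWeight, ← exp_add]
  refine exp_le_exp.2 ?_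
  have h1 : ‖latticeVec m‖ ≤ ‖w + latticeVec m‖ + ‖w‖ := by
    simpa using norm_sub_le (w + latticeVec m) w
  have h2 := norm_nonneg w
  nlinarith [norm_nonneg (latticeVec m), sq_nonneg (‖w + latticeVec m‖ - ‖w‖),
    norm_nonneg (w + latticeVec m)]

lemma norm_mul_norm_gaussKer_latticeVec_le (m : Fin 2 → ℤ) :
    ‖latticeVec m‖ * ‖gaussKer (latticeVec m)‖ ≤ latticeWeight m := by
  refine (norm_mul_norm_gaussKer_le _).trans (exp_le_exp.2 ?_)
  nlinarith [sq_nonneg ‖latticeVec m‖]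

lemma norm_gaussKer_latticeVec_le (m : Fin 2 → ℤ) :
    ‖gaussKer (latticeVec m)‖ ≤ latticeWeight m := by
  by_cases hm : m = 0
  · simp [hm, gaussKer, biotSavart, latticeVec_zero, latticeWeight]
  · obtain ⟨h1, h2⟩ := one_le_norm_latticeVec hm
    refine le_trans ?_ (norm_mul_norm_gaussKer_latticeVec_le m)
    nlinarith [norm_nonneg (gaussKer (latticeVec m))]

lemma summable_gaussKer (x : Plane) : Summable fun m => ‖gaussKer (x + latticeVec m)‖ := by
  refine Summable.of_norm_bounded_eventually (summable_latticeWeight.mul_left (exp (‖x‖ ^ 2))) ?_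
  filter_upwards [(finite_latticeVec_norm_le (‖x‖ + 1)).compl_mem_cofinite] with m hm
  have hm : ‖x‖ + 1 < ‖latticeVec m‖ := not_le.1 hm
  have h1 : ‖latticeVec m‖ ≤ ‖x + latticeVec m‖ + ‖x‖ := by
    simpa using norm_sub_le (x + latticeVec m) x
  rw [norm_norm]
  refine le_trans ?_ ((norm_mul_norm_gaussKer_le _).trans (exp_neg_norm_add_latticeVec_le le_rfl m))
  nlinarith [norm_nonneg (gaussKer (x + latticeVec m))]

/-- Terms of the Fourier series that completes the periodized kernel. -/
def tailTerm (m : Fin 2 → ℤ) (x : Plane) : Plane :=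
  sin (2 * π * inner ℝ (latticeVec m) x) • gaussKer (latticeVec m)

lemma norm_tailTerm_le (m : Fin 2 → ℤ) (x : Plane) : ‖tailTerm m x‖ ≤ latticeWeight m := by
  rw [tailTerm, norm_smul]
  have h1 := Real.abs_sin_le_one (2 * π * inner ℝ (latticeVec m) x)
  have h2 := norm_gaussKer_latticeVec_le m
  calc _ ≤ 1 * latticeWeight m := by rw [norm_eq_abs]; gcongr
    _ = _ := one_mul _

lemma summable_tailTerm (x : Plane) : Summable fun m => tailTerm m x :=
  Summable.of_norm_bounded summable_latticeWeight fun m => norm_tailTerm_le m x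

lemma norm_tailTerm_sub_le (m : Fin 2 → ℤ) (x y : Plane) :
    ‖tailTerm m x - tailTerm m y‖ ≤ 2 * π * ‖x - y‖ * latticeWeight m := by
  rw [tailTerm, tailTerm, ← sub_smul, norm_smul, norm_eq_abs]
  have h1 : ∀ a b : ℝ, |sin a - sin b| ≤ |a - b| := fun a b => by
    have := Real.lipschitzWith_sin.dist_le_mul a b
    simpa [Real.dist_eq] using this
  have h2 : |inner ℝ (latticeVec m) (x - y)| ≤ ‖latticeVec m‖ * ‖x - y‖ :=
    abs_real_inner_le_norm _ _
  have h3 := norm_mul_norm_gaussKer_latticeVec_le m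
  have hπ := pi_pos
  calc _ ≤ |2 * π * inner ℝ (latticeVec m) x - 2 * π * inner ℝ (latticeVec m) y| *
        ‖gaussKer (latticeVec m)‖ := mul_le_mul_of_nonneg_right (h1 _ _) (norm_nonneg _)
    _ = 2 * π * |inner ℝ (latticeVec m) (x - y)| * ‖gaussKer (latticeVec m)‖ := by
        rw [← mul_sub, ← inner_sub_right, abs_mul, abs_of_pos (by positivity)]
    _ ≤ 2 * π * (‖latticeVec m‖ * ‖x - y‖) * ‖gaussKer (latticeVec m)‖ := by gcongr
    _ = 2 * π * ‖x - y‖ * (‖latticeVec m‖ * ‖gaussKer (latticeVec m)‖) := by ring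
    _ ≤ _ := by gcongr

lemma continuous_tailTerm (m : Fin 2 → ℤ) : Continuous (tailTerm m) := by
  unfold tailTerm; fun_prop

lemma inner_latticeVec_latticeVec (m n : Fin 2 → ℤ) :
    inner ℝ (latticeVec m) (latticeVec n) = ((n 0 * m 0 + n 1 * m 1 : ℤ) : ℝ) := by
  simp [latticeVec, PiLp.inner_apply, Fin.sum_univ_two]

/-- The Biot–Savart kernel of the torus as a periodic function of one variable. -/
def torusBiotSavart (x : Plane) : Plane := periodize gaussKer x + ∑' m, tailTerm m x

lemma torusBiotSavart_descends : FlowDomain.torus.Descends torusBiotSavart := by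
  intro n x
  simp only [torusBiotSavart, periodize_descends]
  congr 2
  ext1 m
  rw [tailTerm, tailTerm, inner_add_right, inner_latticeVec_latticeVec, mul_add,
    mul_comm (2 * π) ((_ : ℤ) : ℝ), Real.sin_add_int_mul_two_pi]

lemma torusBiotSavart_neg (x : Plane) : torusBiotSavart (-x) = -torusBiotSavart x := by
  simp only [torusBiotSavart, neg_add, periodize, ← tsum_neg]
  congr 1
  · rw [← (Equiv.neg (Fin 2 → ℤ)).tsum_eq]
    refine tsum_congr fun m => ?_
    rw [← gaussKer_neg, Equiv.neg_apply, latticeVec_neg, neg_add]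
  · refine tsum_congr fun m => ?_
    simp [tailTerm]

@[fun_prop]
lemma continuous_gauss : Continuous gauss := by unfold gauss; fun_prop

lemma measurable_gaussKer : Measurable gaussKer :=
  continuous_gauss.measurable.smul measurable_biotSavart

lemma measurable_torusBiotSavart : Measurable torusBiotSavart := by
  refine Measurable.add ?_ (continuous_tsum continuous_tailTerm summable_latticeWeight
    norm_tailTerm_le).measurable
  refine measurable_of_tendsto_metrizable' atTop
    (f := fun (s : Finset (Fin 2 → ℤ)) x => ∑ m ∈ s, gaussKer (x + latticeVec m)) (fun s => ?_)
    (tendsto_pi_nhds.2 fun x => (summable_gaussKer x).of_norm.hasSum)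
  exact Finset.measurable_sum s fun m _ => measurable_gaussKer.comp (measurable_id.add_const _)

def weightSum : ℝ := ∑' m, latticeWeight m

lemma weightSum_pos : 0 < weightSum :=
  summable_latticeWeight.tsum_pos (fun _ => (exp_pos _).le) 0 (exp_pos _)

lemma norm_torusBiotSavart_le (hx : ‖x‖ ≤ 2) {g : ℝ} (hg : 0 < g) (hg1 : g ≤ 1)
    (h : ∀ m, g ≤ ‖x + latticeVec m‖) : ‖torusBiotSavart x‖ ≤ (exp 4 + 1) * weightSum / g := by
  have hW := weightSum_pos
  have h1 : ‖periodize gaussKer x‖ ≤ exp 4 / g * weightSum := by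
    refine tsum_of_norm_bounded (summable_latticeWeight.hasSum.mul_left (exp 4 / g)) fun m => ?_
    have h2 := (norm_mul_norm_gaussKer_le _).trans (exp_neg_norm_add_latticeVec_le hx m)
    rw [div_mul_eq_mul_div, le_div_iff₀ hg]
    norm_num at h2
    nlinarith [norm_nonneg (gaussKer (x + latticeVec m)), h m]
  have h2 : ‖∑' m, tailTerm m x‖ ≤ weightSum :=
    tsum_of_norm_bounded summable_latticeWeight.hasSum fun m => norm_tailTerm_le m x
  calc _ ≤ exp 4 / g * weightSum + weightSum := (norm_add_le _ _).trans (add_le_add h1 h2)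
    _ ≤ exp 4 / g * weightSum + weightSum / g := by gcongr; exact le_div_self hW.le hg hg1
    _ = _ := by ring

lemma norm_torusBiotSavart_sub_le (hx : ‖x‖ ≤ 2) (hy : ‖y‖ ≤ 2) {g g' : ℝ}
    (hg : 0 < g) (hg1 : g ≤ 1) (hg' : 0 < g') (hg1' : g' ≤ 1)
    (h : ∀ m, g ≤ ‖x + latticeVec m‖) (h' : ∀ m, g' ≤ ‖y + latticeVec m‖) :
    ‖torusBiotSavart x - torusBiotSavart y‖ ≤
      (8 * exp 4 + 2 * π) * weightSum * (‖x - y‖ / (g * g')) := by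
  have hW := weightSum_pos
  have hπ := pi_pos
  have h1 : ‖periodize gaussKer x - periodize gaussKer y‖ ≤
      8 * exp 4 * (‖x - y‖ / (g * g')) * weightSum := by
    rw [periodize, periodize, ← (summable_gaussKer x).of_norm.tsum_sub
      (summable_gaussKer y).of_norm]
    refine tsum_of_norm_bounded (summable_latticeWeight.hasSum.mul_left _) fun m => ?_
    have h2 := exp_neg_norm_add_latticeVec_le hx m
    have h3 := exp_neg_norm_add_latticeVec_le hy m
    have h4 := h m
    have h5 := h' m
    refine (norm_gaussKer_sub_le (norm_pos_iff.1 (hg.trans_le h4))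
      (norm_pos_iff.1 (hg'.trans_le h5))).trans ?_
    rw [add_sub_add_right_eq_sub]
    calc _ ≤ 4 * (‖x - y‖ / (g * g')) * (exp (2 ^ 2) * latticeWeight m +
          exp (2 ^ 2) * latticeWeight m) := by gcongr
      _ = _ := by norm_num; ring
  have h2 : ‖∑' m, tailTerm m x - ∑' m, tailTerm m y‖ ≤ 2 * π * ‖x - y‖ * weightSum := by
    rw [← (summable_tailTerm x).tsum_sub (summable_tailTerm y)]
    exact tsum_of_norm_bounded (summable_latticeWeight.hasSum.mul_left _)
      fun m => norm_tailTerm_sub_le m x y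
  have h3 : ‖x - y‖ ≤ ‖x - y‖ / (g * g') :=
    le_div_self (norm_nonneg _) (mul_pos hg hg') (mul_le_one₀ hg1 hg'.le hg1')
  rw [torusBiotSavart, torusBiotSavart, add_sub_add_comm]
  calc _ ≤ 8 * exp 4 * (‖x - y‖ / (g * g')) * weightSum + 2 * π * ‖x - y‖ * weightSum :=
        (norm_add_le _ _).trans (add_le_add h1 h2)
    _ ≤ 8 * exp 4 * (‖x - y‖ / (g * g')) * weightSum +
        2 * π * (‖x - y‖ / (g * g')) * weightSum := by gcongr
    _ = _ := by ring

def torusKernel (x y : Plane) : Plane := torusBiotSavart (x - y)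

lemma torusKernel_neg (x y : Plane) : torusKernel y x = -torusKernel x y := by
  rw [torusKernel, torusKernel, ← torusBiotSavart_neg, neg_sub]

/-- By periodicity `x - z` may be replaced by a representative of norm `gdist x z < 1`, and `y - z`
by one at distance exactly `gdist x y` from it. Both then lie in the ball of radius `2`, where the
lattice sums are estimated termwise by the planar bounds. -/
lemma kernelBounds_torusKernel : FlowDomain.torus.KernelBounds torusKernel
    ((exp 4 + 1) * weightSum) ((8 * exp 4 + 2 * π) * weightSum) := by
  have hper := torusBiotSavart_descends
  have hle : ∀ x z : Plane, ∀ n m, FlowDomain.torus.gdist x z ≤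
      ‖x - z - latticeVec n + latticeVec m‖ := fun x z n m => by
    refine (FlowDomain.gdist_torus_le x z (n - m)).trans_eq ?_
    rw [dist_eq_norm, sub_eq_add_neg n m, latticeVec_add, latticeVec_neg]
    congr 1; abel
  have hred : ∀ x z n, torusBiotSavart (x - z - latticeVec n) = torusKernel x z := fun x z n => by
    rw [torusKernel, ← hper n (x - z - latticeVec n), sub_add_cancel]
  have hpos : ∀ x z, FlowDomain.torus.gdist x z ≠ 0 → 0 < FlowDomain.torus.gdist x z :=
    fun x z h => (FlowDomain.gdist_nonneg x z).lt_of_ne' h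
  refine ⟨?_, fun y n x => ?_, fun x n y => ?_, fun x _ z _ h => ?_, fun x _ y _ z _ h h' => ?_⟩
  · have h : Measurable fun q : Plane × Plane => q.1 - q.2 := measurable_fst.sub measurable_snd
    exact measurable_torusBiotSavart.comp (h.comp
      ((measurable_subtype_coe.comp measurable_fst).prodMk
        (measurable_subtype_coe.comp measurable_snd)))
  · show torusBiotSavart _ = torusBiotSavart _
    rw [add_sub_right_comm]; exact hper n _
  · rw [← hred x y n, torusKernel, sub_add_eq_sub_sub]
  · obtain ⟨n, hn⟩ := FlowDomain.exists_gdist_torus_eq x z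
    rw [← hred x z n]
    refine norm_torusBiotSavart_le ?_ (hpos _ _ h) (FlowDomain.gdist_torus_lt_one x z).le
      (hle x z n)
    rw [sub_sub, ← dist_eq_norm, ← hn]
    linarith [FlowDomain.gdist_torus_lt_one x z]
  · obtain ⟨n, hn⟩ := FlowDomain.exists_gdist_torus_eq x z
    obtain ⟨l, hl⟩ := FlowDomain.exists_gdist_torus_eq x y
    have h1 : ‖x - z - latticeVec n‖ < 1 := by
      rw [sub_sub, ← dist_eq_norm, ← hn]; exact FlowDomain.gdist_torus_lt_one x z
    have h2 : ‖x - z - latticeVec n - (y - z - latticeVec (n - l))‖ =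
        FlowDomain.torus.gdist x y := by
      rw [hl, dist_eq_norm, sub_eq_add_neg n l, latticeVec_add, latticeVec_neg]
      congr 1; abel
    rw [← hred x z n, ← hred y z (n - l), ← h2]
    refine norm_torusBiotSavart_sub_le (by linarith) ?_ (hpos _ _ h)
      (FlowDomain.gdist_torus_lt_one x z).le (hpos _ _ h') (FlowDomain.gdist_torus_lt_one y z).le
      (hle x z n) (hle y z _)
    have h3 := norm_sub_norm_le (y - z - latticeVec (n - l)) (x - z - latticeVec n)
    rw [norm_sub_rev (y - z - _), h2] at h3
    linarith [FlowDomain.gdist_torus_lt_one x y]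

/-! ### Integration against the torus kernel. -/

namespace FlowDomain

instance : IsFiniteMeasure torus.area :=
  ⟨(measure_mono torus_cell_subset_closedBall).trans_lt measure_closedBall_lt_top |> fun h => by
    simpa [area] using h⟩

lemma integral_torus_eq_prod (g : Plane → ℝ) : ∫ x, g x ∂torus.area =
      ∫ q, g (mkPlane q) ∂((volume.restrict (Ioc (0 : ℝ) 1)).prod (volume.restrict (Ioc 0 1))) := by
  have e : mkPlane ⁻¹' torus.cell = Ico (0 : ℝ) 1 ×ˢ Ico (0 : ℝ) 1 := by
    ext q; simp [cell, Fin.forall_fin_two, mkPlane]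
  rw [area, ← measurePreserving_mkPlane.setIntegral_preimage_emb measurableEmbedding_mkPlane, e,
    Measure.volume_eq_prod, ← Measure.prod_restrict, restrict_Ico_eq_restrict_Ioc]

lemma integral_torus_fderiv (hψ : ContDiff ℝ 1 ψ) (hd : torus.Descends ψ)
    (v : Plane) : ∫ x, fderiv ℝ ψ x v ∂torus.area = 0 := by
  have hc : ∀ w : Plane, Continuous fun x => fderiv ℝ ψ x w := fun w =>
    (hψ.continuous_fderiv (by simp)).clm_apply continuous_const
  have hψd : Differentiable ℝ ψ := hψ.differentiable (by simp)
  have hi : ∀ w : Plane, Integrable (fun q => fderiv ℝ ψ (mkPlane q) w)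
      ((volume.restrict (Ioc (0 : ℝ) 1)).prod (volume.restrict (Ioc (0 : ℝ) 1))) := fun w => by
    rw [Measure.prod_restrict]
    exact (((hc w).comp continuous_mkPlane).continuousOn.integrableOn_compact
      (isCompact_Icc.prod isCompact_Icc)).mono_set
        (prod_mono Ioc_subset_Icc_self Ioc_subset_Icc_self)
  have key : ∀ γ : ℝ → Plane, Continuous γ → ∀ w, (∀ t, HasDerivAt γ w t) →
      (∃ m, γ 1 = γ 0 + latticeVec m) → ∫ t in Ioc (0 : ℝ) 1, fderiv ℝ ψ (γ t) w = 0 := by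
    rintro γ hγ w hw ⟨m, hm⟩
    rw [← intervalIntegral.integral_of_le zero_le_one,
      intervalIntegral.integral_eq_sub_of_hasDerivAt
      (f := fun t => ψ (γ t)) (fun t _ => (hψd _).hasFDerivAt.comp_hasDerivAt t (hw t))
      (((hc w).comp hγ).intervalIntegrable _ _), hm, hd, sub_self]
  have h0 : ∫ x, fderiv ℝ ψ x (mkPlane (1, 0)) ∂torus.area = 0 := by
    rw [integral_torus_eq_prod, integral_prod_symm _ (hi _)]
    refine integral_eq_zero_of_ae (.of_forall fun y => key (fun t => mkPlane (t, y))
      (continuous_mkPlane.comp (by fun_prop)) _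
      (fun t => hasDerivAt_mkPlane (hasDerivAt_id t) (hasDerivAt_const t y)) ⟨![1, 0], ?_⟩)
    ext i; fin_cases i <;> simp [mkPlane, latticeVec]
  have h1 : ∫ x, fderiv ℝ ψ x (mkPlane (0, 1)) ∂torus.area = 0 := by
    rw [integral_torus_eq_prod, integral_prod _ (hi _)]
    refine integral_eq_zero_of_ae (.of_forall fun y => key (fun t => mkPlane (y, t))
      (continuous_mkPlane.comp (by fun_prop)) _
      (fun t => hasDerivAt_mkPlane (hasDerivAt_const t y) (hasDerivAt_id t)) ⟨![0, 1], ?_⟩)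
    ext i; fin_cases i <;> simp [mkPlane, latticeVec]
  have hv : v = v 0 • mkPlane (1, 0) + v 1 • mkPlane (0, 1) := by
    ext i; fin_cases i <;> simp [mkPlane]
  rw [hv]
  simp only [map_add, map_smul, smul_eq_mul]
  rw [integral_add ((integrable_torus_area (hc _)).const_mul _)
    ((integrable_torus_area (hc _)).const_mul _), integral_const_mul, integral_const_mul, h0, h1]
  simp

lemma exists_bound_of_descends {E : Type} [NormedAddCommGroup E] {f : Plane → E}
    (hf : Continuous f) (hd : torus.Descends f) : ∃ M, ∀ x, ‖f x‖ ≤ M := by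
  obtain ⟨M, hM⟩ := (isCompact_closedBall (0 : Plane) 2).exists_bound_of_continuousOn
    hf.continuousOn
  refine ⟨M, fun x => ?_⟩
  rw [← sub_add_cancel x (latticeVec (floorVec x)), hd]
  exact hM _ (torus_cell_subset_closedBall (sub_floorVec_mem_cell x))

lemma hasSum_integral_torus {F : (Fin 2 → ℤ) → Plane → ℝ} (hF : ∀ m, Continuous (F m))
    (hb : ∀ m x, |F m x| ≤ C * latticeWeight m) :
    HasSum (fun m => ∫ x, F m x ∂torus.area) (∫ x, ∑' m, F m x ∂torus.area) := by
  refine hasSum_integral_of_summable_integral_norm (fun m => integrable_torus_area (hF m)) ?_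
  refine Summable.of_nonneg_of_le (fun m => by positivity) (fun m => ?_)
    ((summable_latticeWeight.mul_left C).mul_right (torus.area.real univ))
  refine (integral_mono (integrable_torus_area (hF m)).norm (integrable_const _) (hb m)).trans_eq ?_
  rw [integral_const, smul_eq_mul, mul_comm]

end FlowDomain

open FlowDomain

lemma integrable_gauss : Integrable gauss := by
  refine (integrable_fun_norm_addHaar (E := Plane) volume (f := fun r => exp (-(π * r ^ 2)))).2 ?_
  have := integrable_mul_exp_neg_mul_sq pi_pos
  simpa using this.integrableOn

lemma integrable_gaussKer : Integrable gaussKer := by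
  have h : Integrable fun x : Plane => exp (-(1 * ‖x‖ ^ 2)) / ‖x‖ := by
    refine (integrable_fun_norm_addHaar (E := Plane) volume
      (f := fun r => exp (-(1 * r ^ 2)) / r)).2 ?_
    have h1 := (integrable_exp_neg_mul_sq one_pos).integrableOn (s := Ioi 0)
    refine h1.congr_fun (fun r hr => ?_) measurableSet_Ioi
    have hr : r ≠ 0 := ne_of_gt hr
    simp; field_simp
  refine h.mono' measurable_gaussKer.aestronglyMeasurable (.of_forall fun x => ?_)
  by_cases hx : ‖x‖ = 0
  · rw [norm_eq_zero.1 hx]; simp [gaussKer, biotSavart]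
  · rw [le_div_iff₀ (by positivity), mul_comm]
    simpa using norm_mul_norm_gaussKer_le x

lemma integrable_torusKernel (z : Plane) : Integrable (fun x => torusKernel x z) torus.area := by
  have h := integrable_velocity kernelBounds_torusKernel trivial
    (mul_pos (by positivity) weightSum_pos).le (by norm_num : (2 : ℝ) < 3) (f := fun _ => 1)
    ⟨fun _ _ => rfl, memLp_const 1, ulNorm_lt_top_of_le (M := 1) (by norm_num) (by simp)⟩
    (mem_univ z)
  refine h.neg.congr (.of_forall fun x => ?_)
  simp [torusKernel_neg x z]

lemma aestronglyMeasurable_clm_apply {L : Plane → Plane →L[ℝ] ℝ} (hL : Continuous L)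
    {μ : Measure Plane} (hu : AEStronglyMeasurable u μ) :
    AEStronglyMeasurable (fun x => L x (u x)) μ :=
  Continuous.comp_aestronglyMeasurable₂ (g := fun (A : Plane →L[ℝ] ℝ) (v : Plane) => A v)
    (by fun_prop) hL.aestronglyMeasurable hu

lemma integrable_clm_apply {L : Plane → Plane →L[ℝ] ℝ} (hL : Continuous L)
    (hM : ∀ x, ‖L x‖ ≤ M) {μ : Measure Plane} (hu : Integrable u μ) :
    Integrable (fun x => L x (u x)) μ :=
  (hu.norm.const_mul M).mono' (aestronglyMeasurable_clm_apply hL hu.1)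
    (.of_forall fun x => (L x).le_of_opNorm_le (hM x) _)

/-- The periodized part unfolds to an integral over the plane against `gaussKer`, and the sine
series is integrated term by term. -/
lemma integral_clm_torusKernel {L : Plane → Plane →L[ℝ] ℝ} (hL : Continuous L)
    (hd : torus.Descends L) (z : Plane) :
    ∫ x, L x (torusKernel x z) ∂torus.area = (∫ x, L (x + z) (gaussKer x)) +
      ∑' m, ∫ x, sin (2 * π * inner ℝ (latticeVec m) (x - z)) *
        L x (gaussKer (latticeVec m)) ∂torus.area := by
  obtain ⟨M, hM⟩ := exists_bound_of_descends hL hd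
  have hf := integrable_clm_apply hL hM (integrable_gaussKer.comp_sub_right z)
  have h1 : ∀ x, periodize (fun x => L x (gaussKer (x - z))) x =
      L x (periodize gaussKer (x - z)) := fun x => by
    rw [periodize, periodize, (L x).map_tsum (summable_gaussKer _).of_norm]
    exact tsum_congr fun m => by rw [hd, add_sub_right_comm]
  have h2 := integral_cell_periodize hf
  simp only [h1] at h2
  have hs := hasSum_integral_torus (F := fun m x => sin (2 * π * inner ℝ (latticeVec m) (x - z)) *
      L x (gaussKer (latticeVec m))) (C := M) (fun m => by fun_prop) (fun m x => by
      have := (L x).le_of_opNorm_le_of_le (hM x) (norm_tailTerm_le m (x - z))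
      simpa [tailTerm, map_smul] using this)
  have h3 : ∀ x, ∑' m, sin (2 * π * inner ℝ (latticeVec m) (x - z)) *
      L x (gaussKer (latticeVec m)) = L x (∑' m, tailTerm m (x - z)) := fun x => by
    rw [(L x).map_tsum (summable_tailTerm _)]
    exact tsum_congr fun m => by simp [tailTerm]
  simp only [h3] at hs
  have ht : Integrable (fun x => L x (∑' m, tailTerm m (x - z))) torus.area :=
    integrable_torus_area (hL.clm_apply ((continuous_tsum continuous_tailTerm
    summable_latticeWeight norm_tailTerm_le).comp (continuous_sub_right z)))
  have e : ∀ x, L x (periodize gaussKer (x - z)) =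
      L x (torusKernel x z) - L x (∑' m, tailTerm m (x - z)) := fun x => by
    simp [torusKernel, torusBiotSavart]
  have h4 := integral_add_right_eq_self (μ := volume) (fun x => L x (gaussKer (x - z))) z
  simp only [add_sub_cancel_right] at h4
  rw [hs.tsum_eq, h4, ← h2, ← area]
  simp only [e]
  rw [integral_sub (integrable_clm_apply hL hM (integrable_torusKernel z)) ht, sub_add_cancel]

lemma summable_gauss (y : Plane) : Summable fun m => gauss (y + latticeVec m) :=
  Summable.of_nonneg_of_le (fun _ => (gauss_pos _).le)
    (fun m => (gauss_le _).trans (exp_neg_norm_add_latticeVec_le le_rfl m))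
    (summable_latticeWeight.mul_left _)

/-- Integration by parts against a plane wave with profile `g`. -/
lemma integral_wave_mul_fderiv {g g' : ℝ → ℝ} (hg : ∀ t, HasDerivAt g (g' t) t)
    (hg' : Continuous g') (hp : Function.Periodic g (2 * π))
    (hφ : ContDiff ℝ 1 φ) (hd : torus.Descends φ) (m : Fin 2 → ℤ) (z v : Plane) :
    ∫ x, g (2 * π * inner ℝ (latticeVec m) (x - z)) * fderiv ℝ φ x v ∂torus.area =
      -(2 * π * inner ℝ (latticeVec m) v) *
        ∫ x, g' (2 * π * inner ℝ (latticeVec m) (x - z)) * φ x ∂torus.area := by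
  set θ : Plane → ℝ := fun x => 2 * π * inner ℝ (latticeVec m) (x - z) with hθ
  have hgd : ContDiff ℝ 1 g := by
    rw [contDiff_one_iff_deriv, show deriv g = g' from funext fun t => (hg t).deriv]
    exact ⟨fun t => (hg t).differentiableAt, hg'⟩
  have hθc : ContDiff ℝ 1 θ := by
    have h1 : ContDiff ℝ 1 fun x : Plane => x - z := by fun_prop
    exact contDiff_const.mul (contDiff_const.inner ℝ h1)
  have hθd : ∀ x, HasFDerivAt θ ((2 * π) • innerSL ℝ (latticeVec m)) x := fun x => by
    have h1 := ((innerSL ℝ (latticeVec m)).hasFDerivAt (x := x - z)).comp x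
      ((hasFDerivAt_id x).sub_const z)
    exact h1.const_mul (2 * π)
  have hper : torus.Descends fun x => g (θ x) * φ x := fun n x => by
    simp only [hθ, hd n x]
    rw [add_sub_right_comm, inner_add_right, inner_latticeVec_latticeVec, mul_add,
      mul_comm (2 * π) ((_ : ℤ) : ℝ), hp.int_mul]
  have h := integral_torus_fderiv ((hgd.comp hθc).mul hφ) hper v
  have e : ∀ x, fderiv ℝ (fun x => g (θ x) * φ x) x v = g (θ x) * fderiv ℝ φ x v +
      (2 * π * inner ℝ (latticeVec m) v) * (g' (θ x) * φ x) := fun x => by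
    have := ((hg _).comp_hasFDerivAt x (hθd x)).mul (hφ.differentiable (by simp) x).hasFDerivAt
    have h2 : HasFDerivAt (fun x => g (θ x) * φ x) _ x := this
    rw [h2.fderiv]
    simp; ring
  have hφc := hφ.continuous_fderiv (by simp)
  have hc1 := hφ.continuous
  have hc2 := hθc.continuous
  have hc3 := hgd.continuous
  simp only [comp_def, e] at h
  rw [integral_add (integrable_torus_area (by fun_prop)) (integrable_torus_area (by fun_prop)),
    integral_const_mul] at h
  linarith

lemma integral_sin_mul_fderiv (hφ : ContDiff ℝ 1 φ) (hd : torus.Descends φ)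
    (m : Fin 2 → ℤ) (z v : Plane) :
    ∫ x, sin (2 * π * inner ℝ (latticeVec m) (x - z)) * fderiv ℝ φ x v ∂torus.area =
      -(2 * π * inner ℝ (latticeVec m) v) *
        ∫ x, cos (2 * π * inner ℝ (latticeVec m) (x - z)) * φ x ∂torus.area :=
  integral_wave_mul_fderiv Real.hasDerivAt_sin Real.continuous_cos Real.sin_periodic hφ hd m z v

lemma integral_sin_eq_zero (m : Fin 2 → ℤ) (z : Plane) :
    ∫ x, sin (2 * π * inner ℝ (latticeVec m) (x - z)) ∂torus.area = 0 := by
  by_cases hm : latticeVec m = 0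
  · simp [hm]
  have h := integral_wave_mul_fderiv Real.hasDerivAt_cos (by fun_prop) Real.cos_periodic
    (φ := fun _ => 1) contDiff_const (fun _ _ => rfl) m z (latticeVec m)
  have h1 : 0 < ‖latticeVec m‖ := norm_pos_iff.2 hm
  have := pi_pos
  simpa [integral_neg, hm, Real.pi_ne_zero] using h

lemma tsum_prod_lattice {f g : ℤ → ℂ} (hf : Summable fun n => ‖f n‖)
    (hg : Summable fun n => ‖g n‖) :
    ∑' m : Fin 2 → ℤ, f (m 0) * g (m 1) = (∑' n, f n) * ∑' n, g n := by
  rw [tsum_mul_tsum_of_summable_norm hf hg, ← (finTwoArrowEquiv ℤ).tsum_eq]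
  rfl

/-- Poisson summation, as a product of two one-dimensional theta identities. The translation by `y`
is encoded as an imaginary linear term in the exponent, and taking real parts turns the exponentials
into cosines. -/
lemma tsum_gauss_add (y : Plane) : periodize gauss y =
    ∑' m, gauss (latticeVec m) * cos (2 * π * inner ℝ (latticeVec m) y) := by
  set f : ℝ → ℤ → ℂ := fun t n => Complex.exp (-π / 1 * (n + Complex.I * (-Complex.I * t)) ^ 2)
  set g : ℝ → ℤ → ℂ := fun t n =>
    Complex.exp (-π * 1 * n ^ 2 + 2 * π * (-Complex.I * t) * n)
  have h1 : ∀ t, ∑' n, f t n = ∑' n, g t n := fun t => by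
    have := Complex.tsum_exp_neg_quadratic (a := 1) (by simp) (-Complex.I * t)
    simpa [f, g] using this.symm
  have hfe : ∀ t n, f t n = (exp (-(π * (t + n) ^ 2)) : ℝ) := fun t n => by
    simp only [f]
    push_cast
    congr 1
    linear_combination (-π : ℂ) * (-2 * n * t + t ^ 2 * (Complex.I ^ 2 - 1)) * Complex.I_sq
  have hge : ∀ t n, g t n = (exp (-(π * (0 + n) ^ 2)) : ℝ) *
      Complex.exp ((-(2 * π * (n * t)) : ℝ) * Complex.I) := fun t n => by
    simp only [g]
    push_cast
    rw [← Complex.exp_add]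
    congr 1
    ring
  have hs : ∀ t : ℝ, Summable fun n : ℤ => exp (-(π * (t + n) ^ 2)) := fun t => by
    have h := (summable_gauss (mkPlane (t, 0))).comp_injective (i := fun n : ℤ => ![n, 0])
      (fun a b hab => by simpa using congrFun hab 0)
    refine h.congr fun n => ?_
    simp [gauss, norm_sq_eq, mkPlane, latticeVec]
  have hfs : ∀ t, Summable fun n => ‖f t n‖ := fun t => (hs t).congr fun n => by
    rw [hfe, Complex.norm_real, norm_of_nonneg (exp_pos _).le]
  have hgs : ∀ t, Summable fun n => ‖g t n‖ := fun t => (hs 0).congr fun n => by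
    rw [hge, norm_mul, Complex.norm_exp_ofReal_mul_I, Complex.norm_real,
      norm_of_nonneg (exp_pos _).le, mul_one]
  have hG : ∀ x : Plane, gauss x = exp (-(π * x 0 ^ 2)) * exp (-(π * x 1 ^ 2)) := fun x => by
    rw [← exp_add, gauss, norm_sq_eq]
    simp [mul_add, add_comm]
  have key : ∑' m : Fin 2 → ℤ, f (y 0) (m 0) * f (y 1) (m 1) =
      ∑' m : Fin 2 → ℤ, g (y 0) (m 0) * g (y 1) (m 1) := by
    rw [tsum_prod_lattice (hfs _) (hfs _), tsum_prod_lattice (hgs _) (hgs _), h1, h1]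
  have e1 : ∀ m : Fin 2 → ℤ, f (y 0) (m 0) * f (y 1) (m 1) = (gauss (y + latticeVec m) : ℂ) :=
    fun m => by rw [hfe, hfe, hG]; simp [latticeVec]
  have e2 : ∀ m : Fin 2 → ℤ, g (y 0) (m 0) * g (y 1) (m 1) = (gauss (latticeVec m) : ℂ) *
      Complex.exp ((-(2 * π * inner ℝ (latticeVec m) y) : ℝ) * Complex.I) := fun m => by
    rw [hge, hge, hG, mul_mul_mul_comm, ← Complex.exp_add]
    congr 2
    · simp [latticeVec]
    · simp [latticeVec, PiLp.inner_apply, Fin.sum_univ_two]; ring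
  have hsum : Summable fun m : Fin 2 → ℤ => (gauss (latticeVec m) : ℂ) *
      Complex.exp ((-(2 * π * inner ℝ (latticeVec m) y) : ℝ) * Complex.I) := by
    refine Summable.of_norm ((summable_gauss 0).congr fun m => ?_)
    rw [norm_mul, Complex.norm_exp_ofReal_mul_I, Complex.norm_real,
      norm_of_nonneg (gauss_pos _).le, mul_one, zero_add]
  simp only [e1, e2, ← Complex.ofReal_tsum] at key
  have h := congrArg Complex.re key
  rw [Complex.ofReal_re, Complex.re_tsum hsum] at h
  rw [periodize, h]
  refine tsum_congr fun m => ?_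
  rw [Complex.re_ofReal_mul, Complex.exp_ofReal_mul_I_re, Real.cos_neg]

lemma integral_gauss_mul (hφ : Continuous φ) (hd : torus.Descends φ) (z : Plane) :
    HasSum (fun m => gauss (latticeVec m) *
      ∫ x, cos (2 * π * inner ℝ (latticeVec m) (x - z)) * φ x ∂torus.area)
      (∫ x, gauss x * φ (x + z)) := by
  obtain ⟨M, hM⟩ := exists_bound_of_descends hφ hd
  have hf : Integrable fun x => gauss (x - z) * φ x :=
    (integrable_gauss.comp_sub_right z).mul_bdd hφ.aestronglyMeasurable (.of_forall hM)
  have h2 := integral_cell_periodize hf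
  have h4 := integral_add_right_eq_self (μ := volume) (fun x => gauss (x - z) * φ x) z
  simp only [add_sub_cancel_right] at h4
  rw [h4, ← h2]
  have hs := hasSum_integral_torus (F := fun m x => gauss (latticeVec m) *
    cos (2 * π * inner ℝ (latticeVec m) (x - z)) * φ x) (C := M)
    (fun m => by fun_prop) (fun m x => by
      have h3 := Real.abs_cos_le_one (2 * π * inner ℝ (latticeVec m) (x - z))
      have h4 := exp_neg_norm_add_latticeVec_le (norm_zero (E := Plane)).le m
      have h5 := (gauss_le (latticeVec m)).trans (by simpa using h4)
      have h6 := hM x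
      rw [abs_mul, abs_mul, abs_of_pos (gauss_pos _), mul_comm M]
      have h7 := (gauss_pos (latticeVec m)).le
      calc _ ≤ gauss (latticeVec m) * 1 * M := by gcongr; exact h6
        _ ≤ _ := by rw [mul_one]; exact mul_le_mul_of_nonneg_right h5 ((norm_nonneg _).trans h6))
  have e : ∀ x, periodize (fun x => gauss (x - z) * φ x) x = ∑' m, gauss (latticeVec m) *
      cos (2 * π * inner ℝ (latticeVec m) (x - z)) * φ x := fun x => by
    rw [tsum_mul_right, ← tsum_gauss_add, periodize, periodize, ← tsum_mul_right]
    exact tsum_congr fun m => by rw [hd, add_sub_right_comm]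
  rw [← integral_congr_ae (ae_of_all _ e)] at hs
  simpa only [mul_assoc, integral_const_mul, area] using hs

lemma inner_gaussKer (x : Plane) : inner ℝ x (gaussKer x) = 0 := by
  simp [gaussKer, biotSavart, perp, PiLp.inner_apply, Fin.sum_univ_two, inner_smul_right]
  ring_nf; simp

lemma perp_gaussKer (x : Plane) : perp (gaussKer x) = -(gauss x / (2 * π * ‖x‖ ^ 2)) • x := by
  rw [gaussKer, biotSavart, perp_smul, perp_smul, perp_perp, smul_smul, smul_neg, neg_smul]
  ring_nf

lemma descends_fderiv (hd : torus.Descends φ) : torus.Descends (fderiv ℝ φ) := fun m x => by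
  rw [← fderiv_comp_add_right]; congr 1; ext y; exact hd m y

/-- Both parts are divergence free: the Gaussian part is a radial multiple of the angular field, and
each coefficient `gaussKer m` of the sine series is orthogonal to its frequency `m`. -/
lemma integral_fderiv_torusKernel (hφ : ContDiff ℝ 1 φ) (hd : torus.Descends φ)
    (z : Plane) : ∫ x, fderiv ℝ φ x (torusKernel x z) ∂torus.area = 0 := by
  rw [integral_clm_torusKernel (hφ.continuous_fderiv (by simp)) (descends_fderiv hd)]
  have h1 := integral_radial_mul_fderiv_perp (φ := fun x => φ (x + z)) (hφ.comp (by fun_prop))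
    (fun r => exp (-(π * r ^ 2)) * (1 / (2 * π * r ^ 2)))
  have h2 : ∫ x, fderiv ℝ φ (x + z) (gaussKer x) = 0 := by
    rw [← h1]
    refine integral_congr_ae (ae_of_all _ fun x => ?_)
    simp only [fderiv_comp_add_right, gaussKer, biotSavart, gauss, map_smul, smul_eq_mul, mul_assoc]
  simp [h2, integral_sin_mul_fderiv hφ hd, inner_gaussKer]

/-- The Gaussian part contributes `φ z - ∫ gauss(x) φ(x + z)`. The sine series contributes the
cosine series with coefficients `gauss m`, `m ≠ 0`; by Poisson summation this is `∫ gauss(x) φ(x +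
z)` minus its zero mode `∫ φ`. In other words the kernel has curl `δ - 1`. -/
lemma integral_fderiv_perp_torusKernel (hφ : ContDiff ℝ 1 φ) (hd : torus.Descends φ) (z : Plane) :
    ∫ x, fderiv ℝ φ x (perp (torusKernel x z)) ∂torus.area = φ z - ∫ x, φ x ∂torus.area := by
  have hc := hφ.continuous_fderiv (by simp)
  have hL : Continuous fun x => (fderiv ℝ φ x).comp perpL := hc.clm_comp continuous_const
  have h0 := integral_clm_torusKernel hL (fun m x => by simp only [descends_fderiv hd m x]) z
  simp only [ContinuousLinearMap.comp_apply, perpL_apply, perp_gaussKer,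
    integral_sin_mul_fderiv hφ hd] at h0
  rw [h0]
  obtain ⟨M0, hM0⟩ := exists_bound_of_descends hφ.continuous hd
  obtain ⟨M1, hM1⟩ := exists_bound_of_descends hc (descends_fderiv hd)
  have h1 := integral_gauss_radial (φ := fun x => φ (x + z)) (hφ.comp (by fun_prop))
    (M := max M0 M1) (fun x => (hM0 _).trans (le_max_left _ _))
    (fun x => by rw [fderiv_comp_add_right]; exact (hM1 _).trans (le_max_right _ _))
  have hA : Integrable fun x => gauss x * φ (x + z) := integrable_gauss.mul_bdd
    (hφ.continuous.comp (by fun_prop)).aestronglyMeasurable (.of_forall fun x => hM0 _)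
  have hB : Integrable fun x => fderiv ℝ φ (x + z) (-(gauss x / (2 * π * ‖x‖ ^ 2)) • x) := by
    simp only [← perp_gaussKer]
    exact integrable_clm_apply (hc.comp (by fun_prop)) (fun x => hM1 _)
      (perpL.integrable_comp integrable_gaussKer)
  have hs := integral_gauss_mul hφ.continuous hd z
  have h2 : ∫ x, fderiv ℝ φ (x + z) (-(gauss x / (2 * π * ‖x‖ ^ 2)) • x) =
      φ z - ∫ x, gauss x * φ (x + z) := by
    rw [← zero_add z, ← h1, zero_add, eq_sub_iff_add_eq, ← integral_add hB hA]
    refine integral_congr_ae (ae_of_all _ fun x => ?_)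
    simp only [fderiv_comp_add_right, map_smul, smul_eq_mul]
    ring
  rw [h2, ← hs.tsum_eq, hs.summable.tsum_eq_add_tsum_ite 0]
  have h3 : ∀ m, -(2 * π * inner ℝ (latticeVec m)
      (-(gauss (latticeVec m) / (2 * π * ‖latticeVec m‖ ^ 2)) • latticeVec m)) =
      if m = 0 then 0 else gauss (latticeVec m) := fun m => by
    rw [inner_smul_right, real_inner_self_eq_norm_sq]
    split_ifs with hm
    · simp [hm, latticeVec_zero]
    · have h4 := one_le_norm_latticeVec hm
      have h5 : 0 < ‖latticeVec m‖ := by linarith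
      have := pi_pos
      field_simp
  simp only [h3, ite_mul, zero_mul]
  simp [latticeVec_zero, gauss]
  ring

lemma integral_torusKernel (l : Plane →L[ℝ] ℝ) (z : Plane) :
    ∫ x, l (torusKernel x z) ∂torus.area = 0 := by
  rw [integral_clm_torusKernel (L := fun _ => l) continuous_const (fun _ _ => rfl)]
  have h1 : ∫ x, l (gaussKer x) = 0 := by
    have := integral_neg_eq_self (fun x => l (gaussKer x)) volume
    simp only [gaussKer_neg, map_neg, integral_neg] at this
    linarith
  simp [h1, integral_mul_const, integral_sin_eq_zero]

/-! ### Stream functions. -/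

open FlowDomain

/-- The covector `-v^⊥`, as a linear function of `v`. -/
def perpForm : Plane →L[ℝ] Plane →L[ℝ] ℝ := -(innerSL ℝ).comp perpL

lemma perpForm_apply (v w : Plane) : perpForm v w = v 1 * w 0 - v 0 * w 1 := by
  simp [perpForm, perpL_apply, perp, PiLp.inner_apply, Fin.sum_univ_two]; ring

/-- The antisymmetric part of this bilinear form is the trace of `A` times the area form, so
vanishing divergence of a field is closedness of the associated one-form. -/
lemma perpForm_symm {A : Plane →L[ℝ] Plane} (hA : entry A 0 0 + entry A 1 1 = 0) (x y : Plane) :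
    perpForm (A x) y = perpForm (A y) x := by
  have h : ∀ x : Plane, A x = x 0 • A (single 0 1) + x 1 • A (single 1 1) := fun x => by
    rw [← map_smul, ← map_smul, ← map_add]
    congr 1
    ext i; fin_cases i <;> simp
  rw [perpForm_apply, perpForm_apply, h x, h y]
  simp only [entry] at hA
  simp only [PiLp.add_apply, PiLp.smul_apply, smul_eq_mul]
  linear_combination (x 1 * y 0 - x 0 * y 1) * hA

/-- A bounded, uniformly continuous, divergence free field on the plane has a stream function. -/
lemma exists_streamFunction (hu : UniformContinuous u) (hM0 : 0 ≤ M)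
    (hM : ∀ x, ‖u x‖ ≤ M) (hdiv : WeakDivBound univ u 0) :
    ∃ ψ : Plane → ℝ, ∀ x, HasFDerivAt ψ (perpForm (u x)) x := by
  have hc := hu.continuous.continuousOn (s := univ)
  have hM' : ∀ x ∈ (univ : Set Plane), ‖u x‖ ≤ M := fun x _ => hM x
  set w : ℕ → Plane → Plane := fun n => mollify n univ u
  have hwd : ∀ n, Differentiable ℝ (w n) := fun n =>
    (contDiff_mollify n isOpen_univ hc hM').differentiable (by simp)
  -- Since the weak divergence vanishes, the mollified fields are divergence free pointwise, and the
  -- Poincaré lemma provides their stream functions.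
  have hex : ∀ n, ∃ f : Plane → ℝ, ∀ x, HasFDerivAt f (perpForm (w n x)) x := fun n => by
    have hfd : ∀ x, HasFDerivAt (fun x => perpForm (w n x)) (perpForm.comp (fderiv ℝ (w n) x)) x :=
      fun x => perpForm.hasFDerivAt.comp x (hwd n x).hasFDerivAt
    obtain ⟨f, hf⟩ := convex_univ.exists_forall_hasFDerivAt_of_fderiv_symmetric isOpen_univ
      (ω := fun x => perpForm (w n x)) (fun x _ => (hfd x).differentiableAt.differentiableWithinAt)
      (fun x _ a b => by
        rw [(hfd x).fderiv]
        refine perpForm_symm ?_ a b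
        have := abs_trace_fderiv_mollify_le n isOpen_univ hc hM' hM0 hdiv (x := x) (subset_univ _)
        exact abs_nonpos_iff.1 this)
    exact ⟨f, fun x => hf x (mem_univ x)⟩
  choose f hf using hex
  have hw : TendstoUniformlyOn w u atTop univ := by
    rw [Metric.tendstoUniformlyOn_iff]
    intro ε hε
    obtain ⟨δ, hδ, h⟩ := Metric.uniformContinuous_iff.1 hu (ε / 2) (half_pos hε)
    filter_upwards [tendsto_one_div_add_atTop_nhds_zero_nat.eventually_lt_const hδ] with n hn x _
    rw [dist_comm, dist_eq_norm]
    refine (norm_mollify_sub_le n isOpen_univ hc (subset_univ _) fun z hz => ?_).trans_lt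
      (half_lt_self hε)
    rw [← dist_eq_norm]
    exact (h ((mem_ball.1 hz).trans hn)).le
  have hJ := perpForm.uniformContinuous.comp_tendstoUniformlyOn hw
  -- Subtracting the value at the origin fixes the free constants; with convergence at one point and
  -- uniform convergence of the derivatives, the stream functions converge everywhere.
  have hg : ∀ n x, HasFDerivAt (fun y => f n y - f n 0) (perpForm (w n x)) x := fun n x =>
    (hf n x).sub_const _
  have hlim : ∀ x, ∃ y, Tendsto (fun n => f n x - f n 0) atTop (𝓝 y) := fun x => by
    refine CompleteSpace.complete (cauchy_map_of_uniformCauchySeqOn_fderiv isOpen_univ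
      isPreconnected_univ hJ.uniformCauchySeqOn (fun n y _ => hg n y) (mem_univ 0) (mem_univ x) ?_)
    simpa using (tendsto_const_nhds (x := (0 : ℝ)) (f := (atTop : Filter ℕ))).cauchy_map
  choose ψ hψ using hlim
  exact ⟨ψ, fun x => hasFDerivAt_of_tendstoUniformlyOn isOpen_univ hJ (fun n y _ => hg n y)
    (fun y _ => hψ y) (mem_univ x)⟩

lemma uniformContinuous_of_descends (hu : Continuous u)
    (hd : torus.Descends u) : UniformContinuous u := by
  have h := (isCompact_closedBall (0 : Plane) 3).uniformContinuousOn_of_continuous hu.continuousOn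
  rw [Metric.uniformContinuousOn_iff] at h
  refine Metric.uniformContinuous_iff.2 fun ε hε => ?_
  obtain ⟨δ, hδ, h⟩ := h ε hε
  refine ⟨min δ 1, by positivity, fun {x y} hxy => ?_⟩
  set m := latticeVec (floorVec x)
  have h1 : x - m ∈ closedBall (0 : Plane) 2 :=
    torus_cell_subset_closedBall (sub_floorVec_mem_cell x)
  have h2 : dist (y - m) (x - m) < min δ 1 := by rwa [dist_sub_right, dist_comm]
  rw [mem_closedBall_zero_iff] at h1
  have h3 := norm_le_norm_add_norm_sub' (y - m) (x - m)
  rw [← dist_eq_norm (y - m)] at h3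
  rw [← sub_add_cancel x m, ← sub_add_cancel y m, hd, hd]
  refine h _ (mem_closedBall_zero_iff.2 (by linarith)) _ (mem_closedBall_zero_iff.2 ?_) ?_
  · linarith [h2.trans_le (min_le_right δ 1)]
  · rw [dist_comm]; exact h2.trans_le (min_le_left _ _)

/-- A function with periodic gradient of zero mean is periodic. -/
lemma descends_of_integral_fderiv (hψ : ContDiff ℝ 1 ψ)
    (hd : torus.Descends (fderiv ℝ ψ)) (h0 : ∀ v, ∫ x, fderiv ℝ ψ x v ∂torus.area = 0) :
    torus.Descends ψ := by
  have hψd := hψ.differentiable (by simp)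
  have hconst : ∀ m x, ψ (x + latticeVec m) - ψ x = ψ (latticeVec m) - ψ 0 := fun m x => by
    have h := is_const_of_fderiv_eq_zero (𝕜 := ℝ) (f := fun x => ψ (x + latticeVec m) - ψ x)
      ((hψd.comp (differentiable_id.add_const _)).sub hψd) (fun y => by
        have h1 : DifferentiableAt ℝ (fun x => ψ (x + latticeVec m)) y :=
          (hψd.comp (differentiable_id.add_const _)) y
        rw [fderiv_fun_sub h1 (hψd y), fderiv_comp_add_right, hd, sub_self]) x 0
    simpa using h
  -- The increments of `ψ` over lattice vectors form a homomorphism, which extends to a linear form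
  -- `ℓ`. Then `ψ - ℓ` is periodic, so `ℓ` is the mean of the derivative of `ψ`, and this is zero.
  set c : (Fin 2 → ℤ) →+ ℝ :=
    { toFun := fun m => ψ (latticeVec m) - ψ 0
      map_zero' := by simp [latticeVec_zero]
      map_add' := fun m n => by
        rw [← hconst n (latticeVec m), latticeVec_add]; ring } with hc
  set ℓ : Plane →L[ℝ] ℝ := c ![1, 0] • EuclideanSpace.proj 0 + c ![0, 1] • EuclideanSpace.proj 1
  have hℓ : ∀ m, ℓ (latticeVec m) = c m := fun m => by
    have e : m = m 0 • ![1, 0] + m 1 • ![0, 1] := by ext i; fin_cases i <;> simp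
    conv_rhs => rw [e, map_add, map_zsmul, map_zsmul]
    simp [ℓ, latticeVec, mul_comm]
  have hper : torus.Descends fun x => ψ x - ℓ x := fun m x => by
    have h1 := hconst m x
    have h2 : ℓ (latticeVec m) = ψ (latticeVec m) - ψ 0 := hℓ m
    show ψ (x + latticeVec m) - ℓ (x + latticeVec m) = ψ x - ℓ x
    rw [map_add, h2]
    linarith
  have hz : ∀ v, ℓ v = 0 := fun v => by
    have h1 := integral_torus_fderiv (ψ := fun x => ψ x - ℓ x) (hψ.sub ℓ.contDiff) hper v
    have e : ∀ x, fderiv ℝ (fun x => ψ x - ℓ x) x v = fderiv ℝ ψ x v - ℓ v := fun x => by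
      rw [fderiv_fun_sub (hψd x) ℓ.differentiableAt, ℓ.fderiv]; rfl
    simp only [e] at h1
    have hv : torus.area.real univ = 1 := by
      have := integral_torus_eq_prod fun _ => 1
      rw [integral_const, integral_const, Measure.real, Measure.real, ← univ_prod_univ (α := ℝ),
        Measure.prod_prod] at this
      simpa [Measure.real] using this
    rw [integral_sub (integrable_torus_area ((hψ.continuous_fderiv (by simp)).clm_apply
      continuous_const)) (integrable_const _), h0, integral_const, hv] at h1
    simpa using h1
  intro m x
  have h1 := hconst m x
  have h2 : ℓ (latticeVec m) = ψ (latticeVec m) - ψ 0 := hℓ m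
  rw [hz] at h2
  linarith

lemma sizeConst_nonneg : 0 ≤ (exp 4 + 1) * weightSum := (mul_pos (by positivity) weightSum_pos).le

lemma integral_clm_torusVelocity (hp : 2 < p) (hω : torus.MemL1Ul p ω)
    {L : Plane → Plane →L[ℝ] ℝ} (hL : Continuous L) (hd : torus.Descends L) :
    ∫ x, L x (torus.velocity torusKernel ω x) ∂torus.area =
      ∫ z, ω z * ∫ x, L x (torusKernel x z) ∂torus.area ∂torus.area := by
  obtain ⟨M, hM⟩ := exists_bound_of_descends hL hd
  exact integral_clm_velocity kernelBounds_torusKernel trivial sizeConst_nonneg rfl torusKernel_neg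
    hL hM (integrable_torus_area hL) hp hω

lemma integral_fderiv_torusVelocity (hp : 2 < p)
    (hω : torus.MemL1Ul p ω) (hφ : ContDiff ℝ 1 φ) (hd : torus.Descends φ) :
    ∫ x, fderiv ℝ φ x (torus.velocity torusKernel ω x) ∂torus.area = 0 := by
  rw [integral_clm_torusVelocity hp hω (hφ.continuous_fderiv (by simp)) (descends_fderiv hd)]
  simp [integral_fderiv_torusKernel hφ hd]

lemma divBounded_torusVelocity (hp : 2 < p) (hω : torus.MemL1Ul p ω)
    (B : ℝ≥0∞) : torus.DivBounded (torus.velocity torusKernel ω) B :=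
  ⟨0, aestronglyMeasurable_zero, by simp, fun φ hφ => by
    rw [integral_fderiv_torusVelocity hp hω (hφ.contDiff.of_le (by simp)) (hφ.2 0)]
    simp⟩

lemma operatorBounds_torusKernel (hp : 2 < p) : torus.OperatorBounds torusKernel p 1 :=
  fun _ hω => ⟨divBounded_torusVelocity hp hω _, trivial⟩

lemma isTorusBiotSavart_torusKernel (hp : 2 < p) : IsTorusBiotSavart torusKernel p := by
  intro ω hω hω0
  set u := torus.velocity torusKernel ω with hu
  have hC2 : 0 ≤ (8 * exp 4 + 2 * π) * weightSum :=
    (mul_pos (by have := pi_pos; positivity) weightSum_pos).le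
  have hud : torus.Descends u := descends_velocity kernelBounds_torusKernel ω
  have huc : ContinuousOn u univ := continuousOn_velocity kernelBounds_torusKernel trivial
    sizeConst_nonneg hC2 hp hω
  have hucont : Continuous u := continuousOn_univ.1 huc
  obtain ⟨M, hM⟩ := exists_bound_of_descends hucont hud
  have hdiv : WeakDivBound univ u 0 :=
    DivBounded.weakDivBound le_rfl (divBounded_torusVelocity hp hω _) hud fun φ hφ hφc _ =>
      integrable_fderiv_apply huc (hφ.of_le (by simp)) hφc (subset_univ _)
  obtain ⟨ψ, hψ⟩ := exists_streamFunction (uniformContinuous_of_descends hucont hud)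
    ((norm_nonneg _).trans (hM 0)) hM hdiv
  have hfd : fderiv ℝ ψ = fun x => perpForm (u x) := funext fun x => (hψ x).fderiv
  have hψ1 : ContDiff ℝ 1 ψ := by
    rw [contDiff_one_iff_fderiv, hfd]
    exact ⟨fun x => (hψ x).differentiableAt, perpForm.continuous.comp hucont⟩
  have hgrad : ∀ x, gradient ψ x = -perp (u x) := fun x => by
    have e : InnerProductSpace.toDual ℝ Plane (-perp (u x)) = perpForm (u x) :=
      ContinuousLinearMap.ext fun v => by simp [perpForm, perpL_apply]
    exact HasGradientAt.gradient (hasGradientAt_iff_hasFDerivAt.2 (e ▸ hψ x))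
  refine ⟨ψ, descends_of_integral_fderiv hψ1 ?_ fun v => ?_, hψ1, fun x => ?_, fun φ hφ => ?_⟩
  · rw [hfd]; exact fun m x => by simp only [hud m x]
  · have h := integral_clm_torusVelocity hp hω (L := fun _ => perpForm.flip v) continuous_const
      (fun _ _ => rfl)
    simp only [integral_torusKernel, mul_zero, integral_zero] at h
    simpa [hfd] using h
  · rw [hgrad, perp_neg, perp_perp, neg_neg]
  · have hφ1 : ContDiff ℝ 1 φ := hφ.contDiff.of_le (by simp)
    have hd : torus.Descends φ := hφ.2 0
    have h := integral_clm_torusVelocity hp hω (L := fun x => (fderiv ℝ φ x).comp perpL)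
      ((hφ1.continuous_fderiv (by simp)).clm_comp continuous_const)
      (fun m x => by simp only [descends_fderiv hd m x])
    simp only [ContinuousLinearMap.comp_apply, perpL_apply, integral_fderiv_perp_torusKernel hφ1 hd]
      at h
    obtain ⟨B, hB⟩ := exists_bound_of_descends hφ1.continuous hd
    have hωi := memLp_one_iff_integrable.1 hω.memL1
    simp only [mul_sub] at h
    -- The zero mean of `ω` cancels the contribution of the constant in `δ - 1`.
    rw [integral_sub (hωi.mul_bdd hφ1.continuous.aestronglyMeasurable (.of_forall hB))
      (hωi.mul_const _), integral_mul_const, hω0, zero_mul, sub_zero] at h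
    rw [← h, ← integral_neg]
    refine integral_congr_ae (ae_of_all _ fun x => ?_)
    simp [hgrad, inner_gradient_right, hu]

end

theorem theorem1p8 :
    -- existence for every kernel of the class; `Cp` and `CY` are the constants in the bounds
    (∃ (Cp : (C₁ C₂ C₃ p T normL1 normUl : ℝ) → ℝ)
       (CY : (C₁ C₂ C₃ T normL1 normY Θ3 : ℝ) → ℝ),
      ∀ (D : FlowDomain) (k : Plane → Plane → Plane) (C₁ C₂ C₃ p : ℝ),
        D.IsRegular → 0 < C₁ → 0 < C₂ → 0 < C₃ → 2 < p →
        D.KernelBounds k C₁ C₂ → D.OperatorBounds k p C₃ →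
        ∀ ω₀ : Plane → ℝ, D.MemL1Ul p ω₀ →
          ∃ (ω : ℝ → Plane → ℝ) (v : ℝ → Plane → Plane),
            D.IsWeakSolution k p ω₀ ω v ∧
            (∀ T > 0, ∀ C,
              C = Cp C₁ C₂ C₃ p T (eLpNorm ω₀ 1 D.area).toReal (D.ulNorm p ω₀).toReal →
              ∀ᵐ t ∂(volume.restrict (Icc 0 T)),
                eLpNorm (ω t) 1 D.area ≤ eLpNorm ω₀ 1 D.area ∧
                D.ulNorm p (ω t) ≤ ENNReal.ofReal C ∧
                (∀ x ∈ D.pts, ‖v t x‖ ≤ C) ∧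
                (∀ x ∈ D.pts, ∀ y ∈ D.pts,
                  ‖v t x - v t y‖ ≤
                    max 1 (1 / (p - 2)) * (C * p) * D.gdist x y ^ (1 - 2 / p))) ∧
            (∀ Θ : ℝ → ℝ, IsGrowth Θ → D.yulNorm Θ ω₀ < ∞ →
              (∀ T > 0, ∀ C,
                C = CY C₁ C₂ C₃ T (eLpNorm ω₀ 1 D.area).toReal (D.yulNorm Θ ω₀).toReal (Θ 3) →
                ∀ᵐ t ∂(volume.restrict (Icc 0 T)),
                  D.yulNorm Θ (ω t) ≤ ENNReal.ofReal C ∧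
                  (∀ x ∈ D.pts, ‖v t x‖ ≤ C) ∧
                  (∀ x ∈ D.pts, ∀ y ∈ D.pts,
                    ‖v t x - v t y‖ ≤ C * phiMod Θ (D.gdist x y))) ∧
              (OsgoodGrowth Θ → D.IsLagrangian ω₀ ω v))) ∧
    -- the Biot–Savart kernel of the plane belongs to the class
    (∃ C₁ C₂ C₃ : ℝ, 0 < C₁ ∧ 0 < C₂ ∧ 0 < C₃ ∧
      (FlowDomain.region univ).KernelBounds planeKernel C₁ C₂ ∧
      ∀ p > 2, (FlowDomain.region univ).OperatorBounds planeKernel p C₃) ∧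
    -- the Biot–Savart operator of the torus belongs to the class
    (∃ (k : Plane → Plane → Plane) (C₁ C₂ C₃ : ℝ), 0 < C₁ ∧ 0 < C₂ ∧ 0 < C₃ ∧
      FlowDomain.torus.KernelBounds k C₁ C₂ ∧
      ∀ p > 2, FlowDomain.torus.OperatorBounds k p C₃ ∧ IsTorusBiotSavart k p) := by
  refine ⟨⟨FlowDomain.holderSolConst, FlowDomain.yudovichSolConst,
    fun D k C₁ C₂ C₃ p hD h₁ h₂ h₃ hp hk hK ω₀ hω₀ =>
      FlowDomain.exists_solution hD h₁ h₂ h₃ hp hk hK ω₀ hω₀⟩, ?_, ?_⟩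
  · exact ⟨1 / (2 * Real.pi), 1 / (2 * Real.pi), 1, by positivity, by positivity, one_pos,
      kernelBounds_planeKernel, fun _ hp => operatorBounds_planeKernel hp⟩
  · exact ⟨torusKernel, _, _, 1, mul_pos (by positivity) weightSum_pos,
      mul_pos (by positivity) weightSum_pos, one_pos, kernelBounds_torusKernel,
      fun _ hp => ⟨operatorBounds_torusKernel hp, isTorusBiotSavart_torusKernel hp⟩⟩
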